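/- **Conventions.** Coordinates are $(\xi,\underline u,u)$ with $\xi=\xi^1+i\xi^2\in\mathbb C\cong\mathbb R^2$, $\underline u>0$ and $u<0$. A field is an 18-tuple of functions $\Phi=(e_1,\dots,e_5;\gamma_1,\dots,\gamma_8;w_1,\dots,w_5)$ with values in the real vector space $\mathcal R\subset\mathbb C^{18}$ in which $e_3,e_4,e_5,\gamma_2,\gamma_6$ are real. Put $$D=e_1\partial_{\xi^1}+e_2\partial_{\xi^2},\quad N=e_4\partial_{\xi^1}+e_5\partial_{\xi^2}+\partial_u,\quad L=e_3\partial_{\underline u},\quad \lambda_j=u^{2j},$$ and let $\overline D$ be the complex conjugate of $D$. The symmetric hyperbolic system $\mathbf A(\Phi)\Phi=\mathbf f(\Phi)$ consists of the following equations, in this order ($i=1,2$): * $Le_i=-e_i\gamma_2-\bar e_i\gamma_1$; $\;Ne_3=2e_3\Re\gamma_8$; $\;Le_{3+i}=2\Re(-e_i\gamma_4+e_i\gamma_5+e_i\bar\gamma_3)$; * $L\gamma_1=-2\gamma_1\gamma_2-w_1$; $\;L\gamma_2=-|\gamma_1|^2-\gamma_2^2$; $\;L\gamma_3=\gamma_1\gamma_4-\gamma_1\gamma_5-\gamma_2\gamma_3-w_2$;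 $\;L\gamma_4=-\gamma_2\gamma_4+\gamma_2\gamma_5+\gamma_3\bar\gamma_1$; * $N\gamma_5=-\gamma_3\gamma_7+\gamma_4\gamma_6-\gamma_5\gamma_6-\gamma_5\gamma_8+\gamma_5\bar\gamma_8-\gamma_6\bar\gamma_3+\gamma_7\bar\gamma_4-\gamma_7\bar\gamma_5+w_4$; $\;N\gamma_6=-\gamma_6^2-2\gamma_6\Re\gamma_8-|\gamma_7|^2$; $\;N\gamma_7=-2\gamma_6\gamma_7-3\gamma_7\gamma_8+\gamma_7\bar\gamma_8-w_5$; * $L\gamma_8=-2\gamma_3\gamma_4+2\gamma_3\gamma_5+|\gamma_3|^2+|\gamma_4|^2-\gamma_4\bar\gamma_5-\gamma_5\bar\gamma_4+w_3$; * $\lambda_1B_1=0$, $\;\lambda_jA_j+\lambda_{j+1}B_{j+1}=0$ for $j=1,2,3$, $\;\lambda_4A_4=0$, where $A_1=\overline Dw_1+Lw_2+4\gamma_2w_2+4\gamma_4w_1+\gamma_5w_1$, $A_2=\overline Dw_2+Lw_3+3\gamma_2w_3+2\gamma_4w_2+2\gamma_5w_2+\gamma_7w_1$, $A_3=\overline Dw_3+Lw_4+2\gamma_2w_4+3\gamma_5w_3+2\gamma_7w_2$,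 $A_4=\overline Dw_4+Lw_5+\gamma_2w_5-2\gamma_4w_4+4\gamma_5w_4+3\gamma_7w_3$, $B_1=Nw_1+Dw_2+3\gamma_1w_3-6\gamma_3w_2+\gamma_6w_1-4\gamma_8w_1+4\bar\gamma_4w_2$, $B_2=Nw_2+Dw_3+2\gamma_1w_4-3\gamma_3w_3+2\gamma_6w_2-2\gamma_8w_2+3\bar\gamma_4w_3$, $B_3=Nw_3+Dw_4+\gamma_1w_5+3\gamma_6w_3+2\bar\gamma_4w_4$, $B_4=Nw_4+Dw_5+3\gamma_3w_5+4\gamma_6w_4+2\gamma_8w_4+\bar\gamma_4w_5$. The constraint field $\Phi^\sharp=(t,u,v)$ of $\Phi$ is ($i=1,2$) * $t_i=-2\Im(D\bar e_i+\bar e_i\gamma_3+\bar e_i\bar\gamma_4)$, $\;t_3=De_3-e_3\gamma_3+e_3\bar\gamma_4+e_3\bar\gamma_5$, $\;t_{3+i}=\overline De_{3+i}-N\bar e_i-e_i\gamma_7-\bar e_i\gamma_6+\bar e_i\bar\gamma_8-\bar e_i\gamma_8$; * $u_1=D\gamma_2-\overline D\gamma_1+w_2-3\gamma_1\gamma_4-\gamma_1\bar\gamma_3-\gamma_2\gamma_3+\gamma_2\bar\gamma_4$;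 * $u_2=D\gamma_4+\overline D\gamma_3-w_3+2\gamma_3\gamma_4+\gamma_1\gamma_7-\gamma_2\gamma_6+|\gamma_3|^2+|\gamma_4|^2$; * $u_3=\overline D\gamma_3-\overline D\bar\gamma_4+N\gamma_2-w_3+2\gamma_3\gamma_4-2|\gamma_4|^2+\gamma_1\gamma_7+\gamma_2\gamma_6-\gamma_2\gamma_8-\gamma_2\bar\gamma_8$; * $u_4=D\bar\gamma_4-D\gamma_3-N\gamma_1+3\gamma_1\gamma_8+2\gamma_3^2-2\gamma_3\bar\gamma_4-\gamma_1\gamma_6-\gamma_1\bar\gamma_8-\gamma_2\bar\gamma_7$; * $u_5=\overline D\gamma_5-L\gamma_7-\gamma_2\gamma_7-\gamma_4\gamma_5+\gamma_5^2-\gamma_5\bar\gamma_3-\gamma_6\bar\gamma_1$; * $u_6=L\gamma_6-D\gamma_5-w_3+\gamma_1\gamma_7+\gamma_2\gamma_6-\gamma_3\gamma_5-\gamma_5\bar\gamma_4-|\gamma_5|^2$; * $u_7=D\gamma_8-N\gamma_3-2\gamma_3\gamma_6+\gamma_3\gamma_8-\gamma_3\bar\gamma_8+\gamma_4\bar\gamma_7+\gamma_6\bar\gamma_4$;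 * $u_8=N\gamma_4+\overline D\gamma_8+w_4-2\gamma_3\gamma_7+\gamma_4\gamma_6+\gamma_4\gamma_8-\gamma_4\bar\gamma_8+\gamma_7\bar\gamma_4$; * $u_9=D\gamma_7-\overline D\gamma_6-w_4+3\gamma_3\gamma_7+\gamma_4\gamma_6-\gamma_6\bar\gamma_3+\gamma_7\bar\gamma_4$; * $v_j=\lambda_jA_j$ for $j=1,2,3$. Let $\mathbf e(\xi)=\frac12(1+|\xi|^2)$ and $\boldsymbol\lambda(\xi)=-\frac12\xi$. The Minkowski background $\mathcal M$ has, with $\rho=\underline u-u$, the components $e_1=\mathbf e/\rho$, $e_2=i\mathbf e/\rho$, $e_3=1$, $\gamma_2=1/\rho$, $\gamma_3=\boldsymbol\lambda/\rho$, $\gamma_4=\overline{\boldsymbol\lambda}/\rho$, $\gamma_6=-1/\rho$, all others $0$. Let $[\mathcal M]$ be its expansion in powers of $1/u$, and let $$M=\mathrm{diag}(2,2,2,3,3;\,1,2,2,2,2,2,2,3;\,1,2,3,4,4),\qquad E=\mathrm{diag}(4,4,4,6,6;\,2,4,4,4,4,4,4,6;\,0,0,0,0,0).$$ A *formal solution*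 is a formal power series $[\Psi]=\sum_{k\ge0}u^{-k}\,\Psi(k)(\xi,\underline u)$ with smooth coefficient functions $\Psi(k):\mathbb R^2\times(0,\infty)\to\mathcal R$, such that $\Phi=[\mathcal M]+u^{-M}[\Psi]$ satisfies $u^{E-M}(\mathbf A(\Phi)\Phi-\mathbf f(\Phi))=0$ as a formal series in $1/u$. We write $[\Psi^\sharp]=0$ if the constraint field $\Phi^\sharp$ of this $\Phi$ vanishes as a formal series. **Hypotheses.** For $\sigma\in\{+,-\}$ let $\eta^\sigma:\mathbb R^2\times(0,\infty)\to\mathbb C$ be smooth, with $\eta^\sigma(\xi,\underline u)=\frac{\xi^2}{\bar\xi^2}\,\eta^{-\sigma}(\frac1\xi,\underline u)$ for $\xi\neq0$, with $\eta^\sigma(\xi,\underline u)=0$ unless $\frac12<\underline u<\frac34$, and with $\int_{1/2}^{3/4}\eta^\sigma(\xi,\underline u)\,d\underline u=0$ for all $\xi$. Put $$\Lambda^\sigma(\xi)=\int_{1/2}^{3/4}|\eta^\sigma(\xi,\underline u)|^2\,d\underline u .$$ **Conclusions.** 1. For each $\sigma$ and each real $\mathfrak A\neq0$ there is a unique formal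 solution $[\Psi_F^\sigma]$ with $[\Psi_F^{\sigma\,\sharp}]=0$, with $\Psi_F^\sigma(k)=0$ for $\underline u<\frac12\mathfrak A^4$ and all $k$, and whose component $\gamma_1$ (of the zeroth coefficient $\Psi_F^\sigma(0)$) is $\mathfrak A^{-2}\eta^\sigma(\xi,\mathfrak A^{-4}\underline u)$. 2. For $\underline u>\frac34\mathfrak A^4$ the components of $\Psi^\sigma_F(k)(\xi,\underline u)$ are given by polynomials in $\underline u$ and $\mathfrak A^2$, of degree bounded in terms of $k$, with coefficients that are functions of $\xi$. Let $\widehat\Psi^\sigma_F(k)$ denote these polynomials, viewed as functions on $\underline u>0$, and let $\widehat\Psi^\sigma_{F,0}(k)(\xi,\underline u)$ be the constant term of $\widehat\Psi_F^\sigma(k)$ as a polynomial in $\mathfrak A^2$; it is a polynomial in $\underline u$. 3. For each $\sigma$, $[\widehat\Psi^\sigma_{F,0}]$ is a formal solution with the following characteristic data, and it is the only formal solution with these data: - the nonzero components of $\widehat\Psi^\sigma_{F,0}(0)(\xi,\underline u)$ are, in the slots named, $e_3:-\underline u\Lambda^\sigma$, $\;\gamma_2:-\Lambda^\sigma$, $\;\gamma_8:\underline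 u\Lambda^\sigma$, $\;w_3:\Lambda^\sigma$, $\;w_4:2\underline u\,\mathbf e\,\partial_\xi\Lambda^\sigma$; - in the limit $\underline u\downarrow0$, taken in each coefficient function and pointwise in $\xi$, the nonzero components of $[\widehat\Psi^\sigma_{F,0}](\xi,0,u)$ are $\gamma_2:-\Lambda^\sigma$, $\;w_1:\frac2{u^2}(\mathbf e\,\partial_{\bar\xi}-\boldsymbol\lambda)\,\mathbf e\,\partial_{\bar\xi}\Lambda^\sigma$, $\;w_2:-\frac2u\,\mathbf e\,\partial_{\bar\xi}\Lambda^\sigma$, $\;w_3:\Lambda^\sigma$. Moreover $[\widehat\Psi_{F,0}^{\sigma\,\sharp}]=0$. 4. If $\Lambda^\sigma(\xi)\equiv\Lambda$ is independent of $\xi$ and $\sigma$, then $[\widehat\Psi^\sigma_{F,0}]$ represents Schwarzschild spacetime of mass $m=2^{-3/2}\Lambda$, in the following sense. There is a vacuum field $\Phi$ on $S=\mathbb R^2\times(0,\infty)\times(-\infty,-\Lambda)$: a smooth $\mathcal R$-valued field with $e_3>0$ and $\Im(e_1\bar e_2)\ne0$ for which, with the metric $g$ defined by $g(D,\overline D)=1$,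 $g(N,L)=-1$ and all other products of $D,\overline D,N,L$ equal to $0$, the $\gamma_i$ are the connection coefficients of the Levi-Civita connection and the $w_i$ the components of the Riemann tensor, which is trace free, and for which $L=-\mathrm{grad}\,u$ and $e_3N=-\mathrm{grad}\,\underline u$ are geodesic. There are isometric embeddings $\varphi^\sigma$ of $(S,g)$ into the exterior $\{r>0,\ r>2m\}$ of the Schwarzschild spacetime of mass $m$, with $\varphi^\sigma(\xi,\underline u,u)=\varphi^{-\sigma}(1/\xi,\underline u,u)$ for $\xi\ne0$. And for both $\sigma$ and every $b>0$, all component series of $[\mathcal M]+u^{-M}[\widehat\Psi^\sigma_{F,0}]$ converge to $\Phi$ for all $\xi$, all $0<\underline u\le b$ and all $u<u_2$, where $u_2\le-\Lambda$ depends only on $b$ and $\sigma$. -/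

import Mathlib

open Filter Set
open scoped Topology ContDiff Matrix

namespace FarField

noncomputable section

/-! ### Fields with 18 components and formal series in `1/u` -/

/-- The 18 components `(e, γ, w)` of a field `Φ` with values in `ℂ⁵ ⊕ ℂ⁸ ⊕ ℂ⁵`.  The same labels are
used for the components `(f, ω, z)` of the rescaled field `Ψ`. -/
inductive Cpt : Type
  | e1 | e2 | e3 | e4 | e5
  | γ1 | γ2 | γ3 | γ4 | γ5 | γ6 | γ7 | γ8
  | w1 | w2 | w3 | w4 | w5

/-- The 17 components `(t, u, v)` of a constraint field. -/
inductive SharpCpt : Type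
  | t1 | t2 | t3 | t4 | t5
  | u1 | u2 | u3 | u4 | u5 | u6 | u7 | u8 | u9
  | v1 | v2 | v3

/-- The real vector space `𝓡`: the components `e3, e4, e5, γ2, γ6` are real. -/
def InR (X : Cpt → ℂ) : Prop :=
  (X .e3).im = 0 ∧ (X .e4).im = 0 ∧ (X .e5).im = 0 ∧ (X .γ2).im = 0 ∧ (X .γ6).im = 0

/-- The exponents of the far field ansatz `Φ = M + u^{-M} Ψ`. -/
def expM : Cpt → ℤ
  | .e1 => 2 | .e2 => 2 | .e3 => 2 | .e4 => 3 | .e5 => 3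
  | .γ1 => 1 | .γ2 => 2 | .γ3 => 2 | .γ4 => 2 | .γ5 => 2 | .γ6 => 2 | .γ7 => 2 | .γ8 => 3
  | .w1 => 1 | .w2 => 2 | .w3 => 3 | .w4 => 4 | .w5 => 4

/-- The exponents of the overall factor `u^E` in the system for `Ψ`. -/
def expE : Cpt → ℤ
  | .e1 => 4 | .e2 => 4 | .e3 => 4 | .e4 => 6 | .e5 => 6
  | .γ1 => 2 | .γ2 => 4 | .γ3 => 4 | .γ4 => 4 | .γ5 => 4 | .γ6 => 4 | .γ7 => 4 | .γ8 => 6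
  | .w1 => 0 | .w2 => 0 | .w3 => 0 | .w4 => 0 | .w5 => 0

/-- The exponents in `Φ♯ = u^{-M♯} Ψ♯`. -/
def expMSharp : SharpCpt → ℤ
  | .t1 => 2 | .t2 => 2 | .t3 => 2 | .t4 => 3 | .t5 => 3
  | .u1 => 2 | .u2 => 2 | .u3 => 2 | .u4 => 2 | .u5 => 2 | .u6 => 2
  | .u7 => 3 | .u8 => 3 | .u9 => 3
  | .v1 => 0 | .v2 => -1 | .v3 => -2

/-- Points `(ξ, ū)`, with `ξ = ξ¹ + i ξ²`. -/
abbrev Slice : Type := ℂ × ℝ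

/-- Coefficient functions of `(ξ, ū)`.  Only their values at `ū > 0` matter. -/
abbrev Coef : Type := Slice → ℂ

/-- The half space `ℝ² × (0, ∞)`. -/
def upper : Set Slice := {p | 0 < p.2}

/-- Formal Laurent series in the variable `1/u`: the coefficient of index `n` multiplies
`(1/u)^n`. -/
abbrev Formal : Type := LaurentSeries Coef

/-- The monomial `u^n`. -/
def upow (n : ℤ) : Formal := HahnSeries.single (-n) 1

/-- A coefficient function, as a series that is constant in `u`. -/
def const (g : Coef) : Formal := HahnSeries.single 0 g

/-- The power series `∑ₖ (1/u)^k a(k)`. -/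
def series (a : ℕ → Coef) : Formal := HahnSeries.ofPowerSeries ℤ Coef (PowerSeries.mk a)

/-- Directional derivative of coefficient functions. -/
def dirDeriv (v : Slice) : ZeroHom Coef Coef where
  toFun g := fun p => fderiv ℝ g p v
  map_zero' := by
    funext p
    have h : (0 : Coef) = fun _ => (0 : ℂ) := rfl
    rw [h]
    simp

/-- Complex conjugation of coefficient functions. -/
def conjCoef : ZeroHom Coef Coef where
  toFun g := fun p => starRingEnd ℂ (g p)
  map_zero' := by
    funext p
    simp

/-- Complex conjugation of a formal series (`u` is real). -/
def conj (x : Formal) : Formal := x.map conjCoef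

/-- `∂/∂ξ¹`. -/
def pd1 (x : Formal) : Formal := x.map (dirDeriv (1, 0))

/-- `∂/∂ξ²`. -/
def pd2 (x : Formal) : Formal := x.map (dirDeriv (Complex.I, 0))

/-- `∂/∂ū`. -/
def pd3 (x : Formal) : Formal := x.map (dirDeriv (0, 1))

/-- `∂/∂u = - (1/u)² ∂/∂(1/u)`. -/
def pd4 (x : Formal) : Formal := -(upow (-2) * LaurentSeries.hasseDeriv ℂ 1 x)

/-- Twice the real part. -/
def twoRe (x : Formal) : Formal := x + conj x

/-- Twice the imaginary part. -/
def twoIm (x : Formal) : Formal := (-Complex.I) • (x - conj x)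

/-! ### The quasilinear symmetric hyperbolic system and the constraint field

The weights are `λ_j = u^{2j}`. -/

/-- The vector field `D = e₁ ∂/∂ξ¹ + e₂ ∂/∂ξ²`. -/
def opD (Φ : Cpt → Formal) (x : Formal) : Formal := Φ .e1 * pd1 x + Φ .e2 * pd2 x

/-- The complex conjugate vector field of `D`. -/
def opDbar (Φ : Cpt → Formal) (x : Formal) : Formal :=
  conj (Φ .e1) * pd1 x + conj (Φ .e2) * pd2 x

/-- The vector field `N = e₄ ∂/∂ξ¹ + e₅ ∂/∂ξ² + ∂/∂u`. -/
def opN (Φ : Cpt → Formal) (x : Formal) : Formal :=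
  Φ .e4 * pd1 x + Φ .e5 * pd2 x + pd4 x

/-- The vector field `L = e₃ ∂/∂ū`. -/
def opL (Φ : Cpt → Formal) (x : Formal) : Formal := Φ .e3 * pd3 x

/-- The difference `A(Φ) Φ - f(Φ)` of the two sides of the symmetric hyperbolic system. -/
def shsResidual (Φ : Cpt → Formal) : Cpt → Formal :=
  let D := opD Φ
  let Db := opDbar Φ
  let N := opN Φ
  let L := opL Φ
  let l1 := upow 2
  let l2 := upow 4
  let l3 := upow 6
  let l4 := upow 8
  let e1 := Φ .e1
  let e2 := Φ .e2
  let e3 := Φ .e3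
  let e4 := Φ .e4
  let e5 := Φ .e5
  let γ1 := Φ .γ1
  let γ2 := Φ .γ2
  let γ3 := Φ .γ3
  let γ4 := Φ .γ4
  let γ5 := Φ .γ5
  let γ6 := Φ .γ6
  let γ7 := Φ .γ7
  let γ8 := Φ .γ8
  let w1 := Φ .w1
  let w2 := Φ .w2
  let w3 := Φ .w3
  let w4 := Φ .w4
  let w5 := Φ .w5
  fun i => match i with
  | .e1 => L e1 - (-e1 * γ2 - conj e1 * γ1)
  | .e2 => L e2 - (-e2 * γ2 - conj e2 * γ1)
  | .e3 => N e3 - e3 * twoRe γ8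
  | .e4 => L e4 - twoRe (-e1 * γ4 + e1 * γ5 + e1 * conj γ3)
  | .e5 => L e5 - twoRe (-e2 * γ4 + e2 * γ5 + e2 * conj γ3)
  | .γ1 => L γ1 - (-2 * γ1 * γ2 - w1)
  | .γ2 => L γ2 - (-γ1 * conj γ1 - γ2 * γ2)
  | .γ3 => L γ3 - (γ1 * γ4 - γ1 * γ5 - γ2 * γ3 - w2)
  | .γ4 => L γ4 - (-γ2 * γ4 + γ2 * γ5 + γ3 * conj γ1)
  | .γ5 => N γ5 - (-γ3 * γ7 + γ4 * γ6 - γ5 * γ6 - γ5 * γ8 + γ5 * conj γ8 - γ6 * conj γ3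
      + γ7 * conj γ4 - γ7 * conj γ5 + w4)
  | .γ6 => N γ6 - (-γ6 * γ6 - γ6 * twoRe γ8 - γ7 * conj γ7)
  | .γ7 => N γ7 - (-2 * γ6 * γ7 - 3 * γ7 * γ8 + γ7 * conj γ8 - w5)
  | .γ8 => L γ8 - (-2 * γ3 * γ4 + 2 * γ3 * γ5 + γ3 * conj γ3 + γ4 * conj γ4 - γ4 * conj γ5
      - γ5 * conj γ4 + w3)
  | .w1 => l1 * (N w1 + D w2)
      - (-l1 * (3 * γ1 * w3 - 6 * γ3 * w2 + γ6 * w1 - 4 * γ8 * w1 + 4 * conj γ4 * w2))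
  | .w2 => l1 * (Db w1 + L w2) + l2 * (N w2 + D w3)
      - (-l1 * (4 * γ2 * w2 + 4 * γ4 * w1 + γ5 * w1)
        - l2 * (2 * γ1 * w4 - 3 * γ3 * w3 + 2 * γ6 * w2 - 2 * γ8 * w2 + 3 * conj γ4 * w3))
  | .w3 => l2 * (Db w2 + L w3) + l3 * (N w3 + D w4)
      - (-l2 * (3 * γ2 * w3 + 2 * γ4 * w2 + 2 * γ5 * w2 + γ7 * w1)
        - l3 * (γ1 * w5 + 3 * γ6 * w3 + 2 * conj γ4 * w4))
  | .w4 => l3 * (Db w3 + L w4) + l4 * (N w4 + D w5)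
      - (-l3 * (2 * γ2 * w4 + 3 * γ5 * w3 + 2 * γ7 * w2)
        - l4 * (3 * γ3 * w5 + 4 * γ6 * w4 + 2 * γ8 * w4 + conj γ4 * w5))
  | .w5 => l4 * (Db w4 + L w5)
      - (-l4 * (γ2 * w5 - 2 * γ4 * w4 + 4 * γ5 * w4 + 3 * γ7 * w3))

/-- The constraint field `Φ♯ = (t, u, v)`. -/
def constraintField (Φ : Cpt → Formal) : SharpCpt → Formal :=
  let D := opD Φ
  let Db := opDbar Φ
  let N := opN Φ
  let L := opL Φ
  let l1 := upow 2
  let l2 := upow 4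
  let l3 := upow 6
  let e1 := Φ .e1
  let e2 := Φ .e2
  let e3 := Φ .e3
  let e4 := Φ .e4
  let e5 := Φ .e5
  let γ1 := Φ .γ1
  let γ2 := Φ .γ2
  let γ3 := Φ .γ3
  let γ4 := Φ .γ4
  let γ5 := Φ .γ5
  let γ6 := Φ .γ6
  let γ7 := Φ .γ7
  let γ8 := Φ .γ8
  let w1 := Φ .w1
  let w2 := Φ .w2
  let w3 := Φ .w3
  let w4 := Φ .w4
  fun i => match i with
  | .t1 => -twoIm (D (conj e1) + conj e1 * γ3 + conj e1 * conj γ4)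
  | .t2 => -twoIm (D (conj e2) + conj e2 * γ3 + conj e2 * conj γ4)
  | .t3 => D e3 - e3 * γ3 + e3 * conj γ4 + e3 * conj γ5
  | .t4 => Db e4 - N (conj e1) - e1 * γ7 - conj e1 * γ6 + conj e1 * conj γ8 - conj e1 * γ8
  | .t5 => Db e5 - N (conj e2) - e2 * γ7 - conj e2 * γ6 + conj e2 * conj γ8 - conj e2 * γ8
  | .u1 => D γ2 - Db γ1 + w2 - 3 * γ1 * γ4 - γ1 * conj γ3 - γ2 * γ3 + γ2 * conj γ4
  | .u2 => D γ4 + Db γ3 - w3 + 2 * γ3 * γ4 + γ1 * γ7 - γ2 * γ6 + γ3 * conj γ3 + γ4 * conj γ4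
  | .u3 => Db γ3 - Db (conj γ4) + N γ2 - w3 + 2 * γ3 * γ4 - 2 * γ4 * conj γ4 + γ1 * γ7
      + γ2 * γ6 - γ2 * γ8 - γ2 * conj γ8
  | .u4 => D (conj γ4) - D γ3 - N γ1 + 3 * γ1 * γ8 + 2 * γ3 * γ3 - 2 * γ3 * conj γ4
      - γ1 * γ6 - γ1 * conj γ8 - γ2 * conj γ7
  | .u5 => Db γ5 - L γ7 - γ2 * γ7 - γ4 * γ5 + γ5 * γ5 - γ5 * conj γ3 - γ6 * conj γ1
  | .u6 => L γ6 - D γ5 - w3 + γ1 * γ7 + γ2 * γ6 - γ3 * γ5 - γ5 * conj γ4 - γ5 * conj γ5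
  | .u7 => D γ8 - N γ3 - 2 * γ3 * γ6 + γ3 * γ8 - γ3 * conj γ8 + γ4 * conj γ7 + γ6 * conj γ4
  | .u8 => N γ4 + Db γ8 + w4 - 2 * γ3 * γ7 + γ4 * γ6 + γ4 * γ8 - γ4 * conj γ8 + γ7 * conj γ4
  | .u9 => D γ7 - Db γ6 - w4 + 3 * γ3 * γ7 + γ4 * γ6 - γ6 * conj γ3 + γ7 * conj γ4
  | .v1 => l1 * (Db w1 + L w2 + 4 * γ2 * w2 + 4 * γ4 * w1 + γ5 * w1)
  | .v2 => l2 * (Db w2 + L w3 + 3 * γ2 * w3 + 2 * γ4 * w2 + 2 * γ5 * w2 + γ7 * w1)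
  | .v3 => l3 * (Db w3 + L w4 + 2 * γ2 * w4 + 3 * γ5 * w3 + 2 * γ7 * w2)

/-! ### The Minkowski background and formal solutions -/

/-- `𝐞(ξ) = (1 + |ξ|²)/2`. -/
def bfe : Coef := fun p => ((1 + ‖p.1‖ ^ 2) / 2 : ℝ)

/-- `𝛌(ξ) = -ξ/2`. -/
def bflam : Coef := fun p => -p.1 / 2

/-- The expansion `- ∑ₖ ū^k (1/u)^(k+1)` of `1/ρ`, where `ρ = ū - u`. -/
def invRho : Formal := -(upow (-1) * series (fun k p => (p.2 : ℂ) ^ k))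

/-- The formal expansion of the Minkowski field with both scaling parameters equal to `1`. -/
def minkowski : Cpt → Formal
  | .e1 => invRho * const bfe
  | .e2 => Complex.I • (invRho * const bfe)
  | .e3 => 1
  | .γ2 => invRho
  | .γ3 => invRho * const bflam
  | .γ4 => invRho * conj (const bflam)
  | .γ6 => -invRho
  | _ => 0

/-- The coefficient functions `Ψ(k)` of a formal field `∑ₖ (1/u)^k Ψ(k)(ξ, ū)`. -/
abbrev FormalField : Type := ℕ → Cpt → Coef

/-- The formal field `[M] + u^{-M} [Ψ]`. -/
def fullField (Ψ : FormalField) (i : Cpt) : Formal :=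
  minkowski i + upow (-expM i) * series (fun k => Ψ k i)

/-- A formal series vanishes (all coefficient functions vanish on `ū > 0`). -/
def Vanishes (x : Formal) : Prop := ∀ n : ℤ, ∀ p ∈ upper, x.coeff n p = 0

/-- Two formal fields have the same coefficient functions on `ū > 0`. -/
def Agree (Ψ Ψ' : FormalField) : Prop := ∀ k i, EqOn (Ψ k i) (Ψ' k i) upper

/-- `[Ψ]` is a formal solution of the system for `Ψ` with Minkowski background: its coefficient
functions are smooth with values in `𝓡`, and
`u^{E-M} (A(Φ) Φ - f(Φ)) = 0` for `Φ = [M] + u^{-M} [Ψ]`. -/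
structure IsFormalSolution (Ψ : FormalField) : Prop where
  smooth : ∀ k i, ContDiffOn ℝ ∞ (Ψ k i) upper
  real : ∀ k, ∀ p ∈ upper, InR (fun i => Ψ k i p)
  eqn : ∀ i, Vanishes (upow (expE i - expM i) * shsResidual (fullField Ψ) i)

/-- The formal constraint field `[Ψ♯]` vanishes. -/
def ConstraintsVanish (Ψ : FormalField) : Prop :=
  ∀ j, Vanishes (upow (expMSharp j) * constraintField (fullField Ψ) j)

/-- The far field formal solution with radiation data `data` at past null infinity, that coincides
with the Minkowski background for `ū < u₀`. -/
structure IsFarFieldSolution (data : Coef) (u₀ : ℝ) (Ψ : FormalField) : Prop where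
  solution : IsFormalSolution Ψ
  constraints : ConstraintsVanish Ψ
  vanish : ∀ k i, ∀ p ∈ upper, p.2 < u₀ → Ψ k i p = 0
  data_eq : EqOn (Ψ 0 .γ1) data upper

/-- The data `𝔄⁻² η(ξ, 𝔄⁻⁴ ū)` in the Finite Mass Picture (with `a = 𝔄`). -/
def finiteMassData (𝔄 : ℝ) (η : Coef) : Coef :=
  fun p => ((𝔄 ^ 2)⁻¹ : ℝ) * η (p.1, p.2 / 𝔄 ^ 4)

/-- The formal field whose coefficient functions are the polynomials
`∑_{j,l < d k} c_{k,i,j,l}(ξ) ū^j (𝔄²)^l` in `ū` and `𝔄²`. -/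
def polynomialField (d : ℕ → ℕ) (c : ℕ → Cpt → ℕ → ℕ → ℂ → ℂ) (𝔄 : ℝ) : FormalField :=
  fun k i p => ∑ j ∈ Finset.range (d k), ∑ l ∈ Finset.range (d k),
    c k i j l p.1 * (p.2 : ℂ) ^ j * ((𝔄 : ℂ) ^ 2) ^ l

/-- The constant terms of these polynomials with respect to `𝔄²`; they are polynomials in `ū`. -/
def constantTermField (d : ℕ → ℕ) (c : ℕ → Cpt → ℕ → ℕ → ℂ → ℂ) : FormalField :=
  fun k i p => ∑ j ∈ Finset.range (d k), c k i j 0 p.1 * (p.2 : ℂ) ^ j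

/-! ### Characteristic data -/

/-- `∂/∂ξ = (∂/∂ξ¹ - i ∂/∂ξ²)/2`. -/
def dXi (g : ℂ → ℂ) (ξ : ℂ) : ℂ := (fderiv ℝ g ξ 1 - Complex.I * fderiv ℝ g ξ Complex.I) / 2

/-- `∂/∂ξ̄ = (∂/∂ξ¹ + i ∂/∂ξ²)/2`. -/
def dXiBar (g : ℂ → ℂ) (ξ : ℂ) : ℂ := (fderiv ℝ g ξ 1 + Complex.I * fderiv ℝ g ξ Complex.I) / 2

/-- `Λ(ξ) = ∫_{1/2}^{3/4} |η(ξ, ū)|² dū`. -/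
def pulseEnergy (η : Coef) (ξ : ℂ) : ℝ := ∫ s in (1 / 2 : ℝ)..(3 / 4), ‖η (ξ, s)‖ ^ 2

/-- The prescribed zeroth coefficient `Ψ(0)(ξ, ū)`. -/
def pastData (Λ : ℂ → ℝ) (i : Cpt) : Coef := fun p =>
  match i with
  | .e3 => -((p.2 * Λ p.1 : ℝ) : ℂ)
  | .γ2 => -(Λ p.1 : ℂ)
  | .γ8 => ((p.2 * Λ p.1 : ℝ) : ℂ)
  | .w3 => (Λ p.1 : ℂ)
  | .w4 => 2 * (p.2 : ℂ) * bfe p * dXi (fun ζ => (Λ ζ : ℂ)) p.1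
  | _ => 0

/-- The prescribed coefficient of `(1/u)^k` of `[Ψ](ξ, 0, u)`. -/
def coneData (Λ : ℂ → ℝ) (k : ℕ) (i : Cpt) (ξ : ℂ) : ℂ :=
  let edΛ : ℂ → ℂ := fun ζ => bfe (ζ, 0) * dXiBar (fun ζ' => (Λ ζ' : ℂ)) ζ
  match i, k with
  | .γ2, 0 => -(Λ ξ : ℂ)
  | .w1, 2 => 2 * (bfe (ξ, 0) * dXiBar edΛ ξ - bflam (ξ, 0) * edΛ ξ)
  | .w2, 1 => -2 * edΛ ξ
  | .w3, 0 => (Λ ξ : ℂ)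
  | _, _ => 0

/-- The characteristic initial data: `Ψ(0)` is prescribed, and so is the boundary value of every
coefficient function at `ū = 0`. -/
structure HasCharacteristicData (Λ : ℂ → ℝ) (Ψ : FormalField) : Prop where
  past : ∀ i, EqOn (Ψ 0 i) (pastData Λ i) upper
  cone : ∀ k i ξ, Tendsto (fun s : ℝ => Ψ k i (ξ, s)) (𝓝[>] 0) (𝓝 (coneData Λ k i ξ))

/-! ### Vacuum fields -/

/-- Points `(ξ, ū, u)`. -/
abbrev Pt : Type := ℂ × ℝ × ℝ

/-- The coordinate directions of `(x¹, x², x³, x⁴) = (ξ¹, ξ², ū, u)`. -/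
def coordVec : Fin 4 → Pt := ![(1, 0, 0), (Complex.I, 0, 0), (0, 1, 0), (0, 0, 1)]

/-- Partial derivatives. -/
def pd (μ : Fin 4) (f : Pt → ℂ) (x : Pt) : ℂ := fderiv ℝ f x (coordVec μ)

/-- A complex vector field, by its coordinate components. -/
abbrev VField : Type := Pt → Fin 4 → ℂ

/-- The derivative of a function along a vector field. -/
def along (X : VField) (f : Pt → ℂ) (x : Pt) : ℂ := ∑ μ, X x μ * pd μ f x

/-- The commutator of vector fields. -/
def bracket (X Y : VField) : VField := fun x μ =>
  along X (fun y => Y y μ) x - along Y (fun y => X y μ) x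

/-- The frame matrix; its rows are `D, D̄, N, L`. -/
def frameMatrix (Φ : Pt → Cpt → ℂ) (x : Pt) : Matrix (Fin 4) (Fin 4) ℂ :=
  !![Φ x .e1, Φ x .e2, 0, 0;
     star (Φ x .e1), star (Φ x .e2), 0, 0;
     Φ x .e4, Φ x .e5, 0, 1;
     0, 0, Φ x .e3, 0]

/-- The frame vector fields `(F₁, F₂, F₃, F₄) = (D, D̄, N, L)`. -/
def frame (Φ : Pt → Cpt → ℂ) (a : Fin 4) : VField := fun x => frameMatrix Φ x a

/-- The constant matrix `g_{ab}`, which is its own inverse. -/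
def gFrame : Matrix (Fin 4) (Fin 4) ℂ :=
  !![0, 1, 0, 0;
     1, 0, 0, 0;
     0, 0, 0, -1;
     0, 0, -1, 0]

/-- The coordinate components of the metric with `g(F_a, F_b) = g_{ab}`. -/
def metric (Φ : Pt → Cpt → ℂ) (x : Pt) : Matrix (Fin 4) (Fin 4) ℂ :=
  (frameMatrix Φ x)⁻¹ * gFrame * ((frameMatrix Φ x)⁻¹)ᵀ

/-- The complex bilinear metric. -/
def gPair (Φ : Pt → Cpt → ℂ) (x : Pt) (V W : Fin 4 → ℂ) : ℂ := V ⬝ᵥ (metric Φ x *ᵥ W)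

/-- `pairSign j k` and `pairIndex j k` locate `jk` up to sign in the ordered sequence
`(12), (31), (32), (41), (42), (34)`. -/
def pairSign : Matrix (Fin 4) (Fin 4) ℂ :=
  !![0, 1, -1, -1;
     -1, 0, -1, -1;
     1, 1, 0, 1;
     1, 1, -1, 0]

/-- See `pairSign`. -/
def pairIndex : Matrix (Fin 4) (Fin 4) (Fin 6) :=
  !![0, 0, 1, 3;
     0, 0, 2, 4;
     1, 2, 0, 5;
     3, 4, 5, 0]

/-- The matrix `Γ_{a(jk)}`. -/
def gammaTable (X : Cpt → ℂ) : Matrix (Fin 4) (Fin 6) ℂ :=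
  !![X .γ3 + star (X .γ4), star (X .γ7), X .γ6, X .γ1, X .γ2, X .γ3 - star (X .γ4);
     -X .γ4 - star (X .γ3), X .γ6, X .γ7, X .γ2, star (X .γ1), -X .γ4 + star (X .γ3);
     X .γ8 - star (X .γ8), 0, 0, -X .γ3 + star (X .γ4), X .γ4 - star (X .γ3),
       X .γ8 + star (X .γ8);
     0, star (X .γ5), X .γ5, 0, 0, 0]

/-- The matrix `W_{(ab)(jk)}`. -/
def weylTable (X : Cpt → ℂ) : Matrix (Fin 6) (Fin 6) ℂ :=
  !![X .w3 + star (X .w3), star (X .w4), -X .w4, X .w2, -star (X .w2), X .w3 - star (X .w3);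
     star (X .w4), star (X .w5), 0, 0, -star (X .w3), -star (X .w4);
     -X .w4, 0, X .w5, -X .w3, 0, -X .w4;
     X .w2, 0, -X .w3, X .w1, 0, X .w2;
     -star (X .w2), -star (X .w3), 0, 0, star (X .w1), star (X .w2);
     X .w3 - star (X .w3), -star (X .w4), -X .w4, X .w2, star (X .w2), X .w3 + star (X .w3)]

/-- `Γ_{ajk}`. -/
def Gam (X : Cpt → ℂ) (a j k : Fin 4) : ℂ := pairSign j k * gammaTable X a (pairIndex j k)

/-- `W_{abjk}`. -/
def Weyl (X : Cpt → ℂ) (a b j k : Fin 4) : ℂ :=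
  pairSign a b * pairSign j k * weylTable X (pairIndex a b) (pairIndex j k)

/-- The components of a vector field with respect to the frame. -/
def frameCpt (Φ : Pt → Cpt → ℂ) (Y : VField) (b : Fin 4) (x : Pt) : ℂ :=
  (Y x ᵥ* (frameMatrix Φ x)⁻¹) b

/-- The connection with `g(∇_{F_a} F_j, F_k) = Γ_{ajk}`. -/
def nabla (Φ : Pt → Cpt → ℂ) (X Y : VField) : VField := fun x μ =>
  ∑ c, (along X (frameCpt Φ Y c) x
    + ∑ a, ∑ b, ∑ d, frameCpt Φ X a x * frameCpt Φ Y b x * Gam (Φ x) a b d * gFrame d c)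
    * frameMatrix Φ x c μ

/-- `Φ` is a (smooth) vacuum field on the open set `U`. -/
structure IsVacuumField (Φ : Pt → Cpt → ℂ) (U : Set Pt) : Prop where
  smooth : ∀ i, ContDiffOn ℝ ∞ (fun x => Φ x i) U
  real : ∀ x ∈ U, InR (Φ x)
  e3_pos : ∀ x ∈ U, 0 < (Φ x .e3).re
  nondegenerate : ∀ x ∈ U, (Φ x .e1 * star (Φ x .e2)).im ≠ 0
  /-- The Levi-Civita connection is given by `Γ`. -/
  leviCivita : ∀ x ∈ U, ∀ a j k,
    (1 / 2 : ℂ) * (-gPair Φ x (frame Φ a x) (bracket (frame Φ j) (frame Φ k) x)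
      + gPair Φ x (frame Φ k x) (bracket (frame Φ a) (frame Φ j) x)
      + gPair Φ x (frame Φ j x) (bracket (frame Φ k) (frame Φ a) x)) = Gam (Φ x) a j k
  /-- The Riemann tensor is given by `W`; in particular the Ricci curvature vanishes. -/
  riemann : ∀ x ∈ U, ∀ a b j k,
    gPair Φ x (nabla Φ (frame Φ j) (nabla Φ (frame Φ k) (frame Φ b)) x
      - nabla Φ (frame Φ k) (nabla Φ (frame Φ j) (frame Φ b)) x
      - nabla Φ (bracket (frame Φ j) (frame Φ k)) (frame Φ b) x) (frame Φ a x)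
      = Weyl (Φ x) a b j k
  /-- `e₃ N` is a null geodesic vector field and minus the gradient of `ū`. -/
  grad_ubar : ∀ x ∈ U, ∀ V, gPair Φ x (Φ x .e3 • frame Φ 2 x) V = -V 2
  geodesic_N : ∀ x ∈ U,
    nabla Φ (fun y => Φ y .e3 • frame Φ 2 y) (fun y => Φ y .e3 • frame Φ 2 y) x = 0
  /-- `L` is a null geodesic vector field and minus the gradient of `u`. -/
  grad_u : ∀ x ∈ U, ∀ V, gPair Φ x (frame Φ 3 x) V = -V 3
  geodesic_L : ∀ x ∈ U, nabla Φ (frame Φ 3) (frame Φ 3) x = 0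

/-! ### Schwarzschild -/

/-- Ambient space `(t, r, X)` for the Schwarzschild spacetime, with `X` on the unit sphere. -/
abbrev SchwAmbient : Type := ℝ × ℝ × EuclideanSpace ℝ (Fin 3)

/-- The exterior Schwarzschild spacetime of mass `m`, as a set:
`{(t, r, X) : r > 0, r > 2m, |X| = 1}`. -/
def schwExterior (m : ℝ) : Set SchwAmbient := {q | 0 < q.2.1 ∧ 2 * m < q.2.1 ∧ ‖q.2.2‖ = 1}

/-- The Schwarzschild metric `-(1 - 2m/r) dt² + (1 - 2m/r)⁻¹ dr² + r² g_{S²}`. -/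
def schwMetric (m : ℝ) (q V W : SchwAmbient) : ℝ :=
  -(1 - 2 * m / q.2.1) * (V.1 * W.1) + (1 - 2 * m / q.2.1)⁻¹ * (V.2.1 * W.2.1)
    + q.2.1 ^ 2 * inner ℝ V.2.2 W.2.2

/-- `φ` is an isometry from `U`, with the metric of the field `Φ`, onto an open subset of the
exterior Schwarzschild spacetime of mass `m`. -/
structure IsSchwarzschildIsometry (m : ℝ) (Φ : Pt → Cpt → ℂ) (U : Set Pt) (φ : Pt → SchwAmbient) :
    Prop where
  smooth : ContDiffOn ℝ ∞ φ U
  mapsTo : MapsTo φ U (schwExterior m)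
  injective : InjOn φ U
  isometry : ∀ x ∈ U, ∀ μ ν, metric Φ x μ ν =
    ((schwMetric m (φ x) (fderiv ℝ φ x (coordVec μ)) (fderiv ℝ φ x (coordVec ν)) : ℝ) : ℂ)

/-- The strip `ℝ² × (0, ∞) × (-∞, u₁)`. -/
def strip (u₁ : ℝ) : Set Pt := {x | 0 < x.2.1 ∧ x.2.2 < u₁}

/-- The pair of formal fields `[M] + u^{-M} [Ψ^σ]` represents Schwarzschild spacetime of mass `m`:
both are the expansion, convergent for all sufficiently negative `u` locally uniformly in `ū`, of a
vacuum field `Φ` on the strip `u < u₁`, and this vacuum field is isometric to an open subset of the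
exterior Schwarzschild spacetime of mass `m`.  The two charts `σ` are glued by `ξ ↦ 1/ξ`. -/
def RepresentsSchwarzschild (m u₁ : ℝ) (Ψ : Bool → FormalField) : Prop :=
  ∃ (Φ : Pt → Cpt → ℂ) (φ : Bool → Pt → SchwAmbient),
    IsVacuumField Φ (strip u₁) ∧
    (∀ σ, IsSchwarzschildIsometry m Φ (strip u₁) (φ σ)) ∧
    (∀ σ ξ s u, ξ ≠ 0 → (ξ, s, u) ∈ strip u₁ → φ σ (ξ, s, u) = φ (!σ) (ξ⁻¹, s, u)) ∧
    ∀ σ, ∀ b > 0, ∃ u₂ ≤ u₁, ∀ (ξ : ℂ) (s u : ℝ), 0 < s → s ≤ b → u < u₂ → ∀ i,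
      HasSum (fun n : ℕ => (fullField (Ψ σ) i).coeff n (ξ, s) / (u : ℂ) ^ n) (Φ (ξ, s, u) i)

end

end FarField

open FarField

set_option linter.unusedSimpArgs false
set_option linter.unusedSectionVars false
set_option linter.unusedVariables false

namespace FarField
noncomputable section

open scoped LaurentSeries

/-! ### Differential rings of coefficient functions and of formal series -/

/-- Derivations of a commutative ring into itself. -/
structure Der (A : Type*) [CommRing A] extends A →+ A where
  leibniz' : ∀ x y, toFun (x * y) = toFun x * y + x * toFun y

namespace Der

variable {A : Type*} [CommRing A]

instance : FunLike (Der A) A A where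
  coe d := d.toFun
  coe_injective := by
    rintro ⟨f, _⟩ ⟨g, _⟩ h
    have : f = g := DFunLike.coe_injective h
    subst this
    rfl

instance : AddMonoidHomClass (Der A) A A where
  map_add d := d.map_add'
  map_zero d := d.map_zero'

theorem leibniz (d : Der A) (x y : A) : d (x * y) = d x * y + x * d y := d.leibniz' x y

@[simp] theorem map_one (d : Der A) : d 1 = 0 := by
  have h := d.leibniz 1 1
  simpa using h

@[simp] theorem map_ofNat (d : Der A) (n : ℕ) [n.AtLeastTwo] : d (ofNat(n) : A) = 0 := by
  have h : (ofNat(n) : A) = n • (1 : A) := by rw [nsmul_eq_mul, mul_one]; rfl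
  rw [h, map_nsmul, map_one, smul_zero]

theorem rules (d : Der A) : (∀ x y, d (x + y) = d x + d y) ∧ (∀ x y, d (x - y) = d x - d y) ∧
    (∀ x, d (-x) = -d x) ∧ (∀ x y, d (x * y) = d x * y + x * d y) ∧
    ∀ (n : ℕ) [n.AtLeastTwo], d (ofNat(n) : A) = 0 :=
  ⟨map_add d, map_sub d, map_neg d, d.leibniz, fun n _ => d.map_ofNat n⟩

theorem map_intCast_mul (d : Der A) (n : ℤ) (x : A) : d ((n : A) * x) = n * d x := by
  rw [← zsmul_eq_mul, map_zsmul, zsmul_eq_mul]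

instance : Add (Der A) where
  add d e :=
    { toAddMonoidHom := d.toAddMonoidHom + e.toAddMonoidHom
      leibniz' := fun x y => by
        change d (x * y) + e (x * y) = (d x + e x) * y + x * (d y + e y)
        rw [leibniz, leibniz]
        ring }

instance : SMul A (Der A) where
  smul a d :=
    { toAddMonoidHom := (AddMonoidHom.mulLeft a).comp d.toAddMonoidHom
      leibniz' := fun x y => by
        change a * d (x * y) = a * d x * y + x * (a * d y)
        rw [leibniz]
        ring }

theorem add_apply (d e : Der A) (x : A) : (d + e) x = d x + e x := rfl

theorem smul_apply (a : A) (d : Der A) (x : A) : (a • d) x = a * d x := rfl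

end Der

/-- A ring of coefficient functions of `(ξ, ū)`, with its three derivations, complex conjugation and
the distinguished elements `𝛌` and `ū`. -/
class CoefRing (K : Type*) [CommRing K] [Algebra ℂ K] where
  d1 : Der K
  d2 : Der K
  d3 : Der K
  cj : K →+* K
  lam : K
  s : K
  d1_d2 : ∀ x, d1 (d2 x) = d2 (d1 x)
  d1_d3 : ∀ x, d1 (d3 x) = d3 (d1 x)
  d2_d3 : ∀ x, d2 (d3 x) = d3 (d2 x)
  cj_cj : ∀ x, cj (cj x) = x
  cj_d1 : ∀ x, cj (d1 x) = d1 (cj x)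
  cj_d2 : ∀ x, cj (d2 x) = d2 (cj x)
  cj_d3 : ∀ x, cj (d3 x) = d3 (cj x)
  d1_algebraMap : ∀ c : ℂ, d1 (algebraMap ℂ K c) = 0
  d2_algebraMap : ∀ c : ℂ, d2 (algebraMap ℂ K c) = 0
  d3_algebraMap : ∀ c : ℂ, d3 (algebraMap ℂ K c) = 0
  cj_algebraMap : ∀ c : ℂ, cj (algebraMap ℂ K c) = algebraMap ℂ K (starRingEnd ℂ c)
  cj_s : cj s = s
  d1_s : d1 s = 0
  d2_s : d2 s = 0
  d3_s : d3 s = 1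
  d1_lam : d1 lam = algebraMap ℂ K (-1 / 2)
  d2_lam : d2 lam = algebraMap ℂ K (-Complex.I / 2)
  d3_lam : d3 lam = 0

/-- A commutative ring with four commuting derivations, a conjugation, and an invertible element `U`
that plays the role of the coordinate `u`. -/
class DiffRing (A : Type*) [CommRing A] where
  p1 : Der A
  p2 : Der A
  p3 : Der A
  p4 : Der A
  cj : A →+* A
  U : A
  Z : A
  p1_p2 : ∀ x, p1 (p2 x) = p2 (p1 x)
  p1_p3 : ∀ x, p1 (p3 x) = p3 (p1 x)
  p2_p3 : ∀ x, p2 (p3 x) = p3 (p2 x)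
  p4_p1 : ∀ x, p4 (p1 x) = p1 (p4 x)
  p4_p2 : ∀ x, p4 (p2 x) = p2 (p4 x)
  p4_p3 : ∀ x, p4 (p3 x) = p3 (p4 x)
  cj_cj : ∀ x, cj (cj x) = x
  cj_p1 : ∀ x, cj (p1 x) = p1 (cj x)
  cj_p2 : ∀ x, cj (p2 x) = p2 (cj x)
  cj_p3 : ∀ x, cj (p3 x) = p3 (cj x)
  cj_p4 : ∀ x, cj (p4 x) = p4 (cj x)
  cj_U : cj U = U
  cj_Z : cj Z = Z
  U_Z : U * Z = 1
  p1_U : p1 U = 0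
  p2_U : p2 U = 0
  p3_U : p3 U = 0
  p1_Z : p1 Z = 0
  p2_Z : p2 Z = 0
  p3_Z : p3 Z = 0
  p4_U : p4 U = 1
  p4_Z : p4 Z = -(Z * Z)

section Series

variable {K : Type*} [CommRing K]

/-- A derivation acts on the coefficients of a Laurent series. -/
def coeffDer (d : Der K) : Der K⸨X⸩ where
  toFun x := HahnSeries.map x d
  map_zero' := by ext; simp
  map_add' x y := by ext; simp
  leibniz' x y := by
    ext n
    have h : ∀ x : K⸨X⸩, (HahnSeries.map x d).support ⊆ x.support := by
      intro x a ha hx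
      exact ha (by simp [HahnSeries.map_coeff, hx])
    rw [HahnSeries.map_coeff, HahnSeries.coeff_mul, map_sum, HahnSeries.coeff_add,
      HahnSeries.coeff_mul_right' y.isPWO_support (h y),
      HahnSeries.coeff_mul_left' x.isPWO_support (h x), ← Finset.sum_add_distrib]
    exact Finset.sum_congr rfl fun ij _ => by simp [Der.leibniz]

@[simp] theorem coeffDer_coeff (d : Der K) (x : K⸨X⸩) (n : ℤ) :
    (coeffDer d x).coeff n = d (x.coeff n) := rfl

/-- The series with coefficients `n xₙ`. -/
def euler (x : K⸨X⸩) : K⸨X⸩ :=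
  ⟨fun n => (n : K) * x.coeff n, x.isPWO_support.mono (by
    intro a ha hx
    exact ha (by change x.coeff a = 0 at hx; simp [hx]))⟩

@[simp] theorem euler_coeff (x : K⸨X⸩) (n : ℤ) :
    (euler x).coeff n = (n : K) * x.coeff n := rfl

/-- The Euler derivation `z ∂/∂z`. -/
def eulerDer : Der K⸨X⸩ where
  toFun := euler
  map_zero' := by ext; simp
  map_add' x y := by ext; simp [mul_add]
  leibniz' x y := by
    ext n
    have h1 : ∀ x : K⸨X⸩, (euler x).support ⊆ x.support := by
      intro x a ha hx
      exact ha (by simp [hx])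
    rw [euler_coeff, HahnSeries.coeff_mul, Finset.mul_sum, HahnSeries.coeff_add,
      HahnSeries.coeff_mul_right' y.isPWO_support (h1 y),
      HahnSeries.coeff_mul_left' x.isPWO_support (h1 x), ← Finset.sum_add_distrib]
    refine Finset.sum_congr rfl fun ij hij => ?_
    have : n = ij.1 + ij.2 := (Finset.mem_antidiagonal.mp hij).2.2.symm
    subst this
    simp only [euler_coeff]
    push_cast
    ring

/-- `∂/∂u = -z² ∂/∂z`, for `z = 1/u`. -/
def uDer : Der K⸨X⸩ := (-(HahnSeries.single 1 1 : K⸨X⸩)) • eulerDer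

theorem uDer_coeff (x : K⸨X⸩) (n : ℤ) :
    (uDer x).coeff n = -((n - 1 : ℤ) : K) * x.coeff (n - 1) := by
  have h : uDer x = -((HahnSeries.single 1 1 : K⸨X⸩) * euler x) := by
    change -(HahnSeries.single 1 1 : K⸨X⸩) * euler x = _
    ring
  have h2 := HahnSeries.coeff_single_mul (r := (1 : K)) (x := euler x) (a := n) (b := 1)
  rw [h, HahnSeries.coeff_neg, h2, euler_coeff]
  ring

/-- Conjugation of the coefficients. -/
def coeffMap {K' : Type*} [CommRing K'] (f : K →+* K') : K⸨X⸩ →+* K'⸨X⸩ where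
  toFun x := x.map f
  map_one' := HahnSeries.map_one f.toMonoidWithZeroHom
  map_mul' x y := HahnSeries.map_mul f.toNonUnitalRingHom
  map_zero' := by ext; simp
  map_add' x y := by ext; simp

@[simp] theorem coeffMap_coeff {K' : Type*} [CommRing K'] (f : K →+* K') (x : K⸨X⸩)
    (n : ℤ) : (coeffMap f x).coeff n = f (x.coeff n) := rfl

instance [Algebra ℂ K] [CoefRing K] : DiffRing K⸨X⸩ where
  p1 := coeffDer CoefRing.d1
  p2 := coeffDer CoefRing.d2
  p3 := coeffDer CoefRing.d3
  p4 := uDer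
  cj := coeffMap CoefRing.cj
  U := HahnSeries.single (-1) 1
  Z := HahnSeries.single 1 1
  p1_p2 x := by ext; simp [CoefRing.d1_d2]
  p1_p3 x := by ext; simp [CoefRing.d1_d3]
  p2_p3 x := by ext; simp [CoefRing.d2_d3]
  p4_p1 x := by
    ext n
    simp only [uDer_coeff, coeffDer_coeff, neg_mul, map_neg, Der.map_intCast_mul]
  p4_p2 x := by
    ext n
    simp only [uDer_coeff, coeffDer_coeff, neg_mul, map_neg, Der.map_intCast_mul]
  p4_p3 x := by
    ext n
    simp only [uDer_coeff, coeffDer_coeff, neg_mul, map_neg, Der.map_intCast_mul]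
  cj_cj x := by ext; simp [CoefRing.cj_cj]
  cj_p1 x := by ext; simp [CoefRing.cj_d1]
  cj_p2 x := by ext; simp [CoefRing.cj_d2]
  cj_p3 x := by ext; simp [CoefRing.cj_d3]
  cj_p4 x := by ext; simp [uDer_coeff]
  cj_U := by ext n; simp only [coeffMap_coeff, HahnSeries.coeff_single]; split_ifs <;> simp
  cj_Z := by ext n; simp only [coeffMap_coeff, HahnSeries.coeff_single]; split_ifs <;> simp
  U_Z := by simp
  p1_U := by ext n; simp only [coeffDer_coeff, HahnSeries.coeff_single]; split_ifs <;> simp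
  p2_U := by ext n; simp only [coeffDer_coeff, HahnSeries.coeff_single]; split_ifs <;> simp
  p3_U := by ext n; simp only [coeffDer_coeff, HahnSeries.coeff_single]; split_ifs <;> simp
  p1_Z := by ext n; simp only [coeffDer_coeff, HahnSeries.coeff_single]; split_ifs <;> simp
  p2_Z := by ext n; simp only [coeffDer_coeff, HahnSeries.coeff_single]; split_ifs <;> simp
  p3_Z := by ext n; simp only [coeffDer_coeff, HahnSeries.coeff_single]; split_ifs <;> simp
  p4_U := by
    ext n
    rw [uDer_coeff, HahnSeries.coeff_single, HahnSeries.coeff_one]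
    by_cases h : n = 0
    · subst h; simp
    · rw [if_neg (by omega), if_neg h]; simp
  p4_Z := by
    ext n
    rw [uDer_coeff, HahnSeries.coeff_single, HahnSeries.single_mul_single, HahnSeries.coeff_neg,
      HahnSeries.coeff_single]
    by_cases h : n = 2
    · subst h; norm_num
    · rw [if_neg (by omega), if_neg (by omega)]; simp

end Series

/-! ### Leading coefficients -/

section Lead

variable {K : Type*} [CommRing K]

/-- `x = c zⁿ + O(zⁿ⁺¹)`. -/
def Lead (n : ℤ) (x : K⸨X⸩) (c : K) : Prop := (∀ m < n, x.coeff m = 0) ∧ x.coeff n = c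

namespace Lead

variable {n a b : ℤ} {x y : K⸨X⸩} {c d : K}

theorem congr (h : Lead n x c) (hc : c = d) : Lead n x d := hc ▸ h

theorem add (hx : Lead n x c) (hy : Lead n y d) : Lead n (x + y) (c + d) :=
  ⟨fun m hm => by simp [hx.1 m hm, hy.1 m hm], by simp [hx.2, hy.2]⟩

theorem neg (hx : Lead n x c) : Lead n (-x) (-c) :=
  ⟨fun m hm => by simp [hx.1 m hm], by simp [hx.2]⟩

theorem sub (hx : Lead n x c) (hy : Lead n y d) : Lead n (x - y) (c - d) := by
  simpa [sub_eq_add_neg] using hx.add hy.neg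

theorem zero : Lead n (0 : K⸨X⸩) 0 := ⟨fun _ _ => rfl, rfl⟩

theorem low (hx : Lead a x c) (h : n < a := by omega) : Lead n x 0 :=
  ⟨fun m hm => hx.1 m (hm.trans h), hx.1 n h⟩

theorem succ (hx : Lead n x 0) : Lead (n + 1) x (x.coeff (n + 1)) :=
  ⟨fun m hm => by
    rcases (Int.lt_add_one_iff.mp hm).lt_or_eq with h | h
    · exact hx.1 m h
    · rw [h, hx.2], rfl⟩

theorem mul (hx : Lead a x c) (hy : Lead b y d) (h : n = a + b := by omega) : Lead n (x * y) (c * d) := by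
  have key : ∀ m ≤ a + b, (x * y).coeff m = if m = a + b then c * d else 0 := by
    intro m hm
    rw [HahnSeries.coeff_mul]
    by_cases hcd : m = a + b
    · subst hcd
      rw [if_pos rfl, Finset.sum_eq_single (a, b)]
      · simp [hx.2, hy.2]
      · rintro ⟨i, j⟩ hij hne
        have hs : i + j = a + b := by simpa using (Finset.mem_antidiagonal.mp hij).2.2
        by_cases hi : i < a
        · simp [hx.1 i hi]
        · have : i ≠ a := fun h => hne (by ext <;> simp <;> omega)
          simp [hy.1 j (by omega)]
      · intro hne
        by_contra h0
        apply hne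
        rw [Finset.mem_antidiagonal]
        exact ⟨left_ne_zero_of_mul h0, right_ne_zero_of_mul h0, rfl⟩
    · rw [if_neg hcd]
      refine Finset.sum_eq_zero ?_
      rintro ⟨i, j⟩ hij
      have hs : i + j = m := by simpa using (Finset.mem_antidiagonal.mp hij).2.2
      by_cases hi : i < a
      · simp [hx.1 i hi]
      · simp [hy.1 j (by omega)]
  subst h
  exact ⟨fun m hm => by rw [key m hm.le, if_neg hm.ne], by rw [key _ le_rfl, if_pos rfl]⟩

theorem mul_low (hx : Lead a x c) (hy : Lead b y d) (h : n < a + b := by omega) :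
    Lead n (x * y) 0 :=
  (hx.mul hy rfl).low h

theorem ofNat_mul (m : ℕ) [m.AtLeastTwo] (hx : Lead n x c) :
    Lead n ((ofNat(m) : K⸨X⸩) * x) ((ofNat(m) : K) * c) := by
  have h : (ofNat(m) : K⸨X⸩) * x = m • x := by
    rw [nsmul_eq_mul]; rfl
  have h' : (ofNat(m) : K) * c = m • c := by
    rw [nsmul_eq_mul]; rfl
  rw [h, h']
  exact ⟨fun k hk => by rw [HahnSeries.coeff_smul, hx.1 k hk, smul_zero],
    by rw [HahnSeries.coeff_smul, hx.2]⟩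

theorem map {K' : Type*} [CommRing K'] (f : K →+* K') (hx : Lead n x c) :
    Lead n (coeffMap f x) (f c) :=
  ⟨fun m hm => by simp [hx.1 m hm], by simp [hx.2]⟩

theorem der (f : Der K) (hx : Lead n x c) : Lead n (coeffDer f x) (f c) :=
  ⟨fun m hm => by simp [hx.1 m hm], by simp [hx.2]⟩

theorem uder (hx : Lead a x c) (h : n = a + 1) : Lead n (uDer x) (-(a : K) * c) := by
  subst h
  refine ⟨fun m hm => ?_, ?_⟩
  · rw [uDer_coeff, hx.1 _ (by omega), mul_zero]
  · rw [uDer_coeff]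
    simp [hx.2]

end Lead

end Lead

/-! ### The system and the constraint field over a differential ring -/

section System

open Cpt SharpCpt DiffRing

variable {A : Type*} [CommRing A] [DiffRing A]

/-- The vector field `D`. -/
def fD (F : Cpt → A) : Der A := F e1 • p1 + F e2 • p2

/-- The vector field `D̄`. -/
def fDb (F : Cpt → A) : Der A := cj (F e1) • p1 + cj (F e2) • p2

/-- The vector field `N`. -/
def fN (F : Cpt → A) : Der A := F e4 • p1 + F e5 • p2 + p4

/-- The vector field `L`. -/
def fL (F : Cpt → A) : Der A := F e3 • p3

theorem op_apply (F : Cpt → A) : (∀ x, fD F x = F e1 * p1 x + F e2 * p2 x) ∧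
    (∀ x, fDb F x = cj (F e1) * p1 x + cj (F e2) * p2 x) ∧
    (∀ x, fN F x = F e4 * p1 x + F e5 * p2 x + p4 x) ∧ ∀ x, fL F x = F e3 * p3 x :=
  ⟨fun _ => rfl, fun _ => rfl, fun _ => rfl, fun _ => rfl⟩

/-- The Bianchi expressions `A_1, …, A_4`. -/
def gA1 (F : Cpt → A) : A :=
  fDb F (F w1) + fL F (F w2) + 4 * F γ2 * F w2 + 4 * F γ4 * F w1 + F γ5 * F w1

/-- See `gA1`. -/
def gA2 (F : Cpt → A) : A :=
  fDb F (F w2) + fL F (F w3) + 3 * F γ2 * F w3 + 2 * F γ4 * F w2 + 2 * F γ5 * F w2 + F γ7 * F w1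

/-- See `gA1`. -/
def gA3 (F : Cpt → A) : A :=
  fDb F (F w3) + fL F (F w4) + 2 * F γ2 * F w4 + 3 * F γ5 * F w3 + 2 * F γ7 * F w2

/-- See `gA1`. -/
def gA4 (F : Cpt → A) : A :=
  fDb F (F w4) + fL F (F w5) + F γ2 * F w5 - 2 * F γ4 * F w4 + 4 * F γ5 * F w4 + 3 * F γ7 * F w3

/-- The Bianchi expressions `B_1, …, B_4`. -/
def gB1 (F : Cpt → A) : A :=
  fN F (F w1) + fD F (F w2) + 3 * F γ1 * F w3 - 6 * F γ3 * F w2 + F γ6 * F w1 - 4 * F γ8 * F w1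
    + 4 * cj (F γ4) * F w2

/-- See `gB1`. -/
def gB2 (F : Cpt → A) : A :=
  fN F (F w2) + fD F (F w3) + 2 * F γ1 * F w4 - 3 * F γ3 * F w3 + 2 * F γ6 * F w2
    - 2 * F γ8 * F w2 + 3 * cj (F γ4) * F w3

/-- See `gB1`. -/
def gB3 (F : Cpt → A) : A :=
  fN F (F w3) + fD F (F w4) + F γ1 * F w5 + 3 * F γ6 * F w3 + 2 * cj (F γ4) * F w4

/-- See `gB1`. -/
def gB4 (F : Cpt → A) : A :=
  fN F (F w4) + fD F (F w5) + 3 * F γ3 * F w5 + 4 * F γ6 * F w4 + 2 * F γ8 * F w4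
    + cj (F γ4) * F w5

/-- The difference of the two sides of the symmetric hyperbolic system. -/
def gres (F : Cpt → A) (i : Cpt) : A :=
  match i with
  | e1 => fL F (F e1) - (-F e1 * F γ2 - cj (F e1) * F γ1)
  | e2 => fL F (F e2) - (-F e2 * F γ2 - cj (F e2) * F γ1)
  | e3 => fN F (F e3) - F e3 * (F γ8 + cj (F γ8))
  | e4 => fL F (F e4) - ((-F e1 * F γ4 + F e1 * F γ5 + F e1 * cj (F γ3))
      + cj (-F e1 * F γ4 + F e1 * F γ5 + F e1 * cj (F γ3)))
  | e5 => fL F (F e5) - ((-F e2 * F γ4 + F e2 * F γ5 + F e2 * cj (F γ3))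
      + cj (-F e2 * F γ4 + F e2 * F γ5 + F e2 * cj (F γ3)))
  | γ1 => fL F (F γ1) - (-2 * F γ1 * F γ2 - F w1)
  | γ2 => fL F (F γ2) - (-F γ1 * cj (F γ1) - F γ2 * F γ2)
  | γ3 => fL F (F γ3) - (F γ1 * F γ4 - F γ1 * F γ5 - F γ2 * F γ3 - F w2)
  | γ4 => fL F (F γ4) - (-F γ2 * F γ4 + F γ2 * F γ5 + F γ3 * cj (F γ1))
  | γ5 => fN F (F γ5) - (-F γ3 * F γ7 + F γ4 * F γ6 - F γ5 * F γ6 - F γ5 * F γ8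
      + F γ5 * cj (F γ8) - F γ6 * cj (F γ3) + F γ7 * cj (F γ4) - F γ7 * cj (F γ5) + F w4)
  | γ6 => fN F (F γ6) - (-F γ6 * F γ6 - F γ6 * (F γ8 + cj (F γ8)) - F γ7 * cj (F γ7))
  | γ7 => fN F (F γ7) - (-2 * F γ6 * F γ7 - 3 * F γ7 * F γ8 + F γ7 * cj (F γ8) - F w5)
  | γ8 => fL F (F γ8) - (-2 * F γ3 * F γ4 + 2 * F γ3 * F γ5 + F γ3 * cj (F γ3)
      + F γ4 * cj (F γ4) - F γ4 * cj (F γ5) - F γ5 * cj (F γ4) + F w3)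
  | w1 => U ^ 2 * gB1 F
  | w2 => U ^ 2 * gA1 F + U ^ 4 * gB2 F
  | w3 => U ^ 4 * gA2 F + U ^ 6 * gB3 F
  | w4 => U ^ 6 * gA3 F + U ^ 8 * gB4 F
  | w5 => U ^ 8 * gA4 F

/-- The constraint field; the components `t1`, `t2` are divided by `i`, and the components
`v1`, `v2`, `v3` by `λ_j`. -/
def gcon (F : Cpt → A) (j : SharpCpt) : A :=
  match j with
  | t1 => (fD F (cj (F e1)) + cj (F e1) * F γ3 + cj (F e1) * cj (F γ4))
      - cj (fD F (cj (F e1)) + cj (F e1) * F γ3 + cj (F e1) * cj (F γ4))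
  | t2 => (fD F (cj (F e2)) + cj (F e2) * F γ3 + cj (F e2) * cj (F γ4))
      - cj (fD F (cj (F e2)) + cj (F e2) * F γ3 + cj (F e2) * cj (F γ4))
  | t3 => fD F (F e3) - F e3 * F γ3 + F e3 * cj (F γ4) + F e3 * cj (F γ5)
  | t4 => fDb F (F e4) - fN F (cj (F e1)) - F e1 * F γ7 - cj (F e1) * F γ6
      + cj (F e1) * cj (F γ8) - cj (F e1) * F γ8
  | t5 => fDb F (F e5) - fN F (cj (F e2)) - F e2 * F γ7 - cj (F e2) * F γ6
      + cj (F e2) * cj (F γ8) - cj (F e2) * F γ8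
  | u1 => fD F (F γ2) - fDb F (F γ1) + F w2 - 3 * F γ1 * F γ4 - F γ1 * cj (F γ3) - F γ2 * F γ3
      + F γ2 * cj (F γ4)
  | u2 => fD F (F γ4) + fDb F (F γ3) - F w3 + 2 * F γ3 * F γ4 + F γ1 * F γ7 - F γ2 * F γ6
      + F γ3 * cj (F γ3) + F γ4 * cj (F γ4)
  | u3 => fDb F (F γ3) - fDb F (cj (F γ4)) + fN F (F γ2) - F w3 + 2 * F γ3 * F γ4
      - 2 * F γ4 * cj (F γ4) + F γ1 * F γ7 + F γ2 * F γ6 - F γ2 * F γ8 - F γ2 * cj (F γ8)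
  | u4 => fD F (cj (F γ4)) - fD F (F γ3) - fN F (F γ1) + 3 * F γ1 * F γ8 + 2 * F γ3 * F γ3
      - 2 * F γ3 * cj (F γ4) - F γ1 * F γ6 - F γ1 * cj (F γ8) - F γ2 * cj (F γ7)
  | u5 => fDb F (F γ5) - fL F (F γ7) - F γ2 * F γ7 - F γ4 * F γ5 + F γ5 * F γ5
      - F γ5 * cj (F γ3) - F γ6 * cj (F γ1)
  | u6 => fL F (F γ6) - fD F (F γ5) - F w3 + F γ1 * F γ7 + F γ2 * F γ6 - F γ3 * F γ5
      - F γ5 * cj (F γ4) - F γ5 * cj (F γ5)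
  | u7 => fD F (F γ8) - fN F (F γ3) - 2 * F γ3 * F γ6 + F γ3 * F γ8 - F γ3 * cj (F γ8)
      + F γ4 * cj (F γ7) + F γ6 * cj (F γ4)
  | u8 => fN F (F γ4) + fDb F (F γ8) + F w4 - 2 * F γ3 * F γ7 + F γ4 * F γ6 + F γ4 * F γ8
      - F γ4 * cj (F γ8) + F γ7 * cj (F γ4)
  | u9 => fD F (F γ7) - fDb F (F γ6) - F w4 + 3 * F γ3 * F γ7 + F γ4 * F γ6 - F γ6 * cj (F γ3)
      + F γ7 * cj (F γ4)
  | v1 => gA1 F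
  | v2 => gA2 F
  | v3 => gA3 F

/-- A solution of the symmetric hyperbolic system over a differential ring. -/
structure IsSol (F : Cpt → A) : Prop where
  real_e3 : cj (F e3) = F e3
  real_e4 : cj (F e4) = F e4
  real_e5 : cj (F e5) = F e5
  real_γ2 : cj (F γ2) = F γ2
  real_γ6 : cj (F γ6) = F γ6
  res : ∀ i, gres F i = 0

namespace IsSol

variable {F : Cpt → A} (h : IsSol F)

local notation "G" => gcon F
local notation "D" => fD F
local notation "Db" => fDb F
local notation "N" => fN F
local notation "L" => fL F

theorem Z_U_pow (A : Type*) [CommRing A] [DiffRing A] (n : ℕ) : (Z : A) ^ n * U ^ n = 1 := by rw [← mul_pow, mul_comm, U_Z, one_pow]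

theorem fL_ZZ (x : A) : L (-Z * Z * x) = -Z * Z * L x := by
  simp only [op_apply, Der.leibniz, map_neg, p3_Z]; ring

theorem fDb_ZZ (x : A) : Db (-Z * Z * x) = -Z * Z * Db x := by
  simp only [op_apply, Der.leibniz, map_neg, p1_Z, p2_Z]; ring

theorem cj_D (x : A) : cj (D x) = Db (cj x) := by
  simp only [op_apply, map_add, map_mul, cj_p1, cj_p2]

theorem cj_Db (x : A) : cj (Db x) = D (cj x) := by
  simp only [op_apply, map_add, map_mul, cj_p1, cj_p2, cj_cj]

include h

theorem cj_N (x : A) : cj (N x) = N (cj x) := by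
  simp only [op_apply, map_add, map_mul, cj_p1, cj_p2, cj_p4, h.real_e4, h.real_e5]

theorem cj_L (x : A) : cj (L x) = L (cj x) := by
  simp only [op_apply, map_mul, cj_p3, h.real_e3]

theorem conj_eq {x y x' y' : A} (e : x = y) (hxy : x' - y' = cj x - cj y := by
    simp only [map_add, map_sub, map_neg, map_mul, map_ofNat, cj_cj, cj_D, cj_Db, h.cj_N, h.cj_L,
      cj_Z, h.real_e3, h.real_e4, h.real_e5, h.real_γ2, h.real_γ6] <;> ring) :
    x' = y' := by
  rw [← sub_eq_zero, hxy, e, sub_self]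

theorem gB1_eq : gB1 F = 0 := by
  have e := h.res w1
  simp only [gres] at e
  linear_combination Z ^ 2 * e - gB1 F * Z_U_pow A 2

theorem gB2_eq : gB2 F = -Z * Z * G v1 := by
  have e := h.res w2
  simp only [gres, gcon] at e ⊢
  linear_combination Z ^ 4 * e - gB2 F * Z_U_pow A 4 - Z ^ 2 * gA1 F * Z_U_pow A 2

theorem gB3_eq : gB3 F = -Z * Z * G v2 := by
  have e := h.res w3
  simp only [gres, gcon] at e ⊢
  linear_combination Z ^ 6 * e - gB3 F * Z_U_pow A 6 - Z ^ 2 * gA2 F * Z_U_pow A 4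

theorem gB4_eq : gB4 F = -Z * Z * G v3 := by
  have e := h.res w4
  simp only [gres, gcon] at e ⊢
  linear_combination Z ^ 8 * e - gB4 F * Z_U_pow A 8 - Z ^ 2 * gA3 F * Z_U_pow A 6

theorem gA4_eq : gA4 F = 0 := by
  have e := h.res w5
  simp only [gres] at e
  linear_combination Z ^ 8 * e - gA4 F * Z_U_pow A 8

theorem L_e1 : L (F e1) = -F e1 * F γ2 - cj (F e1) * F γ1 := by
  linear_combination sub_eq_zero.mp (h.res e1)

theorem L_e2 : L (F e2) = -F e2 * F γ2 - cj (F e2) * F γ1 := by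
  linear_combination sub_eq_zero.mp (h.res e2)

theorem N_e3 : N (F e3) = F e3 * F γ8 + F e3 * cj (F γ8) := by
  linear_combination sub_eq_zero.mp (h.res e3)

theorem L_e4 : L (F e4) = F e1 * cj (F γ3) - F e1 * F γ4 + F e1 * F γ5 + cj (F e1) * F γ3 - cj (F
    e1) * cj (F γ4) + cj (F e1) * cj (F γ5) := by
  have e := h.res e4
  simp only [gres, map_add, map_sub, map_neg, map_mul, cj_cj] at e
  linear_combination e

theorem L_e5 : L (F e5) = F e2 * cj (F γ3) - F e2 * F γ4 + F e2 * F γ5 + cj (F e2) * F γ3 - cj (F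
    e2) * cj (F γ4) + cj (F e2) * cj (F γ5) := by
  have e := h.res e5
  simp only [gres, map_add, map_sub, map_neg, map_mul, cj_cj] at e
  linear_combination e

theorem L_γ1 : L (F γ1) = -F w1 - 2 * F γ1 * F γ2 := by
  linear_combination sub_eq_zero.mp (h.res γ1)

theorem L_γ2 : L (F γ2) = -F γ1 * cj (F γ1) - F γ2 * F γ2 := by
  linear_combination sub_eq_zero.mp (h.res γ2)

theorem L_γ3 : L (F γ3) = -F w2 + F γ1 * F γ4 - F γ1 * F γ5 - F γ2 * F γ3 := by
  linear_combination sub_eq_zero.mp (h.res γ3)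

theorem L_γ4 : L (F γ4) = cj (F γ1) * F γ3 - F γ2 * F γ4 + F γ2 * F γ5 := by
  linear_combination sub_eq_zero.mp (h.res γ4)

theorem N_γ5 : N (F γ5) = F w4 - F γ3 * F γ7 - cj (F γ3) * F γ6 + F γ4 * F γ6 + cj (F γ4) * F γ7 -
    F γ5 * F γ6 - F γ5 * F γ8 + F γ5 * cj (F γ8) - cj (F γ5) * F γ7 := by
  linear_combination sub_eq_zero.mp (h.res γ5)

theorem N_γ6 : N (F γ6) = -F γ6 * F γ6 - F γ6 * F γ8 - F γ6 * cj (F γ8) - F γ7 * cj (F γ7) := by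
  linear_combination sub_eq_zero.mp (h.res γ6)

theorem N_γ7 : N (F γ7) = -F w5 - 2 * F γ6 * F γ7 - 3 * F γ7 * F γ8 + F γ7 * cj (F γ8) := by
  linear_combination sub_eq_zero.mp (h.res γ7)

theorem L_γ8 : L (F γ8) = F w3 + F γ3 * cj (F γ3) - 2 * F γ3 * F γ4 + 2 * F γ3 * F γ5 + F γ4 * cj
    (F γ4) - F γ4 * cj (F γ5) - cj (F γ4) * F γ5 := by
  linear_combination sub_eq_zero.mp (h.res γ8)

theorem D_e1b : D (cj (F e1)) = G t1 + Db (F e1) + F e1 * cj (F γ3) + F e1 * F γ4 - cj (F e1) * F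
    γ3 - cj (F e1) * cj (F γ4) := by
  simp only [gcon, map_add, map_mul, cj_cj, cj_D]; ring

theorem D_e2b : D (cj (F e2)) = G t2 + Db (F e2) + F e2 * cj (F γ3) + F e2 * F γ4 - cj (F e2) * F
    γ3 - cj (F e2) * cj (F γ4) := by
  simp only [gcon, map_add, map_mul, cj_cj, cj_D]; ring

theorem D_e3 : D (F e3) = G t3 + F e3 * F γ3 - F e3 * cj (F γ4) - F e3 * cj (F γ5) := by
  simp only [gcon]; ring

theorem Db_e3 : Db (F e3) = cj (G t3) + F e3 * cj (F γ3) - F e3 * F γ4 - F e3 * F γ5 := h.conj_eq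
    h.D_e3

theorem N_e1b : N (cj (F e1)) = -G t4 + Db (F e4) - F e1 * F γ7 - cj (F e1) * F γ6 - cj (F e1) * F
    γ8 + cj (F e1) * cj (F γ8) := by
  simp only [gcon]; ring

theorem N_e1 : N (F e1) = -cj (G t4) + D (F e4) - F e1 * F γ6 + F e1 * F γ8 - F e1 * cj (F γ8) -
    cj (F e1) * cj (F γ7) := h.conj_eq h.N_e1b

theorem N_e2b : N (cj (F e2)) = -G t5 + Db (F e5) - F e2 * F γ7 - cj (F e2) * F γ6 - cj (F e2) * F
    γ8 + cj (F e2) * cj (F γ8) := by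
  simp only [gcon]; ring

theorem N_e2 : N (F e2) = -cj (G t5) + D (F e5) - F e2 * F γ6 + F e2 * F γ8 - F e2 * cj (F γ8) -
    cj (F e2) * cj (F γ7) := h.conj_eq h.N_e2b

theorem D_γ2 : D (F γ2) = G u1 - F w2 + Db (F γ1) + F γ1 * cj (F γ3) + 3 * F γ1 * F γ4 + F γ2 * F
    γ3 - F γ2 * cj (F γ4) := by
  simp only [gcon]; ring

theorem Db_γ2 : Db (F γ2) = cj (G u1) - cj (F w2) + D (cj (F γ1)) + cj (F γ1) * F γ3 + 3 * cj (F
    γ1) * cj (F γ4) + F γ2 * cj (F γ3) - F γ2 * F γ4 := h.conj_eq h.D_γ2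

theorem D_γ4 : D (F γ4) = G u2 + F w3 - Db (F γ3) - F γ1 * F γ7 + F γ2 * F γ6 - F γ3 * cj (F γ3) -
    2 * F γ3 * F γ4 - F γ4 * cj (F γ4) := by
  simp only [gcon]; ring

theorem N_γ1 : N (F γ1) = -G u4 - D (F γ3) + D (cj (F γ4)) - F γ1 * F γ6 + 3 * F γ1 * F γ8 - F γ1
    * cj (F γ8) - F γ2 * cj (F γ7) + 2 * F γ3 * F γ3 - 2 * F γ3 * cj (F γ4) := by
  simp only [gcon]; ring

theorem L_γ7 : L (F γ7) = -G u5 + Db (F γ5) - cj (F γ1) * F γ6 - F γ2 * F γ7 - cj (F γ3) * F γ5 -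
    F γ4 * F γ5 + F γ5 * F γ5 := by
  simp only [gcon]; ring

theorem D_γ5 : D (F γ5) = -G u6 - F w3 + L (F γ6) + F γ1 * F γ7 + F γ2 * F γ6 - F γ3 * F γ5 - cj
    (F γ4) * F γ5 - F γ5 * cj (F γ5) := by
  simp only [gcon]; ring

theorem N_γ3 : N (F γ3) = -G u7 + D (F γ8) - 2 * F γ3 * F γ6 + F γ3 * F γ8 - F γ3 * cj (F γ8) + F
    γ4 * cj (F γ7) + cj (F γ4) * F γ6 := by
  simp only [gcon]; ring

theorem N_γ4 : N (F γ4) = G u8 - F w4 - Db (F γ8) + 2 * F γ3 * F γ7 - F γ4 * F γ6 - F γ4 * F γ8 +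
    F γ4 * cj (F γ8) - cj (F γ4) * F γ7 := by
  simp only [gcon]; ring

theorem D_γ7 : D (F γ7) = G u9 + F w4 + Db (F γ6) - 3 * F γ3 * F γ7 + cj (F γ3) * F γ6 - F γ4 * F
    γ6 - cj (F γ4) * F γ7 := by
  simp only [gcon]; ring

theorem L_w2 : L (F w2) = G v1 - Db (F w1) - 4 * F γ2 * F w2 - 4 * F γ4 * F w1 - F γ5 * F w1 := by
  simp only [gcon, gA1]; ring

theorem L_w3 : L (F w3) = G v2 - Db (F w2) - 3 * F γ2 * F w3 - 2 * F γ4 * F w2 - 2 * F γ5 * F w2 -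
    F γ7 * F w1 := by
  simp only [gcon, gA2]; ring

theorem L_w4 : L (F w4) = G v3 - Db (F w3) - 2 * F γ2 * F w4 - 3 * F γ5 * F w3 - 2 * F γ7 * F w2
    := by
  simp only [gcon, gA3]; ring

theorem L_w5 : L (F w5) = -Db (F w4) - F γ2 * F w5 + 2 * F γ4 * F w4 - 4 * F γ5 * F w4 - 3 * F γ7
    * F w3 := by
  have e := h.gA4_eq
  simp only [gA4] at e
  linear_combination e

theorem N_w1 : N (F w1) = -D (F w2) - 3 * F γ1 * F w3 + 6 * F γ3 * F w2 - 4 * cj (F γ4) * F w2 - F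
    γ6 * F w1 + 4 * F γ8 * F w1 := by
  have e := h.gB1_eq
  simp only [gB1] at e
  linear_combination e

theorem N_w2 : N (F w2) = -D (F w3) - 2 * F γ1 * F w4 + 3 * F γ3 * F w3 - 3 * cj (F γ4) * F w3 - 2
    * F γ6 * F w2 + 2 * F γ8 * F w2 - G v1 * Z * Z := by
  have e := h.gB2_eq
  simp only [gB2] at e
  linear_combination e

theorem N_w3 : N (F w3) = -D (F w4) - F γ1 * F w5 - 2 * cj (F γ4) * F w4 - 3 * F γ6 * F w3 - G v2
    * Z * Z := by
  have e := h.gB3_eq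
  simp only [gB3] at e
  linear_combination e

theorem N_w4 : N (F w4) = -D (F w5) - 3 * F γ3 * F w5 - cj (F γ4) * F w5 - 4 * F γ6 * F w4 - 2 * F
    γ8 * F w4 - G v3 * Z * Z := by
  have e := h.gB4_eq
  simp only [gB4] at e
  linear_combination e

theorem L_e1b : L (cj (F e1)) = -F e1 * cj (F γ1) - cj (F e1) * F γ2 := h.conj_eq h.L_e1

theorem L_e2b : L (cj (F e2)) = -F e2 * cj (F γ1) - cj (F e2) * F γ2 := h.conj_eq h.L_e2

theorem L_γ3b : L (cj (F γ3)) = -cj (F w2) + cj (F γ1) * cj (F γ4) - cj (F γ1) * cj (F γ5) - F γ2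
    * cj (F γ3) := h.conj_eq h.L_γ3

theorem L_γ4b : L (cj (F γ4)) = F γ1 * cj (F γ3) - F γ2 * cj (F γ4) + F γ2 * cj (F γ5) :=
    h.conj_eq h.L_γ4

theorem N_γ5b : N (cj (F γ5)) = cj (F w4) - F γ3 * F γ6 - cj (F γ3) * cj (F γ7) + F γ4 * cj (F γ7)
    + cj (F γ4) * F γ6 - F γ5 * cj (F γ7) - cj (F γ5) * F γ6 + cj (F γ5) * F γ8 - cj (F γ5) * cj
    (F γ8) := h.conj_eq h.N_γ5

theorem L_γ8b : L (cj (F γ8)) = cj (F w3) + F γ3 * cj (F γ3) - 2 * cj (F γ3) * cj (F γ4) + 2 * cj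
    (F γ3) * cj (F γ5) + F γ4 * cj (F γ4) - F γ4 * cj (F γ5) - cj (F γ4) * F γ5 := h.conj_eq
    h.L_γ8

theorem Db_γ4b : Db (cj (F γ4)) = cj (G u2) + cj (F w3) - D (cj (F γ3)) - cj (F γ1) * cj (F γ7) +
    F γ2 * F γ6 - F γ3 * cj (F γ3) - 2 * cj (F γ3) * cj (F γ4) - F γ4 * cj (F γ4) := h.conj_eq
    h.D_γ4

theorem N_γ1b : N (cj (F γ1)) = -cj (G u4) - Db (cj (F γ3)) + Db (F γ4) - cj (F γ1) * F γ6 - cj (F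
    γ1) * F γ8 + 3 * cj (F γ1) * cj (F γ8) - F γ2 * F γ7 + 2 * cj (F γ3) * cj (F γ3) - 2 * cj (F
    γ3) * F γ4 := h.conj_eq h.N_γ1

theorem L_γ7b : L (cj (F γ7)) = -cj (G u5) + D (cj (F γ5)) - F γ1 * F γ6 - F γ2 * cj (F γ7) - F γ3
    * cj (F γ5) - cj (F γ4) * cj (F γ5) + cj (F γ5) * cj (F γ5) := h.conj_eq h.L_γ7

theorem Db_γ5b : Db (cj (F γ5)) = -cj (G u6) - cj (F w3) + L (F γ6) + cj (F γ1) * cj (F γ7) + F γ2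
    * F γ6 - cj (F γ3) * cj (F γ5) - F γ4 * cj (F γ5) - F γ5 * cj (F γ5) := h.conj_eq h.D_γ5

theorem N_γ3b : N (cj (F γ3)) = -cj (G u7) + Db (cj (F γ8)) - 2 * cj (F γ3) * F γ6 - cj (F γ3) * F
    γ8 + cj (F γ3) * cj (F γ8) + F γ4 * F γ6 + cj (F γ4) * F γ7 := h.conj_eq h.N_γ3

theorem N_γ4b : N (cj (F γ4)) = cj (G u8) - cj (F w4) - D (cj (F γ8)) + 2 * cj (F γ3) * cj (F γ7)
    - F γ4 * cj (F γ7) - cj (F γ4) * F γ6 + cj (F γ4) * F γ8 - cj (F γ4) * cj (F γ8) := h.conj_eq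
    h.N_γ4

theorem Db_γ7b : Db (cj (F γ7)) = cj (G u9) + cj (F w4) + D (F γ6) + F γ3 * F γ6 - 3 * cj (F γ3) *
    cj (F γ7) - F γ4 * cj (F γ7) - cj (F γ4) * F γ6 := h.conj_eq h.D_γ7

theorem N_γ2 : N (F γ2) = cj (G u2) + G u3 + F w3 + cj (F w3) - D (cj (F γ3)) - Db (F γ3) - F γ1 *
    F γ7 - cj (F γ1) * cj (F γ7) + F γ2 * F γ8 + F γ2 * cj (F γ8) - F γ3 * cj (F γ3) - 2 * F γ3 *
    F γ4 - 2 * cj (F γ3) * cj (F γ4) + F γ4 * cj (F γ4) := by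
  have e := h.Db_γ4b
  have e2 : G u3 = G u3 := rfl
  conv_rhs at e2 => simp only [gcon]
  linear_combination e - e2

theorem comm_L_D (x : A) : L (D x) = D (L x) + (-D x * F γ2 - Db x * F γ1 - L x * F γ3 + L x * cj
    (F γ4) + L x * cj (F γ5) - p3 x * G t3) := by
  have e : L (D x) - D (L x) = L (F e1) * p1 x + L (F e2) * p2 x - D (F e3) * p3 x := by
    simp only [op_apply, map_add, Der.leibniz, p1_p2, p1_p3, p2_p3, p4_p1, p4_p2, p4_p3]; ring
  simp only [h.L_e1, h.L_e2, h.D_e3] at e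
  simp only [op_apply] at e ⊢
  linear_combination e

theorem comm_L_Db (x : A) : L (Db x) = Db (L x) + (-D x * cj (F γ1) - Db x * F γ2 - L x * cj (F
    γ3) + L x * F γ4 + L x * F γ5 - p3 x * cj (G t3)) := by
  have e : L (Db x) - Db (L x) = L (cj (F e1)) * p1 x + L (cj (F e2)) * p2 x - Db (F e3) * p3 x := by
    simp only [op_apply, map_add, Der.leibniz, p1_p2, p1_p3, p2_p3, p4_p1, p4_p2, p4_p3]; ring
  simp only [h.L_e1b, h.L_e2b, h.Db_e3] at e
  simp only [op_apply] at e ⊢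
  linear_combination e

theorem comm_L_N (x : A) : L (N x) = N (L x) + (D x * cj (F γ3) - D x * F γ4 + D x * F γ5 + Db x *
    F γ3 - Db x * cj (F γ4) + Db x * cj (F γ5) - L x * F γ8 - L x * cj (F γ8)) := by
  have e : L (N x) - N (L x) = L (F e4) * p1 x + L (F e5) * p2 x - N (F e3) * p3 x := by
    simp only [op_apply, map_add, Der.leibniz, p1_p2, p1_p3, p2_p3, p4_p1, p4_p2, p4_p3]; ring
  simp only [h.L_e4, h.L_e5, h.N_e3] at e
  simp only [op_apply] at e ⊢
  linear_combination e

theorem comm_D_N (x : A) : D (N x) = N (D x) + (D x * F γ6 - D x * F γ8 + D x * cj (F γ8) + Db x *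
    cj (F γ7) + p1 x * cj (G t4) + p2 x * cj (G t5)) := by
  have e : D (N x) - N (D x) = D (F e4) * p1 x - N (F e1) * p1 x + D (F e5) * p2 x - N (F e2) * p2 x := by
    simp only [op_apply, map_add, Der.leibniz, p1_p2, p1_p3, p2_p3, p4_p1, p4_p2, p4_p3]; ring
  simp only [h.N_e1, h.N_e2] at e
  simp only [op_apply] at e ⊢
  linear_combination e

theorem comm_Db_N (x : A) : Db (N x) = N (Db x) + (D x * F γ7 + Db x * F γ6 + Db x * F γ8 - Db x *
    cj (F γ8) + p1 x * G t4 + p2 x * G t5) := by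
  have e : Db (N x) - N (Db x) = Db (F e4) * p1 x - N (cj (F e1)) * p1 x + Db (F e5) * p2 x - N (cj (F e2)) * p2 x := by
    simp only [op_apply, map_add, Der.leibniz, p1_p2, p1_p3, p2_p3, p4_p1, p4_p2, p4_p3]; ring
  simp only [h.N_e1b, h.N_e2b] at e
  simp only [op_apply] at e ⊢
  linear_combination e

theorem comm_D_Db (x : A) : D (Db x) = Db (D x) + (D x * cj (F γ3) + D x * F γ4 - Db x * F γ3 - Db
    x * cj (F γ4) + p1 x * G t1 + p2 x * G t2) := by
  have e : D (Db x) - Db (D x) = D (cj (F e1)) * p1 x - Db (F e1) * p1 x + D (cj (F e2)) * p2 x - Db (F e2) * p2 x := by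
    simp only [op_apply, map_add, Der.leibniz, p1_p2, p1_p3, p2_p3, p4_p1, p4_p2, p4_p3]; ring
  simp only [h.D_e1b, h.D_e2b] at e
  simp only [op_apply] at e ⊢
  linear_combination e

theorem comm_N_D (x : A) : N (D x) = D (N x) + (-D x * F γ6 + D x * F γ8 - D x * cj (F γ8) - Db x
    * cj (F γ7) - p1 x * cj (G t4) - p2 x * cj (G t5)) := by
  linear_combination -h.comm_D_N x

theorem comm_N_Db (x : A) : N (Db x) = Db (N x) + (-D x * F γ7 - Db x * F γ6 - Db x * F γ8 + Db x
    * cj (F γ8) - p1 x * G t4 - p2 x * G t5) := by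
  linear_combination -h.comm_Db_N x

theorem comm_N_L (x : A) : N (L x) = L (N x) + (-D x * cj (F γ3) + D x * F γ4 - D x * F γ5 - Db x
    * F γ3 + Db x * cj (F γ4) - Db x * cj (F γ5) + L x * F γ8 + L x * cj (F γ8)) := by
  linear_combination -h.comm_L_N x

theorem L_t1 : L (G t1) = -2 * G t1 * F γ2 + F e1 * cj (G u1) - cj (F e1) * G u1 + p3 (F e1) * cj
    (G t3) - p3 (cj (F e1)) * G t3 := by
  conv_lhs =>
    simp only [gcon, map_add, map_sub, map_mul, cj_cj, cj_D]
    simp only [Der.rules, h.comm_L_D, h.comm_L_Db]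
    simp only [h.L_e1, h.L_e1b, Der.rules]
    simp only [h.D_e1b, h.D_γ2, h.Db_γ2, h.L_e1, h.L_e1b, h.L_γ3, h.L_γ3b,
      h.L_γ4, h.L_γ4b]
  ring

theorem L_t2 : L (G t2) = -2 * G t2 * F γ2 + F e2 * cj (G u1) - cj (F e2) * G u1 + p3 (F e2) * cj
    (G t3) - p3 (cj (F e2)) * G t3 := by
  conv_lhs =>
    simp only [gcon, map_add, map_sub, map_mul, cj_cj, cj_D]
    simp only [Der.rules, h.comm_L_D, h.comm_L_Db]
    simp only [h.L_e2, h.L_e2b, Der.rules]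
    simp only [h.D_e2b, h.D_γ2, h.Db_γ2, h.L_e2, h.L_e2b, h.L_γ3, h.L_γ3b,
      h.L_γ4, h.L_γ4b]
  ring

theorem N_t3 : N (G t3) = F e3 * G u7 + F e3 * cj (G u8) - F γ6 * G t3 - cj (F γ7) * cj (G t3) + 2
    * F γ8 * G t3 - p1 (F e3) * cj (G t4) - p2 (F e3) * cj (G t5) := by
  conv_lhs =>
    simp only [gcon]
    simp only [Der.rules, h.comm_N_D]
    simp only [h.N_e3, Der.rules]
    simp only [h.D_e3, h.Db_e3, h.N_e3, h.N_γ3, h.N_γ4b, h.N_γ5b]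
  ring

theorem L_t4 : L (G t4) = -G t1 * cj (F γ3) + G t1 * F γ4 - G t1 * F γ5 - F e1 * cj (G u4) + F e1
    * G u5 + cj (F e1) * G u3 - cj (F e1) * cj (G u6) - cj (F γ1) * cj (G t4) - F γ2 * G t4 - p3
    (F e4) * cj (G t3) := by
  conv_lhs =>
    simp only [gcon]
    simp only [Der.rules, h.comm_L_Db, h.comm_L_N]
    simp only [h.L_e1b, h.L_e4, Der.rules]
    simp only [h.D_e1b, h.Db_γ4b, h.Db_γ5b, h.L_e1, h.L_e1b, h.L_e4,
      h.L_γ7, h.L_γ8, h.L_γ8b, h.N_e1, h.N_e1b, h.N_γ1b, h.N_γ2]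
  ring

theorem L_t5 : L (G t5) = -G t2 * cj (F γ3) + G t2 * F γ4 - G t2 * F γ5 - F e2 * cj (G u4) + F e2
    * G u5 + cj (F e2) * G u3 - cj (F e2) * cj (G u6) - cj (F γ1) * cj (G t5) - F γ2 * G t5 - p3
    (F e5) * cj (G t3) := by
  conv_lhs =>
    simp only [gcon]
    simp only [Der.rules, h.comm_L_Db, h.comm_L_N]
    simp only [h.L_e2b, h.L_e5, Der.rules]
    simp only [h.D_e2b, h.Db_γ4b, h.Db_γ5b, h.L_e2, h.L_e2b, h.L_e5,
      h.L_γ7, h.L_γ8, h.L_γ8b, h.N_e2, h.N_e2b, h.N_γ1b, h.N_γ2]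
  ring

theorem L_u1 : L (G u1) = G v1 + F γ1 * cj (G u1) - 3 * F γ2 * G u1 + p3 (F γ1) * cj (G t3) - p3
    (F γ2) * G t3 := by
  conv_lhs =>
    simp only [gcon]
    simp only [Der.rules, h.comm_L_D, h.comm_L_Db]
    simp only [h.L_γ1, h.L_γ2, Der.rules]
    simp only [h.D_γ2, h.Db_γ2, h.L_γ1, h.L_γ2, h.L_γ3, h.L_γ3b, h.L_γ4,
      h.L_γ4b, h.L_w2]
  ring

theorem L_u2 : L (G u2) = -G v2 - F γ1 * G u5 - 2 * F γ2 * G u2 - F γ2 * G u6 - F γ3 * cj (G u1) -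
    F γ4 * G u1 + F γ5 * G u1 - p3 (F γ3) * cj (G t3) - p3 (F γ4) * G t3 := by
  conv_lhs =>
    simp only [gcon]
    simp only [Der.rules, h.comm_L_D, h.comm_L_Db]
    simp only [h.L_γ3, h.L_γ4, Der.rules]
    simp only [h.D_γ2, h.D_γ4, h.D_γ5, h.Db_γ2, h.L_γ1, h.L_γ2, h.L_γ3,
      h.L_γ3b, h.L_γ4, h.L_γ4b, h.L_γ7, h.L_w3]
  ring

theorem L_u3 : L (G u3) = -G v2 + F γ1 * cj (G u4) - F γ1 * G u5 + cj (F γ1) * G u4 - 2 * F γ2 * G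
    u3 + F γ2 * cj (G u6) + cj (F γ3) * G u1 - F γ4 * G u1 + F γ5 * G u1 - p3 (F γ3) * cj (G t3) +
    p3 (cj (F γ4)) * cj (G t3) := by
  conv_lhs =>
    simp only [gcon]
    simp only [Der.rules, h.comm_L_Db, h.comm_L_N]
    simp only [h.L_γ2, h.L_γ3, h.L_γ4b, Der.rules]
    simp only [h.D_γ2, h.Db_γ4b, h.Db_γ5b, h.L_γ1, h.L_γ2, h.L_γ3, h.L_γ4,
      h.L_γ4b, h.L_γ7, h.L_γ8, h.L_γ8b, h.L_w3, h.N_γ1, h.N_γ1b, h.N_γ2]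
  ring

theorem L_u4 : L (G u4) = -F γ1 * G u2 + F γ1 * cj (G u2) + 2 * F γ1 * G u3 - F γ1 * G u6 - 2 * F
    γ2 * G u4 + F γ2 * cj (G u5) + F γ3 * G u1 - cj (F γ4) * G u1 + cj (F γ5) * G u1 + p3 (F γ3) *
    G t3 - p3 (cj (F γ4)) * G t3 := by
  conv_lhs =>
    simp only [gcon]
    simp only [Der.rules, h.comm_L_D, h.comm_L_N]
    simp only [h.L_γ1, h.L_γ3, h.L_γ4b, Der.rules]
    simp only [h.D_γ2, h.D_γ4, h.D_γ5, h.Db_γ4b, h.L_γ1, h.L_γ2, h.L_γ3,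
      h.L_γ4b, h.L_γ7b, h.L_γ8, h.L_γ8b, h.N_γ1, h.N_γ2, h.N_w1]
  ring

theorem N_u5 : N (G u5) = cj (F γ3) * G u9 - F γ4 * G u9 + F γ5 * cj (G u7) - F γ5 * G u8 + F γ5 *
    G u9 + F γ6 * cj (G u4) - 2 * F γ6 * G u5 - F γ7 * G u3 + F γ7 * G u6 + F γ7 * cj (G u6) - 2 *
    F γ8 * G u5 + 2 * cj (F γ8) * G u5 - p1 (F γ5) * G t4 - p2 (F γ5) * G t5 := by
  conv_lhs =>
    simp only [gcon]
    simp only [Der.rules, h.comm_N_Db, h.comm_N_L]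
    simp only [h.N_γ5, h.N_γ7, Der.rules]
    simp only [h.D_γ5, h.D_γ7, h.Db_γ4b, h.Db_γ5b, h.L_γ7, h.L_γ8, h.L_γ8b,
      h.L_w5, h.N_γ1b, h.N_γ2, h.N_γ3b, h.N_γ4, h.N_γ5, h.N_γ6, h.N_γ7]
  ring

theorem N_u6 : N (G u6) = F γ3 * G u9 - cj (F γ4) * G u9 + F γ5 * G u7 - F γ5 * cj (G u8) + cj (F
    γ5) * G u9 - F γ6 * G u2 + F γ6 * cj (G u2) + F γ6 * G u3 - 2 * F γ6 * G u6 - F γ7 * G u4 + F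
    γ7 * cj (G u5) + cj (F γ7) * G u5 + p1 (F γ5) * cj (G t4) + p2 (F γ5) * cj (G t5) + G v2 * Z *
    Z := by
  conv_lhs =>
    simp only [gcon]
    simp only [Der.rules, h.comm_N_D, h.comm_N_L]
    simp only [h.N_γ5, h.N_γ6, Der.rules]
    simp only [h.D_γ4, h.D_γ5, h.D_γ7, h.L_γ7, h.L_γ7b, h.L_γ8, h.L_γ8b,
      h.N_γ1, h.N_γ2, h.N_γ3, h.N_γ4b, h.N_γ5, h.N_γ5b, h.N_γ6, h.N_γ7,
      h.N_w3]
  ring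

theorem L_u7 : L (G u7) = -F γ1 * G u8 - F γ2 * G u7 - 2 * F γ3 * G u2 + F γ3 * cj (G u2) + F γ3 *
    G u3 - 2 * F γ3 * G u6 + F γ4 * G u4 - F γ4 * cj (G u5) + cj (F γ4) * G u2 + cj (F γ4) * G u6
    - F γ5 * G u4 - cj (F γ5) * G u2 - p3 (F γ8) * G t3 - G v1 * Z * Z := by
  conv_lhs =>
    simp only [gcon]
    simp only [Der.rules, h.comm_L_D, h.comm_L_N]
    simp only [h.L_γ3, h.L_γ8, Der.rules]
    simp only [h.D_γ4, h.D_γ5, h.L_γ3, h.L_γ4, h.L_γ4b, h.L_γ7b, h.L_γ8,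
      h.L_γ8b, h.N_γ1, h.N_γ2, h.N_γ3, h.N_γ4, h.N_γ5, h.N_w2]
  ring

theorem L_u8 : L (G u8) = G v3 - cj (F γ1) * G u7 - F γ2 * G u8 - F γ3 * cj (G u4) + 2 * F γ3 * G
    u5 + cj (F γ3) * G u2 - F γ4 * G u2 - F γ4 * G u3 + F γ4 * cj (G u6) - cj (F γ4) * G u5 + F γ5
    * G u2 + F γ5 * G u3 - p3 (F γ8) * cj (G t3) := by
  conv_lhs =>
    simp only [gcon]
    simp only [Der.rules, h.comm_L_Db, h.comm_L_N]
    simp only [h.L_γ4, h.L_γ8, Der.rules]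
    simp only [h.D_γ4, h.Db_γ4b, h.Db_γ5b, h.L_γ3, h.L_γ4, h.L_γ4b, h.L_γ7,
      h.L_γ8, h.L_γ8b, h.L_w4, h.N_γ1b, h.N_γ2, h.N_γ3, h.N_γ4, h.N_γ5]
  ring

theorem N_u9 : N (G u9) = F γ6 * cj (G u7) + F γ6 * G u8 - 3 * F γ6 * G u9 - 3 * F γ7 * G u7 + F
    γ7 * cj (G u8) + F γ7 * cj (G u9) - 2 * F γ8 * G u9 + p1 (F γ6) * G t4 - p1 (F γ7) * cj (G t4)
    + p2 (F γ6) * G t5 - p2 (F γ7) * cj (G t5) + G v3 * Z * Z := by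
  conv_lhs =>
    simp only [gcon]
    simp only [Der.rules, h.comm_N_D, h.comm_N_Db]
    simp only [h.N_γ6, h.N_γ7, Der.rules]
    simp only [h.D_γ7, h.Db_γ7b, h.N_γ3, h.N_γ3b, h.N_γ4, h.N_γ4b, h.N_γ6,
      h.N_γ7, h.N_w4]
  ring

theorem bianchi_1 : N (G v1) + Z * Z * L (G v1) + D (G v2) = -2 * G v1 * F γ6 + 3 * G v1 * F γ8 +
    G v1 * cj (F γ8) + 4 * G v2 * F γ3 - 4 * G v2 * cj (F γ4) - G v2 * cj (F γ5) - 2 * G v3 * F γ1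
    + 3 * G u1 * F w3 + 2 * G u2 * F w2 + 4 * G u3 * F w2 - 2 * G u6 * F w2 + 4 * G u8 * F w1 + G
    u9 * F w1 - p1 (F w1) * G t4 + p1 (F w2) * G t1 - p2 (F w1) * G t5 + p2 (F w2) * G t2 + p3 (F
    w3) * G t3 - 4 * G v1 * F γ2 * Z * Z := by
  have e : N (G v1) - Db (gB1 F) + D (G v2) - L (gB2 F)
      = N (gA1 F) - Db (gB1 F) + D (gA2 F) - L (gB2 F) := rfl
  conv_rhs at e =>
    simp only [gA1, gB1, gA2, gB2, Der.rules, h.comm_N_Db,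
      h.comm_N_L, h.comm_D_Db, h.comm_L_D]
    simp only [h.D_γ2, h.D_γ4, h.D_γ5, h.D_γ7, h.Db_γ4b, h.L_γ1, h.L_γ3,
      h.L_γ4b, h.L_γ8, h.L_w2, h.L_w3, h.L_w4, h.N_γ2, h.N_γ4, h.N_γ5,
      h.N_w1, h.N_w2]
  rw [h.gB1_eq, map_zero, h.gB2_eq, fL_ZZ] at e
  linear_combination e

theorem bianchi_2 : N (G v2) + Z * Z * L (G v2) + Z * Z * Db (G v1) + D (G v3) = -3 * G v2 * F γ6
    + G v2 * F γ8 + G v2 * cj (F γ8) + G v3 * F γ3 - 3 * G v3 * cj (F γ4) - G v3 * cj (F γ5) + 2 *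
    G u1 * F w4 + 3 * G u3 * F w3 - 3 * G u6 * F w3 + 2 * G u8 * F w2 + 2 * G u9 * F w2 - p1 (F
    w2) * G t4 + p1 (F w3) * G t1 - p2 (F w2) * G t5 + p2 (F w3) * G t2 + p3 (F w4) * G t3 - 2 * G
    v1 * F γ4 * Z * Z - 2 * G v1 * F γ5 * Z * Z - 3 * G v2 * F γ2 * Z * Z := by
  have e : N (G v2) - Db (gB2 F) + D (G v3) - L (gB3 F)
      = N (gA2 F) - Db (gB2 F) + D (gA3 F) - L (gB3 F) := rfl
  conv_rhs at e =>
    simp only [gA2, gB2, gA3, gB3, Der.rules, h.comm_N_Db,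
      h.comm_N_L, h.comm_D_Db, h.comm_L_D]
    simp only [h.D_γ2, h.D_γ5, h.D_γ7, h.Db_γ4b, h.L_γ1, h.L_γ4b, h.L_w3,
      h.L_w4, h.L_w5, h.N_γ2, h.N_γ4, h.N_γ5, h.N_γ7, h.N_w1, h.N_w2,
      h.N_w3]
  rw [h.gB2_eq, fDb_ZZ, h.gB3_eq, fL_ZZ] at e
  linear_combination e

theorem bianchi_3 : N (G v3) + Z * Z * L (G v3) + Z * Z * Db (G v2) = -4 * G v3 * F γ6 - G v3 * F
    γ8 + G v3 * cj (F γ8) + G u1 * F w5 - 2 * G u2 * F w4 + 2 * G u3 * F w4 - 4 * G u6 * F w4 + 3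
    * G u9 * F w3 - p1 (F w3) * G t4 + p1 (F w4) * G t1 - p2 (F w3) * G t5 + p2 (F w4) * G t2 + p3
    (F w5) * G t3 - 2 * G v1 * F γ7 * Z * Z - 3 * G v2 * F γ5 * Z * Z - 2 * G v3 * F γ2 * Z * Z :=
    by
  have e : N (G v3) - Db (gB3 F) + D (gA4 F) - L (gB4 F)
      = N (gA3 F) - Db (gB3 F) + D (gA4 F) - L (gB4 F) := rfl
  conv_rhs at e =>
    simp only [gA3, gB3, gA4, gB4, Der.rules, h.comm_N_Db,
      h.comm_N_L, h.comm_D_Db, h.comm_L_D]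
    simp only [h.D_γ2, h.D_γ4, h.D_γ5, h.D_γ7, h.Db_γ4b, h.L_γ3, h.L_γ4b,
      h.L_γ8, h.L_w4, h.L_w5, h.N_γ2, h.N_γ5, h.N_γ7, h.N_w2, h.N_w3,
      h.N_w4]
  rw [h.gB3_eq, fDb_ZZ, h.gB4_eq, fL_ZZ, h.gA4_eq, map_zero] at e
  linear_combination e

end IsSol

end System

/-! ### The Minkowski background over a ring of coefficient functions -/

section Background

open Cpt SharpCpt CoefRing

variable {K : Type*} [CommRing K] [Algebra ℂ K] [CoefRing K]

/-- `𝐞 = 1/2 + 2 |𝛌|²`. -/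
def ee : K := algebraMap ℂ K (1 / 2) + 2 * (lam * cj lam)

/-- The imaginary unit. -/
def im : K := algebraMap ℂ K Complex.I

theorem im_mul_im : (im : K) * im = -1 := by
  rw [im, ← map_mul, Complex.I_mul_I, map_neg, map_one]

theorem cj_im : cj (im : K) = -im := by
  rw [im, cj_algebraMap, Complex.conj_I, map_neg]

theorem two_half : (2 : K) * algebraMap ℂ K (1 / 2) = 1 := by
  rw [← map_ofNat (algebraMap ℂ K) 2, ← map_mul]
  norm_num

theorem d1_lam' : d1 (lam : K) = -algebraMap ℂ K (1 / 2) := by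
  rw [d1_lam, ← map_neg]; congr 1; norm_num

theorem d2_lam' : d2 (lam : K) = -(im * algebraMap ℂ K (1 / 2)) := by
  rw [d2_lam, im, ← map_mul, ← map_neg]; congr 1; ring

theorem cj_half : cj (algebraMap ℂ K (1 / 2)) = algebraMap ℂ K (1 / 2) := by
  rw [cj_algebraMap]; congr 1; norm_num [Complex.ext_iff]

theorem cj_ee : cj (ee : K) = ee := by
  simp only [ee, map_add, map_mul, map_ofNat, cj_half, cj_cj]
  ring

theorem d3_ee : d3 (ee : K) = 0 := by
  simp only [ee, map_add, Der.leibniz, Der.map_ofNat, d3_algebraMap, d3_lam, ← cj_d3, map_zero]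
  ring

theorem d1_ee : d1 (ee : K) = -(lam + cj lam) := by
  simp only [ee, map_add, Der.leibniz, Der.map_ofNat, d1_algebraMap, d1_lam', ← cj_d1, map_neg,
    cj_half]
  linear_combination -(lam + cj lam) * two_half (K := K)

theorem d2_ee : d2 (ee : K) = im * (lam - cj lam) := by
  simp only [ee, map_add, Der.leibniz, Der.map_ofNat, d2_algebraMap, d2_lam', ← cj_d2, map_neg,
    cj_half, map_mul, cj_im]
  linear_combination im * (lam - cj lam) * two_half (K := K)

/-- The constant series. -/
def cst : K →+* K⸨X⸩ := HahnSeries.C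

theorem cst_coeff (c : K) (n : ℤ) : (cst c).coeff n = if n = 0 then c else 0 := by
  rw [cst, HahnSeries.C_apply, HahnSeries.coeff_single]
  split_ifs <;> rfl

theorem p1_cst (c : K) : DiffRing.p1 (cst c) = cst (d1 c) := by
  ext n
  change d1 ((cst c).coeff n) = _
  rw [cst_coeff, cst_coeff]
  split_ifs <;> simp

theorem p2_cst (c : K) : DiffRing.p2 (cst c) = cst (d2 c) := by
  ext n
  change d2 ((cst c).coeff n) = _
  rw [cst_coeff, cst_coeff]
  split_ifs <;> simp

theorem p3_cst (c : K) : DiffRing.p3 (cst c) = cst (d3 c) := by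
  ext n
  change d3 ((cst c).coeff n) = _
  rw [cst_coeff, cst_coeff]
  split_ifs <;> simp

theorem p4_cst (c : K) : DiffRing.p4 (cst c) = 0 := by
  ext n
  change (uDer (cst c)).coeff n = 0
  rw [uDer_coeff, cst_coeff]
  by_cases h : n - 1 = 0
  · rw [h]; simp
  · rw [if_neg h, mul_zero]

theorem cj_cst (c : K) : DiffRing.cj (cst c) = cst (cj c) := by
  ext n
  change cj ((cst c).coeff n) = _
  rw [cst_coeff, cst_coeff]
  split_ifs <;> simp

/-- The series `- ∑ₖ ūᵏ zᵏ⁺¹` of `1/ρ`. -/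
def rinv : K⸨X⸩ :=
  -(HahnSeries.single 1 1 * HahnSeries.ofPowerSeries ℤ K (PowerSeries.mk fun k => s ^ k))

theorem coeff_single_mul_series (M : ℤ) (a : ℕ → K) (n : ℤ) :
    ((HahnSeries.single M 1 : K⸨X⸩)
      * HahnSeries.ofPowerSeries ℤ K (PowerSeries.mk a)).coeff n
      = if M ≤ n then a (n - M).toNat else 0 := by
  have h := HahnSeries.coeff_single_mul (r := (1 : K))
    (x := HahnSeries.ofPowerSeries ℤ K (PowerSeries.mk a)) (a := n) (b := M)
  rw [h, one_mul]
  split_ifs with hn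
  · obtain ⟨k, hk⟩ := Int.eq_ofNat_of_zero_le (sub_nonneg.mpr hn)
    rw [hk, HahnSeries.ofPowerSeries_apply_coeff]
    simp
  · rw [HahnSeries.ofPowerSeries_apply]
    refine HahnSeries.embDomain_of_notMem_range ?_
    rintro ⟨k, hk⟩
    simp at hk
    omega

theorem rinv_coeff (n : ℤ) :
    (rinv : K⸨X⸩).coeff n = if 1 ≤ n then -(s : K) ^ (n - 1).toNat else 0 := by
  rw [rinv, HahnSeries.coeff_neg, coeff_single_mul_series]
  split_ifs <;> simp

theorem rinv_mul : (rinv : K⸨X⸩) * (cst s - DiffRing.U) = 1 := by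
  ext n
  have h1 : ((rinv : K⸨X⸩) * cst s).coeff n = rinv.coeff n * s := by
    rw [cst, HahnSeries.C_apply, HahnSeries.coeff_mul_single_zero]
  have h2 : ((rinv : K⸨X⸩) * DiffRing.U).coeff n = rinv.coeff (n + 1) := by
    have := HahnSeries.coeff_mul_single (r := (1 : K)) (x := (rinv : K⸨X⸩)) (a := n)
      (b := -1)
    rw [sub_neg_eq_add, mul_one] at this
    exact this
  rw [mul_sub, HahnSeries.coeff_sub, h1, h2, rinv_coeff, rinv_coeff, HahnSeries.coeff_one]
  rcases lt_trichotomy n 0 with h | h | h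
  · rw [if_neg (by omega), if_neg (by omega), if_neg (by omega)]; simp
  · subst h; simp
  · rw [if_pos (by omega), if_pos (by omega), if_neg (by omega)]
    have : (n + 1 - 1).toNat = (n - 1).toNat + 1 := by omega
    rw [this]
    ring

theorem der_rinv (d : Der K⸨X⸩) :
    d (rinv : K⸨X⸩) = -(rinv * rinv * (d (cst s) - d DiffRing.U)) := by
  have h := congrArg d (rinv_mul (K := K))
  rw [Der.leibniz, Der.map_one, map_sub] at h
  linear_combination rinv * h - d rinv * rinv_mul (K := K)

theorem p1_rinv : DiffRing.p1 (rinv : K⸨X⸩) = 0 := by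
  rw [der_rinv, p1_cst, d1_s, DiffRing.p1_U]; simp

theorem p2_rinv : DiffRing.p2 (rinv : K⸨X⸩) = 0 := by
  rw [der_rinv, p2_cst, d2_s, DiffRing.p2_U]; simp

theorem p3_rinv : DiffRing.p3 (rinv : K⸨X⸩) = -(rinv * rinv) := by
  rw [der_rinv, p3_cst, d3_s, DiffRing.p3_U]; simp

theorem p4_rinv : DiffRing.p4 (rinv : K⸨X⸩) = rinv * rinv := by
  rw [der_rinv, p4_cst, DiffRing.p4_U]; simp

theorem cj_rinv : DiffRing.cj (rinv : K⸨X⸩) = rinv := by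
  ext n
  change cj ((rinv : K⸨X⸩).coeff n) = _
  rw [rinv_coeff]
  split_ifs <;> simp [cj_s]

/-- The Minkowski field. -/
def mink (i : Cpt) : K⸨X⸩ :=
  match i with
  | e1 => rinv * cst ee
  | e2 => cst im * (rinv * cst ee)
  | e3 => 1
  | γ2 => rinv
  | γ3 => rinv * cst lam
  | γ4 => rinv * cst (cj lam)
  | γ6 => -rinv
  | _ => 0

theorem im_im_cst : (cst (im : K)) * cst im = -1 := by
  rw [← map_mul, im_mul_im, map_neg, map_one]

theorem two_half_cst : (2 : K⸨X⸩) * cst (algebraMap ℂ K (1 / 2)) = 1 := by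
  rw [← map_ofNat cst 2, ← map_mul, two_half, map_one]

theorem cst_ee : cst (ee : K)
    = cst (algebraMap ℂ K (1 / 2)) + 2 * (cst lam * cst (cj lam)) := by
  simp only [ee, map_add, map_mul, map_ofNat]

theorem gres_mink (i : Cpt) : gres (mink : Cpt → K⸨X⸩) i = 0 := by
  have hi := im_im_cst (K := K)
  have hh := two_half_cst (K := K)
  cases i <;>
    simp only [gres, gA1, gA2, gA3, gA4, gB1, gB2, gB3, gB4, op_apply, mink, map_zero, map_neg, map_mul, map_add, Der.leibniz, p1_cst, p2_cst, p3_cst,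
      p4_cst, p1_rinv, p2_rinv, p3_rinv, p4_rinv, cj_rinv, cj_cst, cj_cj, d3_ee, d3_lam,
      Der.map_one, cj_im, cj_ee, im, d3_algebraMap, ← cj_d3] <;>
    ring

theorem gcon_mink (j : SharpCpt) : gcon (mink : Cpt → K⸨X⸩) j = 0 := by
  have hi := im_im_cst (K := K)
  have hh := two_half_cst (K := K)
  have h1 : d1 (im : K) = 0 := d1_algebraMap _
  have h2 : d2 (im : K) = 0 := d2_algebraMap _
  have h3 : d3 (im : K) = 0 := d3_algebraMap _
  cases j <;>
    simp only [gcon, gA1, gA2, gA3, gA4, op_apply, mink, map_zero, map_neg, map_mul, map_add, map_sub, Der.leibniz, p1_cst, p2_cst,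
      p3_cst, p4_cst, p1_rinv, p2_rinv, p3_rinv, p4_rinv, cj_rinv, cj_cst, cj_cj, d3_ee, d3_lam,
      Der.map_one, cj_im, cj_ee, h1, h2, h3, d1_lam', d2_lam', d1_ee, d2_ee, ← cj_d1, ← cj_d2,
      ← cj_d3, cj_half, map_sub, DiffRing.cj_cj, map_ofNat, Der.map_ofNat] <;>
    try ring1
  · linear_combination 2 * rinv ^ 2 * cst ee * (cst lam - cst (cj lam)) * hi
  · linear_combination 2 * rinv ^ 2 * cst ee * cst (algebraMap ℂ K (1 / 2)) * hi
      - 2 * rinv ^ 2 * cst ee * hh - 2 * rinv ^ 2 * cst_ee (K := K) - rinv ^ 2 * hh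

end Background

/-! ### Increments: the effect of changing one coefficient of the field -/

section Increments

open Cpt SharpCpt CoefRing

variable {K : Type*} [CommRing K] [Algebra ℂ K] [CoefRing K]

theorem Lead.of_eq {n : ℤ} {x y : K⸨X⸩} {c d : K} (hx : Lead n x c) (h : y = x)
    (hc : c = d) : Lead n y d := by subst h; subst hc; exact hx

theorem d1_im : d1 (im : K) = 0 := d1_algebraMap _
theorem d2_im : d2 (im : K) = 0 := d2_algebraMap _
theorem d3_im : d3 (im : K) = 0 := d3_algebraMap _

/-- Multiplication by `u^m` shifts the leading coefficient. -/
theorem Lead.U_pow_mul {n m : ℤ} {x : K⸨X⸩} {c : K} (hx : Lead n x c) (j : ℕ)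
    (h : m = n - j) : Lead m (DiffRing.U ^ j * x) c := by
  have hU : (DiffRing.U : K⸨X⸩) ^ j = HahnSeries.single (-(j : ℤ)) 1 := by
    change (HahnSeries.single (-1) (1 : K)) ^ j = _
    rw [HahnSeries.single_pow]
    simp
  subst h
  refine ⟨fun l hl => ?_, ?_⟩
  · have := HahnSeries.coeff_single_mul (r := (1 : K)) (x := x) (a := l) (b := -(j : ℤ))
    rw [hU, this, hx.1 _ (by omega), mul_zero]
  · have := HahnSeries.coeff_single_mul (r := (1 : K)) (x := x) (a := n - j) (b := -(j : ℤ))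
    rw [hU, this, one_mul, ← hx.2]
    congr 1
    omega

/-- Leading coefficients of two series and of their difference. -/
structure Jet (a d : ℤ) (x x' : K⸨X⸩) (c c' δ : K) : Prop where
  lead : Lead a x c
  lead' : Lead a x' c'
  inc : Lead d (x' - x) δ

namespace Jet

variable {a d b e n : ℤ} {x x' y y' : K⸨X⸩} {c c' δ g g' ε : K}

theorem cj (h : Jet a d x x' c c' δ) :
    Jet a d (DiffRing.cj x) (DiffRing.cj x') (CoefRing.cj c) (CoefRing.cj c') (CoefRing.cj δ) :=
  ⟨h.lead.map _, h.lead'.map _, (h.inc.map CoefRing.cj).of_eq (map_sub _ _ _).symm rfl⟩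

theorem p1 (h : Jet a d x x' c c' δ) :
    Jet a d (DiffRing.p1 x) (DiffRing.p1 x') (d1 c) (d1 c') (d1 δ) :=
  ⟨h.lead.der _, h.lead'.der _, (h.inc.der d1).of_eq (map_sub (DiffRing.p1 (A := K⸨X⸩)) x' x).symm rfl⟩

theorem p2 (h : Jet a d x x' c c' δ) :
    Jet a d (DiffRing.p2 x) (DiffRing.p2 x') (d2 c) (d2 c') (d2 δ) :=
  ⟨h.lead.der _, h.lead'.der _, (h.inc.der d2).of_eq (map_sub (DiffRing.p2 (A := K⸨X⸩)) x' x).symm rfl⟩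

theorem p3 (h : Jet a d x x' c c' δ) :
    Jet a d (DiffRing.p3 x) (DiffRing.p3 x') (d3 c) (d3 c') (d3 δ) :=
  ⟨h.lead.der _, h.lead'.der _, (h.inc.der d3).of_eq (map_sub (DiffRing.p3 (A := K⸨X⸩)) x' x).symm rfl⟩

theorem inc_p4 (h : Jet a d x x' c c' δ) (hn : n = d + 1 := by omega) :
    Lead n (DiffRing.p4 x' - DiffRing.p4 x) (-(d : K) * δ) :=
  (h.inc.uder hn).of_eq (map_sub (DiffRing.p4 (A := K⸨X⸩)) x' x).symm rfl

theorem inc_eq (h : Jet a d x x' c c' δ) (hn : n = d := by omega) : Lead n (x' - x) δ := hn ▸ h.inc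

theorem inc_low (h : Jet a d x x' c c' δ) (hn : n < d := by omega) : Lead n (x' - x) 0 := h.inc.low hn

theorem mul_both (hx : Jet a d x x' c c' δ) (hy : Jet b e y y' g g' ε) (h1 : n = d + b := by omega)
    (h2 : n = a + e := by omega) : Lead n (x' * y' - x * y) (δ * g' + c * ε) :=
  ((hx.inc.mul hy.lead' h1).add (hx.lead.mul hy.inc h2)).of_eq (by ring) rfl

theorem mul_left (hx : Jet a d x x' c c' δ) (hy : Jet b e y y' g g' ε) (h1 : n = d + b := by omega)
    (h2 : n < a + e := by omega) : Lead n (x' * y' - x * y) (δ * g') :=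
  ((hx.inc.mul hy.lead' h1).add (hx.lead.mul_low hy.inc h2)).of_eq (by ring) (add_zero _)

theorem mul_right (hx : Jet a d x x' c c' δ) (hy : Jet b e y y' g g' ε) (h1 : n < d + b := by omega)
    (h2 : n = a + e := by omega) : Lead n (x' * y' - x * y) (c * ε) :=
  ((hx.inc.mul_low hy.lead' h1).add (hx.lead.mul hy.inc h2)).of_eq (by ring) (zero_add _)

theorem mul_low (hx : Jet a d x x' c c' δ) (hy : Jet b e y y' g g' ε) (h1 : n < d + b := by omega)
    (h2 : n < a + e := by omega) : Lead n (x' * y' - x * y) 0 :=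
  ((hx.inc.mul_low hy.lead' h1).add (hx.lead.mul_low hy.inc h2)).of_eq (by ring) (add_zero _)

end Jet

/-- Rewriting a series by unfolding the expressions of the system. -/
theorem Lead.expand {n : ℤ} {x y : K⸨X⸩} {c : K} (hx : Lead n x c)
    (h : y = x := by
      simp only [gres, gcon, gA1, gA2, gA3, gA4, gB1, gB2, gB3, gB4, op_apply, map_add, map_sub, map_neg, map_mul, DiffRing.cj_cj, DiffRing.cj_p1,
        DiffRing.cj_p2]; ring) : Lead n y c :=
  h ▸ hx

/-- Rewriting a leading coefficient by expanding derivatives. -/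
theorem Lead.simplify {n : ℤ} {x : K⸨X⸩} {c d : K} (hx : Lead n x c)
    (hc : c = d := by
      (try simp only [Int.cast_add, Int.cast_ofNat, Int.cast_natCast, Int.cast_one,
        map_add, map_sub, map_neg, map_mul, Der.leibniz, cj_ee, cj_im, cj_cj, d1_ee, d2_ee, d3_ee,
        d1_im, d2_im, d3_im, ← cj_d1, ← cj_d2, ← cj_d3, d3_lam, d1_lam', d2_lam', cj_half, map_zero,
        map_one, Der.map_one, neg_zero]); ring) : Lead n x d :=
  hc ▸ hx

/-- Two fields, with the leading coefficients of the background, whose difference starts at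
index `k`. -/
structure FieldJets (k : ℕ) (F F' : Cpt → K⸨X⸩) (c c' δ : Cpt → K) : Prop where
  e1 : Jet 1 (2 + k) (F e1) (F' e1) (-ee) (-ee) (δ e1)
  e2 : Jet 1 (2 + k) (F e2) (F' e2) (-(im * ee)) (-(im * ee)) (δ e2)
  e3 : Jet 0 (2 + k) (F e3) (F' e3) 1 1 (δ e3)
  e4 : Jet 3 (3 + k) (F e4) (F' e4) (c e4) (c' e4) (δ e4)
  e5 : Jet 3 (3 + k) (F e5) (F' e5) (c e5) (c' e5) (δ e5)
  γ1 : Jet 1 (1 + k) (F γ1) (F' γ1) (c γ1) (c' γ1) (δ γ1)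
  γ2 : Jet 1 (2 + k) (F γ2) (F' γ2) (-1) (-1) (δ γ2)
  γ3 : Jet 1 (2 + k) (F γ3) (F' γ3) (-lam) (-lam) (δ γ3)
  γ4 : Jet 1 (2 + k) (F γ4) (F' γ4) (-cj lam) (-cj lam) (δ γ4)
  γ5 : Jet 2 (2 + k) (F γ5) (F' γ5) (c γ5) (c' γ5) (δ γ5)
  γ6 : Jet 1 (2 + k) (F γ6) (F' γ6) 1 1 (δ γ6)
  γ7 : Jet 2 (2 + k) (F γ7) (F' γ7) (c γ7) (c' γ7) (δ γ7)
  γ8 : Jet 3 (3 + k) (F γ8) (F' γ8) (c γ8) (c' γ8) (δ γ8)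
  w1 : Jet 1 (1 + k) (F w1) (F' w1) (c w1) (c' w1) (δ w1)
  w2 : Jet 2 (2 + k) (F w2) (F' w2) (c w2) (c' w2) (δ w2)
  w3 : Jet 3 (3 + k) (F w3) (F' w3) (c w3) (c' w3) (δ w3)
  w4 : Jet 4 (4 + k) (F w4) (F' w4) (c w4) (c' w4) (δ w4)
  w5 : Jet 4 (4 + k) (F w5) (F' w5) (c w5) (c' w5) (δ w5)

variable {k : ℕ} {F F' : Cpt → K⸨X⸩} {c c' δ : Cpt → K} (h : FieldJets k F F' c c' δ)

local infixl:65 " ∔ " => Lead.add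
local infixl:65 " ∸ " => Lead.sub
local infixr:70 " ⊙ " => Lead.ofNat_mul

include h

theorem inc_gres_e1 :
    Lead (2 + k) (gres F' e1 - gres F e1) (-ee * δ γ1 + d3 (δ e1)) :=
  (h.e1.mul_low h.γ2 ∔ h.e1.cj.mul_right h.γ1 ∔ h.e1.p3.mul_left h.e3).expand.simplify

theorem inc_gres_e2 :
    Lead (2 + k) (gres F' e2 - gres F e2) (ee * im * δ γ1 + d3 (δ e2)) :=
  (h.e2.mul_low h.γ2 ∔ h.e2.cj.mul_right h.γ1 ∔ h.e2.p3.mul_left h.e3).expand.simplify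

theorem inc_gres_e4 :
    Lead (3 + k) (gres F' e4 - gres F e4) (ee * δ γ3 + ee * cj (δ γ3) - ee * δ γ4 - ee * cj (δ γ4)
    + ee * δ γ5 + ee * cj (δ γ5) + d3 (δ e4)) :=
  (Lead.neg (h.e1.mul_both h.γ3.cj) ∔ h.e1.mul_both h.γ4 ∸ h.e1.mul_right h.γ5 ∸ h.e1.cj.mul_both
  h.γ3 ∔ h.e1.cj.mul_both h.γ4.cj ∸ h.e1.cj.mul_right h.γ5.cj ∔ h.e4.p3.mul_left
  h.e3).expand.simplify

theorem inc_gres_e5 :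
    Lead (3 + k) (gres F' e5 - gres F e5) (-ee * im * δ γ3 + ee * im * cj (δ γ3) - ee * im * δ γ4
    + ee * im * cj (δ γ4) + ee * im * δ γ5 - ee * im * cj (δ γ5) + d3 (δ e5)) :=
  (Lead.neg (h.e2.mul_both h.γ3.cj) ∔ h.e2.mul_both h.γ4 ∸ h.e2.mul_right h.γ5 ∸ h.e2.cj.mul_both
  h.γ3 ∔ h.e2.cj.mul_both h.γ4.cj ∸ h.e2.cj.mul_right h.γ5.cj ∔ h.e5.p3.mul_left
  h.e3).expand.simplify

theorem inc_gres_γ1 :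
    Lead (1 + k) (gres F' γ1 - gres F γ1) (δ w1 + d3 (δ γ1)) :=
  (h.w1.inc_eq ∔ 2 ⊙ h.γ1.mul_low h.γ2 ∔ h.γ1.p3.mul_left h.e3).expand.simplify

theorem inc_gres_γ2 :
    Lead (2 + k) (gres F' γ2 - gres F γ2) (cj (c' γ1) * δ γ1 + c γ1 * cj (δ γ1) + d3 (δ γ2)) :=
  (h.γ1.mul_both h.γ1.cj ∔ h.γ2.mul_low h.γ2 ∔ h.γ2.p3.mul_left h.e3).expand.simplify

theorem inc_gres_γ3 :
    Lead (2 + k) (gres F' γ3 - gres F γ3) (cj (lam) * δ γ1 + δ w2 + d3 (δ γ3)) :=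
  (h.w2.inc_eq ∸ h.γ1.mul_left h.γ4 ∔ h.γ1.mul_low h.γ5 ∔ h.γ2.mul_low h.γ3 ∔ h.γ3.p3.mul_left
  h.e3).expand.simplify

theorem inc_gres_γ4 :
    Lead (2 + k) (gres F' γ4 - gres F γ4) (lam * cj (δ γ1) + d3 (δ γ4)) :=
  (Lead.neg (h.γ1.cj.mul_left h.γ3) ∔ h.γ2.mul_low h.γ4 ∸ h.γ2.mul_low h.γ5 ∔ h.γ4.p3.mul_left
  h.e3).expand.simplify

theorem inc_gres_γ8 :
    Lead (3 + k) (gres F' γ8 - gres F γ8) (lam * cj (δ γ3) - lam * δ γ4 + lam * δ γ5 - cj (lam) *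
    δ γ3 + cj (lam) * cj (δ γ4) - cj (lam) * cj (δ γ5) - δ w3 + d3 (δ γ8)) :=
  (h.w3.inc_eq.neg ∸ h.γ3.mul_both h.γ3.cj ∔ 2 ⊙ h.γ3.mul_both h.γ4 ∸ 2 ⊙ h.γ3.mul_right h.γ5 ∸
  h.γ4.mul_both h.γ4.cj ∔ h.γ4.mul_right h.γ5.cj ∔ h.γ4.cj.mul_right h.γ5 ∔ h.γ8.p3.mul_left
  h.e3).expand.simplify

theorem inc_gres_e3 :
    Lead (3 + k) (gres F' e3 - gres F e3) (-(k : K) * δ e3 - 2 * δ e3 - δ γ8 - cj (δ γ8)) :=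
  (h.e3.inc_p4 ∸ h.e3.mul_right h.γ8 ∸ h.e3.mul_right h.γ8.cj ∔ h.e3.p1.mul_right h.e4 ∔
  h.e3.p2.mul_right h.e5).expand.simplify

theorem inc_gres_γ5 :
    Lead (3 + k) (gres F' γ5 - gres F γ5) (-(k : K) * δ γ5 + cj (δ γ3) - δ γ4 - δ γ5) :=
  (h.w4.inc_low.neg ∔ h.γ5.inc_p4 ∔ h.γ3.mul_right h.γ7 ∔ h.γ3.cj.mul_both h.γ6 ∸ h.γ4.mul_both h.γ6
  ∸ h.γ4.cj.mul_right h.γ7 ∔ h.γ5.mul_left h.γ6 ∔ h.γ5.mul_low h.γ8 ∸ h.γ5.mul_low h.γ8.cj ∔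
  h.γ5.cj.mul_low h.γ7 ∔ h.γ5.p1.mul_low h.e4 ∔ h.γ5.p2.mul_low h.e5).expand.simplify

theorem inc_gres_γ6 :
    Lead (3 + k) (gres F' γ6 - gres F γ6) (-(k : K) * δ γ6) :=
  (h.γ6.inc_p4 ∔ h.γ6.mul_both h.γ6 ∔ h.γ6.mul_low h.γ8 ∔ h.γ6.mul_low h.γ8.cj ∔ h.γ7.mul_low
  h.γ7.cj ∔ h.γ6.p1.mul_low h.e4 ∔ h.γ6.p2.mul_low h.e5).expand.simplify

theorem inc_gres_γ7 :
    Lead (3 + k) (gres F' γ7 - gres F γ7) (-(k : K) * δ γ7) :=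
  (h.w5.inc_low ∔ h.γ7.inc_p4 ∔ 2 ⊙ h.γ6.mul_right h.γ7 ∔ 3 ⊙ h.γ7.mul_low h.γ8 ∸ h.γ7.mul_low
  h.γ8.cj ∔ h.γ7.p1.mul_low h.e4 ∔ h.γ7.p2.mul_low h.e5).expand.simplify

theorem inc_gA1 :
    Lead (2 + k) (gA1 F' - gA1 F) (-4 * cj (lam) * δ w1 - d1 (δ w1) * ee + d2 (δ w1) * ee * im +
    d3 (δ w2)) :=
  (4 ⊙ h.γ2.mul_low h.w2 ∔ 4 ⊙ h.γ4.mul_right h.w1 ∔ h.γ5.mul_low h.w1 ∔ h.w1.p1.mul_left h.e1.cj ∔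
  h.w1.p2.mul_left h.e2.cj ∔ h.w2.p3.mul_left h.e3).expand.simplify

theorem inc_gA2 :
    Lead (3 + k) (gA2 F' - gA2 F) (c' w1 * δ γ7 + c γ7 * δ w1 - 2 * cj (lam) * δ w2 - d1 (δ w2) *
    ee + d2 (δ w2) * ee * im + d3 (δ w3)) :=
  (3 ⊙ h.γ2.mul_low h.w3 ∔ 2 ⊙ h.γ4.mul_right h.w2 ∔ 2 ⊙ h.γ5.mul_low h.w2 ∔ h.γ7.mul_both h.w1 ∔
  h.w2.p1.mul_left h.e1.cj ∔ h.w2.p2.mul_left h.e2.cj ∔ h.w3.p3.mul_left h.e3).expand.simplify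

theorem inc_gA3 :
    Lead (4 + k) (gA3 F' - gA3 F) (2 * c' w2 * δ γ7 + 2 * c γ7 * δ w2 - d1 (δ w3) * ee + d2 (δ w3)
    * ee * im + d3 (δ w4)) :=
  (2 ⊙ h.γ2.mul_low h.w4 ∔ 3 ⊙ h.γ5.mul_low h.w3 ∔ 2 ⊙ h.γ7.mul_both h.w2 ∔ h.w3.p1.mul_left h.e1.cj
  ∔ h.w3.p2.mul_left h.e2.cj ∔ h.w4.p3.mul_left h.e3).expand.simplify

theorem inc_gA4 :
    Lead (4 + k) (gA4 F' - gA4 F) (d3 (δ w5)) :=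
  (h.γ2.mul_low h.w5 ∸ 2 ⊙ h.γ4.mul_low h.w4 ∔ 4 ⊙ h.γ5.mul_low h.w4 ∔ 3 ⊙ h.γ7.mul_low h.w3 ∔
  h.w4.p1.mul_low h.e1.cj ∔ h.w4.p2.mul_low h.e2.cj ∔ h.w5.p3.mul_left h.e3).expand.simplify

theorem inc_gB1 :
    Lead (2 + k) (gB1 F' - gB1 F) (-(k : K) * δ w1) :=
  (h.w1.inc_p4 ∔ 3 ⊙ h.γ1.mul_low h.w3 ∸ 6 ⊙ h.γ3.mul_low h.w2 ∔ 4 ⊙ h.γ4.cj.mul_low h.w2 ∔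
  h.γ6.mul_right h.w1 ∸ 4 ⊙ h.γ8.mul_low h.w1 ∔ h.w1.p1.mul_low h.e4 ∔ h.w2.p1.mul_low h.e1 ∔
  h.w1.p2.mul_low h.e5 ∔ h.w2.p2.mul_low h.e2).expand.simplify

theorem inc_gB2 :
    Lead (3 + k) (gB2 F' - gB2 F) (-(k : K) * δ w2) :=
  (h.w2.inc_p4 ∔ 2 ⊙ h.γ1.mul_low h.w4 ∸ 3 ⊙ h.γ3.mul_low h.w3 ∔ 3 ⊙ h.γ4.cj.mul_low h.w3 ∔ 2 ⊙
  h.γ6.mul_right h.w2 ∸ 2 ⊙ h.γ8.mul_low h.w2 ∔ h.w2.p1.mul_low h.e4 ∔ h.w3.p1.mul_low h.e1 ∔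
  h.w2.p2.mul_low h.e5 ∔ h.w3.p2.mul_low h.e2).expand.simplify

theorem inc_gB3 :
    Lead (4 + k) (gB3 F' - gB3 F) (-(k : K) * δ w3) :=
  (h.w3.inc_p4 ∔ h.γ1.mul_low h.w5 ∔ 2 ⊙ h.γ4.cj.mul_low h.w4 ∔ 3 ⊙ h.γ6.mul_right h.w3 ∔
  h.w3.p1.mul_low h.e4 ∔ h.w4.p1.mul_low h.e1 ∔ h.w3.p2.mul_low h.e5 ∔ h.w4.p2.mul_low
  h.e2).expand.simplify

theorem inc_gB4 :
    Lead (5 + k) (gB4 F' - gB4 F) (-(k : K) * δ w4 - 4 * lam * δ w5 - d1 (δ w5) * ee - d2 (δ w5) *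
    ee * im) :=
  (h.w4.inc_p4 ∔ 3 ⊙ h.γ3.mul_right h.w5 ∔ h.γ4.cj.mul_right h.w5 ∔ 4 ⊙ h.γ6.mul_right h.w4 ∔ 2 ⊙
  h.γ8.mul_low h.w4 ∔ h.w4.p1.mul_low h.e4 ∔ h.w5.p1.mul_left h.e1 ∔ h.w4.p2.mul_low h.e5 ∔
  h.w5.p2.mul_left h.e2).expand.simplify

theorem inc_gcon_t1 :
    ∃ v, Lead (3 + k) (gcon F' t1 - gcon F t1) v :=
  ⟨_, (Lead.neg (h.e1.mul_both h.γ3.cj) ∸ h.e1.mul_both h.γ4 ∔ h.e1.cj.mul_both h.γ3 ∔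
  h.e1.cj.mul_both h.γ4.cj ∸ h.e1.p1.mul_both h.e1.cj ∔ h.e1.cj.p1.mul_both h.e1 ∸ h.e1.p2.mul_both
  h.e2.cj ∔ h.e1.cj.p2.mul_both h.e2).expand⟩

theorem inc_gcon_t2 :
    ∃ v, Lead (3 + k) (gcon F' t2 - gcon F t2) v :=
  ⟨_, (Lead.neg (h.e2.mul_both h.γ3.cj) ∸ h.e2.mul_both h.γ4 ∔ h.e2.cj.mul_both h.γ3 ∔
  h.e2.cj.mul_both h.γ4.cj ∸ h.e2.p1.mul_both h.e1.cj ∔ h.e2.cj.p1.mul_both h.e1 ∸ h.e2.p2.mul_both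
  h.e2.cj ∔ h.e2.cj.p2.mul_both h.e2).expand⟩

theorem inc_gcon_t3 :
    ∃ v, Lead (2 + k) (gcon F' t3 - gcon F t3) v :=
  ⟨_, (Lead.neg (h.e3.mul_right h.γ3) ∔ h.e3.mul_right h.γ4.cj ∔ h.e3.mul_right h.γ5.cj ∔
  h.e3.p1.mul_right h.e1 ∔ h.e3.p2.mul_right h.e2).expand⟩

theorem inc_gcon_t4 :
    ∃ v, Lead (3 + k) (gcon F' t4 - gcon F t4) v :=
  ⟨_, (h.e1.cj.inc_p4.neg ∸ h.e1.mul_right h.γ7 ∸ h.e1.cj.mul_both h.γ6 ∸ h.e1.cj.mul_low h.γ8 ∔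
  h.e1.cj.mul_low h.γ8.cj ∸ h.e1.cj.p1.mul_low h.e4 ∔ h.e4.p1.mul_low h.e1.cj ∸ h.e1.cj.p2.mul_low
  h.e5 ∔ h.e4.p2.mul_low h.e2.cj).expand⟩

theorem inc_gcon_t5 :
    ∃ v, Lead (3 + k) (gcon F' t5 - gcon F t5) v :=
  ⟨_, (h.e2.cj.inc_p4.neg ∸ h.e2.mul_right h.γ7 ∸ h.e2.cj.mul_both h.γ6 ∸ h.e2.cj.mul_low h.γ8 ∔
  h.e2.cj.mul_low h.γ8.cj ∸ h.e2.cj.p1.mul_low h.e4 ∔ h.e5.p1.mul_low h.e1.cj ∸ h.e2.cj.p2.mul_low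
  h.e5 ∔ h.e5.p2.mul_low h.e2.cj).expand⟩

theorem inc_gcon_u1 :
    Lead (2 + k) (gcon F' u1 - gcon F u1) (4 * cj (lam) * δ γ1 + δ w2 + d1 (δ γ1) * ee - d2 (δ γ1)
    * ee * im) :=
  (h.w2.inc_eq ∸ h.γ1.mul_left h.γ3.cj ∸ 3 ⊙ h.γ1.mul_left h.γ4 ∸ h.γ2.mul_low h.γ3 ∔ h.γ2.mul_low
  h.γ4.cj ∸ h.γ1.p1.mul_left h.e1.cj ∔ h.γ2.p1.mul_low h.e1 ∸ h.γ1.p2.mul_left h.e2.cj ∔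
  h.γ2.p2.mul_low h.e2).expand.simplify

theorem inc_gcon_u2 :
    Lead (3 + k) (gcon F' u2 - gcon F u2) (c' γ7 * δ γ1 + c γ1 * δ γ7 - algebraMap ℂ K (1 / 2) *
    im * δ e2 + algebraMap ℂ K (1 / 2) * im * cj (δ e2) + algebraMap ℂ K (1 / 2) * δ e1 +
    algebraMap ℂ K (1 / 2) * cj (δ e1) - lam * cj (δ γ3) - 3 * lam * δ γ4 - 3 * cj (lam) * δ γ3 -
    cj (lam) * cj (δ γ4) - δ γ2 + δ γ6 - δ w3 - d1 (δ γ3) * ee - d1 (δ γ4) * ee + d2 (δ γ3) * ee *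
    im - d2 (δ γ4) * ee * im) :=
  (h.w3.inc_eq.neg ∔ h.γ1.mul_both h.γ7 ∸ h.γ2.mul_both h.γ6 ∔ h.γ3.mul_both h.γ3.cj ∔ 2 ⊙
  h.γ3.mul_both h.γ4 ∔ h.γ4.mul_both h.γ4.cj ∔ h.γ3.p1.mul_both h.e1.cj ∔ h.γ4.p1.mul_both h.e1 ∔
  h.γ3.p2.mul_both h.e2.cj ∔ h.γ4.p2.mul_both h.e2).expand.simplify

theorem inc_gcon_u3 :
    ∃ v, Lead (3 + k) (gcon F' u3 - gcon F u3) v :=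
  ⟨_, (h.w3.inc_eq.neg ∔ h.γ2.inc_p4 ∔ h.γ1.mul_both h.γ7 ∔ h.γ2.mul_both h.γ6 ∸ h.γ2.mul_low h.γ8 ∸
  h.γ2.mul_low h.γ8.cj ∔ 2 ⊙ h.γ3.mul_both h.γ4 ∸ 2 ⊙ h.γ4.mul_both h.γ4.cj ∔ h.γ2.p1.mul_low h.e4 ∔
  h.γ3.p1.mul_both h.e1.cj ∸ h.γ4.cj.p1.mul_both h.e1.cj ∔ h.γ2.p2.mul_low h.e5 ∔ h.γ3.p2.mul_both
  h.e2.cj ∸ h.γ4.cj.p2.mul_both h.e2.cj).expand⟩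

theorem inc_gcon_u4 :
    Lead (2 + k) (gcon F' u4 - gcon F u4) ((k : K) * δ γ1) :=
  (h.γ1.inc_p4.neg ∸ h.γ1.mul_left h.γ6 ∔ 3 ⊙ h.γ1.mul_low h.γ8 ∸ h.γ1.mul_low h.γ8.cj ∸
  h.γ2.mul_low h.γ7.cj ∔ 2 ⊙ h.γ3.mul_low h.γ3 ∸ 2 ⊙ h.γ3.mul_low h.γ4.cj ∸ h.γ1.p1.mul_low h.e4 ∸
  h.γ3.p1.mul_low h.e1 ∔ h.γ4.cj.p1.mul_low h.e1 ∸ h.γ1.p2.mul_low h.e5 ∸ h.γ3.p2.mul_low h.e2 ∔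
  h.γ4.cj.p2.mul_low h.e2).expand.simplify

theorem inc_gcon_u5 :
    Lead (2 + k) (gcon F' u5 - gcon F u5) (-cj (δ γ1) - d3 (δ γ7)) :=
  (Lead.neg (h.γ1.cj.mul_left h.γ6) ∸ h.γ2.mul_low h.γ7 ∸ h.γ3.cj.mul_low h.γ5 ∸ h.γ4.mul_low h.γ5 ∔
  h.γ5.mul_low h.γ5 ∔ h.γ5.p1.mul_low h.e1.cj ∔ h.γ5.p2.mul_low h.e2.cj ∸ h.γ7.p3.mul_left
  h.e3).expand.simplify

theorem inc_gcon_u6 :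
    Lead (2 + k) (gcon F' u6 - gcon F u6) (d3 (δ γ6)) :=
  (h.w3.inc_low.neg ∔ h.γ1.mul_low h.γ7 ∔ h.γ2.mul_low h.γ6 ∸ h.γ3.mul_low h.γ5 ∸ h.γ4.cj.mul_low
  h.γ5 ∸ h.γ5.mul_low h.γ5.cj ∸ h.γ5.p1.mul_low h.e1 ∸ h.γ5.p2.mul_low h.e2 ∔ h.γ6.p3.mul_left
  h.e3).expand.simplify

theorem inc_gcon_u7 :
    ∃ v, Lead (3 + k) (gcon F' u7 - gcon F u7) v :=
  ⟨_, (h.γ3.inc_p4.neg ∸ 2 ⊙ h.γ3.mul_both h.γ6 ∔ h.γ3.mul_low h.γ8 ∸ h.γ3.mul_low h.γ8.cj ∔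
  h.γ4.mul_right h.γ7.cj ∔ h.γ4.cj.mul_both h.γ6 ∸ h.γ3.p1.mul_low h.e4 ∔ h.γ8.p1.mul_low h.e1 ∸
  h.γ3.p2.mul_low h.e5 ∔ h.γ8.p2.mul_low h.e2).expand⟩

theorem inc_gcon_u8 :
    ∃ v, Lead (3 + k) (gcon F' u8 - gcon F u8) v :=
  ⟨_, (h.w4.inc_low ∔ h.γ4.inc_p4 ∸ 2 ⊙ h.γ3.mul_right h.γ7 ∔ h.γ4.mul_both h.γ6 ∔ h.γ4.mul_low h.γ8
  ∸ h.γ4.mul_low h.γ8.cj ∔ h.γ4.cj.mul_right h.γ7 ∔ h.γ4.p1.mul_low h.e4 ∔ h.γ8.p1.mul_low h.e1.cj ∔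
  h.γ4.p2.mul_low h.e5 ∔ h.γ8.p2.mul_low h.e2.cj).expand⟩

theorem inc_gcon_u9 :
    Lead (3 + k) (gcon F' u9 - gcon F u9) (-4 * lam * δ γ7 - cj (δ γ3) + δ γ4 + d1 (δ γ6) * ee -
    d1 (δ γ7) * ee - d2 (δ γ6) * ee * im - d2 (δ γ7) * ee * im) :=
  (h.w4.inc_low.neg ∔ 3 ⊙ h.γ3.mul_right h.γ7 ∸ h.γ3.cj.mul_both h.γ6 ∔ h.γ4.mul_both h.γ6 ∔
  h.γ4.cj.mul_right h.γ7 ∸ h.γ6.p1.mul_both h.e1.cj ∔ h.γ7.p1.mul_left h.e1 ∸ h.γ6.p2.mul_both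
  h.e2.cj ∔ h.γ7.p2.mul_left h.e2).expand.simplify

theorem inc_gres_w1 : Lead (0 + k) (gres F' w1 - gres F w1) (-(k : K) * δ w1) :=
  ((inc_gB1 h).U_pow_mul 2 (by push_cast; ring)).of_eq (by simp only [gres]; ring) rfl

theorem inc_gres_w2 : Lead (-1 + k) (gres F' w2 - gres F w2) (-(k : K) * δ w2) :=
  (((inc_gA1 h).U_pow_mul 2 rfl).low (by push_cast; omega) ∔
    (inc_gB2 h).U_pow_mul 4 (by push_cast; ring)).of_eq (by simp only [gres]; ring) (zero_add _)

theorem inc_gres_w3 : Lead (-2 + k) (gres F' w3 - gres F w3) (-(k : K) * δ w3) :=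
  (((inc_gA2 h).U_pow_mul 4 rfl).low (by push_cast; omega) ∔
    (inc_gB3 h).U_pow_mul 6 (by push_cast; ring)).of_eq (by simp only [gres]; ring) (zero_add _)

theorem inc_gres_w4 : Lead (-3 + k) (gres F' w4 - gres F w4)
    (-(k : K) * δ w4 - 4 * lam * δ w5 - d1 (δ w5) * ee - d2 (δ w5) * ee * im) :=
  (((inc_gA3 h).U_pow_mul 6 rfl).low (by push_cast; omega) ∔
    (inc_gB4 h).U_pow_mul 8 (by push_cast; ring)).of_eq (by simp only [gres]; ring) (zero_add _)

theorem inc_gres_w5 : Lead (-4 + k) (gres F' w5 - gres F w5) (d3 (δ w5)) :=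
  ((inc_gA4 h).U_pow_mul 8 (by push_cast; ring)).of_eq (by simp only [gres]; ring) rfl

omit h

/-- The field `[M] + u^{-M} [Ψ]`. -/
def fullK (Ψ : ℕ → Cpt → K) (i : Cpt) : K⸨X⸩ :=
  mink i + HahnSeries.single (expM i) 1
    * HahnSeries.ofPowerSeries ℤ K (PowerSeries.mk fun k => Ψ k i)

theorem fullK_coeff (Ψ : ℕ → Cpt → K) (i : Cpt) (n : ℤ) :
    (fullK Ψ i).coeff n
      = (mink i).coeff n + if expM i ≤ n then Ψ (n - expM i).toNat i else 0 := by
  rw [fullK, HahnSeries.coeff_add, coeff_single_mul_series]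

theorem fullK_zero : fullK (0 : ℕ → Cpt → K) = mink := by
  ext i n
  rw [fullK_coeff]
  simp

theorem lead_fullK {Ψ : ℕ → Cpt → K} {i : Cpt} {a : ℤ} {c : K} (h : Lead a (mink i) c)
    (ha : a < expM i) : Lead a (fullK Ψ i) c := by
  refine ⟨fun m hm => ?_, ?_⟩
  · rw [fullK_coeff, h.1 m hm, if_neg (by omega), add_zero]
  · rw [fullK_coeff, h.2, if_neg (by omega), add_zero]

theorem lead_fullK_zero {Ψ : ℕ → Cpt → K} {i : Cpt} (h : (mink i : K⸨X⸩) = 0) :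
    Lead (expM i) (fullK Ψ i) (Ψ 0 i) := by
  refine ⟨fun m hm => ?_, ?_⟩
  · rw [fullK_coeff, h, if_neg (by omega)]; simp
  · rw [fullK_coeff, h]; simp

theorem inc_fullK {Ψ Ψ' : ℕ → Cpt → K} {k : ℕ} (h : ∀ j < k, Ψ j = Ψ' j) (i : Cpt) :
    Lead (expM i + k) (fullK Ψ' i - fullK Ψ i) (Ψ' k i - Ψ k i) := by
  refine ⟨fun m hm => ?_, ?_⟩
  · rw [HahnSeries.coeff_sub, fullK_coeff, fullK_coeff]
    split_ifs
    · rw [h _ (by omega)]; ring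
    · ring
  · rw [HahnSeries.coeff_sub, fullK_coeff, fullK_coeff, if_pos (by omega), if_pos (by omega)]
    have : (expM i + (k : ℤ) - expM i).toNat = k := by omega
    rw [this]
    ring

theorem jet_fullK {Ψ Ψ' : ℕ → Cpt → K} {k : ℕ} (h : ∀ j < k, Ψ j = Ψ' j) {i : Cpt} {a : ℤ} {c : K}
    (hm : Lead a (mink i) c) (ha : a < expM i) :
    Jet a (expM i + k) (fullK Ψ i) (fullK Ψ' i) c c (Ψ' k i - Ψ k i) :=
  ⟨lead_fullK hm ha, lead_fullK hm ha, inc_fullK h i⟩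

theorem jet_fullK_zero {Ψ Ψ' : ℕ → Cpt → K} {k : ℕ} (h : ∀ j < k, Ψ j = Ψ' j) {i : Cpt}
    (hm : (mink i : K⸨X⸩) = 0) :
    Jet (expM i) (expM i + k) (fullK Ψ i) (fullK Ψ' i) (Ψ 0 i) (Ψ' 0 i) (Ψ' k i - Ψ k i) :=
  ⟨lead_fullK_zero hm, lead_fullK_zero hm, inc_fullK h i⟩

theorem lead_cst (c : K) : Lead 0 (cst c) c := by
  refine ⟨fun m hm => ?_, ?_⟩
  · rw [cst_coeff, if_neg hm.ne]
  · rw [cst_coeff, if_pos rfl]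

theorem lead_rinv : Lead 1 (rinv : K⸨X⸩) (-1) := by
  refine ⟨fun m hm => ?_, ?_⟩
  · rw [rinv_coeff, if_neg (by omega)]
  · rw [rinv_coeff]; simp

theorem fieldJets_fullK {Ψ Ψ' : ℕ → Cpt → K} {k : ℕ} (h : ∀ j < k, Ψ j = Ψ' j) :
    FieldJets k (fullK Ψ) (fullK Ψ') (Ψ 0) (Ψ' 0) (fun i => Ψ' k i - Ψ k i) where
  e1 := jet_fullK h (i := .e1) (c := -ee) (((lead_rinv.mul (lead_cst _) rfl)).congr (by ring)) (by decide)
  e2 := jet_fullK h (i := .e2) (c := -(im * ee)) (((lead_cst _).mul (lead_rinv.mul (lead_cst _) rfl) rfl).congr (by ring))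
    (by decide)
  e3 := jet_fullK h (i := .e3) ((lead_cst 1).of_eq (map_one cst).symm rfl) (by decide)
  e4 := jet_fullK_zero h (i := .e4) rfl
  e5 := jet_fullK_zero h (i := .e5) rfl
  γ1 := jet_fullK_zero h (i := .γ1) rfl
  γ2 := jet_fullK h (i := .γ2) lead_rinv (by decide)
  γ3 := jet_fullK h (i := .γ3) (c := -lam) (((lead_rinv.mul (lead_cst _) rfl)).congr (by ring)) (by decide)
  γ4 := jet_fullK h (i := .γ4) (c := -cj lam) (((lead_rinv.mul (lead_cst _) rfl)).congr (by ring)) (by decide)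
  γ5 := jet_fullK_zero h (i := .γ5) rfl
  γ6 := jet_fullK h (i := .γ6) (lead_rinv.neg.congr (neg_neg (1 : K))) (by decide)
  γ7 := jet_fullK_zero h (i := .γ7) rfl
  γ8 := jet_fullK_zero h (i := .γ8) rfl
  w1 := jet_fullK_zero h (i := .w1) rfl
  w2 := jet_fullK_zero h (i := .w2) rfl
  w3 := jet_fullK_zero h (i := .w3) rfl
  w4 := jet_fullK_zero h (i := .w4) rfl
  w5 := jet_fullK_zero h (i := .w5) rfl

end Increments

/-! ### Propagation of the constraints -/

section Propagation

open CoefRing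

variable {K : Type*} [CommRing K] [Algebra ℂ K] [CoefRing K]

namespace Lead

variable {n a : ℤ} {x : K⸨X⸩} {c : K}

theorem cj (h : Lead n x c) : Lead n (DiffRing.cj x) (CoefRing.cj c) := h.map _
theorem p1 (h : Lead n x c) : Lead n (DiffRing.p1 x) (d1 c) := h.der _
theorem p2 (h : Lead n x c) : Lead n (DiffRing.p2 x) (d2 c) := h.der _
theorem p3 (h : Lead n x c) : Lead n (DiffRing.p3 x) (d3 c) := h.der _
theorem p4 (h : Lead n x c) : Lead (n + 1) (DiffRing.p4 x) (-(n : K) * c) := h.uder rfl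
theorem cast (h : Lead a x c) (hn : n = a := by omega) : Lead n x c := hn ▸ h

theorem eq_zero_of {d : K} (h : Lead n x c) (hx : 0 = x)
    (hd : Lead n 0 c → Lead n 0 d := by exact fun h => h.simplify) : d = 0 :=
  (hd (h.of_eq hx rfl)).2.symm

end Lead


theorem lead_Z : Lead 1 (DiffRing.Z : K⸨X⸩) 1 := by
  refine ⟨fun m hm => ?_, ?_⟩
  · exact HahnSeries.coeff_single_of_ne hm.ne
  · exact HahnSeries.coeff_single_same 1 1

/-- The order in `1/u` at which the constraint quantities start. -/
def ordCon : SharpCpt → ℤ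
  | .t1 => 2 | .t2 => 2 | .t3 => 2 | .t4 => 3 | .t5 => 3
  | .u1 => 2 | .u2 => 2 | .u3 => 2 | .u4 => 2 | .u5 => 2 | .u6 => 2
  | .u7 => 3 | .u8 => 3 | .u9 => 3
  | .v1 => 2 | .v2 => 3 | .v3 => 4

/-- The leading coefficients of the constraint quantities. -/
structure ConLeads (k : ℕ) (Φ : Cpt → K⸨X⸩) (κ : SharpCpt → K) : Prop where
  t1 : Lead (2 + k) (gcon Φ .t1) (κ .t1)
  t2 : Lead (2 + k) (gcon Φ .t2) (κ .t2)
  t3 : Lead (2 + k) (gcon Φ .t3) (κ .t3)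
  t4 : Lead (3 + k) (gcon Φ .t4) (κ .t4)
  t5 : Lead (3 + k) (gcon Φ .t5) (κ .t5)
  u1 : Lead (2 + k) (gcon Φ .u1) (κ .u1)
  u2 : Lead (2 + k) (gcon Φ .u2) (κ .u2)
  u3 : Lead (2 + k) (gcon Φ .u3) (κ .u3)
  u4 : Lead (2 + k) (gcon Φ .u4) (κ .u4)
  u5 : Lead (2 + k) (gcon Φ .u5) (κ .u5)
  u6 : Lead (2 + k) (gcon Φ .u6) (κ .u6)
  u7 : Lead (3 + k) (gcon Φ .u7) (κ .u7)
  u8 : Lead (3 + k) (gcon Φ .u8) (κ .u8)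
  u9 : Lead (3 + k) (gcon Φ .u9) (κ .u9)
  v1 : Lead (2 + k) (gcon Φ .v1) (κ .v1)
  v2 : Lead (3 + k) (gcon Φ .v2) (κ .v2)
  v3 : Lead (4 + k) (gcon Φ .v3) (κ .v3)

variable {k l : ℕ} {Φ Φ' : Cpt → K⸨X⸩} {c c' δ : Cpt → K} {κ : SharpCpt → K}
  (hs : IsSol Φ) (h : FieldJets l Φ Φ' c c' δ) (hc : ConLeads k Φ κ)

local infixl:65 " ∔ " => Lead.add
local infixl:65 " ∸ " => Lead.sub
local infixr:70 " ⊙ " => Lead.ofNat_mul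

include hs h hc

theorem dual_t1 :
    d3 (κ .t1) = 0 := by
  have e := hs.L_t1
  simp only [op_apply] at e
  exact Lead.eq_zero_of (n := 2 + k)
    (2 ⊙ hc.t1.mul_low h.γ2.lead ∸ h.e1.lead.mul_low hc.u1.cj ∔ h.e1.lead.cj.mul_low hc.u1 ∔
    hc.t1.p3.mul h.e3.lead ∸ h.e1.lead.p3.mul_low hc.t3.cj ∔ h.e1.lead.cj.p3.mul_low hc.t3)
    (by linear_combination -e)

theorem dual_t2 :
    d3 (κ .t2) = 0 := by
  have e := hs.L_t2
  simp only [op_apply] at e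
  exact Lead.eq_zero_of (n := 2 + k)
    (2 ⊙ hc.t2.mul_low h.γ2.lead ∸ h.e2.lead.mul_low hc.u1.cj ∔ h.e2.lead.cj.mul_low hc.u1 ∔
    hc.t2.p3.mul h.e3.lead ∸ h.e2.lead.p3.mul_low hc.t3.cj ∔ h.e2.lead.cj.p3.mul_low hc.t3)
    (by linear_combination -e)

theorem dual_t3 :
    -(k : K) * κ .t3 - κ .t3 - κ .u7 - cj (κ .u8) = 0 := by
  have e := hs.N_t3
  simp only [op_apply] at e
  exact Lead.eq_zero_of (n := 3 + k)
    (hc.t3.p4.cast ∸ h.e3.lead.mul hc.u7 ∸ h.e3.lead.mul hc.u8.cj ∔ h.γ6.lead.mul hc.t3 ∔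
    h.γ7.lead.cj.mul_low hc.t3.cj ∸ 2 ⊙ h.γ8.lead.mul_low hc.t3 ∔ h.e3.lead.p1.mul hc.t4.cj ∔
    hc.t3.p1.mul_low h.e4.lead ∔ h.e3.lead.p2.mul hc.t5.cj ∔ hc.t3.p2.mul_low h.e5.lead)
    (by linear_combination -e)

theorem dual_t4 :
    ee * κ .u3 - ee * cj (κ .u4) + ee * κ .u5 - ee * cj (κ .u6) + d3 (κ .t4) = 0 := by
  have e := hs.L_t4
  simp only [op_apply] at e
  exact Lead.eq_zero_of (n := 3 + k)
    (hc.t1.mul h.γ3.lead.cj ∸ hc.t1.mul h.γ4.lead ∔ hc.t1.mul_low h.γ5.lead ∔ h.e1.lead.mul hc.u4.cj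
    ∸ h.e1.lead.mul hc.u5 ∸ h.e1.lead.cj.mul hc.u3 ∔ h.e1.lead.cj.mul hc.u6.cj ∔
    h.γ1.lead.cj.mul_low hc.t4.cj ∔ h.γ2.lead.mul_low hc.t4 ∔ h.e4.lead.p3.mul_low hc.t3.cj ∔
    hc.t4.p3.mul h.e3.lead)
    (by linear_combination -e)

theorem dual_t5 :
    -ee * im * κ .u3 - ee * im * cj (κ .u4) + ee * im * κ .u5 + ee * im * cj (κ .u6) + d3 (κ .t5) = 0 := by
  have e := hs.L_t5
  simp only [op_apply] at e
  exact Lead.eq_zero_of (n := 3 + k)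
    (hc.t2.mul h.γ3.lead.cj ∸ hc.t2.mul h.γ4.lead ∔ hc.t2.mul_low h.γ5.lead ∔ h.e2.lead.mul hc.u4.cj
    ∸ h.e2.lead.mul hc.u5 ∸ h.e2.lead.cj.mul hc.u3 ∔ h.e2.lead.cj.mul hc.u6.cj ∔
    h.γ1.lead.cj.mul_low hc.t5.cj ∔ h.γ2.lead.mul_low hc.t5 ∔ h.e5.lead.p3.mul_low hc.t3.cj ∔
    hc.t5.p3.mul h.e3.lead)
    (by linear_combination -e)

theorem dual_u1 :
    -κ .v1 + d3 (κ .u1) = 0 := by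
  have e := hs.L_u1
  simp only [op_apply] at e
  exact Lead.eq_zero_of (n := 2 + k)
    (hc.v1.cast.neg ∸ h.γ1.lead.mul_low hc.u1.cj ∔ 3 ⊙ h.γ2.lead.mul_low hc.u1 ∸
    h.γ1.lead.p3.mul_low hc.t3.cj ∔ h.γ2.lead.p3.mul_low hc.t3 ∔ hc.u1.p3.mul h.e3.lead)
    (by linear_combination -e)

theorem dual_u2 :
    d3 (κ .u2) = 0 := by
  have e := hs.L_u2
  simp only [op_apply] at e
  exact Lead.eq_zero_of (n := 2 + k)
    (hc.v2.low ∔ h.γ1.lead.mul_low hc.u5 ∔ 2 ⊙ h.γ2.lead.mul_low hc.u2 ∔ h.γ2.lead.mul_low hc.u6 ∔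
    h.γ3.lead.mul_low hc.u1.cj ∔ h.γ4.lead.mul_low hc.u1 ∸ h.γ5.lead.mul_low hc.u1 ∔
    h.γ3.lead.p3.mul_low hc.t3.cj ∔ h.γ4.lead.p3.mul_low hc.t3 ∔ hc.u2.p3.mul h.e3.lead)
    (by linear_combination -e)

theorem dual_u3 :
    d3 (κ .u3) = 0 := by
  have e := hs.L_u3
  simp only [op_apply] at e
  exact Lead.eq_zero_of (n := 2 + k)
    (hc.v2.low ∸ h.γ1.lead.mul_low hc.u4.cj ∔ h.γ1.lead.mul_low hc.u5 ∸ h.γ1.lead.cj.mul_low hc.u4 ∔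
    2 ⊙ h.γ2.lead.mul_low hc.u3 ∸ h.γ2.lead.mul_low hc.u6.cj ∸ h.γ3.lead.cj.mul_low hc.u1 ∔
    h.γ4.lead.mul_low hc.u1 ∸ h.γ5.lead.mul_low hc.u1 ∔ h.γ3.lead.p3.mul_low hc.t3.cj ∸
    h.γ4.lead.cj.p3.mul_low hc.t3.cj ∔ hc.u3.p3.mul h.e3.lead)
    (by linear_combination -e)

theorem dual_u4 :
    d3 (κ .u4) = 0 := by
  have e := hs.L_u4
  simp only [op_apply] at e
  exact Lead.eq_zero_of (n := 2 + k)
    (h.γ1.lead.mul_low hc.u2 ∸ h.γ1.lead.mul_low hc.u2.cj ∸ 2 ⊙ h.γ1.lead.mul_low hc.u3 ∔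
    h.γ1.lead.mul_low hc.u6 ∔ 2 ⊙ h.γ2.lead.mul_low hc.u4 ∸ h.γ2.lead.mul_low hc.u5.cj ∸
    h.γ3.lead.mul_low hc.u1 ∔ h.γ4.lead.cj.mul_low hc.u1 ∸ h.γ5.lead.cj.mul_low hc.u1 ∸
    h.γ3.lead.p3.mul_low hc.t3 ∔ h.γ4.lead.cj.p3.mul_low hc.t3 ∔ hc.u4.p3.mul h.e3.lead)
    (by linear_combination -e)

theorem dual_u5 :
    -(k : K) * κ .u5 - cj (κ .u4) = 0 := by
  have e := hs.N_u5
  simp only [op_apply] at e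
  exact Lead.eq_zero_of (n := 3 + k)
    (hc.u5.p4.cast ∸ h.γ3.lead.cj.mul_low hc.u9 ∔ h.γ4.lead.mul_low hc.u9 ∸ h.γ5.lead.mul_low
    hc.u7.cj ∔ h.γ5.lead.mul_low hc.u8 ∸ h.γ5.lead.mul_low hc.u9 ∸ h.γ6.lead.mul hc.u4.cj ∔ 2 ⊙
    h.γ6.lead.mul hc.u5 ∔ h.γ7.lead.mul_low hc.u3 ∸ h.γ7.lead.mul_low hc.u6 ∸ h.γ7.lead.mul_low
    hc.u6.cj ∔ 2 ⊙ h.γ8.lead.mul_low hc.u5 ∸ 2 ⊙ h.γ8.lead.cj.mul_low hc.u5 ∔ h.γ5.lead.p1.mul_low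
    hc.t4 ∔ hc.u5.p1.mul_low h.e4.lead ∔ h.γ5.lead.p2.mul_low hc.t5 ∔ hc.u5.p2.mul_low h.e5.lead)
    (by linear_combination -e)

theorem dual_u6 :
    -(k : K) * κ .u6 + κ .u2 - cj (κ .u2) - κ .u3 = 0 := by
  have e := hs.N_u6
  simp only [op_apply] at e
  exact Lead.eq_zero_of (n := 3 + k)
    (hc.u6.p4.cast ∸ h.γ3.lead.mul_low hc.u9 ∔ h.γ4.lead.cj.mul_low hc.u9 ∸ h.γ5.lead.mul_low hc.u7
    ∔ h.γ5.lead.mul_low hc.u8.cj ∸ h.γ5.lead.cj.mul_low hc.u9 ∔ h.γ6.lead.mul hc.u2 ∸ h.γ6.lead.mul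
    hc.u2.cj ∸ h.γ6.lead.mul hc.u3 ∔ 2 ⊙ h.γ6.lead.mul hc.u6 ∔ h.γ7.lead.mul_low hc.u4 ∸
    h.γ7.lead.mul_low hc.u5.cj ∸ h.γ7.lead.cj.mul_low hc.u5 ∸ h.γ5.lead.p1.mul_low hc.t4.cj ∔
    hc.u6.p1.mul_low h.e4.lead ∸ h.γ5.lead.p2.mul_low hc.t5.cj ∔ hc.u6.p2.mul_low h.e5.lead ∸
    (hc.v2.mul lead_Z rfl).mul_low lead_Z)
    (by linear_combination -e)

theorem dual_u7 :
    -lam * κ .u2 + lam * cj (κ .u2) + lam * κ .u3 - lam * κ .u6 + cj (lam) * κ .u4 - cj (lam) * cj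
    (κ .u5) + d3 (κ .u7) = 0 := by
  have e := hs.L_u7
  simp only [op_apply] at e
  exact Lead.eq_zero_of (n := 3 + k)
    (h.γ1.lead.mul_low hc.u8 ∔ h.γ2.lead.mul_low hc.u7 ∔ 2 ⊙ h.γ3.lead.mul hc.u2 ∸ h.γ3.lead.mul
    hc.u2.cj ∸ h.γ3.lead.mul hc.u3 ∔ 2 ⊙ h.γ3.lead.mul hc.u6 ∸ h.γ4.lead.mul hc.u4 ∔ h.γ4.lead.mul
    hc.u5.cj ∸ h.γ4.lead.cj.mul hc.u2 ∸ h.γ4.lead.cj.mul hc.u6 ∔ h.γ5.lead.mul_low hc.u4 ∔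
    h.γ5.lead.cj.mul_low hc.u2 ∔ h.γ8.lead.p3.mul_low hc.t3 ∔ hc.u7.p3.mul h.e3.lead ∔ (hc.v1.mul
    lead_Z rfl).mul_low lead_Z)
    (by linear_combination -e)

theorem dual_u8 :
    -lam * cj (κ .u4) + lam * κ .u5 - cj (lam) * κ .u3 + cj (lam) * cj (κ .u6) + d3 (κ .u8) = 0 := by
  have e := hs.L_u8
  simp only [op_apply] at e
  exact Lead.eq_zero_of (n := 3 + k)
    (hc.v3.low.neg ∔ h.γ1.lead.cj.mul_low hc.u7 ∔ h.γ2.lead.mul_low hc.u8 ∔ h.γ3.lead.mul hc.u4.cj ∸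
    2 ⊙ h.γ3.lead.mul hc.u5 ∸ h.γ3.lead.cj.mul hc.u2 ∔ h.γ4.lead.mul hc.u2 ∔ h.γ4.lead.mul hc.u3 ∸
    h.γ4.lead.mul hc.u6.cj ∔ h.γ4.lead.cj.mul hc.u5 ∸ h.γ5.lead.mul_low hc.u2 ∸ h.γ5.lead.mul_low
    hc.u3 ∔ h.γ8.lead.p3.mul_low hc.t3.cj ∔ hc.u8.p3.mul h.e3.lead)
    (by linear_combination -e)

theorem dual_u9 :
    -(k : K) * κ .u9 - cj (κ .u7) - κ .u8 = 0 := by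
  have e := hs.N_u9
  simp only [op_apply] at e
  exact Lead.eq_zero_of (n := 4 + k)
    (hc.u9.p4.cast ∸ h.γ6.lead.mul hc.u7.cj ∸ h.γ6.lead.mul hc.u8 ∔ 3 ⊙ h.γ6.lead.mul hc.u9 ∔ 3 ⊙
    h.γ7.lead.mul_low hc.u7 ∸ h.γ7.lead.mul_low hc.u8.cj ∸ h.γ7.lead.mul_low hc.u9.cj ∔ 2 ⊙
    h.γ8.lead.mul_low hc.u9 ∸ h.γ6.lead.p1.mul hc.t4 ∔ h.γ7.lead.p1.mul_low hc.t4.cj ∔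
    hc.u9.p1.mul_low h.e4.lead ∸ h.γ6.lead.p2.mul hc.t5 ∔ h.γ7.lead.p2.mul_low hc.t5.cj ∔
    hc.u9.p2.mul_low h.e5.lead ∸ (hc.v3.mul lead_Z rfl).mul_low lead_Z)
    (by linear_combination -e)

theorem dual_v1 :
    -(k : K) * κ .v1 = 0 := by
  have e := hs.bianchi_1
  simp only [op_apply] at e
  exact Lead.eq_zero_of (n := 3 + k)
    (hc.v1.p4.cast ∔ 2 ⊙ hc.v1.mul h.γ6.lead ∸ 3 ⊙ hc.v1.mul_low h.γ8.lead ∸ hc.v1.mul_low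
    h.γ8.lead.cj ∸ 4 ⊙ hc.v2.mul_low h.γ3.lead ∔ 4 ⊙ hc.v2.mul_low h.γ4.lead.cj ∔ hc.v2.mul_low
    h.γ5.lead.cj ∔ 2 ⊙ hc.v3.mul_low h.γ1.lead ∸ 3 ⊙ hc.u1.mul_low h.w3.lead ∸ 2 ⊙ hc.u2.mul_low
    h.w2.lead ∸ 4 ⊙ hc.u3.mul_low h.w2.lead ∔ 2 ⊙ hc.u6.mul_low h.w2.lead ∸ 4 ⊙ hc.u8.mul_low
    h.w1.lead ∸ hc.u9.mul_low h.w1.lead ∔ hc.v1.p1.mul_low h.e4.lead ∔ hc.v2.p1.mul_low h.e1.lead ∔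
    h.w1.lead.p1.mul_low hc.t4 ∸ h.w2.lead.p1.mul_low hc.t1 ∔ hc.v1.p2.mul_low h.e5.lead ∔
    hc.v2.p2.mul_low h.e2.lead ∔ h.w1.lead.p2.mul_low hc.t5 ∸ h.w2.lead.p2.mul_low hc.t2 ∸
    h.w3.lead.p3.mul_low hc.t3 ∔ 4 ⊙ ((hc.v1.mul h.γ2.lead rfl).mul lead_Z rfl).mul_low lead_Z ∔
    ((hc.v1.p3.mul h.e3.lead rfl).mul lead_Z rfl).mul_low lead_Z)
    (by linear_combination -e)

theorem dual_v2 :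
    -(k : K) * κ .v2 = 0 := by
  have e := hs.bianchi_2
  simp only [op_apply] at e
  exact Lead.eq_zero_of (n := 4 + k)
    (hc.v2.p4.cast ∔ 3 ⊙ hc.v2.mul h.γ6.lead ∸ hc.v2.mul_low h.γ8.lead ∸ hc.v2.mul_low h.γ8.lead.cj
    ∸ hc.v3.mul_low h.γ3.lead ∔ 3 ⊙ hc.v3.mul_low h.γ4.lead.cj ∔ hc.v3.mul_low h.γ5.lead.cj ∸ 2 ⊙
    hc.u1.mul_low h.w4.lead ∸ 3 ⊙ hc.u3.mul_low h.w3.lead ∔ 3 ⊙ hc.u6.mul_low h.w3.lead ∸ 2 ⊙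
    hc.u8.mul_low h.w2.lead ∸ 2 ⊙ hc.u9.mul_low h.w2.lead ∔ hc.v2.p1.mul_low h.e4.lead ∔
    hc.v3.p1.mul_low h.e1.lead ∔ h.w2.lead.p1.mul_low hc.t4 ∸ h.w3.lead.p1.mul_low hc.t1 ∔
    hc.v2.p2.mul_low h.e5.lead ∔ hc.v3.p2.mul_low h.e2.lead ∔ h.w2.lead.p2.mul_low hc.t5 ∸
    h.w3.lead.p2.mul_low hc.t2 ∸ h.w4.lead.p3.mul_low hc.t3 ∔ 2 ⊙ ((hc.v1.mul h.γ4.lead rfl).mul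
    lead_Z rfl).mul_low lead_Z ∔ 2 ⊙ ((hc.v1.mul h.γ5.lead rfl).mul lead_Z rfl).mul_low lead_Z ∔ 3 ⊙
    ((hc.v2.mul h.γ2.lead rfl).mul lead_Z rfl).mul_low lead_Z ∔ ((hc.v1.p1.mul h.e1.lead.cj rfl).mul
    lead_Z rfl).mul_low lead_Z ∔ ((hc.v1.p2.mul h.e2.lead.cj rfl).mul lead_Z rfl).mul_low lead_Z ∔
    ((hc.v2.p3.mul h.e3.lead rfl).mul lead_Z rfl).mul_low lead_Z)
    (by linear_combination -e)

theorem dual_v3 :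
    -(k : K) * κ .v3 = 0 := by
  have e := hs.bianchi_3
  simp only [op_apply] at e
  exact Lead.eq_zero_of (n := 5 + k)
    (hc.v3.p4.cast ∔ 4 ⊙ hc.v3.mul h.γ6.lead ∔ hc.v3.mul_low h.γ8.lead ∸ hc.v3.mul_low h.γ8.lead.cj
    ∸ hc.u1.mul_low h.w5.lead ∔ 2 ⊙ hc.u2.mul_low h.w4.lead ∸ 2 ⊙ hc.u3.mul_low h.w4.lead ∔ 4 ⊙
    hc.u6.mul_low h.w4.lead ∸ 3 ⊙ hc.u9.mul_low h.w3.lead ∔ hc.v3.p1.mul_low h.e4.lead ∔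
    h.w3.lead.p1.mul_low hc.t4 ∸ h.w4.lead.p1.mul_low hc.t1 ∔ hc.v3.p2.mul_low h.e5.lead ∔
    h.w3.lead.p2.mul_low hc.t5 ∸ h.w4.lead.p2.mul_low hc.t2 ∸ h.w5.lead.p3.mul_low hc.t3 ∔ 2 ⊙
    ((hc.v1.mul h.γ7.lead rfl).mul lead_Z rfl).mul_low lead_Z ∔ 3 ⊙ ((hc.v2.mul h.γ5.lead rfl).mul
    lead_Z rfl).mul_low lead_Z ∔ 2 ⊙ ((hc.v3.mul h.γ2.lead rfl).mul lead_Z rfl).mul_low lead_Z ∔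
    ((hc.v2.p1.mul h.e1.lead.cj rfl).mul lead_Z rfl).mul_low lead_Z ∔ ((hc.v2.p2.mul h.e2.lead.cj
    rfl).mul lead_Z rfl).mul_low lead_Z ∔ ((hc.v3.p3.mul h.e3.lead rfl).mul lead_Z rfl).mul_low
    lead_Z)
    (by linear_combination -e)

omit hs h hc

/-- Ring homomorphisms that commute with all the structure. -/
structure IsDiffHom {A B : Type*} [CommRing A] [DiffRing A] [CommRing B] [DiffRing B]
    (f : A →+* B) : Prop where
  p1 : ∀ x, f (DiffRing.p1 x) = DiffRing.p1 (f x)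
  p2 : ∀ x, f (DiffRing.p2 x) = DiffRing.p2 (f x)
  p3 : ∀ x, f (DiffRing.p3 x) = DiffRing.p3 (f x)
  p4 : ∀ x, f (DiffRing.p4 x) = DiffRing.p4 (f x)
  cj : ∀ x, f (DiffRing.cj x) = DiffRing.cj (f x)
  U : f DiffRing.U = DiffRing.U

namespace IsDiffHom

variable {A B : Type*} [CommRing A] [DiffRing A] [CommRing B] [DiffRing B] {f : A →+* B}

theorem gcon (hf : IsDiffHom f) (Φ : Cpt → A) (j : SharpCpt) :
    f (gcon Φ j) = FarField.gcon (fun i => f (Φ i)) j := by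
  cases j <;>
    simp only [FarField.gcon, gA1, gA2, gA3, op_apply, map_add,
      map_sub, map_mul, map_ofNat, hf.p1, hf.p2, hf.p3, hf.p4, hf.cj]

theorem gres (hf : IsDiffHom f) (Φ : Cpt → A) (i : Cpt) :
    f (gres Φ i) = FarField.gres (fun i => f (Φ i)) i := by
  cases i <;>
    simp only [FarField.gres, gA1, gA2, gA3, gA4, gB1, gB2, gB3, gB4, op_apply, map_add, map_sub, map_neg, map_mul, map_pow, map_ofNat, hf.p1, hf.p2, hf.p3, hf.p4,
      hf.cj, hf.U]

end IsDiffHom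

/-- Homomorphisms of rings of coefficient functions. -/
structure IsCoefHom {K' : Type*} [CommRing K'] [Algebra ℂ K'] [CoefRing K'] (π : K →+* K') :
    Prop where
  d1 : ∀ x, π (d1 x) = CoefRing.d1 (π x)
  d2 : ∀ x, π (d2 x) = CoefRing.d2 (π x)
  d3 : ∀ x, π (d3 x) = CoefRing.d3 (π x)
  cj : ∀ x, π (cj x) = CoefRing.cj (π x)
  s : π s = CoefRing.s
  lam : π lam = CoefRing.lam
  algebraMap : ∀ c, π (algebraMap ℂ K c) = algebraMap ℂ K' c

section Hom

variable {K' : Type*} [CommRing K'] [Algebra ℂ K'] [CoefRing K'] {π : K →+* K'}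

theorem IsCoefHom.isDiffHom (hπ : IsCoefHom π) : IsDiffHom (coeffMap π) where
  p1 x := by ext n; exact hπ.d1 _
  p2 x := by ext n; exact hπ.d2 _
  p3 x := by ext n; exact hπ.d3 _
  p4 x := by
    ext n
    change π ((uDer x).coeff n) = (uDer (coeffMap π x)).coeff n
    rw [uDer_coeff, uDer_coeff, map_mul, map_neg, map_intCast, coeffMap_coeff]
  cj x := by ext n; exact hπ.cj _
  U := by
    ext n
    change π ((HahnSeries.single (-1) (1 : K)).coeff n) = (HahnSeries.single (-1) (1 : K')).coeff n
    rw [HahnSeries.coeff_single, HahnSeries.coeff_single]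
    split_ifs <;> simp

theorem IsCoefHom.ee (hπ : IsCoefHom π) : π ee = FarField.ee := by
  simp only [FarField.ee, map_add, map_mul, map_ofNat, hπ.lam, hπ.cj, hπ.algebraMap]

theorem coeffMap_cst (f : K →+* K') (c : K) : coeffMap f (cst c) = cst (f c) := by
  ext n
  rw [coeffMap_coeff, cst_coeff, cst_coeff]
  split_ifs <;> simp

theorem IsCoefHom.mink (hπ : IsCoefHom π) (i : Cpt) : coeffMap π (mink i) = mink i := by
  have hr : coeffMap π rinv = rinv := by
    ext n
    rw [coeffMap_coeff, rinv_coeff, rinv_coeff]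
    split_ifs <;> simp [hπ.s]
  cases i <;>
    simp only [FarField.mink, map_mul, map_neg, map_one, map_zero, hr, coeffMap_cst, hπ.ee, hπ.lam,
      hπ.cj, im, hπ.algebraMap]

theorem IsCoefHom.fullK (hπ : IsCoefHom π) (Ψ : ℕ → Cpt → K) (i : Cpt) :
    coeffMap π (fullK Ψ i) = fullK (fun k i => π (Ψ k i)) i := by
  ext n
  rw [coeffMap_coeff, fullK_coeff, fullK_coeff, map_add, ← hπ.mink, coeffMap_coeff]
  split_ifs <;> simp

/-- A homomorphism of coefficient rings (restriction to the past) on whose kernel `∂/∂ū` is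
bijective. -/
structure IsPastRestriction (π : K →+* K') : Prop extends IsCoefHom π where
  inj : ∀ x, π x = 0 → CoefRing.d3 x = 0 → x = 0
  surj : ∀ y, π y = 0 → ∃ x, π x = 0 ∧ CoefRing.d3 x = y

theorem IsCoefHom.gcon_coeff (hπ : IsCoefHom π) {Ψ : ℕ → Cpt → K} (h : ∀ k i, π (Ψ k i) = 0)
    (j : SharpCpt) (n : ℤ) : π ((gcon (FarField.fullK Ψ) j).coeff n) = 0 := by
  have e : (fun i => coeffMap π (FarField.fullK Ψ i)) = FarField.mink := by
    funext i
    rw [hπ.fullK, ← fullK_zero]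
    congr 1
    funext k i
    exact h k i
  rw [← coeffMap_coeff, hπ.isDiffHom.gcon, e, gcon_mink]
  rfl

theorem IsCoefHom.gres_coeff (hπ : IsCoefHom π) {Ψ : ℕ → Cpt → K} (h : ∀ k i, π (Ψ k i) = 0)
    (i : Cpt) (n : ℤ) : π ((gres (FarField.fullK Ψ) i).coeff n) = 0 := by
  have e : (fun i => coeffMap π (FarField.fullK Ψ i)) = FarField.mink := by
    funext i
    rw [hπ.fullK, ← fullK_zero]
    congr 1
    funext k i
    exact h k i
  rw [← coeffMap_coeff, hπ.isDiffHom.gres, e, gres_mink]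
  rfl

theorem natCast_mul_eq_zero {k : ℕ} (hk : k ≠ 0) {x : K} (h : (k : K) * x = 0) : x = 0 := by
  have : algebraMap ℂ K (k : ℂ)⁻¹ * ((k : K) * x) = x := by
    rw [← mul_assoc, ← map_natCast (algebraMap ℂ K), ← map_mul,
      inv_mul_cancel₀ (Nat.cast_ne_zero.mpr hk), map_one, one_mul]
  rw [← this, h, mul_zero]

theorem gcon_fullK_base (Ψ : ℕ → Cpt → K) (j : SharpCpt) :
    ∀ m < ordCon j, (gcon (fullK Ψ) j).coeff m = 0 := by
  have h : FieldJets 0 (fullK 0) (fullK Ψ) _ _ _ := fieldJets_fullK (fun _ hj => by omega)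
  rw [fullK_zero] at h
  have key : ∀ (n : ℤ) (x : K⸨X⸩) (v : K), x = 0 → Lead (n + (0 : ℕ))
      (gcon (fullK Ψ) j - x) v → ordCon j ≤ n → ∀ m < ordCon j, (gcon (fullK Ψ) j).coeff m = 0 := by
    intro n x v hx hv hn m hm
    have := hv.1 m (by push_cast; omega)
    rwa [hx, sub_zero] at this
  have g := gcon_mink (K := K)
  cases j
  · obtain ⟨v, hv⟩ := inc_gcon_t1 h; exact key _ _ v (g _) hv (by decide)
  · obtain ⟨v, hv⟩ := inc_gcon_t2 h; exact key _ _ v (g _) hv (by decide)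
  · obtain ⟨v, hv⟩ := inc_gcon_t3 h; exact key _ _ v (g _) hv (by decide)
  · obtain ⟨v, hv⟩ := inc_gcon_t4 h; exact key _ _ v (g _) hv (by decide)
  · obtain ⟨v, hv⟩ := inc_gcon_t5 h; exact key _ _ v (g _) hv (by decide)
  · exact key _ _ _ (g _) (inc_gcon_u1 h) (by decide)
  · exact key _ _ _ (g _) (inc_gcon_u2 h) (by decide)
  · obtain ⟨v, hv⟩ := inc_gcon_u3 h; exact key _ _ v (g _) hv (by decide)
  · exact key _ _ _ (g _) (inc_gcon_u4 h) (by decide)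
  · exact key _ _ _ (g _) (inc_gcon_u5 h) (by decide)
  · exact key _ _ _ (g _) (inc_gcon_u6 h) (by decide)
  · obtain ⟨v, hv⟩ := inc_gcon_u7 h; exact key _ _ v (g _) hv (by decide)
  · obtain ⟨v, hv⟩ := inc_gcon_u8 h; exact key _ _ v (g _) hv (by decide)
  · exact key _ _ _ (g _) (inc_gcon_u9 h) (by decide)
  · exact key _ _ _ (g .v1) (inc_gA1 h) (by decide)
  · exact key _ _ _ (g .v2) (inc_gA2 h) (by decide)
  · exact key _ _ _ (g .v3) (inc_gA3 h) (by decide)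

/-- The constraint quantities that satisfy transport equations along `N`, and have to vanish to
leading order. -/
def IsFreeCon (j : SharpCpt) : Prop :=
  j = .v1 ∨ j = .v2 ∨ j = .v3 ∨ j = .u5 ∨ j = .u6 ∨ j = .u9

/-- A solution that is trivial in the past satisfies the constraints, if they hold to leading
order. -/
theorem gcon_eq_zero (hπ : IsPastRestriction π) {Ψ : ℕ → Cpt → K} (hs : IsSol (fullK Ψ))
    (hp : ∀ k i, π (Ψ k i) = 0)
    (h0 : ∀ j, IsFreeCon j → (gcon (fullK Ψ) j).coeff (ordCon j) = 0) (j : SharpCpt) :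
    gcon (fullK Ψ) j = 0 := by
  have main : ∀ k : ℕ, ∀ j, ∀ m < ordCon j + k, (gcon (fullK Ψ) j).coeff m = 0 := by
    intro k
    induction k with
    | zero => intro j m hm; exact gcon_fullK_base Ψ j m (by simpa using hm)
    | succ k ih =>
      set κ : SharpCpt → K := fun j => (gcon (fullK Ψ) j).coeff (ordCon j + k) with hκ
      have hl : ∀ j, Lead (ordCon j + k) (gcon (fullK Ψ) j) (κ j) := fun j => ⟨ih j, rfl⟩
      have hc : ConLeads k (fullK Ψ) κ := ⟨hl .t1, hl .t2, hl .t3, hl .t4, hl .t5, hl .u1, hl .u2,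
        hl .u3, hl .u4, hl .u5, hl .u6, hl .u7, hl .u8, hl .u9, hl .v1, hl .v2, hl .v3⟩
      have h : FieldJets 0 (fullK Ψ) (fullK Ψ) _ _ _ := fieldJets_fullK (fun _ _ => rfl)
      have hz : ∀ j, π (κ j) = 0 := fun j => hπ.toIsCoefHom.gcon_coeff hp _ _
      have free : ∀ j, IsFreeCon j → (k : K) * κ j = 0 → κ j = 0 := by
        intro j hj hkj
        by_cases hk : k = 0
        · subst hk
          simpa [hκ] using h0 j hj
        · exact natCast_mul_eq_zero hk hkj
      have v1 : κ .v1 = 0 := free _ (by simp [IsFreeCon]) (by linear_combination -dual_v1 hs h hc)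
      have v2 : κ .v2 = 0 := free _ (by simp [IsFreeCon]) (by linear_combination -dual_v2 hs h hc)
      have v3 : κ .v3 = 0 := free _ (by simp [IsFreeCon]) (by linear_combination -dual_v3 hs h hc)
      have t1 : κ .t1 = 0 := hπ.inj _ (hz _) (dual_t1 hs h hc)
      have t2 : κ .t2 = 0 := hπ.inj _ (hz _) (dual_t2 hs h hc)
      have u1 : κ .u1 = 0 := hπ.inj _ (hz _) (by linear_combination dual_u1 hs h hc + v1)
      have u2 : κ .u2 = 0 := hπ.inj _ (hz _) (dual_u2 hs h hc)
      have u3 : κ .u3 = 0 := hπ.inj _ (hz _) (dual_u3 hs h hc)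
      have u4 : κ .u4 = 0 := hπ.inj _ (hz _) (dual_u4 hs h hc)
      have u2c : CoefRing.cj (κ .u2) = 0 := by rw [u2, map_zero]
      have u4c : CoefRing.cj (κ .u4) = 0 := by rw [u4, map_zero]
      have u5 : κ .u5 = 0 := free _ (by simp [IsFreeCon])
        (by linear_combination -dual_u5 hs h hc - u4c)
      have u6 : κ .u6 = 0 := free _ (by simp [IsFreeCon])
        (by linear_combination -dual_u6 hs h hc + u2 - u2c - u3)
      have u5c : CoefRing.cj (κ .u5) = 0 := by rw [u5, map_zero]
      have u6c : CoefRing.cj (κ .u6) = 0 := by rw [u6, map_zero]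
      have t4 : κ .t4 = 0 := hπ.inj _ (hz _) (by
        linear_combination dual_t4 hs h hc - FarField.ee * (u3 - u4c + u5 - u6c))
      have t5 : κ .t5 = 0 := hπ.inj _ (hz _) (by
        linear_combination dual_t5 hs h hc - FarField.ee * im * (-u3 - u4c + u5 + u6c))
      have u7 : κ .u7 = 0 := hπ.inj _ (hz _) (by
        linear_combination dual_u7 hs h hc - lam * (-u2 + u2c + u3 - u6)
          - CoefRing.cj lam * (u4 - u5c))
      have u8 : κ .u8 = 0 := hπ.inj _ (hz _) (by
        linear_combination dual_u8 hs h hc - lam * (-u4c + u5) - CoefRing.cj lam * (-u3 + u6c))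
      have u7c : CoefRing.cj (κ .u7) = 0 := by rw [u7, map_zero]
      have u8c : CoefRing.cj (κ .u8) = 0 := by rw [u8, map_zero]
      have t3 : κ .t3 = 0 := natCast_mul_eq_zero (k := k + 1) (by omega) (by
        push_cast
        linear_combination -dual_t3 hs h hc - u7 - u8c)
      have u9 : κ .u9 = 0 := free _ (by simp [IsFreeCon])
        (by linear_combination -dual_u9 hs h hc - u7c - u8)
      have hall : ∀ j, κ j = 0 := by intro j; cases j <;> assumption
      intro j m hm
      rcases (show m < ordCon j + k ∨ m = ordCon j + k by push_cast at hm; omega) with h1 | h1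
      · exact ih j m h1
      · rw [h1]; exact hall j
  ext m
  have := main (m - ordCon j + 1).toNat j m (by omega)
  simpa using this

end Hom

end Propagation

/-! ### Existence and uniqueness of formal solutions over a ring of coefficient functions -/

section Construction

open CoefRing

variable {K : Type*} [CommRing K] [Algebra ℂ K] [CoefRing K]

/-- The components that are real. -/
def IsRealCpt (i : Cpt) : Prop := i = .e3 ∨ i = .e4 ∨ i = .e5 ∨ i = .γ2 ∨ i = .γ6

/-- The order in `1/u` at which the zeroth coefficient of the field enters the residual. -/
def ordRes : Cpt → ℤ
  | .e1 => 2 | .e2 => 2 | .e3 => 3 | .e4 => 3 | .e5 => 3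
  | .γ1 => 1 | .γ2 => 2 | .γ3 => 2 | .γ4 => 2 | .γ5 => 3 | .γ6 => 3 | .γ7 => 3 | .γ8 => 3
  | .w1 => 0 | .w2 => -1 | .w3 => -2 | .w4 => -3 | .w5 => -4

theorem inc_gres_low {k : ℕ} {Φ Φ' : Cpt → K⸨X⸩} {c c' δ : Cpt → K}
    (h : FieldJets k Φ Φ' c c' δ) (i : Cpt) {m : ℤ} (hm : m < ordRes i + k) :
    (gres Φ' i).coeff m = (gres Φ i).coeff m := by
  rw [← sub_eq_zero, ← HahnSeries.coeff_sub]
  cases i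
  exacts [(inc_gres_e1 h).1 m hm, (inc_gres_e2 h).1 m hm, (inc_gres_e3 h).1 m hm, (inc_gres_e4 h).1
    m hm, (inc_gres_e5 h).1 m hm, (inc_gres_γ1 h).1 m hm, (inc_gres_γ2 h).1 m hm, (inc_gres_γ3 h).1
    m hm, (inc_gres_γ4 h).1 m hm, (inc_gres_γ5 h).1 m hm, (inc_gres_γ6 h).1 m hm, (inc_gres_γ7 h).1
    m hm, (inc_gres_γ8 h).1 m hm, (inc_gres_w1 h).1 m hm, (inc_gres_w2 h).1 m hm, (inc_gres_w3 h).1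
    m hm, (inc_gres_w4 h).1 m hm, (inc_gres_w5 h).1 m hm]

/-- The inverse of a positive integer. -/
def invK (k : ℕ) : K := algebraMap ℂ K (k : ℂ)⁻¹

theorem mul_invK {k : ℕ} (hk : k ≠ 0) : (k : K) * invK k = 1 := by
  rw [invK, ← map_natCast (algebraMap ℂ K), ← map_mul,
    mul_inv_cancel₀ (Nat.cast_ne_zero.mpr hk), map_one]

theorem cj_invK (k : ℕ) : cj (invK k : K) = invK k := by
  rw [invK, cj_algebraMap, map_inv₀, map_natCast]

section Existence

variable {K' : Type*} [CommRing K'] [Algebra ℂ K'] [CoefRing K'] {π : K →+* K'}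

theorem IsPastRestriction.surj_real (hπ : IsPastRestriction π) {y : K} (hy : π y = 0)
    (hr : cj y = y) : ∃ x, π x = 0 ∧ d3 x = y ∧ cj x = x := by
  obtain ⟨x, hx, hxy⟩ := hπ.surj y hy
  refine ⟨x, hx, hxy, ?_⟩
  rw [← sub_eq_zero]
  refine hπ.inj _ ?_ ?_
  · rw [map_sub, hπ.cj, hx, map_zero, sub_zero]
  · rw [map_sub, ← cj_d3, hxy, hr, sub_self]

/-- The solution of the linear equations for one coefficient of the field, given the components
`γ1, γ6, γ7, w`. -/
theorem exists_increment (hπ : IsPastRestriction π) (k : ℕ) {r : Cpt → K} (hr : ∀ i, π (r i) = 0)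
    (hrr : ∀ i, IsRealCpt i → cj (r i) = r i) {q : K} (hq : π q = 0) (hqr : cj q = q)
    {a1 a6 a7 b1 b2 b3 b4 b5 : K} (h1 : π a1 = 0) (h6 : π a6 = 0) (h6r : cj a6 = a6)
    (h7 : π a7 = 0) (hb1 : π b1 = 0) (hb2 : π b2 = 0) (hb3 : π b3 = 0) (hb4 : π b4 = 0)
    (hb5 : π b5 = 0) :
    ∃ δ : Cpt → K, (δ .γ1 = a1 ∧ δ .γ6 = a6 ∧ δ .γ7 = a7 ∧ δ .w1 = b1 ∧ δ .w2 = b2 ∧ δ .w3 = b3 ∧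
      δ .w4 = b4 ∧ δ .w5 = b5) ∧ (∀ i, π (δ i) = 0) ∧ (∀ i, IsRealCpt i → cj (δ i) = δ i) ∧
      r .e1 + (-ee * δ .γ1 + d3 (δ .e1)) = 0 ∧
      r .e2 + (ee * im * δ .γ1 + d3 (δ .e2)) = 0 ∧
      r .e3 + (-(k : K) * δ .e3 - 2 * δ .e3 - δ .γ8 - cj (δ .γ8)) = 0 ∧
      r .e4 + (ee * δ .γ3 + ee * cj (δ .γ3) - ee * δ .γ4 - ee * cj (δ .γ4) + ee * δ .γ5
        + ee * cj (δ .γ5) + d3 (δ .e4)) = 0 ∧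
      r .e5 + (-ee * im * δ .γ3 + ee * im * cj (δ .γ3) - ee * im * δ .γ4 + ee * im * cj (δ .γ4)
        + ee * im * δ .γ5 - ee * im * cj (δ .γ5) + d3 (δ .e5)) = 0 ∧
      r .γ2 + (q + d3 (δ .γ2)) = 0 ∧
      r .γ3 + (cj lam * δ .γ1 + δ .w2 + d3 (δ .γ3)) = 0 ∧
      r .γ4 + (lam * cj (δ .γ1) + d3 (δ .γ4)) = 0 ∧
      r .γ5 + (-(k : K) * δ .γ5 + cj (δ .γ3) - δ .γ4 - δ .γ5) = 0 ∧
      r .γ8 + (lam * cj (δ .γ3) - lam * δ .γ4 + lam * δ .γ5 - cj lam * δ .γ3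
        + cj lam * cj (δ .γ4) - cj lam * cj (δ .γ5) - δ .w3 + d3 (δ .γ8)) = 0 := by
  have hcj : ∀ x, π x = 0 → π (cj x) = 0 := fun x hx => by rw [hπ.cj, hx, map_zero]
  obtain ⟨x1, hx1, hx1'⟩ := hπ.surj (-r .e1 + ee * a1) (by simp [hr, h1])
  obtain ⟨x2, hx2, hx2'⟩ := hπ.surj (-r .e2 - ee * im * a1) (by simp [hr, h1])
  obtain ⟨g2, hg2, hg2', hg2r⟩ := hπ.surj_real (y := -r .γ2 - q) (by simp [hr, hq])
    (by rw [map_sub, map_neg, hqr, hrr _ (by simp [IsRealCpt])])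
  obtain ⟨g3, hg3, hg3'⟩ := hπ.surj (-r .γ3 - cj lam * a1 - b2) (by simp [hr, h1, hb2])
  obtain ⟨g4, hg4, hg4'⟩ := hπ.surj (-r .γ4 - lam * cj a1) (by simp [hr, hcj _ h1])
  set g5 : K := invK (k + 1) * (r .γ5 + cj g3 - g4) with hg5'
  have hg5 : π g5 = 0 := by simp [g5, hr, hcj _ hg3, hg4]
  obtain ⟨g8, hg8, hg8'⟩ := hπ.surj (-r .γ8 - (lam * cj g3 - lam * g4 + lam * g5 - cj lam * g3
        + cj lam * cj g4 - cj lam * cj g5 - b3))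
    (by simp [hr, hcj _ hg3, hcj _ hg4, hcj _ hg5, hg3, hg4, hg5, hb3])
  obtain ⟨x4, hx4, hx4', hx4r⟩ := hπ.surj_real (y := -r .e4 - (ee * g3 + ee * cj g3 - ee * g4
      - ee * cj g4 + ee * g5 + ee * cj g5))
    (by simp [hr, hcj _ hg3, hcj _ hg4, hcj _ hg5, hg3, hg4, hg5])
    (by simp only [map_sub, map_neg, map_add, map_mul, cj_ee, cj_cj,
          hrr .e4 (by simp [IsRealCpt])]; ring)
  obtain ⟨x5, hx5, hx5', hx5r⟩ := hπ.surj_real (y := -r .e5 - (-ee * im * g3 + ee * im * cj g3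
      - ee * im * g4 + ee * im * cj g4 + ee * im * g5 - ee * im * cj g5))
    (by simp [hr, hcj _ hg3, hcj _ hg4, hcj _ hg5, hg3, hg4, hg5])
    (by simp only [map_sub, map_neg, map_add, map_mul, cj_ee, cj_cj, cj_im,
          hrr .e5 (by simp [IsRealCpt])]; ring)
  set x3 : K := invK (k + 2) * (r .e3 - g8 - cj g8) with hx3'
  have hx3 : π x3 = 0 := by simp [x3, hr, hcj _ hg8, hg8]
  have i1 : ((k : K) + 1) * invK (k + 1) = 1 := by
    have := mul_invK (K := K) (k := k + 1) (by omega)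
    push_cast at this
    exact this
  have i2 : ((k : K) + 2) * invK (k + 2) = 1 := by
    have := mul_invK (K := K) (k := k + 2) (by omega)
    push_cast at this
    exact this
  refine ⟨fun i => match i with
    | .e1 => x1 | .e2 => x2 | .e3 => x3 | .e4 => x4 | .e5 => x5
    | .γ1 => a1 | .γ2 => g2 | .γ3 => g3 | .γ4 => g4 | .γ5 => g5 | .γ6 => a6 | .γ7 => a7 | .γ8 => g8
    | .w1 => b1 | .w2 => b2 | .w3 => b3 | .w4 => b4 | .w5 => b5,
    ⟨rfl, rfl, rfl, rfl, rfl, rfl, rfl, rfl⟩, ?_, ?_, ?_, ?_, ?_, ?_, ?_, ?_, ?_, ?_, ?_, ?_⟩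
  · intro i; cases i <;> assumption
  · rintro i (rfl | rfl | rfl | rfl | rfl)
    · simp only [x3, map_mul, map_sub, cj_invK, cj_cj, hrr .e3 (by simp [IsRealCpt])]; ring
    all_goals assumption
  · simp only [hx1']; ring
  · simp only [hx2']; ring
  · simp only [x3]
    linear_combination -(r .e3 - g8 - cj g8) * i2
  · simp only [hx4']; ring
  · simp only [hx5']; ring
  · simp only [hg2']; ring
  · simp only [hg3']; ring
  · simp only [hg4']; ring
  · simp only [g5]
    linear_combination -(r .γ5 + cj g3 - g4) * i1
  · simp only [hg8']; ring

/-- A field that solves the equations up to index `k`. -/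
structure SolvesBelow (π : K →+* K') (k : ℕ) (Ψ : ℕ → Cpt → K) : Prop where
  past : ∀ j i, π (Ψ j i) = 0
  real : ∀ j i, IsRealCpt i → cj (Ψ j i) = Ψ j i
  res : ∀ i, ∀ m < ordRes i + k, (gres (fullK Ψ) i).coeff m = 0

theorem cj_fullK {Ψ : ℕ → Cpt → K} {i : Cpt} (hi : IsRealCpt i) (h : ∀ j, cj (Ψ j i) = Ψ j i) :
    DiffRing.cj (fullK Ψ i) = fullK Ψ i := by
  have hm : DiffRing.cj (mink i : K⸨X⸩) = mink i := by
    rcases hi with rfl | rfl | rfl | rfl | rfl <;> simp [mink, cj_rinv]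
  ext n
  change cj ((fullK Ψ i).coeff n) = _
  rw [fullK_coeff, map_add]
  congr 1
  · conv_rhs => rw [← hm]
    rfl
  · split_ifs
    · exact h _
    · exact map_zero _

theorem cj_gres {A : Type*} [CommRing A] [DiffRing A] {Φ : Cpt → A}
    (h : ∀ i, IsRealCpt i → DiffRing.cj (Φ i) = Φ i) {i : Cpt} (hi : IsRealCpt i) :
    DiffRing.cj (gres Φ i) = gres Φ i := by
  have h3 := h .e3 (by simp [IsRealCpt])
  have h4 := h .e4 (by simp [IsRealCpt])
  have h5 := h .e5 (by simp [IsRealCpt])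
  have hg2 := h .γ2 (by simp [IsRealCpt])
  have hg6 := h .γ6 (by simp [IsRealCpt])
  rcases hi with rfl | rfl | rfl | rfl | rfl <;>
    simp only [gres, op_apply, map_add, map_sub, map_neg, map_mul, DiffRing.cj_cj,
      DiffRing.cj_p1, DiffRing.cj_p2, DiffRing.cj_p3, DiffRing.cj_p4, h3, h4, h5, hg2, hg6] <;>
    ring

theorem SolvesBelow.of_increment {k : ℕ} {Ψ : ℕ → Cpt → K} (hΨ : SolvesBelow π k Ψ)
    {δ : Cpt → K} (hp : ∀ i, π (δ i) = 0) (hr : ∀ i, IsRealCpt i → cj (δ i) = δ i)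
    (h : ∀ i, (gres (fullK (Function.update Ψ k (Ψ k + δ))) i).coeff (ordRes i + k) = 0) :
    SolvesBelow π (k + 1) (Function.update Ψ k (Ψ k + δ)) where
  past j i := by
    by_cases hj : j = k
    · subst hj; simp [hΨ.past, hp]
    · simp [hj, hΨ.past]
  real j i hi := by
    by_cases hj : j = k
    · subst hj; simp [hΨ.real _ _ hi, hr _ hi]
    · simp [hj, hΨ.real _ _ hi]
  res i m hm := by
    rcases (show m < ordRes i + k ∨ m = ordRes i + k by push_cast at hm; omega) with h1 | h1
    · have hj := fieldJets_fullK (Ψ := Ψ) (Ψ' := Function.update Ψ k (Ψ k + δ)) (k := k)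
        (fun j hj => by simp [hj.ne])
      rw [inc_gres_low hj i h1]
      exact hΨ.res i m h1
    · rw [h1]; exact h i

theorem SolvesBelow.step (hπ : IsPastRestriction π) {k : ℕ} (hk : k ≠ 0) {Ψ : ℕ → Cpt → K}
    (hΨ : SolvesBelow π k Ψ) :
    ∃ Ψ', SolvesBelow π (k + 1) Ψ' ∧ ∀ j < k, Ψ' j = Ψ j := by
  set r : Cpt → K := fun i => (gres (fullK Ψ) i).coeff (ordRes i + k) with hrdef
  have hr : ∀ i, π (r i) = 0 := fun i => hπ.toIsCoefHom.gres_coeff hΨ.past i _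
  have hrr : ∀ i, IsRealCpt i → cj (r i) = r i := by
    intro i hi
    have := cj_gres (Φ := fullK Ψ) (fun i hi => cj_fullK hi fun j => hΨ.real j i hi) hi
    exact congrArg (fun x => x.coeff (ordRes i + k)) this
  have hcj : ∀ x, π x = 0 → π (cj x) = 0 := fun x hx => by rw [hπ.cj, hx, map_zero]
  have ik := mul_invK (K := K) hk
  obtain ⟨b5, hb5, hb5'⟩ := hπ.surj (-r .w5) (by simp [hr])
  obtain ⟨a1, ha1, ha1'⟩ := hπ.surj (-r .γ1 - invK k * r .w1) (by simp [hr])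
  have hd1 : π (d1 b5) = 0 := by rw [hπ.d1, hb5, map_zero]
  have hd2 : π (d2 b5) = 0 := by rw [hπ.d2, hb5, map_zero]
  obtain ⟨δ, ⟨e1, e6, e7, f1, f2, f3, f4, f5⟩, hδ, hδr, l1, l2, l3, l4, l5, lg2, lg3, lg4, lg5,
      lg8⟩ :=
    exists_increment hπ k hr hrr (q := cj (Ψ 0 .γ1) * a1 + Ψ 0 .γ1 * cj a1)
      (by simp [ha1, hcj _ ha1]) (by simp only [map_add, map_mul, cj_cj]; ring)
      (a1 := a1) (a6 := invK k * r .γ6) (a7 := invK k * r .γ7) (b1 := invK k * r .w1)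
      (b2 := invK k * r .w2) (b3 := invK k * r .w3)
      (b4 := invK k * (r .w4 - 4 * lam * b5 - d1 b5 * ee - d2 b5 * ee * im)) (b5 := b5)
      ha1 (by simp [hr]) (by rw [map_mul, cj_invK, hrr _ (by simp [IsRealCpt])]) (by simp [hr])
      (by simp [hr]) (by simp [hr]) (by simp [hr]) (by simp [hr, hb5, hd1, hd2]) hb5
  have hj := fieldJets_fullK (Ψ := Ψ) (Ψ' := Function.update Ψ k (Ψ k + δ)) (k := k)
    (fun j hj => by simp [hj.ne])
  have hδ' : (fun i => Function.update Ψ k (Ψ k + δ) k i - Ψ k i) = δ := by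
    funext i; simp
  have h0 : Function.update Ψ k (Ψ k + δ) 0 = Ψ 0 := by simp [Ne.symm hk]
  rw [hδ', h0] at hj
  refine ⟨_, hΨ.of_increment hδ hδr fun i => ?_, fun j hj => by simp [hj.ne]⟩
  have key : ∀ {v : K}, Lead (ordRes i + k)
      (gres (fullK (Function.update Ψ k (Ψ k + δ))) i - gres (fullK Ψ) i) v → r i + v = 0 →
      (gres (fullK (Function.update Ψ k (Ψ k + δ))) i).coeff (ordRes i + k) = 0 := by
    intro v hv h
    have := hv.2
    rw [HahnSeries.coeff_sub] at this
    linear_combination this + h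
  cases i
  · exact key (inc_gres_e1 hj) l1
  · exact key (inc_gres_e2 hj) l2
  · exact key (inc_gres_e3 hj) l3
  · exact key (inc_gres_e4 hj) l4
  · exact key (inc_gres_e5 hj) l5
  · exact key (inc_gres_γ1 hj) (by rw [f1, e1, ha1']; ring)
  · exact key (inc_gres_γ2 hj) (by rw [e1]; exact lg2)
  · exact key (inc_gres_γ3 hj) lg3
  · exact key (inc_gres_γ4 hj) lg4
  · exact key (inc_gres_γ5 hj) lg5
  · exact key (inc_gres_γ6 hj) (by rw [e6]; linear_combination -r .γ6 * ik)
  · exact key (inc_gres_γ7 hj) (by rw [e7]; linear_combination -r .γ7 * ik)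
  · exact key (inc_gres_γ8 hj) lg8
  · exact key (inc_gres_w1 hj) (by rw [f1]; linear_combination -r .w1 * ik)
  · exact key (inc_gres_w2 hj) (by rw [f2]; linear_combination -r .w2 * ik)
  · exact key (inc_gres_w3 hj) (by rw [f3]; linear_combination -r .w3 * ik)
  · exact key (inc_gres_w4 hj) (by
      rw [f4, f5]
      linear_combination -(r .w4 - 4 * lam * b5 - d1 b5 * ee - d2 b5 * ee * im) * ik)
  · exact key (inc_gres_w5 hj) (by rw [f5, hb5']; ring)

/-- The zeroth coefficient of the solution. -/
theorem SolvesBelow.start (hπ : IsPastRestriction π) {g : K} (hg : π g = 0) :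
    ∃ Ψ : ℕ → Cpt → K, SolvesBelow π 1 Ψ ∧ Ψ 0 .γ1 = g ∧
      ∀ Ψ' : ℕ → Cpt → K, Ψ' 0 = Ψ 0 →
        ∀ j, IsFreeCon j → (gcon (fullK Ψ') j).coeff (ordCon j) = 0 := by
  have hcj : ∀ x, π x = 0 → π (cj x) = 0 := fun x hx => by rw [hπ.cj, hx, map_zero]
  have hd1 : ∀ x, π x = 0 → π (d1 x) = 0 := fun x hx => by rw [hπ.d1, hx, map_zero]
  have hd2 : ∀ x, π x = 0 → π (d2 x) = 0 := fun x hx => by rw [hπ.d2, hx, map_zero]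
  have hd3 : ∀ x, π x = 0 → π (d3 x) = 0 := fun x hx => by rw [hπ.d3, hx, map_zero]
  obtain ⟨a7, ha7, ha7'⟩ := hπ.surj (-cj g) (by simp [hcj _ hg])
  set b2 : K := -4 * cj lam * g - ee * d1 g + ee * im * d2 g with hb2'
  have hb2 : π b2 = 0 := by simp [b2, hg, hd1 _ hg, hd2 _ hg]
  obtain ⟨b3, hb3, hb3'⟩ := hπ.surj (d3 g * a7 + 2 * cj lam * b2 + d1 b2 * ee - d2 b2 * ee * im)
    (by simp [ha7, hb2, hd1 _ hb2, hd2 _ hb2])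
  obtain ⟨b4, hb4, hb4'⟩ := hπ.surj (-2 * b2 * a7 + d1 b3 * ee - d2 b3 * ee * im)
    (by simp [ha7, hb3, hd1 _ hb3, hd2 _ hb3])
  obtain ⟨δ, ⟨e1, e6, e7, f1, f2, f3, f4, f5⟩, hδ, hδr, l1, l2, l3, l4, l5, lg2, lg3, lg4, lg5,
      lg8⟩ :=
    exists_increment hπ 0 (r := 0) (by simp) (by simp) (q := cj g * g)
      (by simp [hg]) (by simp only [map_mul, cj_cj]; ring)
      (a1 := g) (a6 := 0) (a7 := a7) (b1 := -d3 g) (b2 := b2) (b3 := b3) (b4 := b4) (b5 := 0)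
      hg (by simp) (by simp) ha7 (by simp [hd3 _ hg]) hb2 hb3 hb4 (by simp)
  have h0 : SolvesBelow π 0 (0 : ℕ → Cpt → K) :=
    ⟨fun j i => by simp, fun j i _ => by simp, fun i m hm => by rw [fullK_zero, gres_mink]; rfl⟩
  have hjets : ∀ Ψ' : ℕ → Cpt → K, Ψ' 0 = δ →
      FieldJets 0 (mink : Cpt → K⸨X⸩) (fullK Ψ') 0 δ δ := by
    intro Ψ' h
    have hj := fieldJets_fullK (Ψ := (0 : ℕ → Cpt → K)) (Ψ' := Ψ') (k := 0)
      (fun j hj => by omega)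
    have hδ' : (fun i => Ψ' 0 i - (0 : ℕ → Cpt → K) 0 i) = δ := by
      funext i; simp [h]
    rwa [hδ', h, fullK_zero] at hj
  have hj := hjets (Function.update 0 0 ((0 : ℕ → Cpt → K) 0 + δ)) (by simp)
  refine ⟨Function.update 0 0 ((0 : ℕ → Cpt → K) 0 + δ),
    h0.of_increment hδ hδr fun i => ?_, by simp [e1], ?_⟩
  · have key : ∀ {v : K}, Lead (ordRes i + (0 : ℕ))
        (gres (fullK (Function.update 0 0 ((0 : ℕ → Cpt → K) 0 + δ))) i - gres mink i) v → v = 0 →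
        (gres (fullK (Function.update 0 0 ((0 : ℕ → Cpt → K) 0 + δ))) i).coeff
          (ordRes i + (0 : ℕ)) = 0 := by
      intro v hv h
      have := hv.2
      rwa [gres_mink, sub_zero, h] at this
    simp only [Pi.zero_apply, zero_add] at l1 l2 l3 l4 l5 lg2 lg3 lg4 lg5 lg8
    cases i
    · exact key (inc_gres_e1 hj) l1
    · exact key (inc_gres_e2 hj) l2
    · exact key (inc_gres_e3 hj) l3
    · exact key (inc_gres_e4 hj) l4
    · exact key (inc_gres_e5 hj) l5
    · exact key (inc_gres_γ1 hj) (by rw [f1, e1]; ring)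
    · exact key (inc_gres_γ2 hj) (by
        rw [e1, Pi.zero_apply]; linear_combination lg2)
    · exact key (inc_gres_γ3 hj) lg3
    · exact key (inc_gres_γ4 hj) lg4
    · exact key (inc_gres_γ5 hj) lg5
    · exact key (inc_gres_γ6 hj) (by simp)
    · exact key (inc_gres_γ7 hj) (by simp)
    · exact key (inc_gres_γ8 hj) lg8
    · exact key (inc_gres_w1 hj) (by simp)
    · exact key (inc_gres_w2 hj) (by simp)
    · exact key (inc_gres_w3 hj) (by simp)
    · exact key (inc_gres_w4 hj) (by simp [f5])
    · exact key (inc_gres_w5 hj) (by simp [f5])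
  · intro Ψ' hΨ' j hfree
    have hj' := hjets Ψ' (by rw [hΨ']; simp)
    have key : ∀ {v : K}, Lead (ordCon j + (0 : ℕ)) (gcon (fullK Ψ') j - gcon mink j) v → v = 0 →
        (gcon (fullK Ψ') j).coeff (ordCon j) = 0 := by
      intro v hv h
      have := hv.2
      rwa [gcon_mink, sub_zero, h, Nat.cast_zero, add_zero] at this
    have hzero : ∀ i, (0 : Cpt → K) i = 0 := fun _ => rfl
    rcases hfree with rfl | rfl | rfl | rfl | rfl | rfl
    · refine key (inc_gA1 hj') ?_
      rw [f1, f2]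
      simp only [b2, map_add, map_sub, map_neg, Der.leibniz, d3_ee, d3_im, ← cj_d3, d3_lam, map_zero,
        ← d1_d3, ← d2_d3, Der.map_ofNat]
      ring
    · refine key (inc_gA2 hj') ?_
      rw [f1, f2, f3, e7, hb3', hzero]
      ring
    · refine key (inc_gA3 hj') ?_
      rw [f2, f3, f4, e7, hb4', hzero]
      ring
    · refine key (inc_gcon_u5 hj') ?_
      rw [e1, e7, ha7']
      ring
    · refine key (inc_gcon_u6 hj') ?_
      rw [e6, map_zero]
    · refine key (inc_gcon_u9 hj') ?_
      simp only [Pi.zero_apply, zero_add] at lg3 lg4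
      have hg3 : d3 (δ .γ3) = -(cj lam * g) - b2 := by rw [e1, f2] at lg3; linear_combination lg3
      have hg4 : d3 (δ .γ4) = -(lam * cj g) := by rw [e1] at lg4; linear_combination lg4
      rw [e6, e7]
      refine hπ.inj _ ?_ ?_
      · simp [ha7, hcj _ (hδ .γ3), hδ .γ4, hd1 _ ha7, hd2 _ ha7]
      · simp only [map_add, map_sub, map_neg, Der.leibniz, d3_ee, d3_im, d3_lam, map_zero,
          ← cj_d3, ← d1_d3, ← d2_d3, hg3, hg4, ha7', b2, map_mul, cj_cj, cj_im, cj_ee, map_ofNat,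
          cj_d1, cj_d2, Der.map_ofNat]
        ring

theorem exists_solution (hπ : IsPastRestriction π) {g : K} (hg : π g = 0) :
    ∃ Ψ : ℕ → Cpt → K, IsSol (fullK Ψ) ∧ (∀ j, gcon (fullK Ψ) j = 0) ∧ Ψ 0 .γ1 = g ∧
      (∀ k i, π (Ψ k i) = 0) ∧ ∀ k i, IsRealCpt i → cj (Ψ k i) = Ψ k i := by
  obtain ⟨Ψ₁, h₁, h₁g, h₁c⟩ := SolvesBelow.start hπ hg
  choose! F hF1 hF2 using fun (k : ℕ) (Ψ : ℕ → Cpt → K) (h : SolvesBelow π (k + 1) Ψ) =>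
    h.step hπ (Nat.succ_ne_zero k)
  let S : ℕ → ℕ → Cpt → K := fun n => Nat.rec Ψ₁ (fun n Ψ => F n Ψ) n
  have hS : ∀ n, SolvesBelow π (n + 1) (S n) := by
    intro n
    induction n with
    | zero => exact h₁
    | succ n ih => exact hF1 n _ ih
  have hstep : ∀ n, ∀ j < n + 1, S (n + 1) j = S n j := fun n j hj => hF2 n _ (hS n) j hj
  have hstab : ∀ j n, j ≤ n → S n j = S j j := by
    intro j n hn
    induction n, hn using Nat.le_induction with
    | base => rfl
    | succ n hn ih => rw [hstep n j (by omega), ih]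
  set Ψ : ℕ → Cpt → K := fun k => S k k with hΨ
  have hp : ∀ k i, π (Ψ k i) = 0 := fun k i => (hS k).past k i
  have hr : ∀ k i, IsRealCpt i → cj (Ψ k i) = Ψ k i := fun k i hi => (hS k).real k i hi
  have hres : ∀ i, gres (fullK Ψ) i = 0 := by
    intro i
    ext m
    obtain ⟨n, hn⟩ : ∃ n : ℕ, m < ordRes i + (n + 1 : ℕ) := ⟨(m - ordRes i).toNat, by omega⟩
    have hj := fieldJets_fullK (Ψ := S n) (Ψ' := Ψ) (k := n + 1)
      (fun j hj => hstab j n (by omega))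
    rw [inc_gres_low hj i hn, (hS n).res i m hn]
    rfl
  have hsol : IsSol (fullK Ψ) :=
    ⟨cj_fullK (by simp [IsRealCpt]) fun j => hr j _ (by simp [IsRealCpt]),
      cj_fullK (by simp [IsRealCpt]) fun j => hr j _ (by simp [IsRealCpt]),
      cj_fullK (by simp [IsRealCpt]) fun j => hr j _ (by simp [IsRealCpt]),
      cj_fullK (by simp [IsRealCpt]) fun j => hr j _ (by simp [IsRealCpt]),
      cj_fullK (by simp [IsRealCpt]) fun j => hr j _ (by simp [IsRealCpt]), hres⟩
  exact ⟨Ψ, hsol, gcon_eq_zero hπ hsol hp (h₁c Ψ rfl), h₁g, hp, hr⟩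

end Existence

section Uniqueness

variable {Ψ Ψ' : ℕ → Cpt → K} {k : ℕ}

theorem lead_eq_zero {n : ℤ} {x y : K⸨X⸩} {v : K} (h : Lead n (x - y) v) (hx : x = 0)
    (hy : y = 0) : v = 0 := by
  subst hx; subst hy
  rw [sub_zero] at h
  exact h.2.symm

/-- Two solutions that agree below index `k`, and in the components `γ1, γ6, γ7, w` at index `k`,
agree at index `k`. -/
theorem eq_of_free_eq (h : ∀ i, gres (fullK Ψ) i = 0) (h' : ∀ i, gres (fullK Ψ') i = 0)
    (hk : ∀ j < k, Ψ j = Ψ' j)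
    (hZ : ∀ i, d3 (Ψ' k i - Ψ k i) = 0 → Ψ' k i - Ψ k i = 0)
    (e1 : Ψ' k .γ1 - Ψ k .γ1 = 0) (e6 : Ψ' k .γ6 - Ψ k .γ6 = 0) (e7 : Ψ' k .γ7 - Ψ k .γ7 = 0)
    (f1 : Ψ' k .w1 - Ψ k .w1 = 0) (f2 : Ψ' k .w2 - Ψ k .w2 = 0) (f3 : Ψ' k .w3 - Ψ k .w3 = 0)
    (f4 : Ψ' k .w4 - Ψ k .w4 = 0) (f5 : Ψ' k .w5 - Ψ k .w5 = 0) : Ψ k = Ψ' k := by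
  have hj := fieldJets_fullK hk
  set δ : Cpt → K := fun i => Ψ' k i - Ψ k i with hδ
  have zero : ∀ {i n v}, Lead n (gres (fullK Ψ') i - gres (fullK Ψ) i) v → v = 0 :=
    fun hv => lead_eq_zero hv (h' _) (h _)
  have e1' : δ .γ1 = 0 := e1
  have e1c : cj (δ .γ1) = 0 := by rw [e1', map_zero]
  have f2' : δ .w2 = 0 := f2
  have f3' : δ .w3 = 0 := f3
  have x1 : δ .e1 = 0 := hZ _ (by linear_combination zero (inc_gres_e1 hj) + ee * e1')
  have x2 : δ .e2 = 0 := hZ _ (by linear_combination zero (inc_gres_e2 hj) - ee * im * e1')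
  have g2 : δ .γ2 = 0 := hZ _ (by
    linear_combination zero (inc_gres_γ2 hj) - cj (Ψ' 0 .γ1) * e1' - Ψ 0 .γ1 * e1c)
  have g3 : δ .γ3 = 0 := hZ _ (by linear_combination zero (inc_gres_γ3 hj) - cj lam * e1' - f2')
  have g4 : δ .γ4 = 0 := hZ _ (by linear_combination zero (inc_gres_γ4 hj) - lam * e1c)
  have g3c : cj (δ .γ3) = 0 := by rw [g3, map_zero]
  have g4c : cj (δ .γ4) = 0 := by rw [g4, map_zero]
  have g5 : δ .γ5 = 0 := natCast_mul_eq_zero (k := k + 1) (by omega) (by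
    push_cast
    linear_combination -zero (inc_gres_γ5 hj) + g3c - g4)
  have g5c : cj (δ .γ5) = 0 := by rw [g5, map_zero]
  have g8 : δ .γ8 = 0 := hZ _ (by
    linear_combination zero (inc_gres_γ8 hj) - lam * (g3c - g4 + g5) + cj lam * (g3 - g4c + g5c)
      + f3')
  have g8c : cj (δ .γ8) = 0 := by rw [g8, map_zero]
  have x4 : δ .e4 = 0 := hZ _ (by
    linear_combination zero (inc_gres_e4 hj) - ee * (g3 + g3c - g4 - g4c + g5 + g5c))
  have x5 : δ .e5 = 0 := hZ _ (by
    linear_combination zero (inc_gres_e5 hj) - ee * im * (-g3 + g3c - g4 + g4c + g5 - g5c))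
  have x3 : δ .e3 = 0 := natCast_mul_eq_zero (k := k + 2) (by omega) (by
    push_cast
    linear_combination -zero (inc_gres_e3 hj) - g8 - g8c)
  have hall : ∀ i, δ i = 0 := by intro i; cases i <;> assumption
  funext i
  exact (sub_eq_zero.mp (hall i)).symm

theorem eq_succ (h : ∀ i, gres (fullK Ψ) i = 0) (h' : ∀ i, gres (fullK Ψ') i = 0)
    (hk : ∀ j < k, Ψ j = Ψ' j) (hk0 : k ≠ 0)
    (hZ : ∀ i, d3 (Ψ' k i - Ψ k i) = 0 → Ψ' k i - Ψ k i = 0) : Ψ k = Ψ' k := by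
  have hj := fieldJets_fullK hk
  have zero : ∀ {i n v}, Lead n (gres (fullK Ψ') i - gres (fullK Ψ) i) v → v = 0 :=
    fun hv => lead_eq_zero hv (h' _) (h _)
  set δ : Cpt → K := fun i => Ψ' k i - Ψ k i with hδ
  have f5 : δ .w5 = 0 := hZ _ (zero (inc_gres_w5 hj))
  have f5a : d1 (δ .w5) = 0 := by rw [f5, map_zero]
  have f5b : d2 (δ .w5) = 0 := by rw [f5, map_zero]
  have f4 : δ .w4 = 0 := natCast_mul_eq_zero hk0 (by
    linear_combination -zero (inc_gres_w4 hj) - 4 * lam * f5 - ee * f5a - ee * im * f5b)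
  have f1 : δ .w1 = 0 := natCast_mul_eq_zero hk0 (by linear_combination -zero (inc_gres_w1 hj))
  have f2 : δ .w2 = 0 := natCast_mul_eq_zero hk0 (by linear_combination -zero (inc_gres_w2 hj))
  have f3 : δ .w3 = 0 := natCast_mul_eq_zero hk0 (by linear_combination -zero (inc_gres_w3 hj))
  have e6 : δ .γ6 = 0 := natCast_mul_eq_zero hk0 (by linear_combination -zero (inc_gres_γ6 hj))
  have e7 : δ .γ7 = 0 := natCast_mul_eq_zero hk0 (by linear_combination -zero (inc_gres_γ7 hj))
  have e1 : δ .γ1 = 0 := hZ _ (by linear_combination zero (inc_gres_γ1 hj) - f1)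
  exact eq_of_free_eq h h' hk hZ e1 e6 e7 f1 f2 f3 f4 f5

theorem eq_zero_index (h : ∀ i, gres (fullK Ψ) i = 0) (h' : ∀ i, gres (fullK Ψ') i = 0)
    (hc : ∀ j, gcon (fullK Ψ) j = 0) (hc' : ∀ j, gcon (fullK Ψ') j = 0)
    (hZ : ∀ i, d3 (Ψ' 0 i - Ψ 0 i) = 0 → Ψ' 0 i - Ψ 0 i = 0)
    (hd : Ψ 0 .γ1 = Ψ' 0 .γ1) : Ψ 0 = Ψ' 0 := by
  have hk : ∀ j < 0, Ψ j = Ψ' j := fun j hj => by omega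
  have hj := fieldJets_fullK hk
  have zero : ∀ {i n v}, Lead n (gres (fullK Ψ') i - gres (fullK Ψ) i) v → v = 0 :=
    fun hv => lead_eq_zero hv (h' _) (h _)
  have zeroc : ∀ {i n v}, Lead n (gcon (fullK Ψ') i - gcon (fullK Ψ) i) v → v = 0 :=
    fun hv => lead_eq_zero hv (hc' _) (hc _)
  set δ : Cpt → K := fun i => Ψ' 0 i - Ψ 0 i with hδ
  have e1 : δ .γ1 = 0 := by simp [hδ, hd]
  have e1c : cj (δ .γ1) = 0 := by rw [e1, map_zero]
  have e1d : d3 (δ .γ1) = 0 := by rw [e1, map_zero]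
  have f1 : δ .w1 = 0 := by linear_combination zero (inc_gres_γ1 hj) - e1d
  have f1a : d1 (δ .w1) = 0 := by rw [f1, map_zero]
  have f1b : d2 (δ .w1) = 0 := by rw [f1, map_zero]
  have e6 : δ .γ6 = 0 := hZ _ (zeroc (inc_gcon_u6 hj))
  have e7 : δ .γ7 = 0 := hZ _ (by linear_combination -zeroc (inc_gcon_u5 hj) - e1c)
  have f2 : δ .w2 = 0 := hZ _ (by
    linear_combination zeroc (i := .v1) (inc_gA1 hj) + 4 * cj lam * f1 + ee * f1a - ee * im * f1b)
  have f2a : d1 (δ .w2) = 0 := by rw [f2, map_zero]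
  have f2b : d2 (δ .w2) = 0 := by rw [f2, map_zero]
  have f3 : δ .w3 = 0 := hZ _ (by
    linear_combination zeroc (i := .v2) (inc_gA2 hj) - Ψ' 0 .w1 * e7 - Ψ 0 .γ7 * f1
      + 2 * cj lam * f2 + ee * f2a - ee * im * f2b)
  have f3a : d1 (δ .w3) = 0 := by rw [f3, map_zero]
  have f3b : d2 (δ .w3) = 0 := by rw [f3, map_zero]
  have f4 : δ .w4 = 0 := hZ _ (by
    linear_combination zeroc (i := .v3) (inc_gA3 hj) - 2 * Ψ' 0 .w2 * e7 - 2 * Ψ 0 .γ7 * f2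
      + ee * f3a - ee * im * f3b)
  have f5 : δ .w5 = 0 := hZ _ (zero (inc_gres_w5 hj))
  exact eq_of_free_eq h h' hk hZ e1 e6 e7 f1 f2 f3 f4 f5

end Uniqueness

end Construction

/-! ### Rings of smooth functions -/

section SmoothFunctions

open TopologicalSpace (Opens)

/-- A space of parameters that includes the coordinates `(ξ, ū)`. -/
class Coords (E : Type) [NormedAddCommGroup E] [NormedSpace ℝ E] where
  pr : E →L[ℝ] Slice
  v1 : E
  v2 : E
  v3 : E
  pr_v1 : pr v1 = (1, 0)
  pr_v2 : pr v2 = (Complex.I, 0)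
  pr_v3 : pr v3 = (0, 1)

variable {E : Type} [NormedAddCommGroup E] [NormedSpace ℝ E]

open Classical in
/-- Extension by zero. -/
def extend {U : Opens E} (f : U → ℂ) (p : E) : ℂ := if h : p ∈ U then f ⟨p, h⟩ else 0

theorem extend_of_mem {U : Opens E} (f : U → ℂ) {p : E} (h : p ∈ U) : extend f p = f ⟨p, h⟩ :=
  dif_pos h

/-- The smooth complex functions on an open set, as a subalgebra. -/
def smSubalgebra (U : Opens E) : Subalgebra ℂ (U → ℂ) where
  carrier := {f | ContDiffOn ℝ ∞ (extend f) U}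
  mul_mem' {f g} hf hg := (ContDiffOn.mul hf hg).congr fun p hp => by
    simp [extend_of_mem _ (show p ∈ U from hp)]
  add_mem' {f g} hf hg := (ContDiffOn.add hf hg).congr fun p hp => by
    simp [extend_of_mem _ (show p ∈ U from hp)]
  algebraMap_mem' c := (contDiffOn_const (c := c)).congr fun p hp => by
    simp [extend_of_mem _ (show p ∈ U from hp)]

/-- The smooth complex functions on an open set. -/
def Sm (U : Opens E) : Type := smSubalgebra U

instance (U : Opens E) : CommRing (Sm U) := inferInstanceAs (CommRing (smSubalgebra U))

instance (U : Opens E) : Algebra ℂ (Sm U) := inferInstanceAs (Algebra ℂ (smSubalgebra U))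

namespace Sm

variable {U : Opens E}

/-- A smooth function, extended by zero. -/
def fn (f : Sm U) : E → ℂ := extend f.1

theorem contDiffOn (f : Sm U) : ContDiffOn ℝ ∞ f.fn U := f.2

/-- The element of `Sm U` defined by a function on the whole space. -/
def mk (g : E → ℂ) (hg : ContDiffOn ℝ ∞ g U) : Sm U :=
  ⟨fun p => g p, hg.congr fun _ hp => extend_of_mem _ (show _ ∈ U from hp)⟩

theorem fn_mk {g : E → ℂ} (hg : ContDiffOn ℝ ∞ g U) {p : E} (hp : p ∈ U) : (mk g hg).fn p = g p :=
  extend_of_mem _ hp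

theorem ext_fn {f g : Sm U} (h : ∀ p ∈ U, f.fn p = g.fn p) : f = g := by
  apply Subtype.ext
  funext p
  have := h p p.2
  rwa [fn, fn, extend_of_mem _ p.2, extend_of_mem _ p.2] at this

/-- Evaluation at a point. -/
def eval {p : E} (hp : p ∈ U) : Sm U →+* ℂ := (Pi.evalRingHom (fun _ : U => ℂ) ⟨p, hp⟩).comp (smSubalgebra U).val.toRingHom

theorem fn_eq_eval (f : Sm U) {p : E} (hp : p ∈ U) : f.fn p = eval hp f := extend_of_mem _ hp

theorem fn_add (f g : Sm U) {p : E} (hp : p ∈ U) : (f + g).fn p = f.fn p + g.fn p := by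
  simp only [fn_eq_eval _ hp, map_add]

theorem fn_mul (f g : Sm U) {p : E} (hp : p ∈ U) : (f * g).fn p = f.fn p * g.fn p := by
  simp only [fn_eq_eval _ hp, map_mul]

theorem fn_sub (f g : Sm U) {p : E} (hp : p ∈ U) : (f - g).fn p = f.fn p - g.fn p := by
  simp only [fn_eq_eval _ hp, map_sub]

theorem fn_zero (p : E) : (0 : Sm U).fn p = 0 := by
  unfold fn extend
  split_ifs <;> rfl

theorem fn_algebraMap (c : ℂ) {p : E} (hp : p ∈ U) : (algebraMap ℂ (Sm U) c).fn p = c :=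
  extend_of_mem _ hp

theorem differentiableAt (f : Sm U) {p : E} (hp : p ∈ U) : DifferentiableAt ℝ f.fn p :=
  (f.contDiffOn.contDiffAt (U.isOpen.mem_nhds hp)).differentiableAt (by simp)

theorem fderiv_congr {f : Sm U} {g : E → ℂ} (h : ∀ p ∈ U, f.fn p = g p) {p : E} (hp : p ∈ U) :
    fderiv ℝ f.fn p = fderiv ℝ g p :=
  Filter.EventuallyEq.fderiv_eq (Filter.eventuallyEq_of_mem (U.isOpen.mem_nhds hp) h)

theorem contDiffOn_fderiv {g : E → ℂ} (hg : ContDiffOn ℝ ∞ g U) (v : E) :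
    ContDiffOn ℝ ∞ (fun p => fderiv ℝ g p v) U :=
  (hg.fderiv_of_isOpen U.isOpen (by simp)).clm_apply contDiffOn_const

/-- The derivative in the direction `v`. -/
def der (v : E) : Der (Sm U) where
  toFun f := mk (fun p => fderiv ℝ f.fn p v) (contDiffOn_fderiv f.contDiffOn v)
  map_zero' := ext_fn fun p hp => by
    rw [fn_mk _ hp, fderiv_congr (g := fun _ => 0) (fun p _ => fn_zero p) hp, fn_zero]
    simp
  map_add' f g := ext_fn fun p hp => by
    rw [fn_add _ _ hp, fn_mk _ hp, fn_mk _ hp, fn_mk _ hp,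
      fderiv_congr (g := fun p => f.fn p + g.fn p) (fun p hp => fn_add f g hp) hp,
      fderiv_fun_add (f.differentiableAt hp) (g.differentiableAt hp)]
    rfl
  leibniz' f g := ext_fn fun p hp => by
    rw [fn_add _ _ hp, fn_mul _ _ hp, fn_mul _ _ hp, fn_mk _ hp, fn_mk _ hp, fn_mk _ hp,
      fderiv_congr (g := fun p => f.fn p * g.fn p) (fun p hp => fn_mul f g hp) hp,
      fderiv_fun_mul (f.differentiableAt hp) (g.differentiableAt hp)]
    simp only [add_apply, smul_apply, smul_eq_mul]
    ring

theorem fn_der (v : E) (f : Sm U) {p : E} (hp : p ∈ U) : (der v f).fn p = fderiv ℝ f.fn p v :=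
  fn_mk _ hp

theorem der_comm (v w : E) (f : Sm U) : der v (der w f) = der w (der v f) := by
  refine ext_fn fun p hp => ?_
  have hd : DifferentiableAt ℝ (fderiv ℝ f.fn) p :=
    ((f.contDiffOn.fderiv_of_isOpen U.isOpen (m := ∞) (by simp)).contDiffAt
      (U.isOpen.mem_nhds hp)).differentiableAt (by simp)
  have key : ∀ v w : E, (der v (der w f)).fn p = fderiv ℝ (fderiv ℝ f.fn) p v w := by
    intro v w
    rw [fn_der v _ hp, fderiv_congr (g := fun q => fderiv ℝ f.fn q w) (fun q hq => fn_der w f hq) hp,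
      fderiv_clm_apply hd (differentiableAt_const w)]
    simp
  rw [key, key]
  exact ((f.contDiffOn.contDiffAt (U.isOpen.mem_nhds hp)).isSymmSndFDerivAt
    (by simp only [minSmoothness_of_isRCLikeNormedField]; exact WithTop.coe_le_coe.mpr le_top)) v w

theorem contDiffOn_conj {g : E → ℂ} (hg : ContDiffOn ℝ ∞ g U) :
    ContDiffOn ℝ ∞ (fun p => starRingEnd ℂ (g p)) U :=
  Complex.conjCLE.contDiff.comp_contDiffOn hg

/-- Complex conjugation. -/
def star : Sm U →+* Sm U where
  toFun f := mk (fun p => starRingEnd ℂ (f.fn p)) (contDiffOn_conj f.contDiffOn)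
  map_one' := ext_fn fun p hp => by
    rw [fn_mk _ hp, fn_eq_eval _ hp, map_one, map_one]
  map_mul' f g := ext_fn fun p hp => by
    rw [fn_mul _ _ hp, fn_mk _ hp, fn_mk _ hp, fn_mk _ hp, fn_mul _ _ hp, map_mul]
  map_zero' := ext_fn fun p hp => by
    rw [fn_mk _ hp, fn_zero, map_zero]
  map_add' f g := ext_fn fun p hp => by
    rw [fn_add _ _ hp, fn_mk _ hp, fn_mk _ hp, fn_mk _ hp, fn_add _ _ hp, map_add]

theorem fn_star (f : Sm U) {p : E} (hp : p ∈ U) : (star f).fn p = starRingEnd ℂ (f.fn p) :=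
  fn_mk _ hp

theorem star_der (v : E) (f : Sm U) : star (der v f) = der v (star f) := by
  refine ext_fn fun p hp => ?_
  rw [fn_star _ hp, fn_der v _ hp, fn_der v _ hp,
    fderiv_congr (g := fun q => Complex.conjCLE (f.fn q)) (fun q hq => fn_star f hq) hp]
  have := (Complex.conjCLE.toContinuousLinearMap.hasFDerivAt.comp p
    (f.differentiableAt hp).hasFDerivAt).fderiv
  exact (congrArg (fun L => L v) this).symm

theorem der_mk {g : E → ℂ} (hg : ContDiffOn ℝ ∞ g U) (v : E) :
    der v (mk g hg) = mk (fun p => fderiv ℝ g p v) (contDiffOn_fderiv hg v) :=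
  ext_fn fun p hp => by
    rw [fn_der v _ hp, fn_mk _ hp, fderiv_congr (fun q hq => fn_mk hg hq) hp]

theorem der_algebraMap (v : E) (c : ℂ) : der v (algebraMap ℂ (Sm U) c) = 0 :=
  ext_fn fun p hp => by
    rw [fn_der v _ hp, fderiv_congr (g := fun _ => c) (fun q hq => fn_algebraMap c hq) hp, fn_zero]
    simp

variable [Coords E]

theorem contDiff_pr_snd : ContDiff ℝ ∞ fun p : E => ((Coords.pr p).2 : ℂ) :=
  Complex.ofRealCLM.contDiff.comp (contDiff_snd.comp (Coords.pr : E →L[ℝ] Slice).contDiff)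

theorem contDiff_pr_fst : ContDiff ℝ ∞ fun p : E => -(Coords.pr p).1 / 2 :=
  ((contDiff_fst.comp (Coords.pr : E →L[ℝ] Slice).contDiff).neg).div_const 2

/-- The function `ū`. -/
def coordS : Sm U := mk (fun p => ((Coords.pr p).2 : ℂ)) contDiff_pr_snd.contDiffOn

/-- The function `𝛌 = -ξ/2`. -/
def coordLam : Sm U := mk (fun p => -(Coords.pr p).1 / 2) contDiff_pr_fst.contDiffOn

theorem der_coordS (v : E) : der v (coordS : Sm U) = algebraMap ℂ (Sm U) ((Coords.pr v).2 : ℂ) := by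
  refine ext_fn fun p hp => ?_
  rw [coordS, der_mk, fn_mk _ hp, fn_algebraMap _ hp]
  have : (fun p : E => ((Coords.pr p).2 : ℂ))
      = Complex.ofRealCLM.comp ((ContinuousLinearMap.snd ℝ ℂ ℝ).comp Coords.pr) := rfl
  rw [this, ContinuousLinearMap.fderiv]
  rfl

theorem der_coordLam (v : E) :
    der v (coordLam : Sm U) = algebraMap ℂ (Sm U) (-(Coords.pr v).1 / 2) := by
  refine ext_fn fun p hp => ?_
  rw [coordLam, der_mk, fn_mk _ hp, fn_algebraMap _ hp]
  have : (fun p : E => -(Coords.pr p).1 / 2)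
      = ((-(1 / 2) : ℝ) • ((ContinuousLinearMap.fst ℝ ℂ ℝ).comp (Coords.pr : E →L[ℝ] Slice)) :
          E →L[ℝ] ℂ) := by
    funext p
    simp
    ring
  rw [this, ContinuousLinearMap.fderiv]
  simp
  ring

instance : CoefRing (Sm U) where
  d1 := der Coords.v1
  d2 := der Coords.v2
  d3 := der Coords.v3
  cj := star
  lam := coordLam
  s := coordS
  d1_d2 := der_comm _ _
  d1_d3 := der_comm _ _
  d2_d3 := der_comm _ _
  cj_cj f := ext_fn fun p hp => by rw [fn_star _ hp, fn_star _ hp, Complex.conj_conj]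
  cj_d1 := star_der _
  cj_d2 := star_der _
  cj_d3 := star_der _
  d1_algebraMap := der_algebraMap _
  d2_algebraMap := der_algebraMap _
  d3_algebraMap := der_algebraMap _
  cj_algebraMap c := ext_fn fun p hp => by
    rw [fn_star _ hp, fn_algebraMap _ hp, fn_algebraMap _ hp]
  cj_s := ext_fn fun p hp => by
    rw [fn_star _ hp, coordS, fn_mk _ hp, Complex.conj_ofReal]
  d1_s := by rw [der_coordS, Coords.pr_v1]; simp
  d2_s := by rw [der_coordS, Coords.pr_v2]; simp
  d3_s := by rw [der_coordS, Coords.pr_v3]; simp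
  d1_lam := by rw [der_coordLam, Coords.pr_v1]
  d2_lam := by rw [der_coordLam, Coords.pr_v2]
  d3_lam := by rw [der_coordLam, Coords.pr_v3]; simp

section Pullback

variable {E' : Type} [NormedAddCommGroup E'] [NormedSpace ℝ E'] {V : Opens E'}

theorem contDiffOn_comp {φ : E' → E} (hφ : ContDiffOn ℝ ∞ φ V) (hV : ∀ p ∈ V, φ p ∈ U)
    (f : Sm U) : ContDiffOn ℝ ∞ (fun p => f.fn (φ p)) V :=
  f.contDiffOn.comp hφ hV

/-- Composition with a smooth map. -/
def pullback (φ : E' → E) (hφ : ContDiffOn ℝ ∞ φ V) (hV : ∀ p ∈ V, φ p ∈ U) : Sm U →+* Sm V where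
  toFun f := mk (fun p => f.fn (φ p)) (contDiffOn_comp hφ hV f)
  map_one' := ext_fn fun p hp => by
    rw [fn_mk _ hp, fn_eq_eval _ (hV p hp), fn_eq_eval _ hp, map_one, map_one]
  map_mul' f g := ext_fn fun p hp => by
    rw [fn_mul _ _ hp, fn_mk _ hp, fn_mk _ hp, fn_mk _ hp, fn_mul _ _ (hV p hp)]
  map_zero' := ext_fn fun p hp => by
    rw [fn_mk _ hp, fn_zero, fn_zero]
  map_add' f g := ext_fn fun p hp => by
    rw [fn_add _ _ hp, fn_mk _ hp, fn_mk _ hp, fn_mk _ hp, fn_add _ _ (hV p hp)]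

theorem fn_pullback {φ : E' → E} {hφ : ContDiffOn ℝ ∞ φ V} {hV : ∀ p ∈ V, φ p ∈ U} (f : Sm U)
    {p : E'} (hp : p ∈ V) : (pullback φ hφ hV f).fn p = f.fn (φ p) :=
  fn_mk _ hp

theorem pullback_der {φ : E' → E} {hφ : ContDiffOn ℝ ∞ φ V} {hV : ∀ p ∈ V, φ p ∈ U} {v : E}
    {v' : E'} (hv : ∀ p ∈ V, fderiv ℝ φ p v' = v) (f : Sm U) :
    pullback φ hφ hV (der v f) = der v' (pullback φ hφ hV f) := by
  refine ext_fn fun p hp => ?_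
  have hd : DifferentiableAt ℝ φ p :=
    (hφ.contDiffAt (V.isOpen.mem_nhds hp)).differentiableAt (by simp)
  rw [fn_pullback _ hp, fn_der _ _ (hV p hp), fn_der _ _ hp,
    fderiv_congr (fun q hq => fn_pullback f hq) hp]
  have := fderiv_comp p (f.differentiableAt (hV p hp)) hd
  rw [Function.comp_def] at this
  rw [this, ContinuousLinearMap.comp_apply, hv p hp]

theorem isCoefHom_pullback [Coords E'] {φ : E' → E} {hφ : ContDiffOn ℝ ∞ φ V}
    {hV : ∀ p ∈ V, φ p ∈ U} (hpr : ∀ p ∈ V, (Coords.pr (φ p) : Slice) = Coords.pr p)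
    (h1 : ∀ p ∈ V, fderiv ℝ φ p Coords.v1 = Coords.v1)
    (h2 : ∀ p ∈ V, fderiv ℝ φ p Coords.v2 = Coords.v2)
    (h3 : ∀ p ∈ V, fderiv ℝ φ p Coords.v3 = Coords.v3) :
    IsCoefHom (pullback φ hφ hV) where
  d1 := pullback_der h1
  d2 := pullback_der h2
  d3 := pullback_der h3
  cj f := ext_fn fun p hp => by
    change (pullback φ hφ hV (star f)).fn p = (star _).fn p
    rw [fn_pullback _ hp, fn_star _ (hV p hp), fn_star _ hp, fn_pullback _ hp]
  s := ext_fn fun p hp => by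
    change (pullback φ hφ hV coordS).fn p = coordS.fn p
    rw [fn_pullback _ hp, coordS, coordS, fn_mk _ (hV p hp), fn_mk _ hp, hpr p hp]
  lam := ext_fn fun p hp => by
    change (pullback φ hφ hV coordLam).fn p = coordLam.fn p
    rw [fn_pullback _ hp, coordLam, coordLam, fn_mk _ (hV p hp), fn_mk _ hp, hpr p hp]
  algebraMap c := ext_fn fun p hp => by
    rw [fn_pullback _ hp, fn_algebraMap _ (hV p hp), fn_algebraMap _ hp]

end Pullback

end Sm

instance : Coords Slice where
  pr := ContinuousLinearMap.id ℝ Slice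
  v1 := (1, 0)
  v2 := (Complex.I, 0)
  v3 := (0, 1)
  pr_v1 := rfl
  pr_v2 := rfl
  pr_v3 := rfl

instance : Coords (Slice × ℝ) where
  pr := ContinuousLinearMap.fst ℝ Slice ℝ
  v1 := ((1, 0), 0)
  v2 := ((Complex.I, 0), 0)
  v3 := ((0, 1), 0)
  pr_v1 := rfl
  pr_v2 := rfl
  pr_v3 := rfl

end SmoothFunctions

/-! ### Integrals that depend on parameters -/

section ParametricIntegral

open MeasureTheory

theorem eventually_forall_mem_of_isCompact {X Y : Type*} [TopologicalSpace X] [TopologicalSpace Y]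
    {W : Set (X × Y)} (hW : IsOpen W) {C : Set Y} (hC : IsCompact C) {x : X}
    (h : ∀ y ∈ C, (x, y) ∈ W) : ∀ᶠ x' in 𝓝 x, ∀ y ∈ C, (x', y) ∈ W := by
  obtain ⟨u, v, hu, -, hxu, hCv, huv⟩ := generalized_tube_lemma (isCompact_singleton (x := x)) hC hW
    (by rintro ⟨a, b⟩ ⟨ha, hb⟩; obtain rfl : a = x := ha; exact h b hb)
  filter_upwards [hu.mem_nhds (hxu rfl)] with x' hx' y hy
  exact huv ⟨hx', hCv hy⟩

variable {E : Type} [NormedAddCommGroup E] [NormedSpace ℝ E]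

theorem hasFDerivAt_integral_unit {F : Type} [NormedAddCommGroup F] [NormedSpace ℝ F]
    {W : Set (E × ℝ)} (hW : IsOpen W) {h : E × ℝ → F} (hh : ContDiffOn ℝ 1 h W) {x : E}
    (hx : ∀ t ∈ Icc (0 : ℝ) 1, (x, t) ∈ W) :
    HasFDerivAt (fun x => ∫ t in (0 : ℝ)..1, h (x, t))
      (∫ t in (0 : ℝ)..1, (fderiv ℝ h (x, t)).comp (ContinuousLinearMap.inl ℝ E ℝ)) x := by
  have hcont : ContinuousOn (fderiv ℝ h) W := hh.continuousOn_fderiv_of_isOpen hW le_rfl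
  have hmap : ∀ x : E, Continuous fun t : ℝ => (x, t) := fun x => by fun_prop
  have hcW : ∀ x, (∀ t ∈ Icc (0 : ℝ) 1, (x, t) ∈ W) →
      ContinuousOn (fun t => h (x, t)) (uIcc (0 : ℝ) 1) := by
    intro x hx
    rw [uIcc_of_le zero_le_one]
    exact hh.continuousOn.comp (hmap x).continuousOn hx
  have hcd : ContinuousOn (fun t => (fderiv ℝ h (x, t)).comp (ContinuousLinearMap.inl ℝ E ℝ))
      (uIcc (0 : ℝ) 1) := by
    rw [uIcc_of_le zero_le_one]
    exact (hcont.comp (hmap x).continuousOn hx).clm_comp continuousOn_const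
  obtain ⟨C, hC⟩ : ∃ C, ∀ t ∈ Icc (0 : ℝ) 1,
      ‖(fderiv ℝ h (x, t)).comp (ContinuousLinearMap.inl ℝ E ℝ)‖ ≤ C :=
    isCompact_Icc.exists_bound_of_continuousOn (by rwa [uIcc_of_le zero_le_one] at hcd)
  have hopen : IsOpen {q ∈ W | ‖(fderiv ℝ h q).comp (ContinuousLinearMap.inl ℝ E ℝ)‖ < C + 1} := by
    have := (hcont.clm_comp (continuousOn_const
      (c := ContinuousLinearMap.inl ℝ E ℝ))).norm.isOpen_inter_preimage hW
      (isOpen_Iio (a := C + 1))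
    exact this
  have hev := eventually_forall_mem_of_isCompact hopen isCompact_Icc (x := x)
    (fun t ht => ⟨hx t ht, by linarith [hC t ht]⟩)
  have hsub : uIoc (0 : ℝ) 1 ⊆ Icc 0 1 := by
    rw [uIoc_of_le zero_le_one]; exact Ioc_subset_Icc_self
  refine intervalIntegral.hasFDerivAt_integral_of_dominated_of_fderiv_le
    (F := fun x t => h (x, t))
    (F' := fun x t => (fderiv ℝ h (x, t)).comp (ContinuousLinearMap.inl ℝ E ℝ))
    (bound := fun _ => C + 1) hev ?_ (hcW x hx).intervalIntegrable ?_ ?_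
    intervalIntegrable_const ?_
  · filter_upwards [hev] with y hy
    exact ((hcW y fun t ht => (hy t ht).1).intervalIntegrable (μ := volume)).def'.aestronglyMeasurable
  · exact (hcd.intervalIntegrable (μ := volume)).def'.aestronglyMeasurable
  · exact Filter.Eventually.of_forall fun t ht y hy => (hy t (hsub ht)).2.le
  · refine Filter.Eventually.of_forall fun t ht y hy => ?_
    have hd : DifferentiableAt ℝ h (y, t) :=
      ((hh.contDiffAt (hW.mem_nhds (hy t (hsub ht)).1)).differentiableAt (by simp))
    exact hd.hasFDerivAt.comp y (hasFDerivAt_prodMk_left y t)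

theorem contDiffOn_integral_unit {V : Set E} (hV : IsOpen V) {W : Set (E × ℝ)} (hW : IsOpen W)
    (hVW : ∀ x ∈ V, ∀ t ∈ Icc (0 : ℝ) 1, (x, t) ∈ W) (n : ℕ) :
    ∀ {F : Type} [NormedAddCommGroup F] [NormedSpace ℝ F] {h : E × ℝ → F}
      (hh : ContDiffOn ℝ ∞ h W), ContDiffOn ℝ n (fun x => ∫ t in (0 : ℝ)..1, h (x, t)) V := by
  induction n with
  | zero =>
    intro F _ _ h hh x hx
    have := (hasFDerivAt_integral_unit hW (hh.of_le (by simp)) (hVW x hx)).continuousAt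
    exact contDiffOn_zero.mpr (fun y hy => (hasFDerivAt_integral_unit hW (hh.of_le (by simp))
      (hVW y hy)).continuousAt.continuousWithinAt) x hx
  | succ n ih =>
    intro F _ _ h hh
    push_cast
    rw [contDiffOn_succ_iff_fderiv_of_isOpen hV]
    refine ⟨fun x hx => (hasFDerivAt_integral_unit hW (hh.of_le (by simp))
      (hVW x hx)).differentiableAt.differentiableWithinAt, by simp, ?_⟩
    refine (ih (h := fun q => (fderiv ℝ h q).comp (ContinuousLinearMap.inl ℝ E ℝ))
      ((hh.fderiv_of_isOpen hW (by simp)).clm_comp contDiffOn_const)).congr fun x hx => ?_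
    exact (hasFDerivAt_integral_unit hW (hh.of_le (by simp)) (hVW x hx)).fderiv

end ParametricIntegral

/-! ### Smooth functions on the half space -/

section HalfSpace

open MeasureTheory TopologicalSpace

theorem isOpen_upper : IsOpen upper := isOpen_lt continuous_const continuous_snd

/-- The half space `ū > 0`. -/
def upperO : Opens Slice := ⟨upper, isOpen_upper⟩

/-- The part `0 < ū < u₀` of the half space. -/
def pastO (u₀ : ℝ) : Opens Slice :=
  ⟨{p | 0 < p.2 ∧ p.2 < u₀}, isOpen_upper.inter (isOpen_lt continuous_snd continuous_const)⟩

theorem pastO_le {u₀ : ℝ} {p : Slice} (hp : p ∈ pastO u₀) : p ∈ upperO := hp.1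

namespace Sm

theorem hasDerivAt_snd {U : Opens Slice} (f : Sm U) {ξ : ℂ} {s : ℝ} (hp : (ξ, s) ∈ U) :
    HasDerivAt (fun τ => f.fn (ξ, τ)) ((CoefRing.d3 f).fn (ξ, s)) s := by
  have h1 := (f.differentiableAt hp).hasFDerivAt
  have h2 : HasDerivAt (fun τ : ℝ => (ξ, τ)) (0, 1) s :=
    (hasDerivAt_const s ξ).prodMk (hasDerivAt_id s)
  have h3 := h1.comp_hasDerivAt s h2
  have h4 : (CoefRing.d3 f).fn (ξ, s) = fderiv ℝ f.fn (ξ, s) (0, 1) := fn_der _ f hp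
  rw [h4]
  exact h3

theorem continuousOn_line (f : Sm upperO) (ξ : ℂ) {a b : ℝ} (ha : 0 < a) (hb : 0 < b) :
    ContinuousOn (fun τ => f.fn (ξ, τ)) (uIcc a b) := by
  refine f.contDiffOn.continuousOn.comp (by fun_prop) fun τ hτ => ?_
  exact lt_of_lt_of_le (lt_min ha hb) hτ.1

theorem integral_d3 (f : Sm upperO) (ξ : ℂ) {c s : ℝ} (hc : 0 < c) (hs : 0 < s) :
    ∫ τ in c..s, (CoefRing.d3 f).fn (ξ, τ) = f.fn (ξ, s) - f.fn (ξ, c) := by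
  refine intervalIntegral.integral_eq_sub_of_hasDerivAt (fun τ hτ => f.hasDerivAt_snd ?_)
    ((CoefRing.d3 f).continuousOn_line ξ hc hs).intervalIntegrable
  exact lt_of_lt_of_le (lt_min hc hs) hτ.1

theorem contDiffOn_primitive (g : Sm upperO) {c : ℝ} (hc : 0 < c) :
    ContDiffOn ℝ ∞ (fun p : Slice => ∫ τ in c..p.2, g.fn (p.1, τ)) upperO := by
  have hφ : ContDiff ℝ ∞ fun q : Slice × ℝ => ((q.1.1, c + (q.1.2 - c) * q.2) : Slice) := by
    fun_prop
  have hW : IsOpen ((fun q : Slice × ℝ => ((q.1.1, c + (q.1.2 - c) * q.2) : Slice)) ⁻¹' upper) :=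
    isOpen_upper.preimage hφ.continuous
  have hVW : ∀ p ∈ upper, ∀ t ∈ Icc (0 : ℝ) 1,
      (p, t) ∈ (fun q : Slice × ℝ => ((q.1.1, c + (q.1.2 - c) * q.2) : Slice)) ⁻¹' upper := by
    intro p hp t ht
    change 0 < c + (p.2 - c) * t
    have : 0 < p.2 := hp
    rcases eq_or_lt_of_le ht.1 with h | h
    · rw [← h]; simpa using hc
    · nlinarith [ht.2, mul_pos this h, mul_nonneg hc.le (sub_nonneg.mpr ht.2)]
  have hh : ContDiffOn ℝ ∞
      (fun q : Slice × ℝ => g.fn ((q.1.1, c + (q.1.2 - c) * q.2) : Slice))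
      ((fun q : Slice × ℝ => ((q.1.1, c + (q.1.2 - c) * q.2) : Slice)) ⁻¹' upper) :=
    g.contDiffOn.comp hφ.contDiffOn fun _ h => h
  have key : ContDiffOn ℝ ∞
      (fun p : Slice => ∫ t in (0 : ℝ)..1, g.fn (p.1, c + (p.2 - c) * t)) upperO :=
    contDiffOn_infty.mpr fun n => contDiffOn_integral_unit isOpen_upper hW hVW n hh
  have hs : ContDiff ℝ ∞ fun p : Slice => p.2 - c := by fun_prop
  refine (hs.contDiffOn.smul key).congr fun p hp => ?_
  change _ = (p.2 - c) • ∫ t in (0 : ℝ)..1, g.fn (p.1, c + (p.2 - c) * t)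
  rw [intervalIntegral.smul_integral_comp_add_mul (fun τ => g.fn (p.1, τ))]
  simp

/-- The primitive with respect to `ū` that vanishes at `ū = c`. -/
def primitive (c : ℝ) (hc : 0 < c) (g : Sm upperO) : Sm upperO :=
  mk (fun p => ∫ τ in c..p.2, g.fn (p.1, τ)) (g.contDiffOn_primitive hc)

theorem fn_primitive {c : ℝ} (hc : 0 < c) (g : Sm upperO) {p : Slice} (hp : p ∈ upperO) :
    (primitive c hc g).fn p = ∫ τ in c..p.2, g.fn (p.1, τ) := fn_mk _ hp

theorem d3_primitive {c : ℝ} (hc : 0 < c) (g : Sm upperO) :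
    CoefRing.d3 (primitive c hc g) = g := by
  refine ext_fn fun ⟨ξ, s⟩ hp => ?_
  have hs : 0 < s := hp
  have h1 := (primitive c hc g).hasDerivAt_snd hp
  have hcont : ContinuousAt (fun τ => g.fn (ξ, τ)) s :=
    ContinuousAt.comp (f := fun τ : ℝ => (ξ, τ))
      (g.contDiffOn.contDiffAt (upperO.isOpen.mem_nhds hp)).continuousAt (by fun_prop)
  have hmeas : StronglyMeasurableAtFilter (fun τ => g.fn (ξ, τ)) (𝓝 s) := by
    refine ContinuousOn.stronglyMeasurableAtFilter (s := Ioi 0) isOpen_Ioi ?_ s hs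
    exact g.contDiffOn.continuousOn.comp (by fun_prop) fun τ hτ => hτ
  have h2 : HasDerivAt (fun τ => ∫ x in c..τ, g.fn (ξ, x)) (g.fn (ξ, s)) s :=
    intervalIntegral.integral_hasDerivAt_right
      (g.continuousOn_line ξ hc hs).intervalIntegrable hmeas hcont
  have h3 : HasDerivAt (fun τ => (primitive c hc g).fn (ξ, τ)) (g.fn (ξ, s)) s := by
    refine h2.congr_of_eventuallyEq ?_
    filter_upwards [lt_mem_nhds hs] with τ hτ
    exact fn_primitive hc g hτ
  exact h1.unique h3

end Sm

/-- Restriction to the past. -/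
def toPast (u₀ : ℝ) : Sm upperO →+* Sm (pastO u₀) :=
  Sm.pullback id contDiffOn_id fun _ => pastO_le

theorem toPast_eq_zero_iff {u₀ : ℝ} {f : Sm upperO} :
    toPast u₀ f = 0 ↔ ∀ p : Slice, 0 < p.2 → p.2 < u₀ → f.fn p = 0 := by
  constructor
  · intro h p h1 h2
    have h3 : (toPast u₀ f).fn p = f.fn p := Sm.fn_pullback f (p := p) ⟨h1, h2⟩
    rw [← h3, h, Sm.fn_zero]
  · intro h
    refine Sm.ext_fn fun p hp => ?_
    have h3 : (toPast u₀ f).fn p = f.fn p := Sm.fn_pullback f hp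
    rw [h3, Sm.fn_zero, h p hp.1 hp.2]

theorem isPastRestriction_toPast {u₀ : ℝ} (hu : 0 < u₀) : IsPastRestriction (toPast u₀) where
  toIsCoefHom := Sm.isCoefHom_pullback (fun _ _ => rfl) (fun p _ => by rw [fderiv_id]; rfl)
    (fun p _ => by rw [fderiv_id]; rfl) (fun p _ => by rw [fderiv_id]; rfl)
  inj f hf hd := by
    refine Sm.ext_fn fun ⟨ξ, s⟩ hp => ?_
    have h := f.integral_d3 ξ (c := u₀ / 2) (by positivity) (show 0 < s from hp)
    rw [hd] at h
    simp only [Sm.fn_zero, intervalIntegral.integral_zero] at h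
    rw [toPast_eq_zero_iff.mp hf (ξ, u₀ / 2) (half_pos hu) (half_lt_self hu)] at h
    rw [Sm.fn_zero]
    linear_combination -h
  surj y hy := by
    refine ⟨Sm.primitive (u₀ / 2) (half_pos hu) y, toPast_eq_zero_iff.mpr fun p h1 h2 => ?_,
      Sm.d3_primitive _ y⟩
    rw [Sm.fn_primitive _ _ (show p ∈ upperO from h1)]
    rw [intervalIntegral.integral_congr (g := fun _ => 0), intervalIntegral.integral_zero]
    intro τ hτ
    refine toPast_eq_zero_iff.mp hy (p.1, τ) (lt_of_lt_of_le (lt_min (half_pos hu) h1) hτ.1) ?_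
    exact lt_of_le_of_lt hτ.2 (max_lt (half_lt_self hu) h2)

end HalfSpace

/-! ### Formal series with smooth coefficients -/

section Transfer

open Cpt SharpCpt

/-- The formal series `X` has the smooth coefficient functions `x`. -/
def Rep (X : Formal) (x : (Sm upperO)⸨X⸩) : Prop :=
  ∀ n, ∀ p ∈ upper, X.coeff n p = (x.coeff n).fn p

namespace Rep

variable {X Y : Formal} {x y : (Sm upperO)⸨X⸩}

theorem iff_coeffMap : Rep X x ↔ ∀ p (hp : p ∈ upperO),
    coeffMap (Pi.evalRingHom (fun _ : Slice => ℂ) p) X = coeffMap (Sm.eval (U := upperO) hp) x := by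
  constructor
  · intro h p hp
    ext n
    rw [coeffMap_coeff, coeffMap_coeff, ← Sm.fn_eq_eval]
    exact h n p hp
  · intro h n p hp
    have := congrArg (fun z => HahnSeries.coeff z n) (h p hp)
    simp only [coeffMap_coeff] at this
    exact this.trans (Sm.fn_eq_eval _ (show p ∈ upperO from hp)).symm

theorem add (hX : Rep X x) (hY : Rep Y y) : Rep (X + Y) (x + y) := by
  rw [iff_coeffMap] at *
  intro p hp
  rw [map_add, map_add, hX p hp, hY p hp]

theorem sub (hX : Rep X x) (hY : Rep Y y) : Rep (X - Y) (x - y) := by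
  rw [iff_coeffMap] at *
  intro p hp
  rw [map_sub, map_sub, hX p hp, hY p hp]

theorem mul (hX : Rep X x) (hY : Rep Y y) : Rep (X * Y) (x * y) := by
  rw [iff_coeffMap] at *
  intro p hp
  rw [map_mul, map_mul, hX p hp, hY p hp]

theorem neg (hX : Rep X x) : Rep (-X) (-x) := by
  rw [iff_coeffMap] at *
  intro p hp
  rw [map_neg, map_neg, hX p hp]

theorem zero : Rep 0 0 := by
  rw [iff_coeffMap]
  intro p hp
  rw [map_zero, map_zero]

theorem one : Rep 1 1 := by
  rw [iff_coeffMap]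
  intro p hp
  rw [map_one, map_one]

theorem ofNat (n : ℕ) [n.AtLeastTwo] : Rep (ofNat(n)) (ofNat(n)) := by
  rw [iff_coeffMap]
  intro p hp
  rw [map_ofNat, map_ofNat]

theorem conj (hX : Rep X x) : Rep (conj X) (DiffRing.cj x) := fun n p hp => by
  change starRingEnd ℂ (X.coeff n p) = (Sm.star (x.coeff n)).fn p
  rw [Sm.fn_star _ hp, hX n p hp]

theorem der (hX : Rep X x) (v : Slice) : Rep (X.map (dirDeriv v)) (coeffDer (Sm.der v) x) :=
  fun n p hp => by
    change fderiv ℝ (X.coeff n) p v = (Sm.der v (x.coeff n)).fn p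
    rw [Sm.fn_der _ _ hp, Sm.fderiv_congr (fun q hq => (hX n q hq).symm) hp]

theorem pd1 (hX : Rep X x) : Rep (pd1 X) (DiffRing.p1 x) := hX.der _

theorem pd2 (hX : Rep X x) : Rep (pd2 X) (DiffRing.p2 x) := hX.der _

theorem pd3 (hX : Rep X x) : Rep (pd3 X) (DiffRing.p3 x) := hX.der _

theorem pd4 (hX : Rep X x) : Rep (pd4 X) (DiffRing.p4 x) := fun n p hp => by
  have h1 : (FarField.pd4 X).coeff n = -((n - 1 : ℤ) • X.coeff (n - 1)) := by
    have h := HahnSeries.coeff_single_mul (r := (1 : Coef)) (x := LaurentSeries.hasseDeriv ℂ 1 X)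
      (a := n) (b := 2)
    rw [FarField.pd4, HahnSeries.coeff_neg]
    change -((HahnSeries.single (- -2) (1 : Coef) * LaurentSeries.hasseDeriv ℂ 1 X).coeff n) = _
    rw [neg_neg, h, one_mul, LaurentSeries.hasseDeriv_coeff, Ring.choose_one_right]
    have e : n - 2 + ((1 : ℕ) : ℤ) = n - 1 := by push_cast; ring
    rw [e]
  have h2 : (DiffRing.p4 x).coeff n = -((n - 1 : ℤ) : Sm upperO) * x.coeff (n - 1) := uDer_coeff x n
  rw [h1, h2, Sm.fn_mul _ _ hp, ← hX _ p hp]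
  rw [Sm.fn_eq_eval (-((n - 1 : ℤ) : Sm upperO)) hp, map_neg, map_intCast]
  simp
  ring

theorem upow (j : ℕ) : Rep (upow j) (DiffRing.U ^ j) := fun n p hp => by
  have hU : (DiffRing.U : (Sm upperO)⸨X⸩) ^ j = HahnSeries.single (-(j : ℤ)) 1 := by
    change (HahnSeries.single (-1) (1 : Sm upperO)) ^ j = _
    rw [HahnSeries.single_pow]
    simp
  rw [hU, FarField.upow, HahnSeries.coeff_single, HahnSeries.coeff_single]
  split_ifs
  · rw [Sm.fn_eq_eval _ hp, map_one]; rfl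
  · rw [Sm.fn_zero]; rfl

theorem single (m : ℤ) : Rep (FarField.upow m) (HahnSeries.single (-m) 1) := fun n p hp => by
  rw [FarField.upow, HahnSeries.coeff_single, HahnSeries.coeff_single]
  split_ifs
  · rw [Sm.fn_eq_eval _ hp, map_one]; rfl
  · rw [Sm.fn_zero]; rfl

theorem const {g : Coef} {c : Sm upperO} (h : ∀ p ∈ upper, g p = c.fn p) :
    Rep (const g) (cst c) := fun n p hp => by
  rw [cst_coeff, FarField.const, HahnSeries.coeff_single]
  split_ifs
  · exact h p hp
  · rw [Sm.fn_zero]; rfl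

theorem smul (c : ℂ) (hX : Rep X x) : Rep (c • X) (cst (algebraMap ℂ (Sm upperO) c) * x) := by
  have h : c • X = FarField.const (fun _ => c) * X := by
    ext n
    rw [FarField.const, HahnSeries.coeff_single_zero_mul]
    rfl
  rw [h]
  exact (const fun p hp => (Sm.fn_algebraMap c hp).symm).mul hX

theorem ofPowerSeries_coeff {R : Type*} [CommRing R] (a : ℕ → R) (n : ℤ) :
    (HahnSeries.ofPowerSeries ℤ R (PowerSeries.mk a)).coeff n
      = if 0 ≤ n then a n.toNat else 0 := by
  split_ifs with hn
  · obtain ⟨k, rfl⟩ := Int.eq_ofNat_of_zero_le hn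
    rw [HahnSeries.ofPowerSeries_apply_coeff]
    simp
  · rw [HahnSeries.ofPowerSeries_apply]
    refine HahnSeries.embDomain_of_notMem_range ?_
    rintro ⟨k, hk⟩
    simp at hk
    omega

theorem series {a : ℕ → Coef} {b : ℕ → Sm upperO} (h : ∀ k, ∀ p ∈ upper, a k p = (b k).fn p) :
    Rep (series a) (HahnSeries.ofPowerSeries ℤ _ (PowerSeries.mk b)) := fun n p hp => by
  rw [FarField.series, ofPowerSeries_coeff, ofPowerSeries_coeff]
  split_ifs
  · exact h _ p hp
  · rw [Sm.fn_zero]; rfl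

theorem of_eq (hX : Rep X x) (h : x = y) : Rep X y := h ▸ hX

theorem vanishes_iff (hX : Rep X x) : Vanishes X ↔ x = 0 := by
  constructor
  · intro h
    ext n
    refine Sm.ext_fn fun p hp => ?_
    rw [← hX n p hp, h n p hp, HahnSeries.coeff_zero, Sm.fn_zero]
  · rintro rfl n p hp
    rw [hX n p hp, HahnSeries.coeff_zero, Sm.fn_zero]

variable {Φ : Cpt → Formal} {φ : Cpt → (Sm upperO)⸨X⸩}

theorem upow2 : Rep (FarField.upow 2) (DiffRing.U ^ 2) := upow 2

theorem upow4 : Rep (FarField.upow 4) (DiffRing.U ^ 4) := upow 4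

theorem upow6 : Rep (FarField.upow 6) (DiffRing.U ^ 6) := upow 6

theorem upow8 : Rep (FarField.upow 8) (DiffRing.U ^ 8) := upow 8

theorem upow_mul_vanishes_iff (m : ℤ) (hX : Rep X x) :
    Vanishes (FarField.upow m * X) ↔ x = 0 := by
  rw [((single m).mul hX).vanishes_iff]
  refine ⟨fun h => ?_, fun h => by rw [h, mul_zero]⟩
  have h1 : (HahnSeries.single m (1 : Sm upperO)) * HahnSeries.single (-m) 1 = 1 := by
    rw [HahnSeries.single_mul_single]; simp
  rw [← one_mul x, ← h1, mul_assoc, h, mul_zero]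

theorem pow_mul_eq_zero_iff (n : ℕ) : DiffRing.U ^ n * x = 0 ↔ x = 0 := by
  refine ⟨fun h => ?_, fun h => by rw [h, mul_zero]⟩
  have h1 : (DiffRing.Z : (Sm upperO)⸨X⸩) ^ n * DiffRing.U ^ n = 1 := by
    rw [← mul_pow, mul_comm, DiffRing.U_Z, one_pow]
  rw [← one_mul x, ← h1, mul_assoc, h, mul_zero]

theorem cst_mul_eq_zero_iff {c : ℂ} (hc : c ≠ 0) :
    cst (algebraMap ℂ (Sm upperO) c) * x = 0 ↔ x = 0 := by
  refine ⟨fun h => ?_, fun h => by rw [h, mul_zero]⟩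
  have h1 : cst (algebraMap ℂ (Sm upperO) c⁻¹) * cst (algebraMap ℂ (Sm upperO) c) = 1 := by
    rw [← map_mul, ← map_mul, inv_mul_cancel₀ hc, map_one, map_one]
  rw [← one_mul x, ← h1, mul_assoc, h, mul_zero]

set_option maxHeartbeats 1600000 in
theorem shsResidual (h : ∀ i, Rep (Φ i) (φ i)) (i : Cpt) :
    Rep (shsResidual Φ i) (gres φ i) := by
  have key : ∃ y, Rep (FarField.shsResidual Φ i) y ∧ y = gres φ i := by
    cases i <;>
    · apply Exists.intro
      apply And.intro
      · simp only [FarField.shsResidual, opD, opDbar, opN, opL, twoRe]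
        repeat' with_reducible first
          | exact h _ | apply pd4 | exact upow2 | exact upow4 | exact upow6 | exact upow8
          | exact ofNat _ | apply add | apply sub | apply mul | apply neg
          | apply conj | apply pd1 | apply pd2 | apply pd3
      · simp only [gres, gA1, gA2, gA3, gA4, gB1, gB2, gB3, gB4, op_apply]
        try ring1
  obtain ⟨y, hy, rfl⟩ := key
  exact hy

set_option maxHeartbeats 1600000 in
/-- The constraint expressions in the normalisation of `constraintField`. -/
theorem constraintField_iff (h : ∀ i, Rep (Φ i) (φ i)) (j : SharpCpt) (m : ℤ) :
    Vanishes (FarField.upow m * constraintField Φ j) ↔ gcon φ j = 0 := by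
  have key : ∃ y, Rep (FarField.constraintField Φ j) y ∧ (y = 0 ↔ gcon φ j = 0) := by
    cases j <;>
    · apply Exists.intro
      apply And.intro
      · simp only [FarField.constraintField, opD, opDbar, opN, opL, twoIm]
        repeat' with_reducible first
          | exact h _ | apply pd4 | exact upow2 | exact upow4 | exact upow6
          | exact ofNat _ | apply add | apply sub | apply mul | apply neg | apply smul
          | apply conj | apply pd1 | apply pd2 | apply pd3
      · simp only [gcon, gA1, gA2, gA3, op_apply]
        first
          | done
          | exact Iff.rfl
          | rw [pow_mul_eq_zero_iff]
          | rw [neg_eq_zero, cst_mul_eq_zero_iff (neg_ne_zero.mpr Complex.I_ne_zero)]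
  obtain ⟨y, hy, hy'⟩ := key
  rw [hy.upow_mul_vanishes_iff, hy']

end Rep

theorem fn_s {p : Slice} (hp : p ∈ upperO) : (CoefRing.s : Sm upperO).fn p = (p.2 : ℂ) :=
  Sm.fn_mk _ hp

theorem rep_invRho : Rep invRho rinv := by
  refine (Rep.mul (Rep.single (-1)) (Rep.series (b := fun k => CoefRing.s ^ k) ?_)).neg.of_eq ?_
  · intro k p hp
    rw [Sm.fn_eq_eval _ hp, map_pow, ← Sm.fn_eq_eval _ hp]
    rw [fn_s hp]
  · rw [rinv]; rfl

theorem fn_lam {p : Slice} (hp : p ∈ upperO) :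
    (CoefRing.lam : Sm upperO).fn p = -p.1 / 2 := Sm.fn_mk _ hp

theorem fn_cj (f : Sm upperO) {p : Slice} (hp : p ∈ upperO) :
    (CoefRing.cj f).fn p = starRingEnd ℂ (f.fn p) := Sm.fn_star f hp

theorem fn_ee {p : Slice} (hp : p ∈ upperO) : (ee : Sm upperO).fn p = bfe p := by
  rw [Sm.fn_eq_eval _ hp, ee, map_add, map_mul, map_mul, map_ofNat, ← Sm.fn_eq_eval _ hp,
    ← Sm.fn_eq_eval _ hp, ← Sm.fn_eq_eval _ hp, fn_cj _ hp, fn_lam hp, Sm.fn_algebraMap _ hp, bfe,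
    Complex.mul_conj, Complex.normSq_eq_norm_sq]
  push_cast
  rw [norm_div, norm_neg, Complex.norm_ofNat]
  push_cast
  ring

theorem rep_minkowski (i : Cpt) : Rep (minkowski i) (mink i) := by
  have he : Rep (const bfe) (cst ee) := Rep.const fun p hp => (fn_ee hp).symm
  have hl : Rep (const bflam) (cst CoefRing.lam) := Rep.const fun p hp => (fn_lam hp).symm
  have h1 := rep_invRho.mul he
  have h4 : Rep (conj (const bflam)) (cst (CoefRing.cj CoefRing.lam)) :=
    hl.conj.of_eq (cj_cst _)
  cases i
  · exact h1
  · exact h1.smul Complex.I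
  · exact Rep.one
  all_goals first
    | exact Rep.zero
    | exact rep_invRho
    | exact rep_invRho.mul hl
    | exact rep_invRho.mul h4
    | exact rep_invRho.neg

theorem rep_fullField {Ψ : FormalField} {ψ : ℕ → Cpt → Sm upperO}
    (h : ∀ k i, ∀ p ∈ upper, Ψ k i p = (ψ k i).fn p) (i : Cpt) :
    Rep (fullField Ψ i) (fullK ψ i) := by
  refine (rep_minkowski i).add (((Rep.single _).mul (Rep.series fun k => h k i)).of_eq ?_)
  rw [neg_neg]

/-- The formal field given by smooth coefficient functions. -/
def toFormal (ψ : ℕ → Cpt → Sm upperO) : FormalField := fun k i => (ψ k i).fn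

theorem isReal_iff {f : Sm upperO} :
    CoefRing.cj f = f ↔ ∀ p ∈ upper, (f.fn p).im = 0 := by
  constructor
  · intro h p hp
    rw [← Complex.conj_eq_iff_im, ← fn_cj f hp, h]
  · intro h
    refine Sm.ext_fn fun p hp => ?_
    rw [fn_cj f hp]
    exact Complex.conj_eq_iff_im.mpr (h p hp)

theorem inR_iff {X : Cpt → ℂ} : InR X ↔ ∀ i, IsRealCpt i → (X i).im = 0 := by
  constructor
  · rintro ⟨h1, h2, h3, h4, h5⟩ i (rfl | rfl | rfl | rfl | rfl) <;> assumption
  · intro h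
    refine ⟨h _ ?_, h _ ?_, h _ ?_, h _ ?_, h _ ?_⟩ <;> simp [IsRealCpt]

theorem isFormalSolution_iff {Ψ : FormalField} {ψ : ℕ → Cpt → Sm upperO}
    (h : ∀ k i, ∀ p ∈ upper, Ψ k i p = (ψ k i).fn p) :
    IsFormalSolution Ψ ↔
      (∀ k i, IsRealCpt i → CoefRing.cj (ψ k i) = ψ k i) ∧ ∀ i, gres (fullK ψ) i = 0 := by
  have hrep := rep_fullField h
  have hreal : (∀ k, ∀ p ∈ upper, InR fun i => Ψ k i p) ↔
      ∀ k i, IsRealCpt i → CoefRing.cj (ψ k i) = ψ k i := by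
    simp only [inR_iff, isReal_iff]
    constructor
    · intro hr k i hi p hp
      rw [← h k i p hp]
      exact hr k p hp i hi
    · intro hr k p hp i hi
      rw [h k i p hp]
      exact hr k i hi p hp
  constructor
  · intro hs
    exact ⟨hreal.mp hs.real, fun i =>
      ((Rep.shsResidual hrep i).upow_mul_vanishes_iff _).mp (hs.eqn i)⟩
  · rintro ⟨h1, h2⟩
    exact ⟨fun k i => (ψ k i).contDiffOn.congr fun p hp => h k i p hp, hreal.mpr h1, fun i =>
      ((Rep.shsResidual hrep i).upow_mul_vanishes_iff _).mpr (h2 i)⟩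

theorem constraintsVanish_iff {Ψ : FormalField} {ψ : ℕ → Cpt → Sm upperO}
    (h : ∀ k i, ∀ p ∈ upper, Ψ k i p = (ψ k i).fn p) :
    ConstraintsVanish Ψ ↔ ∀ j, gcon (fullK ψ) j = 0 :=
  forall_congr' fun j => Rep.constraintField_iff (rep_fullField h) j _

/-- The coefficient functions of a smooth formal field. -/
def ofFormal (Ψ : FormalField) (h : ∀ k i, ContDiffOn ℝ ∞ (Ψ k i) upper) (k : ℕ) (i : Cpt) :
    Sm upperO := Sm.mk (Ψ k i) (h k i)

theorem fn_ofFormal (Ψ : FormalField) (h : ∀ k i, ContDiffOn ℝ ∞ (Ψ k i) upper) (k : ℕ) (i : Cpt) :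
    ∀ p ∈ upper, Ψ k i p = (ofFormal Ψ h k i).fn p := fun p hp => (Sm.fn_mk (h k i) hp).symm

end Transfer

/-! ### The far field solution -/

section FarFieldSolution

theorem contDiffOn_finiteMassData {η : Coef} (hη : ContDiffOn ℝ ∞ η upper) {α : ℝ} (hα : α ≠ 0) :
    ContDiffOn ℝ ∞ (finiteMassData α η) upper := by
  refine contDiffOn_const.mul (hη.comp (f := fun p : Slice => (p.1, p.2 / α ^ 4)) ?_ ?_)
  · exact ContDiff.contDiffOn (by fun_prop)
  · intro p hp
    have : 0 < p.2 := hp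
    exact div_pos this (by positivity)

theorem finiteMassData_past {η : Coef} (hη : ∀ p ∈ upper, η p ≠ 0 → 1 / 2 < p.2 ∧ p.2 < 3 / 4)
    {α : ℝ} (hα : α ≠ 0) {p : Slice} (hp : p ∈ upper) (h : p.2 < α ^ 4 / 2) :
    finiteMassData α η p = 0 := by
  have h4 : 0 < α ^ 4 := by positivity
  have h0 : 0 < p.2 := hp
  by_contra hne
  have h1 : η (p.1, p.2 / α ^ 4) ≠ 0 := right_ne_zero_of_mul hne
  have h2 := (hη _ (div_pos h0 h4) h1).1
  rw [lt_div_iff₀ h4] at h2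
  linarith

theorem exists_isFarFieldSolution {data : Coef} (hd : ContDiffOn ℝ ∞ data upper) {u₀ : ℝ}
    (hu : 0 < u₀) (hpast : ∀ p ∈ upper, p.2 < u₀ → data p = 0) :
    ∃ Ψ, IsFarFieldSolution data u₀ Ψ := by
  have hfn : ∀ p ∈ upper, (Sm.mk (U := upperO) data hd).fn p = data p := fun p hp =>
    Sm.fn_mk hd hp
  obtain ⟨ψ, h1, h2, h3, h4, h5⟩ := exists_solution (isPastRestriction_toPast hu)
    (g := Sm.mk (U := upperO) data hd)
    (toPast_eq_zero_iff.mpr fun p hp hpu => (hfn p hp).trans (hpast p hp hpu))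
  have h : ∀ k i, ∀ p ∈ upper, toFormal ψ k i p = (ψ k i).fn p := fun _ _ _ _ => rfl
  refine ⟨toFormal ψ, (isFormalSolution_iff h).mpr ⟨h5, h1.res⟩, (constraintsVanish_iff h).mpr h2,
    fun k i p hp hpu => toPast_eq_zero_iff.mp (h4 k i) p hp hpu, fun p hp => ?_⟩
  change (ψ 0 .γ1).fn p = _
  rw [h3, hfn p hp]

theorem IsFarFieldSolution.agree {data : Coef} {u₀ : ℝ} (hu : 0 < u₀) {Ψ Ψ' : FormalField}
    (h : IsFarFieldSolution data u₀ Ψ) (h' : IsFarFieldSolution data u₀ Ψ') : Agree Ψ Ψ' := by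
  have e := fn_ofFormal Ψ h.solution.smooth
  have e' := fn_ofFormal Ψ' h'.solution.smooth
  set ψ := ofFormal Ψ h.solution.smooth
  set ψ' := ofFormal Ψ' h'.solution.smooth
  have hπ := isPastRestriction_toPast hu
  have p0 : ∀ k i, toPast u₀ (ψ k i) = 0 := fun k i =>
    toPast_eq_zero_iff.mpr fun p hp hpu => by rw [← e k i p hp, h.vanish k i p hp hpu]
  have p0' : ∀ k i, toPast u₀ (ψ' k i) = 0 := fun k i =>
    toPast_eq_zero_iff.mpr fun p hp hpu => by rw [← e' k i p hp, h'.vanish k i p hp hpu]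
  have hZ : ∀ k i, CoefRing.d3 (ψ' k i - ψ k i) = 0 → ψ' k i - ψ k i = 0 := fun k i hd =>
    hπ.inj _ (by rw [map_sub, p0, p0', sub_zero]) hd
  have hr := ((isFormalSolution_iff e).mp h.solution).2
  have hr' := ((isFormalSolution_iff e').mp h'.solution).2
  have hc := (constraintsVanish_iff e).mp h.constraints
  have hc' := (constraintsVanish_iff e').mp h'.constraints
  have key : ∀ k, ψ k = ψ' k := by
    intro k
    induction k using Nat.strong_induction_on with
    | _ k ih =>
      rcases Nat.eq_zero_or_pos k with rfl | hk
      · refine eq_zero_index hr hr' hc hc' (hZ 0) (Sm.ext_fn fun p hp => ?_)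
        rw [← e 0 .γ1 p hp, ← e' 0 .γ1 p hp, h.data_eq hp, h'.data_eq hp]
      · exact eq_succ hr hr' ih hk.ne' (hZ k)
  intro k i p hp
  rw [e k i p hp, e' k i p hp, key k]

end FarFieldSolution

/-! ### Weights of the coefficient functions -/

section Weights

open CoefRing Cpt SharpCpt

variable {K : Type*} [CommRing K] [Algebra ℂ K] [CoefRing K] {P : ℤ → AddSubgroup K}

/-- A decreasing filtration of a ring of coefficient functions in which `∂/∂ū` has weight `-2`. -/
structure IsWeight (P : ℤ → AddSubgroup K) : Prop where
  le : ∀ {a b x}, x ∈ P b → a ≤ b → x ∈ P a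
  mul : ∀ {a b x y}, x ∈ P a → y ∈ P b → x * y ∈ P (a + b)
  d1 : ∀ {a x}, x ∈ P a → d1 x ∈ P a
  d2 : ∀ {a x}, x ∈ P a → d2 x ∈ P a
  d3 : ∀ {a x}, x ∈ P a → d3 x ∈ P (a - 2)
  cj : ∀ {a x}, x ∈ P a → cj x ∈ P a
  const : ∀ c : ℂ, algebraMap ℂ K c ∈ P 0
  lam : CoefRing.lam ∈ P 0
  s : CoefRing.s ∈ P 0

namespace IsWeight

variable (hP : IsWeight P) {a b : ℤ} {x y : K}
include hP

theorem add (hx : x ∈ P a) (hy : y ∈ P b) : x + y ∈ P (min a b) :=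
  (P _).add_mem (hP.le hx (min_le_left _ _)) (hP.le hy (min_le_right _ _))

theorem sub (hx : x ∈ P a) (hy : y ∈ P b) : x - y ∈ P (min a b) :=
  (P _).sub_mem (hP.le hx (min_le_left _ _)) (hP.le hy (min_le_right _ _))

theorem neg (hx : x ∈ P a) : -x ∈ P a := (P _).neg_mem hx

theorem natCast (n : ℕ) : (n : K) ∈ P 0 := by
  rw [← map_natCast (algebraMap ℂ K) n]
  exact hP.const _

theorem ofNat (n : ℕ) [n.AtLeastTwo] : (ofNat(n) : K) ∈ P 0 := hP.natCast n

theorem one : (1 : K) ∈ P 0 := by simpa using hP.natCast 1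

theorem im : (im : K) ∈ P 0 := hP.const _

theorem ee : (ee : K) ∈ P 0 :=
  hP.add (hP.const _) (hP.mul (hP.ofNat 2) (hP.mul hP.lam (hP.cj hP.lam)))

theorem pow_s (k : ℕ) : (CoefRing.s : K) ^ k ∈ P 0 := by
  induction k with
  | zero => simpa using hP.one
  | succ k ih => rw [pow_succ]; exact hP.mul ih hP.s

theorem natCast_mul_cancel {n : ℕ} (hn : n ≠ 0) (h : (n : K) * x ∈ P a) : x ∈ P a := by
  have h1 := hP.mul (hP.const (n : ℂ)⁻¹) h
  rw [zero_add, ← mul_assoc, ← map_natCast (algebraMap ℂ K) n, ← map_mul,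
    inv_mul_cancel₀ (Nat.cast_ne_zero.mpr hn), map_one, one_mul] at h1
  exact h1

end IsWeight

/-- All coefficients of a series have weight at least `w`. -/
def SeriesMem (P : ℤ → AddSubgroup K) (w : ℤ) (x : K⸨X⸩) : Prop := ∀ n, x.coeff n ∈ P w

namespace SeriesMem

variable (hP : IsWeight P) {a b : ℤ} {x y : K⸨X⸩}

theorem add (hx : SeriesMem P a x) (hy : SeriesMem P a y) : SeriesMem P a (x + y) := fun n => by
  rw [HahnSeries.coeff_add]; exact (P a).add_mem (hx n) (hy n)

theorem neg (hx : SeriesMem P a x) : SeriesMem P a (-x) := fun n => by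
  rw [HahnSeries.coeff_neg]; exact (P a).neg_mem (hx n)

theorem sub (hx : SeriesMem P a x) (hy : SeriesMem P a y) : SeriesMem P a (x - y) := by
  rw [sub_eq_add_neg]; exact hx.add hy.neg

theorem zero : SeriesMem P a 0 := fun n => (P a).zero_mem

include hP

theorem le (hx : SeriesMem P b x) (h : a ≤ b) : SeriesMem P a x := fun n => hP.le (hx n) h

theorem mul (hx : SeriesMem P a x) (hy : SeriesMem P b y) : SeriesMem P (a + b) (x * y) :=
  fun n => by
    rw [HahnSeries.coeff_mul]
    exact (P _).sum_mem fun ij _ => hP.mul (hx _) (hy _)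

theorem p4 (hx : SeriesMem P a x) : SeriesMem P a (DiffRing.p4 x) := fun n => by
  change (uDer x).coeff n ∈ P a
  rw [uDer_coeff, ← Int.cast_neg, ← zsmul_eq_mul]
  exact (P a).zsmul_mem (hx _) _

theorem cst {c : K} (hc : c ∈ P a) : SeriesMem P a (cst c) := fun n => by
  rw [cst_coeff]
  split_ifs
  · exact hc
  · exact (P a).zero_mem

theorem one : SeriesMem P 0 (1 : K⸨X⸩) := by
  rw [← map_one FarField.cst]; exact cst hP hP.one

theorem rinv : SeriesMem P 0 (rinv : K⸨X⸩) := fun n => by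
  rw [rinv_coeff]
  split_ifs
  · exact (P 0).neg_mem (hP.pow_s _)
  · exact (P 0).zero_mem

theorem mink (i : Cpt) : SeriesMem P 0 (mink i : K⸨X⸩) := by
  have hr := rinv hP
  have he := cst hP hP.ee
  have hl := cst hP hP.lam
  have hl' := cst hP (hP.cj hP.lam)
  have hi := cst hP hP.im
  cases i
  all_goals first
    | exact zero
    | exact one hP
    | exact hr
    | exact hr.neg
    | exact mul hP hr he
    | exact mul hP hr hl
    | exact mul hP hr hl'
    | exact mul hP hi (mul hP hr he)

theorem p3_mink (i : Cpt) : SeriesMem P 0 (DiffRing.p3 (FarField.mink i : K⸨X⸩)) := by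
  have hr := mul hP (rinv hP) (rinv hP)
  have he := cst hP hP.ee
  have hl := cst hP hP.lam
  have hl' := cst hP (hP.cj hP.lam)
  have hi := cst hP hP.im
  cases i <;>
    simp only [FarField.mink, Der.leibniz, p3_rinv, p3_cst, d3_ee, d3_lam, ← cj_d3, FarField.im,
      d3_algebraMap, map_zero, map_neg, mul_zero, zero_mul, add_zero, zero_add, Der.map_one]
  all_goals first
    | exact zero
    | exact hr.neg
    | exact hr.neg.neg
    | exact mul hP hr.neg he
    | exact mul hP hr.neg hl
    | exact mul hP hr.neg hl'
    | exact mul hP hi (mul hP hr.neg he)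

end SeriesMem

/-- `x` differs from the background value `m`, of weight at least `w₀`, by terms of weight at least
`w`. -/
structure Near (P : ℤ → AddSubgroup K) (w₀ w : ℤ) (x m : K⸨X⸩) : Prop where
  base : SeriesMem P w₀ m
  diff : SeriesMem P w (x - m)

namespace Near

variable (hP : IsWeight P) {a₀ b₀ a b : ℤ} {x y m n : K⸨X⸩}

theorem neg (hx : Near P a₀ a x m) : Near P a₀ a (-x) (-m) :=
  ⟨hx.base.neg, by rw [neg_sub_neg, ← neg_sub]; exact hx.diff.neg⟩

include hP

theorem cj (hx : Near P a₀ a x m) : Near P a₀ a (DiffRing.cj x) (DiffRing.cj m) :=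
  ⟨fun n => hP.cj (hx.base n), by rw [← map_sub]; exact fun n => hP.cj (hx.diff n)⟩

theorem p1 (hx : Near P a₀ a x m) : Near P a₀ a (DiffRing.p1 x) (DiffRing.p1 m) :=
  ⟨fun n => hP.d1 (hx.base n), by rw [← map_sub]; exact fun n => hP.d1 (hx.diff n)⟩

theorem p2 (hx : Near P a₀ a x m) : Near P a₀ a (DiffRing.p2 x) (DiffRing.p2 m) :=
  ⟨fun n => hP.d2 (hx.base n), by rw [← map_sub]; exact fun n => hP.d2 (hx.diff n)⟩

theorem p4 (hx : Near P a₀ a x m) : Near P a₀ a (DiffRing.p4 x) (DiffRing.p4 m) :=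
  ⟨hx.base.p4 hP, by rw [← map_sub]; exact hx.diff.p4 hP⟩

theorem le (hx : Near P b₀ b x m) (h : a ≤ b) : SeriesMem P a (x - m) := hx.diff.le hP h

theorem add (hx : Near P a₀ a x m) (hy : Near P b₀ b y n) :
    Near P (min a₀ b₀) (min a b) (x + y) (m + n) :=
  ⟨(hx.base.le hP (min_le_left _ _)).add (hy.base.le hP (min_le_right _ _)), by
    rw [add_sub_add_comm]
    exact (hx.diff.le hP (min_le_left _ _)).add (hy.diff.le hP (min_le_right _ _))⟩

theorem sub (hx : Near P a₀ a x m) (hy : Near P b₀ b y n) :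
    Near P (min a₀ b₀) (min a b) (x - y) (m - n) := by
  rw [sub_eq_add_neg, sub_eq_add_neg]
  exact hx.add hP hy.neg

theorem mul (hx : Near P a₀ a x m) (hy : Near P b₀ b y n) :
    Near P (a₀ + b₀) (min (a + b) (min (a₀ + b) (a + b₀))) (x * y) (m * n) :=
  ⟨hx.base.mul hP hy.base, by
    have h : x * y - m * n = (x - m) * (y - n) + (m * (y - n) + (x - m) * n) := by ring
    rw [h]
    exact ((hx.diff.mul hP hy.diff).le hP (min_le_left _ _)).add
      (((hx.base.mul hP hy.diff).le hP ((min_le_right _ _).trans (min_le_left _ _))).add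
        ((hx.diff.mul hP hy.base).le hP ((min_le_right _ _).trans (min_le_right _ _))))⟩

theorem ofNat (n : ℕ) [n.AtLeastTwo] : Near P 0 9 (ofNat(n) : K⸨X⸩) (ofNat(n)) :=
  ⟨by rw [← map_ofNat FarField.cst]; exact SeriesMem.cst hP (hP.ofNat n),
    by rw [sub_self]; exact SeriesMem.zero⟩

theorem U_pow (j : ℕ) : Near P 0 9 (DiffRing.U ^ j : K⸨X⸩) (DiffRing.U ^ j) :=
  ⟨by
    have hU : SeriesMem P 0 (DiffRing.U : K⸨X⸩) := fun n => by
      change (HahnSeries.single (-1) (1 : K)).coeff n ∈ P 0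
      rw [HahnSeries.coeff_single]
      split_ifs
      · exact hP.one
      · exact (P 0).zero_mem
    induction j with
    | zero => rw [pow_zero]; exact SeriesMem.one hP
    | succ j ih =>
      rw [pow_succ]
      exact ih.mul hP hU,
    by rw [sub_self]; exact SeriesMem.zero⟩

end Near

/-- Lower bounds for the weights of the components. -/
def wt : Cpt → ℤ
  | .e1 => 1 | .e2 => 1 | .e3 => 0 | .e4 => 2 | .e5 => 2
  | .γ1 => -1 | .γ2 => 0 | .γ3 => 1 | .γ4 => 1 | .γ5 => 0 | .γ6 => 2 | .γ7 => 1 | .γ8 => 2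
  | .w1 => -3 | .w2 => -1 | .w3 => 0 | .w4 => 2 | .w5 => 2

/-- Weights of the components of the Minkowski field, with `9` standing for a vanishing component. -/
def wtMink : Cpt → ℤ
  | .e1 => 0 | .e2 => 0 | .e3 => 0 | .γ2 => 0 | .γ3 => 0 | .γ4 => 0 | .γ6 => 0 | _ => 9

/-- Lower bounds for the weights of those components of the residual that are needed. -/
def wtRes : Cpt → ℤ
  | .e1 => -1 | .e2 => -1 | .γ1 => -3 | .γ2 => -2 | .γ3 => -1 | .γ4 => -1 | .w5 => 0
  | .w1 => -9 | .w2 => -9 | .w3 => -9 | .w4 => -9 | .γ6 => -9 | .γ7 => -9 | _ => 0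

/-- Lower bounds for the weights of those components of the constraint field that are needed. -/
def wtCon : SharpCpt → ℤ
  | .u1 => -1 | .u4 => -1 | .u5 => -1 | .u6 => 0 | .v2 => -2 | .v3 => 0 | _ => -9

section Residual

variable {Ψ : ℕ → Cpt → K} (hP : IsWeight P)
include hP

theorem near_fullK (h : ∀ k i, Ψ k i ∈ P (wt i)) (i : Cpt) :
    Near P (wtMink i) (wt i) (fullK Ψ i) (mink i) :=
  ⟨by cases i <;> first | exact SeriesMem.mink hP _ | exact SeriesMem.zero, fun n => by
    rw [HahnSeries.coeff_sub, fullK_coeff, add_sub_cancel_left]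
    split_ifs
    · exact h _ _
    · exact (P _).zero_mem⟩

theorem near_p3_fullK (h : ∀ k i, Ψ k i ∈ P (wt i)) (i : Cpt) :
    Near P (wtMink i) (wt i - 2) (DiffRing.p3 (fullK Ψ i)) (DiffRing.p3 (mink i)) :=
  ⟨by
    cases i <;> first
      | exact SeriesMem.p3_mink hP _
      | (change SeriesMem P _ (DiffRing.p3 0); rw [map_zero]; exact SeriesMem.zero), by
    rw [← map_sub]
    exact fun n => hP.d3 ((near_fullK hP h i).diff n)⟩

theorem gres_fullK_mem (h : ∀ k i, Ψ k i ∈ P (wt i)) (i : Cpt) (n : ℤ) :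
    (gres (fullK Ψ) i).coeff n ∈ P (wtRes i) := by
  have h0 := near_fullK hP h
  have h3 := near_p3_fullK hP h
  have key : SeriesMem P (wtRes i) (gres (fullK Ψ) i - gres mink i) := by
    cases i <;>
    · apply Near.le hP
      · simp only [gres, gA1, gA2, gA3, gA4, gB1, gB2, gB3, gB4, op_apply]
        repeat' with_reducible first
          | exact h0 _ | exact h3 _ | exact Near.ofNat hP _ | exact Near.U_pow hP _
          | apply Near.p4 hP | apply Near.p1 hP | apply Near.p2 hP | apply Near.cj hP
          | apply Near.neg | apply Near.add hP | apply Near.sub hP | apply Near.mul hP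
      · decide
  have := key n
  rwa [gres_mink, sub_zero] at this

theorem gcon_fullK_mem (h : ∀ k i, Ψ k i ∈ P (wt i)) (j : SharpCpt) (n : ℤ) :
    (gcon (fullK Ψ) j).coeff n ∈ P (wtCon j) := by
  have h0 := near_fullK hP h
  have h3 := near_p3_fullK hP h
  have key : SeriesMem P (wtCon j) (gcon (fullK Ψ) j - gcon mink j) := by
    cases j <;>
    · apply Near.le hP
      · simp only [gcon, gA1, gA2, gA3, op_apply]
        repeat' with_reducible first
          | exact h0 _ | exact h3 _ | exact Near.ofNat hP _
          | apply Near.p4 hP | apply Near.p1 hP | apply Near.p2 hP | apply Near.cj hP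
          | apply Near.neg | apply Near.add hP | apply Near.sub hP | apply Near.mul hP
      · decide
  have := key n
  rwa [gcon_mink, sub_zero] at this

end Residual

section Induction

variable {Ψ : ℕ → Cpt → K}

theorem lead_mem {w n : ℤ} {x y : K⸨X⸩} {v : K} (h : Lead n (x - y) v) (hx : x = 0)
    (hy : ∀ n, y.coeff n ∈ P w) : v ∈ P w := by
  rw [← h.2, hx, zero_sub, HahnSeries.coeff_neg]
  exact (P w).neg_mem (hy n)

/-- The coefficients of a solution respect the weights, if integration in `ū` raises the weight
by two. -/
theorem mem_wt (hP : IsWeight P) (hr : ∀ i, gres (fullK Ψ) i = 0) (hc : ∀ j, gcon (fullK Ψ) j = 0)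
    (hint : ∀ k i w, -2 ≤ w → d3 (Ψ k i) ∈ P w → Ψ k i ∈ P (w + 2)) (h0 : Ψ 0 .γ1 ∈ P (-1)) :
    ∀ k i, Ψ k i ∈ P (wt i) := by
  intro k
  induction k using Nat.strong_induction_on with
  | _ k ih =>
    obtain ⟨T, hT1, hT2, hT⟩ : ∃ T : ℕ → Cpt → K, (∀ j < k, T j = Ψ j) ∧ (∀ i, T k i = 0) ∧
        ∀ j i, T j i ∈ P (wt i) := by
      refine ⟨fun j i => if j < k then Ψ j i else 0, fun j hj => by simp [hj], fun i => by simp,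
        fun j i => ?_⟩
      by_cases hj : j < k
      · simpa [hj] using ih j hj i
      · simp [hj]
    have hj := fieldJets_fullK hT1
    simp only [hT2, sub_zero] at hj
    have hR := gres_fullK_mem hP hT
    have hC := gcon_fullK_mem hP hT
    have hΨ : ∀ i, Ψ k i ∈ P (wt i) → Ψ 0 i ∈ P (wt i) := fun i hi => by
      rcases Nat.eq_zero_or_pos k with rfl | hk
      · exact hi
      · exact ih 0 hk i
    have integ : ∀ {i w x}, -2 ≤ w → w + 2 = wt i → x + d3 (Ψ k i) ∈ P w → x ∈ P w →
        Ψ k i ∈ P (wt i) := fun {i w x} hw hi h hx =>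
      hi ▸ hint k i w hw (((P w).add_mem_cancel_left hx).mp h)
    have g1 : Ψ k .γ1 ∈ P (wt .γ1) := by
      rcases Nat.eq_zero_or_pos k with rfl | hk
      · exact h0
      · exact hP.natCast_mul_cancel hk.ne' (lead_mem (inc_gcon_u4 hj) (hc .u4) (hC .u4))
    have w1 : Ψ k .w1 ∈ P (wt .w1) :=
      ((P _).add_mem_cancel_right (hP.d3 g1)).mp (lead_mem (inc_gres_γ1 hj) (hr .γ1) (hR .γ1))
    have g10 := hΨ _ g1
    have w10 := hΨ _ w1
    have g2 : Ψ k .γ2 ∈ P (wt .γ2) := by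
      refine integ (by decide) rfl (lead_mem (inc_gres_γ2 hj) (hr .γ2) (hR .γ2)) ?_
      exact (P _).add_mem (hP.mul (hP.cj g10) g1) (hP.mul (hT 0 .γ1) (hP.cj g1))
    have w2' : 4 * CoefRing.cj CoefRing.lam * Ψ k .γ1 + d1 (Ψ k .γ1) * ee - d2 (Ψ k .γ1) * ee * im
          ∈ P (wt .w2) := id ?_
    have w2 : Ψ k .w2 ∈ P (wt .w2) := by
      have h : _ ∈ P (wt .w2) := (lead_mem (inc_gcon_u1 hj) (hc .u1) (hC .u1))
      refine ((P _).add_mem_cancel_right w2').mp ?_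
      convert h using 1
      ring
    have w20 := hΨ _ w2
    have g3 : Ψ k .γ3 ∈ P (wt .γ3) :=
      integ (by decide) rfl (lead_mem (inc_gres_γ3 hj) (hr .γ3) (hR .γ3)) ?_
    have g4 : Ψ k .γ4 ∈ P (wt .γ4) :=
      integ (by decide) rfl (lead_mem (inc_gres_γ4 hj) (hr .γ4) (hR .γ4)) ?_
    have g7 : Ψ k .γ7 ∈ P (wt .γ7) := by
      have h := hP.neg (lead_mem (inc_gcon_u5 hj) (hc .u5) (hC .u5))
      rw [neg_sub, sub_neg_eq_add, add_comm] at h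
      exact integ (by decide) rfl h (hP.cj g1)
    have g70 := hΨ _ g7
    have w3 : Ψ k .w3 ∈ P (wt .w3) :=
      integ (by decide) rfl (lead_mem (inc_gA2 hj) (hc .v2) (hC .v2)) ?_
    have w4 : Ψ k .w4 ∈ P (wt .w4) :=
      integ (by decide) rfl (lead_mem (inc_gA3 hj) (hc .v3) (hC .v3)) ?_
    have w5 : Ψ k .w5 ∈ P (wt .w5) :=
      hint k .w5 0 (by decide) (lead_mem (inc_gres_w5 hj) (hr .w5) (hR .w5))
    have g6 : Ψ k .γ6 ∈ P (wt .γ6) :=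
      hint k .γ6 0 (by decide) (lead_mem (inc_gcon_u6 hj) (hc .u6) (hC .u6))
    have g5' : CoefRing.cj (Ψ k .γ3) - Ψ k .γ4 ∈ P (wt .γ5) := id ?_
    have g5 : Ψ k .γ5 ∈ P (wt .γ5) := by
      have h := (lead_mem (inc_gres_γ5 hj) (hr .γ5) (hR .γ5))
      refine hP.natCast_mul_cancel (Nat.succ_ne_zero k) ?_
      convert (P _).sub_mem g5' h using 1
      push_cast
      ring
    have g8 : Ψ k .γ8 ∈ P (wt .γ8) :=
      integ (by decide) rfl (lead_mem (inc_gres_γ8 hj) (hr .γ8) (hR .γ8)) ?_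
    have e3' : Ψ k .γ8 + CoefRing.cj (Ψ k .γ8) ∈ P (wt .e3) := id ?_
    have e3 : Ψ k .e3 ∈ P (wt .e3) := by
      have h : _ ∈ P (wt .e3) := (lead_mem (inc_gres_e3 hj) (hr .e3) (hR .e3))
      refine hP.natCast_mul_cancel (Nat.succ_ne_zero (k + 1)) ?_
      convert (P _).neg_mem ((P _).add_mem h e3') using 1
      push_cast
      ring
    have e1 : Ψ k .e1 ∈ P (wt .e1) :=
      integ (by decide) rfl (lead_mem (inc_gres_e1 hj) (hr .e1) (hR .e1)) ?_
    have e2 : Ψ k .e2 ∈ P (wt .e2) :=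
      integ (by decide) rfl (lead_mem (inc_gres_e2 hj) (hr .e2) (hR .e2)) ?_
    have e4 : Ψ k .e4 ∈ P (wt .e4) :=
      integ (by decide) rfl (lead_mem (inc_gres_e4 hj) (hr .e4) (hR .e4)) ?_
    have e5 : Ψ k .e5 ∈ P (wt .e5) :=
      integ (by decide) rfl (lead_mem (inc_gres_e5 hj) (hr .e5) (hR .e5)) ?_
    · intro i
      cases i <;> assumption
    all_goals
      apply hP.le
      · repeat' with_reducible first
          | assumption | exact hT 0 _ | exact hP.ofNat _ | exact hP.ee | exact hP.im
          | exact hP.lam | apply hP.cj | apply hP.d1 | apply hP.d2 | apply hP.neg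
          | apply hP.add | apply hP.sub | apply hP.mul
      · decide

end Induction

end Weights

/-! ### Families of coefficient functions -/

section Pi

variable {ι K : Type*} [CommRing K]

/-- The pointwise derivation of a ring of families. -/
def Der.pi (d : Der K) : Der (ι → K) where
  toFun f := fun i => d (f i)
  map_zero' := funext fun i => map_zero d
  map_add' f g := funext fun i => map_add d _ _
  leibniz' f g := funext fun i => d.leibniz _ _

instance [Algebra ℂ K] [CoefRing K] : CoefRing (ι → K) where
  d1 := CoefRing.d1.pi
  d2 := CoefRing.d2.pi
  d3 := CoefRing.d3.pi
  cj := CoefRing.cj.compLeft ι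
  lam := fun _ => CoefRing.lam
  s := fun _ => CoefRing.s
  d1_d2 x := funext fun i => CoefRing.d1_d2 _
  d1_d3 x := funext fun i => CoefRing.d1_d3 _
  d2_d3 x := funext fun i => CoefRing.d2_d3 _
  cj_cj x := funext fun i => CoefRing.cj_cj _
  cj_d1 x := funext fun i => CoefRing.cj_d1 _
  cj_d2 x := funext fun i => CoefRing.cj_d2 _
  cj_d3 x := funext fun i => CoefRing.cj_d3 _
  d1_algebraMap c := funext fun i => CoefRing.d1_algebraMap _
  d2_algebraMap c := funext fun i => CoefRing.d2_algebraMap _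
  d3_algebraMap c := funext fun i => CoefRing.d3_algebraMap _
  cj_algebraMap c := funext fun i => CoefRing.cj_algebraMap _
  cj_s := funext fun i => CoefRing.cj_s
  d1_s := funext fun i => CoefRing.d1_s
  d2_s := funext fun i => CoefRing.d2_s
  d3_s := funext fun i => CoefRing.d3_s
  d1_lam := funext fun i => CoefRing.d1_lam
  d2_lam := funext fun i => CoefRing.d2_lam
  d3_lam := funext fun i => CoefRing.d3_lam

theorem isCoefHom_eval [Algebra ℂ K] [CoefRing K] (i : ι) :
    IsCoefHom (Pi.evalRingHom (fun _ : ι => K) i) where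
  d1 _ := rfl
  d2 _ := rfl
  d3 _ := rfl
  cj _ := rfl
  s := rfl
  lam := rfl
  algebraMap _ := rfl

end Pi

/-! ### Functions that are polynomial at late times -/

section Late

open TopologicalSpace CoefRing

/-- The region `ū > 3/4`. -/
def lateO : Opens Slice := ⟨{p | 3 / 4 < p.2}, isOpen_lt continuous_const continuous_snd⟩

theorem lateO_le {p : Slice} (hp : p ∈ lateO) : p ∈ upperO :=
  lt_trans (by norm_num : (0 : ℝ) < 3 / 4) hp

/-- Restriction to late times. -/
def toLate : Sm upperO →+* Sm lateO := Sm.pullback id contDiffOn_id fun _ => lateO_le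

theorem fn_toLate (f : Sm upperO) {p : Slice} (hp : p ∈ lateO) : (toLate f).fn p = f.fn p :=
  Sm.fn_pullback f hp

theorem isCoefHom_toLate : IsCoefHom toLate :=
  Sm.isCoefHom_pullback (fun _ _ => rfl) (fun p _ => by rw [fderiv_id]; rfl)
    (fun p _ => by rw [fderiv_id]; rfl) (fun p _ => by rw [fderiv_id]; rfl)

theorem iterate_leibniz {A : Type*} [CommRing A] (d : Der A) (n : ℕ) :
    ∀ {a b : ℕ} {x y : A}, d^[a] x = 0 → d^[b] y = 0 → a + b ≤ n + 1 → d^[n] (x * y) = 0 := by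
  have h0 : ∀ n, d^[n] (0 : A) = 0 := fun n => iterate_map_zero d n
  induction n with
  | zero =>
    intro a b x y hx hy hab
    rcases (show a = 0 ∨ b = 0 by omega) with rfl | rfl
    · simp [show x = 0 from hx]
    · simp [show y = 0 from hy]
  | succ n ih =>
    intro a b x y hx hy hab
    rcases a with _ | a
    · rw [show x = 0 from hx, zero_mul, h0]
    rcases b with _ | b
    · rw [show y = 0 from hy, mul_zero, h0]
    rw [Function.iterate_succ_apply, Der.leibniz, iterate_map_add,
      ih (a := a) (b := b + 1) hx hy (by omega), ih (a := a + 1) (b := b) hx hy (by omega), add_zero]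

theorem late_polynomial (n : ℕ) : ∀ (g : Sm lateO), d3^[n] g = 0 →
    ∃ c : ℕ → ℂ → ℂ, (∀ j, ContDiff ℝ ∞ (c j)) ∧ ∀ ξ (t : ℝ), 3 / 4 < t →
      g.fn (ξ, t) = ∑ j ∈ Finset.range n, c j ξ * (t : ℂ) ^ j := by
  induction n with
  | zero =>
    intro g hg
    refine ⟨fun _ _ => 0, fun _ => contDiff_const, fun ξ t _ => ?_⟩
    rw [show g = 0 from hg, Sm.fn_zero, Finset.sum_range_zero]
  | succ n ih =>
    intro g hg
    obtain ⟨c, hc, hgc⟩ := ih (d3 g) hg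
    have h1 : (1 : ℝ) ∈ Ioi (3 / 4 : ℝ) := by norm_num
    let q : ℂ → ℝ → ℂ := fun ξ t => ∑ j ∈ Finset.range n, c j ξ / (j + 1) * (t : ℂ) ^ (j + 1)
    have hq : ∀ ξ (t : ℝ), HasDerivAt (q ξ) (∑ j ∈ Finset.range n, c j ξ * (t : ℂ) ^ j) t := by
      intro ξ t
      refine HasDerivAt.fun_sum fun j _ => ?_
      have h := ((HasDerivAt.ofReal_comp (hasDerivAt_id t)).pow (j + 1)).const_mul (c j ξ / (j + 1))
      have h2 : (j : ℂ) + 1 ≠ 0 := Nat.cast_add_one_ne_zero j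
      have e : c j ξ * (t : ℂ) ^ j
          = c j ξ / (j + 1) * (((j + 1 : ℕ) : ℂ) * (t : ℂ) ^ j * ((1 : ℝ) : ℂ)) := by
        push_cast
        field_simp
      rw [e]
      exact h
    have hconst : ∀ ξ (t : ℝ), 3 / 4 < t → g.fn (ξ, t) - q ξ t = g.fn (ξ, 1) - q ξ 1 := by
      intro ξ t ht
      have hd : ∀ τ ∈ Ioi (3 / 4 : ℝ), HasDerivAt (fun τ => g.fn (ξ, τ) - q ξ τ) 0 τ := by
        intro τ hτ
        have := (g.hasDerivAt_snd (show (ξ, τ) ∈ lateO from hτ)).sub (hq ξ τ)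
        rwa [hgc ξ τ hτ, sub_self] at this
      exact IsOpen.is_const_of_deriv_eq_zero isOpen_Ioi isPreconnected_Ioi
        (fun τ hτ => (hd τ hτ).differentiableAt.differentiableWithinAt)
        (fun τ hτ => (hd τ hτ).deriv) ht h1
    refine ⟨fun j => Nat.casesOn j (fun ξ => g.fn (ξ, 1) - q ξ 1) fun j ξ => c j ξ / (j + 1), ?_, ?_⟩
    · rintro (_ | j)
      · refine ContDiff.sub ?_ (ContDiff.sum fun j _ => ((hc j).div_const _).mul contDiff_const)
        exact contDiffOn_univ.mp (g.contDiffOn.comp (by fun_prop) fun ξ _ => h1)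
      · exact (hc j).div_const _
    · intro ξ t ht
      rw [Finset.sum_range_succ']
      simp only [pow_zero, mul_one]
      change _ = q ξ t + (g.fn (ξ, 1) - q ξ 1)
      linear_combination hconst ξ t ht

end Late

/-! ### Weighted families depending on the parameter `α` -/

section Families

open TopologicalSpace CoefRing Cpt

/-- The possible values of the parameter `α`. -/
abbrev Param : Type := {α : ℝ // α ≠ 0}

theorem Param.pow_four_pos (α : Param) : 0 < (α : ℝ) ^ 4 := by
  have := α.2
  positivity

/-- The rescaling `f(ξ, ū) ↦ f(ξ, ū / α⁴)`. -/
def scale (α : Param) : Sm upperO →+* Sm upperO :=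
  Sm.pullback (fun p => (p.1, p.2 / (α : ℝ) ^ 4)) (ContDiff.contDiffOn (by fun_prop))
    fun _ hp => div_pos hp α.pow_four_pos

theorem fn_scale (α : Param) (f : Sm upperO) {p : Slice} (hp : p ∈ upperO) :
    (scale α f).fn p = f.fn (p.1, p.2 / (α : ℝ) ^ 4) := Sm.fn_pullback f hp

theorem fderiv_scale (c : ℝ) (p v : Slice) :
    fderiv ℝ (fun p : Slice => (p.1, p.2 / c)) p v = (v.1, v.2 / c) := by
  have h : HasFDerivAt (fun p : Slice => (p.1, p.2 / c))
      ((ContinuousLinearMap.fst ℝ ℂ ℝ).prod (c⁻¹ • ContinuousLinearMap.snd ℝ ℂ ℝ)) p := by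
    have h2 := ((hasFDerivAt_snd (𝕜 := ℝ) (p := p)).const_smul c⁻¹)
    refine (hasFDerivAt_fst (𝕜 := ℝ) (p := p)).prodMk (h2.congr_of_eventuallyEq ?_)
    exact Eventually.of_forall fun q => by simp [div_eq_inv_mul]
  rw [h.fderiv]
  simp [div_eq_inv_mul]

theorem scale_d1 (α : Param) (f : Sm upperO) : scale α (d1 f) = d1 (scale α f) :=
  Sm.pullback_der (v := ((1, 0) : Slice)) (v' := ((1, 0) : Slice))
    (fun p _ => (fderiv_scale _ _ _).trans (by simp)) f

theorem scale_d2 (α : Param) (f : Sm upperO) : scale α (d2 f) = d2 (scale α f) :=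
  Sm.pullback_der (v := ((Complex.I, 0) : Slice)) (v' := ((Complex.I, 0) : Slice))
    (fun p _ => (fderiv_scale _ _ _).trans (by simp)) f

theorem d3_scale (α : Param) (f : Sm upperO) :
    d3 (scale α f) = algebraMap ℂ _ ((((α : ℝ) ^ 4)⁻¹ : ℝ) : ℂ) * scale α (d3 f) := by
  have h : scale α (Sm.der (0, 1 / (α : ℝ) ^ 4) f) = d3 (scale α f) :=
    Sm.pullback_der (v' := ((0, 1) : Slice)) (fun p _ => fderiv_scale _ _ _) f
  refine h.symm.trans (Sm.ext_fn fun p hp => ?_)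
  have hp' : (p.1, p.2 / (α : ℝ) ^ 4) ∈ upperO := div_pos hp α.pow_four_pos
  rw [fn_scale _ _ hp, Sm.fn_mul _ _ hp, Sm.fn_algebraMap _ hp, fn_scale _ _ hp,
    Sm.fn_der _ _ hp', show (d3 f).fn _ = _ from Sm.fn_der _ f hp']
  have e : ((0, 1 / (α : ℝ) ^ 4) : Slice) = ((α : ℝ) ^ 4)⁻¹ • ((0, 1) : Slice) := by simp
  rw [e, map_smul, Complex.real_smul]
  rfl

theorem scale_cj (α : Param) (f : Sm upperO) : scale α (cj f) = cj (scale α f) :=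
  Sm.ext_fn fun p hp => by
    rw [fn_scale _ _ hp, fn_cj _ hp, fn_cj _ (div_pos hp α.pow_four_pos : _ ∈ upperO),
      fn_scale _ _ hp]

/-- The family `α^{2l} g(ξ, ū / α⁴)`. -/
def gen (l : ℤ) (g : Sm upperO) : Param → Sm upperO :=
  fun α => algebraMap ℂ _ (((α : ℝ) : ℂ) ^ (2 * l)) * scale α g

theorem fn_gen (l : ℤ) (g : Sm upperO) (α : Param) {p : Slice} (hp : p ∈ upperO) :
    (gen l g α).fn p = ((α : ℝ) : ℂ) ^ (2 * l) * g.fn (p.1, p.2 / (α : ℝ) ^ 4) := by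
  rw [gen, Sm.fn_mul _ _ hp, Sm.fn_algebraMap _ hp, fn_scale _ _ hp]

/-- `g` is at late times a polynomial in `ū` of degree at most `l / 2`. -/
def LateDegree (l : ℤ) (g : Sm upperO) : Prop := d3^[(l / 2 + 1).toNat] (toLate g) = 0

/-- The span of the families `α^{2l} g(ξ, ū / α⁴)` with `l ≥ w`, where `g` is at late times a
polynomial of degree at most `l / 2`. -/
def weightSpan (w : ℤ) : AddSubgroup (Param → Sm upperO) :=
  AddSubgroup.closure {f | ∃ l, w ≤ l ∧ ∃ g, LateDegree l g ∧ f = gen l g}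

theorem gen_mem {w l : ℤ} {g : Sm upperO} (h : w ≤ l) (hg : LateDegree l g) :
    gen l g ∈ weightSpan w := AddSubgroup.subset_closure ⟨l, h, g, hg, rfl⟩

theorem weightSpan_le {w : ℤ} {H : AddSubgroup (Param → Sm upperO)}
    (h : ∀ l, w ≤ l → ∀ g, LateDegree l g → gen l g ∈ H) : weightSpan w ≤ H := by
  refine (AddSubgroup.closure_le H).mpr ?_
  rintro _ ⟨l, hl, g, hg, rfl⟩
  exact h l hl g hg

theorem weightSpan_map {w w' : ℤ} (φ : (Param → Sm upperO) →+ (Param → Sm upperO))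
    (h : ∀ l, w ≤ l → ∀ g, LateDegree l g → φ (gen l g) ∈ weightSpan w') {x : Param → Sm upperO}
    (hx : x ∈ weightSpan w) : φ x ∈ weightSpan w' :=
  weightSpan_le (H := (weightSpan w').comap φ) h hx

theorem gen_mul (l l' : ℤ) (g g' : Sm upperO) : gen l g * gen l' g' = gen (l + l') (g * g') := by
  funext α
  have h : (((α : ℝ) : ℂ)) ≠ 0 := Complex.ofReal_ne_zero.mpr α.2
  change algebraMap ℂ _ _ * scale α g * (algebraMap ℂ _ _ * scale α g')
    = algebraMap ℂ _ _ * scale α (g * g')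
  rw [mul_add, zpow_add₀ h, map_mul, map_mul]
  ring

theorem LateDegree.mul {l l' : ℤ} {g g' : Sm upperO} (hg : LateDegree l g)
    (hg' : LateDegree l' g') : LateDegree (l + l') (g * g') := by
  unfold LateDegree at *
  rw [map_mul]
  by_cases h : l < 0
  · rw [show (l / 2 + 1).toNat = 0 by omega] at hg
    rw [show toLate g = 0 from hg, zero_mul, iterate_map_zero]
  by_cases h' : l' < 0
  · rw [show (l' / 2 + 1).toNat = 0 by omega] at hg'
    rw [show toLate g' = 0 from hg', mul_zero, iterate_map_zero]
  exact iterate_leibniz _ _ hg hg' (by omega)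

theorem d3_gen (l : ℤ) (g : Sm upperO) : d3 (gen l g) = gen (l - 2) (d3 g) := by
  funext α
  have h : (((α : ℝ) : ℂ)) ≠ 0 := Complex.ofReal_ne_zero.mpr α.2
  change d3 (algebraMap ℂ _ _ * scale α g) = algebraMap ℂ _ _ * scale α (d3 g)
  rw [Der.leibniz, d3_algebraMap, zero_mul, zero_add, d3_scale, ← mul_assoc, ← map_mul]
  congr 2
  rw [mul_sub, zpow_sub₀ h, div_eq_mul_inv]
  push_cast
  norm_cast

theorem weightSpan_op (φ : Sm upperO →+ Sm upperO) (φ' : Sm lateO →+ Sm lateO)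
    (h1 : ∀ l g α, φ (gen l g α) = gen l (φ g) α) (h2 : ∀ g, toLate (φ g) = φ' (toLate g))
    (h3 : ∀ x, φ' (d3 x) = d3 (φ' x)) {w : ℤ} {x : Param → Sm upperO} (hx : x ∈ weightSpan w) :
    (fun α => φ (x α)) ∈ weightSpan w := by
  refine weightSpan_map (φ.compLeft Param) (fun l hl g hg => ?_) hx
  have e : φ.compLeft Param (gen l g) = gen l (φ g) := funext fun α => h1 l g α
  rw [e]
  refine gen_mem hl ?_
  unfold LateDegree at *
  rw [h2, ← (Function.Semiconj.iterate_right (f := φ') (ga := d3) (gb := d3) h3 _) _, hg, map_zero]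

theorem gen_zero_mem {g : Sm upperO} (hg : d3 g = 0) : gen 0 g ∈ weightSpan 0 := by
  refine gen_mem le_rfl ?_
  change d3 (toLate g) = 0
  rw [← isCoefHom_toLate.d3, hg, map_zero]

theorem gen_zero_eq {g : Sm upperO} (h : ∀ α, scale α g = g) : gen 0 g = fun _ => g :=
  funext fun α => by rw [gen, mul_zero, zpow_zero, map_one, one_mul, h]

theorem isWeight_weightSpan : IsWeight weightSpan where
  le hx h := weightSpan_le (fun l hl g hg => gen_mem (h.trans hl) hg) hx
  mul {a b x y} hx hy := by
    refine weightSpan_map (w := a) (AddMonoidHom.mulRight y) (fun l hl g hg => ?_) hx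
    refine weightSpan_map (w := b) (AddMonoidHom.mulLeft (gen l g)) (fun l' hl' g' hg' => ?_) hy
    change gen l g * gen l' g' ∈ _
    rw [gen_mul]
    exact gen_mem (by omega) (hg.mul hg')
  d1 hx := weightSpan_op d1.toAddMonoidHom d1.toAddMonoidHom
    (fun l g α => by
      change d1 (algebraMap ℂ _ _ * scale α g) = algebraMap ℂ _ _ * scale α (d1 g)
      rw [Der.leibniz, d1_algebraMap, zero_mul, zero_add, scale_d1])
    isCoefHom_toLate.d1 d1_d3 hx
  d2 hx := weightSpan_op d2.toAddMonoidHom d2.toAddMonoidHom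
    (fun l g α => by
      change d2 (algebraMap ℂ _ _ * scale α g) = algebraMap ℂ _ _ * scale α (d2 g)
      rw [Der.leibniz, d2_algebraMap, zero_mul, zero_add, scale_d2])
    isCoefHom_toLate.d2 d2_d3 hx
  d3 hx := by
    refine weightSpan_map d3.toAddMonoidHom (fun l hl g hg => ?_) hx
    change d3 (gen l g) ∈ _
    rw [d3_gen]
    refine gen_mem (by omega) ?_
    unfold LateDegree at *
    rw [isCoefHom_toLate.d3]
    by_cases h : l < 0
    · rw [show (l / 2 + 1).toNat = 0 by omega] at hg
      rw [show toLate g = 0 from hg, map_zero, iterate_map_zero]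
    · rwa [show (l / 2 + 1).toNat = ((l - 2) / 2 + 1).toNat + 1 by omega,
        Function.iterate_succ_apply] at hg
  cj hx := weightSpan_op cj.toAddMonoidHom cj.toAddMonoidHom
    (fun l g α => by
      change cj (algebraMap ℂ _ _ * scale α g) = algebraMap ℂ _ _ * scale α (cj g)
      rw [map_mul, cj_algebraMap, scale_cj, map_zpow₀, Complex.conj_ofReal])
    isCoefHom_toLate.cj cj_d3 hx
  const c := by
    have h : gen 0 (algebraMap ℂ _ c) = algebraMap ℂ (Param → Sm upperO) c :=
      gen_zero_eq fun α => Sm.ext_fn fun p hp => by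
        rw [fn_scale _ _ hp, Sm.fn_algebraMap _ hp,
          Sm.fn_algebraMap _ (div_pos hp α.pow_four_pos : (p.1, p.2 / (α : ℝ) ^ 4) ∈ upperO)]
    exact h ▸ gen_zero_mem (d3_algebraMap c)
  lam := by
    have h : gen 0 lam = (lam : Param → Sm upperO) :=
      gen_zero_eq fun α => Sm.ext_fn fun p hp => by
        rw [fn_scale _ _ hp, fn_lam hp,
          fn_lam (div_pos hp α.pow_four_pos : (p.1, p.2 / (α : ℝ) ^ 4) ∈ upperO)]
    exact h ▸ gen_zero_mem d3_lam
  s := by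
    have h : gen 2 s = (s : Param → Sm upperO) := funext fun α => Sm.ext_fn fun p hp => by
      have h0 : (((α : ℝ) : ℂ)) ≠ 0 := Complex.ofReal_ne_zero.mpr α.2
      rw [fn_gen _ _ _ hp, fn_s (div_pos hp α.pow_four_pos : (p.1, p.2 / (α : ℝ) ^ 4) ∈ upperO)]
      change _ = (s : Sm upperO).fn p
      rw [fn_s hp]
      push_cast
      exact mul_div_cancel₀ _ (pow_ne_zero 4 h0)
    refine h ▸ gen_mem (by norm_num) ?_
    change d3 (d3 (toLate s)) = 0
    rw [isCoefHom_toLate.s, d3_s, Der.map_one]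

/-- Functions of `(ξ, ū)` are determined by `∂/∂ū` and their values at one `ū`. -/
theorem Sm.eq_of_d3 {f g : Sm upperO} {c : ℝ} (hc : 0 < c) (h : d3 f = d3 g)
    (h' : ∀ ξ, f.fn (ξ, c) = g.fn (ξ, c)) : f = g := by
  refine Sm.ext_fn fun ⟨ξ, s⟩ hp => ?_
  have h1 := f.integral_d3 ξ hc (show 0 < s from hp)
  have h2 := g.integral_d3 ξ hc (show 0 < s from hp)
  rw [h, h2] at h1
  linear_combination h' ξ - h1

theorem mem_weightSpan_of_d3 {f : Param → Sm upperO} {w : ℤ} (hw : -2 ≤ w)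
    (hf : ∀ (α : Param) ξ, (f α).fn (ξ, (α : ℝ) ^ 4 / 4) = 0) (h : d3 f ∈ weightSpan w) :
    f ∈ weightSpan (w + 2) := by
  suffices H : ∀ x ∈ weightSpan w, ∃ F ∈ weightSpan (w + 2), d3 F = x ∧
      ∀ (α : Param) ξ, (F α).fn (ξ, (α : ℝ) ^ 4 / 4) = 0 by
    obtain ⟨F, h1, h2, h3⟩ := H _ h
    have e : f = F := funext fun α => Sm.eq_of_d3 (div_pos α.pow_four_pos four_pos)
      (congrFun h2.symm α) fun ξ => by rw [hf, h3]
    exact e ▸ h1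
  have hpos : ∀ (α : Param) (ξ : ℂ), (ξ, (α : ℝ) ^ 4 / 4) ∈ upperO := fun α ξ =>
    div_pos α.pow_four_pos four_pos
  intro x hx
  induction hx using AddSubgroup.closure_induction with
  | mem x hx =>
    obtain ⟨l, hl, g, hg, rfl⟩ := hx
    have h4 : (0 : ℝ) < 1 / 4 := by norm_num
    refine ⟨gen (l + 2) (Sm.primitive (1 / 4) h4 g), gen_mem (by omega) ?_, ?_, fun α ξ => ?_⟩
    · unfold LateDegree at *
      rw [show ((l + 2) / 2 + 1).toNat = (l / 2 + 1).toNat + 1 by omega,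
        Function.iterate_succ_apply, ← isCoefHom_toLate.d3, Sm.d3_primitive, hg]
    · rw [d3_gen, Sm.d3_primitive, add_sub_cancel_right]
    · have h5 : (α : ℝ) ^ 4 / 4 / (α : ℝ) ^ 4 = 1 / 4 := by
        have := α.pow_four_pos.ne'
        rw [div_right_comm, div_self this]
      rw [fn_gen _ _ _ (hpos α ξ), h5, Sm.fn_primitive h4 g (show (ξ, (1 / 4 : ℝ)) ∈ upperO from h4),
        intervalIntegral.integral_same, mul_zero]
  | zero => exact ⟨0, zero_mem _, map_zero _, fun α ξ => Sm.fn_zero _⟩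
  | add x y _ _ hx hy =>
    obtain ⟨F, h1, rfl, h3⟩ := hx
    obtain ⟨G, k1, rfl, k3⟩ := hy
    refine ⟨F + G, add_mem h1 k1, map_add _ _ _, fun α ξ => ?_⟩
    rw [Pi.add_apply, Sm.fn_add _ _ (hpos α ξ), h3, k3, add_zero]
  | neg x _ hx =>
    obtain ⟨F, h1, rfl, h3⟩ := hx
    refine ⟨-F, neg_mem h1, map_neg _ _, fun α ξ => ?_⟩
    rw [Pi.neg_apply, ← zero_sub, Sm.fn_sub _ _ (hpos α ξ), h3, Sm.fn_zero, sub_zero]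

/-- At late times the family `f` is given by the polynomial in `ū` and `α²` with the coefficients
`c j l`; all its terms have weight at least `w`. -/
structure IsLatePolynomial (w : ℤ) (D : ℕ) (c : ℕ → ℕ → ℂ → ℂ) (f : Param → Sm upperO) : Prop where
  smooth : ∀ j l, ContDiff ℝ ∞ (c j l)
  support : ∀ j l, D ≤ j ∨ D ≤ l ∨ (2 * j + l : ℤ) < w → c j l = 0
  eq : ∀ (α : Param) ξ (s : ℝ), 3 / 4 * (α : ℝ) ^ 4 < s → (f α).fn (ξ, s) =
    ∑ j ∈ Finset.range D, ∑ l ∈ Finset.range D,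
      c j l ξ * (s : ℂ) ^ j * (((α : ℝ) : ℂ) ^ 2) ^ l

theorem IsLatePolynomial.mono {w : ℤ} {D D' : ℕ} {c : ℕ → ℕ → ℂ → ℂ} {f : Param → Sm upperO}
    (h : IsLatePolynomial w D c f) (hD : D ≤ D') : IsLatePolynomial w D' c f := by
  refine ⟨h.smooth, fun j l hjl => h.support j l (by omega), fun α ξ s hs => ?_⟩
  rw [h.eq α ξ s hs]
  have hsub := Finset.range_subset_range.mpr hD
  rw [← Finset.sum_subset hsub fun j _ hj => Finset.sum_eq_zero fun l _ => by
    rw [h.support j l (Or.inl (by simpa using hj))]; simp]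
  refine Finset.sum_congr rfl fun j _ => Finset.sum_subset hsub fun l _ hl => ?_
  rw [h.support j l (Or.inr (Or.inl (by simpa using hl)))]
  simp

theorem exists_isLatePolynomial {w : ℤ} {f : Param → Sm upperO} (hf : f ∈ weightSpan w) :
    ∃ D c, IsLatePolynomial w D c f := by
  have hup : ∀ {α : Param} {ξ : ℂ} {s : ℝ}, 3 / 4 * (α : ℝ) ^ 4 < s → (ξ, s) ∈ upperO :=
    fun {α ξ s} hs => (mul_pos (by norm_num) α.pow_four_pos).trans hs
  induction hf using AddSubgroup.closure_induction with
  | mem x hx =>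
    obtain ⟨l, hl, g, hg, rfl⟩ := hx
    obtain ⟨c, hc, hgc⟩ := late_polynomial _ _ hg
    set N := (l / 2 + 1).toNat with hN
    refine ⟨l.toNat + 1, fun j m ξ => if (2 * j + m : ℤ) = l ∧ j < N then c j ξ else 0, ?_, ?_, ?_⟩
    · intro j m
      by_cases h : (2 * j + m : ℤ) = l ∧ j < N
      · simpa [h] using hc j
      · simpa [h] using contDiff_const
    · intro j m h
      funext ξ
      rw [if_neg (by omega)]
      rfl
    · intro α ξ s hs
      have h0 : (((α : ℝ) : ℂ)) ≠ 0 := Complex.ofReal_ne_zero.mpr α.2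
      have hs' : 3 / 4 < s / (α : ℝ) ^ 4 := (lt_div_iff₀ α.pow_four_pos).mpr hs
      rw [fn_gen _ _ _ (hup hs), ← fn_toLate g (p := (ξ, s / (α : ℝ) ^ 4)) hs', hgc _ _ hs',
        Finset.mul_sum]
      have hsub : Finset.range N ⊆ Finset.range (l.toNat + 1) :=
        Finset.range_subset_range.mpr (by omega)
      rw [← Finset.sum_subset hsub fun j _ hj => Finset.sum_eq_zero fun m _ => by
        rw [if_neg fun h => hj (Finset.mem_range.mpr h.2)]; simp]
      refine Finset.sum_congr rfl fun j hj => ?_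
      have hj' := Finset.mem_range.mp hj
      rw [Finset.sum_eq_single (l - 2 * j).toNat]
      · rw [if_pos ⟨by omega, hj'⟩]
        have e : (((α : ℝ) : ℂ) ^ 2) ^ (l - 2 * j).toNat
            = ((α : ℝ) : ℂ) ^ (2 * l) / (((α : ℝ) : ℂ) ^ 4) ^ j := by
          rw [← pow_mul, ← pow_mul, eq_div_iff (pow_ne_zero _ h0), ← pow_add, ← zpow_natCast]
          congr 1
          omega
        rw [e]
        push_cast
        rw [div_pow]
        ring
      · intro m _ hm
        rw [if_neg (by omega)]
        simp
      · intro h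
        exact absurd (Finset.mem_range.mpr (by omega)) h
  | zero =>
    refine ⟨0, fun _ _ _ => 0, fun _ _ => contDiff_const, fun _ _ _ => rfl, fun α ξ s _ => ?_⟩
    exact Sm.fn_zero _
  | add x y _ _ hx hy =>
    obtain ⟨D, c, h⟩ := hx
    obtain ⟨D', c', h'⟩ := hy
    have k := h.mono (le_max_left D D')
    have k' := h'.mono (le_max_right D D')
    refine ⟨max D D', fun j l ξ => c j l ξ + c' j l ξ, fun j l => (h.smooth j l).add (h'.smooth j l),
      fun j l hjl => ?_, fun α ξ s hs => ?_⟩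
    · funext ξ
      rw [k.support j l hjl, k'.support j l hjl]
      simp
    · rw [Pi.add_apply, Sm.fn_add _ _ (hup hs), k.eq α ξ s hs, k'.eq α ξ s hs]
      simp only [add_mul, Finset.sum_add_distrib]
  | neg x _ hx =>
    obtain ⟨D, c, h⟩ := hx
    refine ⟨D, fun j l ξ => -c j l ξ, fun j l => (h.smooth j l).neg, fun j l hjl => ?_,
      fun α ξ s hs => ?_⟩
    · funext ξ
      rw [h.support j l hjl]
      simp
    · rw [Pi.neg_apply, ← zero_sub, Sm.fn_sub _ _ (hup hs), h.eq α ξ s hs, Sm.fn_zero]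
      simp only [neg_mul, Finset.sum_neg_distrib, zero_sub]

end Families

/-! ### The far field solution at late times -/

section LateExpansion

open TopologicalSpace CoefRing Cpt

/-- At late times the far field solutions with data `η` are given by the polynomials in `ū` and `α²`
with the coefficients `c`, which respect the weights. -/
structure IsLateExpansion (η : Coef) (d : ℕ → ℕ) (c : ℕ → Cpt → ℕ → ℕ → ℂ → ℂ) : Prop where
  smooth : ∀ k i j l, ContDiff ℝ ∞ (c k i j l)
  support : ∀ k i (j l : ℕ), (2 * j + l : ℤ) < wt i → c k i j l = 0
  eq : ∀ α : ℝ, α ≠ 0 → ∀ Ψ, IsFarFieldSolution (finiteMassData α η) (α ^ 4 / 2) Ψ →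
    ∀ k i ξ s, 3 / 4 * α ^ 4 < s → Ψ k i (ξ, s) = polynomialField d c α k i (ξ, s)

variable {η : Coef} (hη : ContDiffOn ℝ ∞ η upper)
  (hsupp : ∀ p ∈ upper, η p ≠ 0 → 1 / 2 < p.2 ∧ p.2 < 3 / 4)

include hη hsupp

theorem exists_solution_finiteMassData {α : ℝ} (hα : α ≠ 0) :
    ∃ Ψ, IsFarFieldSolution (finiteMassData α η) (α ^ 4 / 2) Ψ :=
  exists_isFarFieldSolution (contDiffOn_finiteMassData hη hα) (by positivity) fun _ hp h =>
    finiteMassData_past hsupp hα hp h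

theorem exists_isLatePolynomial_solution :
    ∃ (D : ℕ → Cpt → ℕ) (c : ℕ → Cpt → ℕ → ℕ → ℂ → ℂ) (ψ : ℕ → Cpt → Param → Sm upperO),
      (∀ k i, IsLatePolynomial (wt i) (D k i) (c k i) (ψ k i)) ∧
      ∀ α : Param, IsFarFieldSolution (finiteMassData α η) ((α : ℝ) ^ 4 / 2)
        (toFormal fun k i => ψ k i α) := by
  choose F hF using fun α : Param => exists_solution_finiteMassData hη hsupp α.2
  let ψ : ℕ → Cpt → Param → Sm upperO := fun k i α => ofFormal (F α) (hF α).solution.smooth k i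
  have hψ : ∀ α k i, ∀ p ∈ upper, F α k i p = (ψ k i α).fn p := fun α =>
    fn_ofFormal (F α) (hF α).solution.smooth
  have hmap : ∀ α i, coeffMap (Pi.evalRingHom (fun _ : Param => Sm upperO) α) (fullK ψ i)
      = fullK (fun k i => ψ k i α) i := fun α i => (isCoefHom_eval α).fullK ψ i
  have hr : ∀ i, gres (fullK ψ) i = 0 := fun i => by
    ext n α
    have h := (isCoefHom_eval (K := Sm upperO) α).isDiffHom.gres (fullK ψ) i
    simp only [hmap, ((isFormalSolution_iff (hψ α)).mp (hF α).solution).2 i] at h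
    exact congrArg (fun z => HahnSeries.coeff z n) h
  have hc : ∀ j, gcon (fullK ψ) j = 0 := fun j => by
    ext n α
    have h := (isCoefHom_eval (K := Sm upperO) α).isDiffHom.gcon (fullK ψ) j
    simp only [hmap, (constraintsVanish_iff (hψ α)).mp (hF α).constraints j] at h
    exact congrArg (fun z => HahnSeries.coeff z n) h
  have h0 : ψ 0 .γ1 = gen (-1) (Sm.mk (U := upperO) η hη) := funext fun α => Sm.ext_fn fun p hp => by
    have hq : (p.1, p.2 / (α : ℝ) ^ 4) ∈ upperO := div_pos hp α.pow_four_pos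
    rw [← hψ α 0 .γ1 p hp, (hF α).data_eq hp, fn_gen _ _ _ hp, Sm.fn_mk hη hq, finiteMassData,
      show (2 * -1 : ℤ) = -(2 : ℕ) by norm_num, zpow_neg, zpow_natCast]
    push_cast
    rfl
  have hlate : LateDegree (-1) (Sm.mk (U := upperO) η hη) := Sm.ext_fn fun p hp => by
    change (toLate _).fn p = _
    rw [fn_toLate _ hp, Sm.fn_mk hη (lateO_le hp), Sm.fn_zero]
    by_contra h
    exact lt_asymm (hsupp p (lateO_le hp) h).2 hp
  have hmem := mem_wt isWeight_weightSpan hr hc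
    (fun k i w hw h => mem_weightSpan_of_d3 hw (fun α ξ => by
      have := α.pow_four_pos
      have hp : (ξ, (α : ℝ) ^ 4 / 4) ∈ upper := div_pos this four_pos
      rw [← hψ α k i _ hp]
      refine (hF α).vanish k i _ hp ?_
      change (α : ℝ) ^ 4 / 4 < (α : ℝ) ^ 4 / 2
      linarith) h)
    (h0 ▸ gen_mem le_rfl hlate)
  choose D c hD using fun k i => exists_isLatePolynomial (hmem k i)
  refine ⟨D, c, ψ, hD, fun α => ?_⟩
  have e : ∀ k i, ∀ p ∈ upper, toFormal (fun k i => ψ k i α) k i p = (ψ k i α).fn p :=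
    fun _ _ _ _ => rfl
  have hs := (isFormalSolution_iff (hψ α)).mp (hF α).solution
  refine ⟨(isFormalSolution_iff e).mpr hs, (constraintsVanish_iff e).mpr
    ((constraintsVanish_iff (hψ α)).mp (hF α).constraints), fun k i p hp hu => ?_, fun p hp => ?_⟩
  · rw [e k i p hp, ← hψ α k i p hp, (hF α).vanish k i p hp hu]
  · rw [e 0 _ p hp, ← hψ α 0 _ p hp, (hF α).data_eq hp]

end LateExpansion

section LateExpansion

theorem exists_bound (f : Bool → Cpt → ℕ) : ∃ d, ∀ σ i, f σ i ≤ d := by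
  have h : (Set.univ : Set (Bool × Cpt)).Finite := by
    have : Finite Cpt := by
      refine Finite.of_surjective (α := Fin 18)
        ![.e1, .e2, .e3, .e4, .e5, .γ1, .γ2, .γ3, .γ4, .γ5, .γ6, .γ7, .γ8, .w1, .w2, .w3, .w4, .w5]
        fun i => ?_
      cases i
      exacts [⟨0, rfl⟩, ⟨1, rfl⟩, ⟨2, rfl⟩, ⟨3, rfl⟩, ⟨4, rfl⟩, ⟨5, rfl⟩, ⟨6, rfl⟩, ⟨7, rfl⟩,
        ⟨8, rfl⟩, ⟨9, rfl⟩, ⟨10, rfl⟩, ⟨11, rfl⟩, ⟨12, rfl⟩, ⟨13, rfl⟩, ⟨14, rfl⟩, ⟨15, rfl⟩,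
        ⟨16, rfl⟩, ⟨17, rfl⟩]
    exact Set.finite_univ
  obtain ⟨d, hd⟩ := (h.image fun q => f q.1 q.2).bddAbove
  exact ⟨d, fun σ i => hd ⟨(σ, i), mem_univ _, rfl⟩⟩

/-- The late time polynomials exist, with common bounds for the degrees. -/
theorem exists_isLateExpansion {η : Bool → Coef} (hη : ∀ σ, ContDiffOn ℝ ∞ (η σ) upper)
    (hsupp : ∀ σ, ∀ p ∈ upper, η σ p ≠ 0 → 1 / 2 < p.2 ∧ p.2 < 3 / 4) :
    ∃ (d : ℕ → ℕ) (c : Bool → ℕ → Cpt → ℕ → ℕ → ℂ → ℂ), ∀ σ, IsLateExpansion (η σ) d (c σ) := by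
  choose D c ψ h h' using fun σ => exists_isLatePolynomial_solution (hη σ) (hsupp σ)
  choose d hd using fun k => exists_bound fun σ i => D σ k i
  refine ⟨d, c, fun σ => ⟨fun k i => (h σ k i).smooth, fun k i j l hjl =>
    (h σ k i).support j l (Or.inr (Or.inr hjl)), fun α hα Ψ hΨ k i ξ s hs => ?_⟩⟩
  have hp : (ξ, s) ∈ upper := lt_trans (by positivity : (0 : ℝ) < 3 / 4 * α ^ 4) hs
  have := hΨ.agree (by positivity) (h' σ ⟨α, hα⟩) k i hp
  rw [this]
  exact ((h σ k i).mono (hd k σ i)).eq ⟨α, hα⟩ ξ s hs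

end LateExpansion

/-! ### The limit of vanishing parameter -/

section Limit

open TopologicalSpace CoefRing

/-- Coefficient functions of `(ξ, ū)`, defined for all `ū`, that depend on a parameter. -/
abbrev SmParam : Type := Sm (⊤ : Opens (Slice × ℝ))

theorem hasFDerivAt_mk_left (x : ℝ) (p : Slice) :
    HasFDerivAt (fun p : Slice => (p, x)) (ContinuousLinearMap.inl ℝ Slice ℝ) p :=
  (hasFDerivAt_id p).prodMk (hasFDerivAt_const x p)

/-- The value at a parameter, on an open set. -/
def atParam (x : ℝ) (U : Opens Slice) : SmParam →+* Sm U :=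
  Sm.pullback (fun p => (p, x)) (ContDiff.contDiffOn (by fun_prop)) fun _ _ => mem_univ _

theorem fn_atParam (x : ℝ) {U : Opens Slice} (F : SmParam) {p : Slice} (hp : p ∈ U) :
    (atParam x U F).fn p = F.fn (p, x) := Sm.fn_pullback F hp

theorem isCoefHom_atParam (x : ℝ) (U : Opens Slice) : IsCoefHom (atParam x U) :=
  Sm.isCoefHom_pullback (fun _ _ => rfl) (fun p _ => by rw [(hasFDerivAt_mk_left x p).fderiv]; rfl)
    (fun p _ => by rw [(hasFDerivAt_mk_left x p).fderiv]; rfl)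
    (fun p _ => by rw [(hasFDerivAt_mk_left x p).fderiv]; rfl)

theorem SmParam.continuous (F : SmParam) : Continuous F.fn :=
  (contDiffOn_univ.mp F.contDiffOn).continuous

theorem limit_param {F : SmParam} {v : ℂ → ℂ} (h : ∀ α : ℝ, α ≠ 0 → ∀ ξ s,
    3 / 4 * α ^ 4 < s → F.fn ((ξ, s), α ^ 2) = v ξ) {ξ : ℂ} {s : ℝ} (hs : 0 ≤ s) :
    F.fn ((ξ, s), 0) = v ξ := by
  have h1 : Continuous fun α : ℝ => F.fn ((ξ, s + α ^ 4), α ^ 2) := F.continuous.comp (by fun_prop)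
  have h2 : Tendsto (fun α : ℝ => F.fn ((ξ, s + α ^ 4), α ^ 2)) (𝓝[≠] 0) (𝓝 (F.fn ((ξ, s), 0))) := by
    have := h1.tendsto 0
    simp only [ne_eq, OfNat.ofNat_ne_zero, not_false_eq_true, zero_pow, add_zero] at this
    exact this.mono_left nhdsWithin_le_nhds
  refine tendsto_nhds_unique (h2.congr' ?_) (tendsto_const_nhds (x := v ξ))
  filter_upwards [self_mem_nhdsWithin] with α hα
  have h4 : 0 < α ^ 4 := by have : α ≠ 0 := hα; positivity
  exact h α hα _ _ (by linarith)

variable {η : Coef} {d : ℕ → ℕ} {c : ℕ → Cpt → ℕ → ℕ → ℂ → ℂ}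

theorem contDiff_polynomial (h : IsLateExpansion η d c) (k : ℕ) (i : Cpt) :
    ContDiff ℝ ∞ fun q : Slice × ℝ => ∑ j ∈ Finset.range (d k), ∑ l ∈ Finset.range (d k),
      c k i j l q.1.1 * (q.1.2 : ℂ) ^ j * (q.2 : ℂ) ^ l := by
  have h1 : ContDiff ℝ ∞ fun q : Slice × ℝ => (q.1.2 : ℂ) :=
    Complex.ofRealCLM.contDiff.comp (by fun_prop)
  have h2 : ContDiff ℝ ∞ fun q : Slice × ℝ => (q.2 : ℂ) :=
    Complex.ofRealCLM.contDiff.comp (by fun_prop)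
  have h3 : ContDiff ℝ ∞ fun q : Slice × ℝ => q.1.1 := by fun_prop
  exact ContDiff.sum fun j _ => ContDiff.sum fun l _ =>
    (((h.smooth k i j l).comp h3).mul (h1.pow j)).mul (h2.pow l)

/-- The late time polynomials. -/
def lateSm (h : IsLateExpansion η d c) (k : ℕ) (i : Cpt) : SmParam :=
  Sm.mk _ (contDiff_polynomial h k i).contDiffOn

theorem fn_lateSm (h : IsLateExpansion η d c) (k : ℕ) (i : Cpt) (q : Slice × ℝ) :
    (lateSm h k i).fn q = ∑ j ∈ Finset.range (d k), ∑ l ∈ Finset.range (d k),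
      c k i j l q.1.1 * (q.1.2 : ℂ) ^ j * (q.2 : ℂ) ^ l := Sm.fn_mk _ (mem_univ q)

theorem constantTermField_eq (h : IsLateExpansion η d c) (k : ℕ) (i : Cpt) (p : Slice) :
    constantTermField d c k i p = (lateSm h k i).fn (p, 0) := by
  rw [fn_lateSm, constantTermField]
  refine Finset.sum_congr rfl fun j hj => ?_
  rw [Finset.sum_eq_single_of_mem 0 (by simp at hj ⊢; omega) fun l _ hl => by simp [hl]]
  simp

theorem lateSm_zero (h : IsLateExpansion η d c) (k : ℕ) {i : Cpt} (hi : 0 < wt i) (ξ : ℂ) :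
    (lateSm h k i).fn ((ξ, 0), 0) = 0 := by
  rw [fn_lateSm]
  refine Finset.sum_eq_zero fun j _ => Finset.sum_eq_zero fun l _ => ?_
  rcases Nat.eq_zero_or_pos j with rfl | hj
  · rcases Nat.eq_zero_or_pos l with rfl | hl
    · rw [h.support k i 0 0 (by simpa using hi)]
      simp
    · simp [hl.ne']
  · simp [hj.ne']

theorem fn_lateSm_late (h : IsLateExpansion η d c) {α : ℝ} (hα : α ≠ 0) {Ψ : FormalField}
    (hΨ : IsFarFieldSolution (finiteMassData α η) (α ^ 4 / 2) Ψ) (k : ℕ) (i : Cpt) {ξ : ℂ} {s : ℝ}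
    (hs : 3 / 4 * α ^ 4 < s) : (lateSm h k i).fn ((ξ, s), α ^ 2) = Ψ k i (ξ, s) := by
  rw [h.eq α hα Ψ hΨ k i ξ s hs, fn_lateSm, polynomialField]
  push_cast
  rfl

variable (hη : ContDiffOn ℝ ∞ η upper)
  (hsupp : ∀ p ∈ upper, η p ≠ 0 → 1 / 2 < p.2 ∧ p.2 < 3 / 4) (h : IsLateExpansion η d c)

include hη hsupp

/-- A relation that holds for the far field solutions holds at late times for the polynomials. -/
theorem late_relation {R : ∀ {K : Type} [CommRing K] [Algebra ℂ K] [CoefRing K],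
      (ℕ → Cpt → K) → K}
    (hR : ∀ {K K' : Type} [CommRing K] [Algebra ℂ K] [CoefRing K] [CommRing K'] [Algebra ℂ K']
      [CoefRing K'] {π : K →+* K'}, IsCoefHom π → ∀ Ψ : ℕ → Cpt → K,
      π (R Ψ) = R fun k i => π (Ψ k i))
    (h0 : ∀ ψ : ℕ → Cpt → Sm upperO, (∀ k i, IsRealCpt i → cj (ψ k i) = ψ k i) →
      (∀ i, gres (fullK ψ) i = 0) → (∀ j, gcon (fullK ψ) j = 0) → R ψ = 0)
    {ξ : ℂ} {s : ℝ} (hs : 0 ≤ s) : (R (lateSm h)).fn ((ξ, s), 0) = 0 := by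
  refine limit_param (v := fun _ => 0) (fun α hα ξ s hs => ?_) hs
  obtain ⟨Ψ, hΨ⟩ := exists_solution_finiteMassData hη hsupp hα
  let V : Opens Slice := ⟨{p | 3 / 4 * α ^ 4 < p.2}, isOpen_lt continuous_const continuous_snd⟩
  have hV : ∀ p ∈ V, p ∈ upperO := fun p hp =>
    lt_trans (by positivity : (0 : ℝ) < 3 / 4 * α ^ 4) hp
  let ρ : Sm upperO →+* Sm V := Sm.pullback id contDiffOn_id hV
  have hρ : IsCoefHom ρ := Sm.isCoefHom_pullback (fun _ _ => rfl) (fun p _ => by rw [fderiv_id]; rfl)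
    (fun p _ => by rw [fderiv_id]; rfl) (fun p _ => by rw [fderiv_id]; rfl)
  have hψ := fn_ofFormal Ψ hΨ.solution.smooth
  set ψ := ofFormal Ψ hΨ.solution.smooth
  have hs1 := (isFormalSolution_iff hψ).mp hΨ.solution
  have e : (fun k i => atParam (α ^ 2) V (lateSm h k i)) = fun k i => ρ (ψ k i) := by
    funext k i
    refine Sm.ext_fn fun p hp => ?_
    rw [fn_atParam _ _ hp, fn_lateSm_late h hα hΨ k i hp, hψ k i p (hV p hp)]
    have h5 : (ρ (ψ k i)).fn p = (ψ k i).fn (id p) :=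
      Sm.fn_pullback (φ := id) (hφ := contDiffOn_id) (hV := hV) (ψ k i) hp
    exact h5.symm
  have h1 := hR (isCoefHom_atParam (α ^ 2) V) (lateSm h)
  rw [e, ← hR hρ, h0 ψ hs1.1 hs1.2 ((constraintsVanish_iff hψ).mp hΨ.constraints), map_zero] at h1
  rw [← fn_atParam (α ^ 2) (U := V) _ (show (ξ, s) ∈ V from hs), h1, Sm.fn_zero]

theorem late_gres (i : Cpt) (n : ℤ) {ξ : ℂ} {s : ℝ} (hs : 0 ≤ s) :
    ((gres (fullK (lateSm h)) i).coeff n).fn ((ξ, s), 0) = 0 :=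
  late_relation hη hsupp h (R := fun Ψ => (gres (fullK Ψ) i).coeff n)
    (fun hπ Ψ => by
      rw [← coeffMap_coeff, hπ.isDiffHom.gres]
      simp only [hπ.fullK])
    (fun ψ _ hr _ => by rw [hr]; rfl) hs

theorem late_gcon (j : SharpCpt) (n : ℤ) {ξ : ℂ} {s : ℝ} (hs : 0 ≤ s) :
    ((gcon (fullK (lateSm h)) j).coeff n).fn ((ξ, s), 0) = 0 :=
  late_relation hη hsupp h (R := fun Ψ => (gcon (fullK Ψ) j).coeff n)
    (fun hπ Ψ => by
      rw [← coeffMap_coeff, hπ.isDiffHom.gcon]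
      simp only [hπ.fullK])
    (fun ψ _ _ hc => by rw [hc]; rfl) hs

theorem late_real (k : ℕ) {i : Cpt} (hi : IsRealCpt i) {ξ : ℂ} {s : ℝ} (hs : 0 ≤ s) :
    (cj (lateSm h k i) - lateSm h k i).fn ((ξ, s), 0) = 0 :=
  late_relation hη hsupp h (R := fun Ψ => cj (Ψ k i) - Ψ k i)
    (fun hπ Ψ => by rw [map_sub, hπ.cj])
    (fun ψ hr _ _ => by rw [hr k i hi, sub_self]) hs

end Limit

/-! ### The boundary values at `ū = 0` -/

section Cone

open Cpt SharpCpt CoefRing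
open FarField.DiffRing (Z p4 cj_Z p1_Z p2_Z p4_Z)

variable {K K' : Type*} [CommRing K] [Algebra ℂ K] [CoefRing K] [CommRing K'] [Algebra ℂ K']
  [CoefRing K'] {κ : K →+* K'}

/-- Restriction to `ū = 0`, a homomorphism that is compatible with all the structure except the
derivative with respect to `ū`. -/
structure IsConeHom (κ : K →+* K') : Prop where
  d1 : ∀ x, κ (d1 x) = CoefRing.d1 (κ x)
  d2 : ∀ x, κ (d2 x) = CoefRing.d2 (κ x)
  cj : ∀ x, κ (cj x) = CoefRing.cj (κ x)
  s : κ s = 0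
  lam : κ lam = CoefRing.lam
  algebraMap : ∀ c, κ (algebraMap ℂ K c) = algebraMap ℂ K' c

theorem eq_zero_of_intCast_mul {x : K} {m : ℤ} (hm : m ≠ 0) (h : (m : K) * x = 0) : x = 0 := by
  have h1 : algebraMap ℂ K ((m : ℂ)⁻¹) * (m : K) = 1 := by
    rw [← map_intCast (algebraMap ℂ K) m, ← map_mul, inv_mul_cancel₀ (by exact_mod_cast hm), map_one]
  rw [← one_mul x, ← h1, mul_assoc, h, mul_zero]

/-- The homogeneous solutions of `∂Y/∂u = -m Y/u` are the multiples of `u^{-m}`. -/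
theorem coeff_eq_zero_of_p4 {Y : K⸨X⸩} {m : ℤ}
    (h : p4 Y + cst (m : K) * (Z * Y) = 0) {n : ℤ} (hn : n ≠ m) :
    Y.coeff n = 0 := by
  have h1 := congrArg (fun x => HahnSeries.coeff x (n + 1)) h
  have h2 : (p4 Y).coeff (n + 1) = -((n + 1 - 1 : ℤ) : K) * Y.coeff (n + 1 - 1) :=
    uDer_coeff Y _
  have h3 : (cst (m : K) * (Z * Y)).coeff (n + 1) = (m : K) * Y.coeff n := by
    rw [cst, HahnSeries.C_apply, HahnSeries.coeff_single_zero_mul]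
    have := HahnSeries.coeff_single_mul (r := (1 : K)) (x := Y) (a := n + 1) (b := 1)
    change (m : K) * (HahnSeries.single 1 1 * Y).coeff (n + 1) = _
    rw [this, one_mul, add_sub_cancel_right]
  simp only [HahnSeries.coeff_add, h2, h3, add_sub_cancel_right, HahnSeries.coeff_zero] at h1
  refine eq_zero_of_intCast_mul (m := m - n) (sub_ne_zero.mpr hn.symm) ?_
  push_cast
  linear_combination h1

namespace IsConeHom

variable (hκ : IsConeHom κ)

include hκ

theorem map_p1 (x : K⸨X⸩) :
    coeffMap κ (DiffRing.p1 x) = DiffRing.p1 (coeffMap κ x) := by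
  ext n; exact hκ.d1 _

theorem map_p2 (x : K⸨X⸩) :
    coeffMap κ (DiffRing.p2 x) = DiffRing.p2 (coeffMap κ x) := by
  ext n; exact hκ.d2 _

theorem map_p4 (x : K⸨X⸩) :
    coeffMap κ (p4 x) = p4 (coeffMap κ x) := by
  ext n
  change κ ((uDer x).coeff n) = (uDer (coeffMap κ x)).coeff n
  rw [uDer_coeff, uDer_coeff, map_mul, map_neg, map_intCast, coeffMap_coeff]

theorem map_cj (x : K⸨X⸩) :
    coeffMap κ (DiffRing.cj x) = DiffRing.cj (coeffMap κ x) := by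
  ext n; exact hκ.cj _

theorem map_rinv : coeffMap κ rinv = -Z := by
  ext n
  change κ (rinv.coeff n) = (-HahnSeries.single 1 1 : K'⸨X⸩).coeff n
  rw [rinv_coeff, HahnSeries.coeff_neg, HahnSeries.coeff_single]
  rcases lt_trichotomy n 1 with h | rfl | h
  · rw [if_neg (by omega), if_neg (by omega), map_zero, neg_zero]
  · simp
  · rw [if_pos (by omega), if_neg (by omega), map_neg, map_pow, hκ.s,
      zero_pow (by omega : (n - 1).toNat ≠ 0)]

theorem map_ee : κ ee = ee := by
  simp only [ee, map_add, map_mul, map_ofNat, hκ.lam, hκ.cj, hκ.algebraMap]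

theorem map_im : κ im = im := hκ.algebraMap _

variable {Ψ : ℕ → Cpt → K} {F : Cpt → K'⸨X⸩}
  (hF : ∀ i, F i = coeffMap κ (fullK Ψ i))

include hF

/-- The boundary values satisfy the equations without `∂/∂ū`. -/
theorem boundary (hr : ∀ i n, κ ((gres (fullK Ψ) i).coeff n) = 0)
    (hc : ∀ j n, κ ((gcon (fullK Ψ) j).coeff n) = 0) :
    gres F e3 = 0 ∧ gres F γ5 = 0 ∧ gB1 F = 0 ∧ gcon F u1 = 0 ∧ gcon F u2 = 0 ∧ gcon F u3 = 0 ∧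
      gcon F u4 = 0 := by
  obtain rfl : F = fun i => coeffMap κ (fullK Ψ i) := funext hF
  have hr' : ∀ i, coeffMap κ (gres (fullK Ψ) i) = 0 := fun i => by ext n; exact hr i n
  have hc' : ∀ j, coeffMap κ (gcon (fullK Ψ) j) = 0 := fun i => by ext n; exact hc i n
  have hB : coeffMap κ (gB1 (fullK Ψ)) = 0 := by
    have e := hr' w1
    have u : (Z : K⸨X⸩) ^ 2 * DiffRing.U ^ 2 = 1 := by
      rw [← mul_pow, mul_comm, DiffRing.U_Z, one_pow]
    have : gB1 (fullK Ψ) = Z ^ 2 * gres (fullK Ψ) w1 := by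
      simp only [gres]
      linear_combination -gB1 (fullK Ψ) * u
    rw [this, map_mul, e, mul_zero]
  refine ⟨.trans ?_ (hr' e3), .trans ?_ (hr' γ5), .trans ?_ hB, .trans ?_ (hc' u1),
    .trans ?_ (hc' u2), .trans ?_ (hc' u3), .trans ?_ (hc' u4)⟩ <;>
  simp only [gres, gcon, gB1, op_apply, map_add, map_sub, map_neg, map_mul,
    map_ofNat, hκ.map_p1, hκ.map_p2, hκ.map_p4, hκ.map_cj]

theorem coeff_boundary (i : Cpt) (n : ℤ) : (F i - coeffMap κ (mink i)).coeff n
    = if expM i ≤ n then κ (Ψ (n - expM i).toNat i) else 0 := by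
  rw [hF, HahnSeries.coeff_sub, coeffMap_coeff, coeffMap_coeff, fullK_coeff, map_add]
  split_ifs <;> simp

theorem coeff_boundary_nat (i : Cpt) (k : ℕ) : (F i - coeffMap κ (mink i)).coeff (expM i + k)
    = κ (Ψ k i) := by
  rw [hκ.coeff_boundary hF, if_pos (by omega)]
  congr 3
  omega

theorem boundary_of_weight (h0 : ∀ k i, 0 < wt i → κ (Ψ k i) = 0) {i : Cpt} (hi : 0 < wt i) :
    F i = coeffMap κ (mink i) := by
  refine sub_eq_zero.mp ?_
  ext n
  rw [hκ.coeff_boundary hF]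
  split_ifs
  · rw [h0 _ _ hi, HahnSeries.coeff_zero]
  · rfl

theorem boundary_zero_of_p4 {i : Cpt} {m : ℤ} (hm : m < expM i)
    (h : p4 (F i - coeffMap κ (mink i))
      + cst (m : K') * (Z * (F i - coeffMap κ (mink i))) = 0) :
    F i = coeffMap κ (mink i) := by
  refine sub_eq_zero.mp ?_
  ext n
  by_cases hn : n = m
  · rw [hκ.coeff_boundary hF, if_neg (by omega)]
    rfl
  · exact coeff_eq_zero_of_p4 h hn

end IsConeHom

theorem cst_mul_Z_pow_coeff (c : K) (m : ℕ) (n : ℤ) :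
    (cst c * Z ^ m).coeff n = if n = m then c else 0 := by
  have hZ : (Z : K⸨X⸩) ^ m = HahnSeries.single (m : ℤ) 1 := by
    change (HahnSeries.single 1 (1 : K)) ^ m = _
    rw [HahnSeries.single_pow]
    simp
  rw [hZ, cst, HahnSeries.C_apply, HahnSeries.coeff_single_zero_mul, HahnSeries.coeff_single]
  split_ifs <;> simp

/-- The boundary values of a solution that are determined by the equations along `ū = 0`. -/
theorem boundary_values (hκ : IsConeHom κ) {Ψ : ℕ → Cpt → K}
    (hr : ∀ i n, κ ((gres (fullK Ψ) i).coeff n) = 0)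
    (hc : ∀ j n, κ ((gcon (fullK Ψ) j).coeff n) = 0) (h0 : ∀ k i, 0 < wt i → κ (Ψ k i) = 0)
    (hγ : κ (Ψ 0 γ1) = 0) (hw : κ (Ψ 0 w1) = 0) {l q r : K'} (hl : κ (Ψ 0 γ2) = -l)
    (hq : ee * (d1 l + im * d2 l) = q) (hR : ee * (d1 q + im * d2 q) - 2 * lam * q = 2 * r)
    (k : ℕ) (i : Cpt) :
    κ (Ψ k i) = match i, k with
      | .γ2, 0 => -l
      | .w1, 2 => r
      | .w2, 1 => -q
      | .w3, 0 => l
      | _, _ => 0 := by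
  obtain ⟨F, hF⟩ : ∃ F : Cpt → K'⸨X⸩, ∀ i, F i = coeffMap κ (fullK Ψ i) := ⟨_, fun _ => rfl⟩
  obtain ⟨b1, b2, b3, b4, b5, b6, b7⟩ := hκ.boundary hF hr hc
  have hco := hκ.coeff_boundary_nat hF
  have hW := fun {i} hi => hκ.boundary_of_weight hF h0 (i := i) hi
  have hZp := fun {i m} => hκ.boundary_zero_of_p4 hF (i := i) (m := m)
  have hc0 := hκ.coeff_boundary hF
  have me1 : F e1 = -Z * cst ee := by
    rw [hW (by decide), mink, map_mul, coeffMap_cst, hκ.map_rinv, hκ.map_ee]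
  have me2 : F e2 = -(cst im * (Z * cst ee)) := by
    rw [hW (by decide), mink, map_mul, map_mul, coeffMap_cst, coeffMap_cst, hκ.map_rinv, hκ.map_ee,
      hκ.map_im]
    ring
  have me4 : F e4 = 0 := (hW (by decide)).trans (map_zero _)
  have me5 : F e5 = 0 := (hW (by decide)).trans (map_zero _)
  have mg3 : F γ3 = -Z * cst lam := by
    rw [hW (by decide), mink, map_mul, coeffMap_cst, hκ.map_rinv, hκ.lam]
  have mg4 : F γ4 = -Z * cst (cj lam) := by
    rw [hW (by decide), mink, map_mul, coeffMap_cst, hκ.map_rinv, hκ.cj, hκ.lam]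
  have mg6 : F γ6 = Z := by
    rw [hW (by decide), mink, map_neg, hκ.map_rinv, neg_neg]
  have mg7 : F γ7 = 0 := (hW (by decide)).trans (map_zero _)
  have mg8 : F γ8 = 0 := (hW (by decide)).trans (map_zero _)
  have mw4 : F w4 = 0 := (hW (by decide)).trans (map_zero _)
  have mw5 : F w5 = 0 := (hW (by decide)).trans (map_zero _)
  have m1 : coeffMap κ (mink e3) = 1 := map_one _
  have m2 : coeffMap κ (mink γ2) = -Z := hκ.map_rinv
  have m0 : coeffMap κ (mink γ1) = 0 ∧ coeffMap κ (mink γ5) = 0 ∧ coeffMap κ (mink w1) = 0 ∧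
      coeffMap κ (mink w2) = 0 ∧ coeffMap κ (mink w3) = 0 :=
    ⟨map_zero _, map_zero _, map_zero _, map_zero _, map_zero _⟩
  obtain ⟨n1, n5, nw1, nw2, nw3⟩ := m0
  have ii := im_im_cst (K := K')
  have hf := two_half_cst (K := K')
  -- the frame component `e3` and `γ5`
  have x3 : F e3 = 1 := by
    rw [← m1]
    refine hZp (m := 0) (by decide) ?_
    simp only [gres, op_apply, me4, me5, mg8, map_zero] at b1
    rw [m1, map_sub, Der.map_one, Int.cast_zero, map_zero]
    linear_combination b1
  have g5 : F γ5 = 0 := by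
    rw [← n5]
    refine hZp (m := 1) (by decide) ?_
    simp only [gres, op_apply, me4, me5, mg8, mg7, mg3, mg4, mg6, mw4, map_zero, map_mul, map_neg,
      cj_Z, cj_cst] at b2
    rw [n5, sub_zero, Int.cast_one, map_one]
    linear_combination b2
  -- the component `γ1`
  have g1 : F γ1 = 0 := by
    have h1 : p4 (F γ1) + cst ((1 : ℤ) : K') * (Z * F γ1) = 0 := by
      simp only [gcon, op_apply, me4, me5, mg8, mg7, mg3, mg4, mg6, mw4, map_zero, map_mul, map_neg,
        cj_Z, cj_cst, cj_cj] at b7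
      rw [Int.cast_one, map_one]
      linear_combination -b7
    ext n
    by_cases hn : n = 1
    · subst hn
      have := hco γ1 0
      rw [n1, sub_zero, hγ] at this
      exact this
    · exact coeff_eq_zero_of_p4 h1 hn
  -- the components `γ2` and `w3`
  have hw3 : F w3 = -Z * (F γ2 + Z) := by
    simp only [gcon, op_apply, me1, me2, mg8, mg7, mg3, mg4, mg6, g1, map_zero, map_mul,
      map_neg, cj_Z, cj_cst, cj_cj, cj_ee, cj_im, Der.leibniz, p1_Z,
      p2_Z, p1_cst, p2_cst, d1_lam', d2_lam', ← cj_d1, ← cj_d2, cj_half] at b5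
    linear_combination -b5 + 2 * Z ^ 2 * cst ee * cst (algebraMap ℂ K' (1 / 2)) * ii
      - 2 * Z ^ 2 * cst ee * hf - 2 * Z ^ 2 * cst_ee (K := K')
      - Z ^ 2 * hf
  have h2 : p4 (F γ2 + Z)
      + cst ((2 : ℤ) : K') * (Z * (F γ2 + Z)) = 0 := by
    simp only [gcon, op_apply, me1, me2, me4, me5, mg8, mg7, mg3, mg4, mg6, g1, map_zero,
      map_mul, map_neg, cj_Z, cj_cst, cj_cj] at b6
    rw [map_add, p4_Z, Int.cast_ofNat, map_ofNat]
    linear_combination b6 + hw3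
  have hg2 : F γ2 + Z = -(cst l * Z ^ 2) := by
    ext n
    rw [HahnSeries.coeff_neg, cst_mul_Z_pow_coeff]
    split_ifs with hn
    · subst hn
      have := hco γ2 0
      rw [m2, sub_neg_eq_add, hl] at this
      exact this
    · rw [coeff_eq_zero_of_p4 h2 hn, neg_zero]
  have hw3' : F w3 = cst l * Z ^ 3 := by rw [hw3, hg2]; ring
  have hg2' : F γ2 = -(cst l * Z ^ 2) - Z := by linear_combination hg2
  have hw2 : F w2 = -(cst q * Z ^ 3) := by
    simp only [gcon, op_apply, me1, me2, mg3, mg4, g1, hg2', map_zero, map_sub, map_mul,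
      map_neg, cj_Z, cj_cst, cj_cj, Der.leibniz, p1_Z, p2_Z, p1_cst,
      p2_cst, pow_two] at b4
    have := congrArg (cst (K := K')) hq
    simp only [map_mul, map_add] at this
    linear_combination b4 - Z ^ 3 * this
  have hw1 : F w1 = cst r * Z ^ 3 := by
    have h1 : p4 (F w1 - cst r * Z ^ 3)
        + cst ((1 : ℤ) : K') * (Z * (F w1 - cst r * Z ^ 3)) = 0 := by
      have e3 : (Z : K'⸨X⸩) ^ 3 = Z * (Z * Z) := by ring
      simp only [gB1, op_apply, me1, me2, me4, me5, mg3, mg4, mg6, mg8, g1, hw2, map_zero,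
        map_sub, map_mul, map_neg, cj_Z, cj_cst, cj_cj, Der.leibniz, p1_Z,
        p2_Z, p1_cst, p2_cst, e3] at b3
      have := congrArg (cst (K := K')) hR
      simp only [map_mul, map_add, map_sub, map_ofNat] at this
      rw [Int.cast_one, map_one]
      simp only [e3, map_sub, Der.leibniz, p4_cst, p4_Z]
      linear_combination b3 - Z ^ 4 * this
    refine sub_eq_zero.mp ?_
    ext n
    by_cases hn : n = 1
    · subst hn
      have := hco w1 0
      rw [nw1, sub_zero, hw] at this
      rw [HahnSeries.coeff_sub, cst_mul_Z_pow_coeff, if_neg (by norm_num)]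
      simpa [expM] using this
    · exact coeff_eq_zero_of_p4 h1 hn
  have hmono : ∀ {i : Cpt} {c : K'} {m : ℕ}, F i - coeffMap κ (mink i) = cst c * Z ^ m →
      κ (Ψ k i) = if expM i + k = m then c else 0 := fun {i c m} h => by
    rw [← hco i k, h, cst_mul_Z_pow_coeff]
  have hzero : ∀ {i : Cpt}, F i = coeffMap κ (mink i) → κ (Ψ k i) = 0 := fun {i} h => by
    rw [← hco i k, h, sub_self]
    rfl
  cases i
  case γ2 =>
    have := hmono (i := γ2) (c := -l) (m := 2) (by rw [m2, hg2', map_neg]; ring)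
    rcases k with _ | k
    · simpa [expM] using this
    · rw [this, if_neg (by simp [expM]; omega)]
      rfl
  case w1 =>
    have := hmono (i := w1) (by rw [nw1, sub_zero, hw1])
    rcases k with _ | _ | _ | k
    · simpa [expM] using this
    · simpa [expM] using this
    · simpa [expM] using this
    · rw [this, if_neg (by simp [expM]; omega)]
      rfl
  case w2 =>
    have := hmono (i := w2) (c := -q) (m := 3) (by rw [nw2, sub_zero, hw2, map_neg]; ring)
    rcases k with _ | _ | k
    · simpa [expM] using this
    · simpa [expM] using this
    · rw [this, if_neg (by simp [expM]; omega)]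
      rfl
  case w3 =>
    have := hmono (i := w3) (by rw [nw3, sub_zero, hw3'])
    rcases k with _ | k
    · simpa [expM] using this
    · rw [this, if_neg (by simp [expM]; omega)]
      rfl
  case e3 => exact hzero (x3.trans m1.symm)
  case γ1 => exact hzero (g1.trans n1.symm)
  case γ5 => exact hzero (g5.trans n5.symm)
  all_goals exact h0 _ _ (by decide)

/-- The zeroth coefficient of a solution whose component `γ1` vanishes. -/
theorem past_values {Ψ : ℕ → Cpt → K} (hr : ∀ i, gres (fullK Ψ) i = 0)
    (hc : ∀ j, gcon (fullK Ψ) j = 0) (hγ : Ψ 0 γ1 = 0)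
    (hZ : ∀ i, 0 < wt i → d3 (Ψ 0 i) = 0 → Ψ 0 i = 0) :
    (∀ i, i ≠ e3 → i ≠ γ2 → i ≠ γ8 → i ≠ w3 → i ≠ w4 → Ψ 0 i = 0) ∧ Ψ 0 w3 = -Ψ 0 γ2 ∧
      d3 (Ψ 0 γ2) = 0 ∧
      d3 (Ψ 0 γ8) = Ψ 0 w3 ∧ 2 * Ψ 0 e3 = -(Ψ 0 γ8 + cj (Ψ 0 γ8)) ∧
      d3 (Ψ 0 w4) = ee * (d1 (Ψ 0 w3) - im * d2 (Ψ 0 w3)) := by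
  have hj := fieldJets_fullK (Ψ := 0) (Ψ' := Ψ) (k := 0) (fun j hj => by omega)
  have zero : ∀ {i n v}, Lead n (gres (fullK Ψ) i - gres (fullK 0) i) v → v = 0 :=
    fun hv => lead_eq_zero hv (hr _) (by rw [fullK_zero, gres_mink])
  have zeroc : ∀ {i n v}, Lead n (gcon (fullK Ψ) i - gcon (fullK 0) i) v → v = 0 :=
    fun hv => lead_eq_zero hv (hc _) (by rw [fullK_zero, gcon_mink])
  have hδ : (fun i => Ψ 0 i - (0 : ℕ → Cpt → K) 0 i) = Ψ 0 := funext fun i => sub_zero _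
  rw [hδ] at hj
  set δ : Cpt → K := Ψ 0 with hδ'
  have i1 : cj (δ γ1) = 0 := by rw [hγ, map_zero]
  have i2 : d3 (δ γ1) = 0 := by rw [hγ, map_zero]
  have i3 : d1 (δ γ1) = 0 := by rw [hγ, map_zero]
  have i4 : d2 (δ γ1) = 0 := by rw [hγ, map_zero]
  have f1 : δ w1 = 0 := by linear_combination zero (inc_gres_γ1 hj) - i2
  have f2 : δ w2 = 0 := by
    linear_combination zeroc (inc_gcon_u1 hj) - 4 * cj lam * hγ - ee * i3 + ee * im * i4
  have x1 : δ e1 = 0 := hZ _ (by decide) (by linear_combination zero (inc_gres_e1 hj) + ee * hγ)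
  have x2 : δ e2 = 0 := hZ _ (by decide) (by
    linear_combination zero (inc_gres_e2 hj) - ee * im * hγ)
  have g3 : δ γ3 = 0 := hZ _ (by decide) (by
    linear_combination zero (inc_gres_γ3 hj) - cj lam * hγ - f2)
  have g4 : δ γ4 = 0 := hZ _ (by decide) (by
    linear_combination zero (inc_gres_γ4 hj) - lam * i1)
  have g7 : δ γ7 = 0 := hZ _ (by decide) (by linear_combination -zeroc (inc_gcon_u5 hj) - i1)
  have g6 : δ γ6 = 0 := hZ _ (by decide) (zeroc (inc_gcon_u6 hj))
  have f5 : δ w5 = 0 := hZ _ (by decide) (zero (inc_gres_w5 hj))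
  have x1c : cj (δ e1) = 0 := by rw [x1, map_zero]
  have x2c : cj (δ e2) = 0 := by rw [x2, map_zero]
  have g3c : cj (δ γ3) = 0 := by rw [g3, map_zero]
  have g4c : cj (δ γ4) = 0 := by rw [g4, map_zero]
  have g5 : δ γ5 = 0 := by
    have := zero (inc_gres_γ5 hj)
    push_cast at this
    linear_combination -this + g3c - g4
  have g5c : cj (δ γ5) = 0 := by rw [g5, map_zero]
  have x4 : δ e4 = 0 := hZ _ (by decide) (by
    linear_combination zero (inc_gres_e4 hj) - ee * (g3 + g3c - g4 - g4c + g5 + g5c))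
  have x5 : δ e5 = 0 := hZ _ (by decide) (by
    linear_combination zero (inc_gres_e5 hj) - ee * im * (-g3 + g3c - g4 + g4c + g5 - g5c))
  refine ⟨fun i n1 n2 n3 n4 n5 => ?_, ?_, ?_, ?_, ?_, ?_⟩
  · cases i <;> first | assumption | exact absurd rfl ‹_›
  · have := zeroc (inc_gcon_u2 hj)
    simp only [hγ, g7, x1, x2, g3, g4, g6, map_zero] at this
    linear_combination -this
  · have := zero (inc_gres_γ2 hj)
    simp only [hγ, Pi.zero_apply] at this
    linear_combination this
  · have := zero (inc_gres_γ8 hj)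
    simp only [g3, g4, g5, map_zero] at this
    linear_combination this
  · have := zero (inc_gres_e3 hj)
    push_cast at this
    linear_combination -this
  · have := zeroc (i := .v3) (inc_gA3 hj)
    simp only [g7, f2, Pi.zero_apply] at this
    linear_combination this

end Cone

/-! ### The constant term solution and its characteristic data -/

section Characteristic

open TopologicalSpace CoefRing Cpt

theorem Sm.fderiv_fst {U : Opens Slice} {f : Sm U} {g : ℂ → ℂ} (h : ∀ p ∈ U, f.fn p = g p.1)
    {p : Slice} (hp : p ∈ U) (v : ℂ) : fderiv ℝ f.fn p (v, 0) = fderiv ℝ g p.1 v := by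
  have h1 : HasFDerivAt (fun ζ : ℂ => (ζ, p.2)) (ContinuousLinearMap.inl ℝ ℂ ℝ) p.1 :=
    (hasFDerivAt_id p.1).prodMk (hasFDerivAt_const p.2 p.1)
  have h2 : HasFDerivAt (fun ζ : ℂ => f.fn (ζ, p.2)) _ p.1 :=
    (f.differentiableAt hp).hasFDerivAt.comp p.1 h1
  have h3 : (fun ζ : ℂ => f.fn (ζ, p.2)) =ᶠ[𝓝 p.1] g := by
    filter_upwards [h1.continuousAt.preimage_mem_nhds (U.isOpen.mem_nhds hp)] with ζ hζ
    exact h _ hζ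
  rw [← h3.fderiv_eq, h2.fderiv]
  rfl

theorem Sm.fn_d1_fst {U : Opens Slice} {f : Sm U} {g : ℂ → ℂ} (h : ∀ p ∈ U, f.fn p = g p.1)
    {p : Slice} (hp : p ∈ U) : (d1 f).fn p = fderiv ℝ g p.1 1 :=
  (Sm.fn_der _ f hp).trans (Sm.fderiv_fst h hp 1)

theorem Sm.fn_d2_fst {U : Opens Slice} {f : Sm U} {g : ℂ → ℂ} (h : ∀ p ∈ U, f.fn p = g p.1)
    {p : Slice} (hp : p ∈ U) : (d2 f).fn p = fderiv ℝ g p.1 Complex.I :=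
  (Sm.fn_der _ f hp).trans (Sm.fderiv_fst h hp Complex.I)

theorem Sm.fn_neg {U : Opens Slice} (f : Sm U) {p : Slice} (hp : p ∈ U) : (-f).fn p = -f.fn p := by
  simp only [Sm.fn_eq_eval _ hp, map_neg]

theorem Sm.fn_im {U : Opens Slice} {p : Slice} (hp : p ∈ U) : (im : Sm U).fn p = Complex.I :=
  Sm.fn_algebraMap _ hp

theorem Sm.fn_ee' {U : Opens Slice} {p : Slice} (hp : p ∈ U) : (ee : Sm U).fn p = bfe p := by
  have h1 : (lam : Sm U).fn p = -p.1 / 2 := Sm.fn_mk _ hp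
  have h2 : (cj (lam : Sm U)).fn p = starRingEnd ℂ ((lam : Sm U).fn p) := Sm.fn_star _ hp
  have h3 : (2 : Sm U) = algebraMap ℂ (Sm U) 2 := (map_ofNat _ 2).symm
  rw [ee, Sm.fn_add _ _ hp, Sm.fn_mul _ _ hp, Sm.fn_mul _ _ hp, h3, Sm.fn_algebraMap _ hp,
    Sm.fn_algebraMap _ hp, h2, h1, Complex.mul_conj, Complex.normSq_eq_norm_sq, norm_div, norm_neg,
    Complex.norm_ofNat, bfe]
  push_cast
  ring

/-- Functions on the half space with the same derivative along `ū` and the same limits at `ū = 0`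
are equal. -/
theorem Sm.eq_of_d3_of_tendsto {f g : Sm upperO} (h : d3 f = d3 g)
    (ht : ∀ ξ, Tendsto (fun s => f.fn (ξ, s) - g.fn (ξ, s)) (𝓝[>] 0) (𝓝 0)) : f = g := by
  refine Sm.ext_fn fun ⟨ξ, s⟩ hp => sub_eq_zero.mp ?_
  refine tendsto_nhds_unique (tendsto_const_nhds.congr' ?_) (ht ξ)
  filter_upwards [self_mem_nhdsWithin] with τ hτ
  have h0 : d3 (f - g) = 0 := by rw [map_sub, h, sub_self]
  have h1 := (f - g).integral_d3 ξ (c := τ) (s := s) hτ hp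
  simp only [h0, Sm.fn_zero, intervalIntegral.integral_zero] at h1
  rw [Sm.fn_sub _ _ hp, Sm.fn_sub _ _ (show (ξ, τ) ∈ upperO from hτ)] at h1
  linear_combination -h1

theorem Sm.eq_zero_of_d3_of_tendsto {f : Sm upperO} (h : d3 f = 0)
    (ht : ∀ ξ, Tendsto (fun s => f.fn (ξ, s)) (𝓝[>] 0) (𝓝 0)) : f = 0 :=
  Sm.eq_of_d3_of_tendsto (h.trans (map_zero _).symm) fun ξ => by simpa [Sm.fn_zero] using ht ξ

theorem hasFDerivAt_cone (p : Slice) : HasFDerivAt (fun p : Slice => (((p.1, 0), 0) : Slice × ℝ))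
    ((ContinuousLinearMap.inl ℝ Slice ℝ).comp ((ContinuousLinearMap.inl ℝ ℂ ℝ).comp
      (ContinuousLinearMap.fst ℝ ℂ ℝ))) p :=
  ((ContinuousLinearMap.inl ℝ Slice ℝ).comp ((ContinuousLinearMap.inl ℝ ℂ ℝ).comp
      (ContinuousLinearMap.fst ℝ ℂ ℝ))).hasFDerivAt

/-- Restriction to `ū = 0`, at the parameter `0`. -/
def toCone : SmParam →+* Sm (⊤ : Opens Slice) :=
  Sm.pullback (fun p => ((p.1, 0), 0)) (ContDiff.contDiffOn (by fun_prop)) fun _ _ => mem_univ _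

theorem fn_toCone (F : SmParam) (p : Slice) : (toCone F).fn p = F.fn ((p.1, 0), 0) :=
  Sm.fn_pullback F (mem_univ p)

theorem isConeHom_toCone : IsConeHom toCone where
  d1 := Sm.pullback_der fun p _ => by rw [(hasFDerivAt_cone p).fderiv]; rfl
  d2 := Sm.pullback_der fun p _ => by rw [(hasFDerivAt_cone p).fderiv]; rfl
  cj f := Sm.ext_fn fun p hp => by
    have h1 : (cj f).fn ((p.1, 0), 0) = starRingEnd ℂ (f.fn ((p.1, 0), 0)) :=
      Sm.fn_star f (mem_univ _)
    have h2 : (cj (toCone f)).fn p = starRingEnd ℂ ((toCone f).fn p) := Sm.fn_star _ hp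
    rw [fn_toCone, h1, h2, fn_toCone]
  s := Sm.ext_fn fun p hp => by
    have h1 : (s : SmParam).fn ((p.1, 0), 0) = ((0 : ℝ) : ℂ) := Sm.fn_mk _ (mem_univ _)
    rw [fn_toCone, h1, Sm.fn_zero, Complex.ofReal_zero]
  lam := Sm.ext_fn fun p hp => by
    have h1 : (lam : SmParam).fn ((p.1, 0), 0) = -p.1 / 2 := Sm.fn_mk _ (mem_univ _)
    have h2 : (lam : Sm (⊤ : Opens Slice)).fn p = -p.1 / 2 := Sm.fn_mk _ hp
    rw [fn_toCone, h1, h2]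
  algebraMap c := Sm.ext_fn fun p hp => by
    rw [fn_toCone, Sm.fn_algebraMap _ (mem_univ _), Sm.fn_algebraMap _ hp]

theorem tendsto_cone (F : SmParam) (ξ : ℂ) :
    Tendsto (fun s => (atParam 0 upperO F).fn (ξ, s)) (𝓝[>] 0) (𝓝 (F.fn ((ξ, 0), 0))) := by
  have h1 : Continuous fun s : ℝ => F.fn ((ξ, s), 0) := F.continuous.comp (by fun_prop)
  refine ((h1.tendsto 0).mono_left nhdsWithin_le_nhds).congr' ?_
  filter_upwards [self_mem_nhdsWithin] with τ hτ
  rw [fn_atParam 0 F (show (ξ, τ) ∈ upperO from hτ)]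

variable {η : Coef} {d : ℕ → ℕ} {c : ℕ → Cpt → ℕ → ℕ → ℂ → ℂ} (h : IsLateExpansion η d c)

/-- The constant terms in `α²` of the late time polynomials. -/
def constSm (k : ℕ) (i : Cpt) : Sm upperO := atParam 0 upperO (lateSm h k i)

theorem fn_constSm (k : ℕ) (i : Cpt) : ∀ p ∈ upper, constantTermField d c k i p
    = (constSm h k i).fn p := fun p hp => by
  rw [constantTermField_eq h, constSm, fn_atParam 0 _ hp]

theorem tendsto_constSm (k : ℕ) (i : Cpt) (ξ : ℂ) : Tendsto (fun s => (constSm h k i).fn (ξ, s))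
    (𝓝[>] 0) (𝓝 ((lateSm h k i).fn ((ξ, 0), 0))) := tendsto_cone _ ξ

theorem setIntegral_pulse (hsupp : ∀ p ∈ upper, η p ≠ 0 → 1 / 2 < p.2 ∧ p.2 < 3 / 4) {T : ℝ}
    (hT : 3 / 4 < T) (ξ : ℂ) : ∫ s in (1 / 4 : ℝ)..T, ‖η (ξ, s)‖ ^ 2 = pulseEnergy η ξ := by
  rw [pulseEnergy, intervalIntegral.integral_of_le (by linarith),
    intervalIntegral.integral_of_le (by norm_num)]
  refine MeasureTheory.setIntegral_eq_of_subset_of_forall_sdiff_eq_zero measurableSet_Ioc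
    (Ioc_subset_Ioc (by norm_num) hT.le) fun s hs => ?_
  by_contra hne
  have h0 : η (ξ, s) ≠ 0 := fun h => hne (by simp [h])
  have := hsupp (ξ, s) (lt_trans (by norm_num) hs.1.1) h0
  exact hs.2 ⟨this.1, this.2.le⟩

variable (hη : ContDiffOn ℝ ∞ η upper)
  (hsupp : ∀ p ∈ upper, η p ≠ 0 → 1 / 2 < p.2 ∧ p.2 < 3 / 4)

include h hη hsupp

theorem gres_constSm (i : Cpt) : gres (fullK (constSm h)) i = 0 := by
  ext n
  refine Sm.ext_fn fun p hp => ?_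
  have e : gres (fullK (constSm h)) i = coeffMap (atParam 0 upperO) (gres (fullK (lateSm h)) i) := by
    rw [(isCoefHom_atParam 0 upperO).isDiffHom.gres]
    simp only [(isCoefHom_atParam 0 upperO).fullK]
    rfl
  rw [e, coeffMap_coeff, fn_atParam 0 _ hp, late_gres hη hsupp h i n (le_of_lt hp),
    HahnSeries.coeff_zero, Sm.fn_zero]

theorem gcon_constSm (j : SharpCpt) : gcon (fullK (constSm h)) j = 0 := by
  ext n
  refine Sm.ext_fn fun p hp => ?_
  have e : gcon (fullK (constSm h)) j = coeffMap (atParam 0 upperO) (gcon (fullK (lateSm h)) j) := by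
    rw [(isCoefHom_atParam 0 upperO).isDiffHom.gcon]
    simp only [(isCoefHom_atParam 0 upperO).fullK]
    rfl
  rw [e, coeffMap_coeff, fn_atParam 0 _ hp, late_gcon hη hsupp h j n (le_of_lt hp),
    HahnSeries.coeff_zero, Sm.fn_zero]

theorem isFormalSolution_constantTermField : IsFormalSolution (constantTermField d c) := by
  refine (isFormalSolution_iff (fn_constSm h)).mpr ⟨fun k i hi => ?_, gres_constSm h hη hsupp⟩
  refine sub_eq_zero.mp (Sm.ext_fn fun p hp => ?_)
  rw [constSm, ← (isCoefHom_atParam 0 upperO).cj, ← map_sub, fn_atParam 0 _ hp,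
    late_real hη hsupp h k hi (le_of_lt hp), Sm.fn_zero]

theorem constraintsVanish_constantTermField : ConstraintsVanish (constantTermField d c) :=
  (constraintsVanish_iff (fn_constSm h)).mpr (gcon_constSm h hη hsupp)

theorem lateSm_γ1 {ξ : ℂ} {s : ℝ} (hs : 0 ≤ s) : (lateSm h 0 γ1).fn ((ξ, s), 0) = 0 := by
  refine limit_param (v := fun _ => 0) (fun α hα ξ s hs => ?_) hs
  obtain ⟨Ψ, hΨ⟩ := exists_solution_finiteMassData hη hsupp hα
  have h4 : 0 < α ^ 4 := by positivity
  have hp : 0 < s := lt_trans (by positivity) hs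
  rw [fn_lateSm_late h hα hΨ 0 _ hs, hΨ.data_eq (show (ξ, s) ∈ upper from hp), finiteMassData]
  by_contra hne
  have h1 := (hsupp (ξ, s / α ^ 4) (div_pos hp h4) (right_ne_zero_of_mul hne)).2
  rw [div_lt_iff₀ h4] at h1
  linarith

theorem lateSm_γ2 {ξ : ℂ} {s : ℝ} (hs : 0 ≤ s) :
    (lateSm h 0 γ2).fn ((ξ, s), 0) = -(pulseEnergy η ξ : ℂ) := by
  refine limit_param (v := fun ξ => -(pulseEnergy η ξ : ℂ)) (fun α hα ξ s hs => ?_) hs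
  obtain ⟨Ψ, hΨ⟩ := exists_solution_finiteMassData hη hsupp hα
  have h4 : 0 < α ^ 4 := by positivity
  have hp : 0 < s := lt_trans (by positivity) hs
  have hψ := fn_ofFormal Ψ hΨ.solution.smooth
  set ψ := ofFormal Ψ hΨ.solution.smooth
  have hr := ((isFormalSolution_iff hψ).mp hΨ.solution).2
  have hj := fieldJets_fullK (Ψ := 0) (Ψ' := ψ) (k := 0) (fun j hj => by omega)
  have e := lead_eq_zero (inc_gres_γ2 hj) (hr _) (by rw [fullK_zero, gres_mink])
  simp only [Pi.zero_apply, sub_zero, zero_mul, add_zero] at e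
  have hd : d3 (ψ 0 γ2) = -(cj (ψ 0 γ1) * ψ 0 γ1) := by linear_combination e
  have hp' : 0 < α ^ 4 / 4 := by positivity
  have h1 := (ψ 0 γ2).integral_d3 ξ (c := α ^ 4 / 4) (s := s) hp' hp
  rw [← hψ 0 γ2 (ξ, α ^ 4 / 4) hp', hΨ.vanish 0 γ2 (ξ, α ^ 4 / 4) hp'
    (show α ^ 4 / 4 < α ^ 4 / 2 by linarith), sub_zero, ← hψ 0 γ2 (ξ, s) hp] at h1
  rw [fn_lateSm_late h hα hΨ 0 _ hs, ← h1]
  have h2 : ∀ τ ∈ uIcc (α ^ 4 / 4) s, (d3 (ψ 0 γ2)).fn (ξ, τ)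
      = ((-((α ^ 4)⁻¹ * ‖η (ξ, τ / α ^ 4)‖ ^ 2) : ℝ) : ℂ) := fun τ hτ => by
    have hτ0 : (ξ, τ) ∈ upperO := lt_of_lt_of_le (lt_min hp' hp) hτ.1
    rw [hd, Sm.fn_neg _ hτ0, Sm.fn_mul _ _ hτ0, fn_cj _ hτ0, ← hψ 0 γ1 _ hτ0, hΨ.data_eq hτ0,
      finiteMassData, mul_comm, Complex.mul_conj, Complex.normSq_eq_norm_sq, norm_mul, mul_pow,
      Complex.norm_real, Real.norm_eq_abs, sq_abs]
    push_cast
    rw [inv_pow, ← pow_mul]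
  rw [intervalIntegral.integral_congr h2, intervalIntegral.integral_ofReal,
    intervalIntegral.integral_neg, intervalIntegral.integral_const_mul,
    intervalIntegral.integral_comp_div (fun τ => ‖η (ξ, τ)‖ ^ 2) h4.ne', div_right_comm,
    div_self h4.ne', setIntegral_pulse hsupp (by rwa [lt_div_iff₀ h4]), smul_eq_mul,
    inv_mul_cancel_left₀ h4.ne']
  push_cast
  rfl

theorem constSm_of_weight {i : Cpt} (hi : 0 < wt i) (h0 : d3 (constSm h 0 i) = 0) :
    constSm h 0 i = 0 :=
  Sm.eq_zero_of_d3_of_tendsto h0 fun ξ => by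
    rw [← lateSm_zero h 0 hi ξ]
    exact tendsto_constSm h 0 i ξ

theorem hasCharacteristicData_constantTermField :
    HasCharacteristicData (pulseEnergy η) (constantTermField d c) := by
  have hγ : constSm h 0 γ1 = 0 := Sm.ext_fn fun p hp => by
    rw [constSm, fn_atParam 0 _ hp, lateSm_γ1 h hη hsupp (le_of_lt hp), Sm.fn_zero]
  obtain ⟨v0, v3, v2, v8, ve, v4⟩ := past_values (gres_constSm h hη hsupp)
    (gcon_constSm h hη hsupp) hγ fun i hi => constSm_of_weight h hη hsupp hi
  have f2 : ∀ p ∈ upperO, (constSm h 0 γ2).fn p = -(pulseEnergy η p.1 : ℂ) := fun p hp => by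
    rw [constSm, fn_atParam 0 _ hp, lateSm_γ2 h hη hsupp (le_of_lt hp)]
  have f3 : ∀ p ∈ upperO, (constSm h 0 w3).fn p = (pulseEnergy η p.1 : ℂ) := fun p hp => by
    rw [v3, Sm.fn_neg _ hp, f2 p hp, neg_neg]
  have d33 : d3 (constSm h 0 w3) = 0 := by rw [v3, map_neg, v2, neg_zero]
  have lim : ∀ (x y : Sm upperO) (i : Cpt), 0 < wt i → x = constSm h 0 i → d3 y = 0 →
      d3 x = y → x = s * y := fun x y i hi hx hy hxy => by
    refine Sm.eq_of_d3_of_tendsto (by rw [hxy, Der.leibniz, d3_s, hy]; ring) fun ξ => ?_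
    have t1 : Tendsto (fun s => x.fn (ξ, s)) (𝓝[>] 0) (𝓝 0) := by
      rw [← lateSm_zero h 0 hi ξ, hx]
      exact tendsto_constSm h 0 i ξ
    have t2 : Tendsto (fun s : ℝ => (s : ℂ) * y.fn (ξ, 1)) (𝓝[>] 0) (𝓝 (0 * y.fn (ξ, 1))) :=
      ((Complex.continuous_ofReal.tendsto 0).mono_left nhdsWithin_le_nhds).mul_const _
    have t3 := t1.sub t2
    rw [zero_mul, sub_zero] at t3
    refine t3.congr' ?_
    filter_upwards [self_mem_nhdsWithin] with τ hτ
    have hτ' : (ξ, τ) ∈ upperO := hτ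
    have := y.integral_d3 ξ (c := 1) (s := τ) one_pos hτ
    simp only [hy, Sm.fn_zero, intervalIntegral.integral_zero] at this
    rw [Sm.fn_mul _ _ hτ', fn_s hτ', sub_eq_zero.mp this.symm]
  have s8 := lim _ _ γ8 (by decide) rfl d33 v8
  have s4 := lim _ _ w4 (by decide) rfl (by
    rw [Der.leibniz, d3_ee, map_sub, Der.leibniz, d3_im, ← d1_d3, ← d2_d3, d33]; simp) v4
  have f8 : ∀ p ∈ upperO, (constSm h 0 γ8).fn p = ((p.2 * pulseEnergy η p.1 : ℝ) : ℂ) :=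
    fun p hp => by
      rw [s8, Sm.fn_mul _ _ hp, fn_s hp, f3 p hp, Complex.ofReal_mul]
  have hpast : ∀ i, EqOn (constantTermField d c 0 i) (pastData (pulseEnergy η) i) upper := by
    intro i p hp
    have hp' : p ∈ upperO := hp
    rw [fn_constSm h 0 i p hp]
    have hv := v0 i
    cases i
    case e3 =>
      have := congrArg (fun f => Sm.fn f p) ve
      simp only [two_mul, Sm.fn_add _ _ hp', Sm.fn_neg _ hp', fn_cj _ hp', f8 p hp',
        Complex.conj_ofReal] at this
      change _ = -((p.2 * pulseEnergy η p.1 : ℝ) : ℂ)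
      linear_combination this / 2
    case γ2 => exact f2 p hp'
    case γ8 => exact f8 p hp'
    case w3 => exact f3 p hp'
    case w4 =>
      rw [s4, Sm.fn_mul _ _ hp', Sm.fn_mul _ _ hp', Sm.fn_sub _ _ hp', Sm.fn_mul _ _ hp', fn_s hp',
        Sm.fn_im hp', Sm.fn_ee' hp', Sm.fn_d1_fst (g := fun ζ => (pulseEnergy η ζ : ℂ)) f3 hp',
        Sm.fn_d2_fst (g := fun ζ => (pulseEnergy η ζ : ℂ)) f3 hp']
      simp only [pastData, dXi]
      ring
    all_goals
      rw [hv nofun nofun nofun nofun nofun, Sm.fn_zero]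
      rfl
  have hw1 : toCone (lateSm h 0 w1) = 0 := Sm.ext_fn fun p _ => by
    rw [fn_toCone, Sm.fn_zero]
    have t := tendsto_constSm h 0 w1 p.1
    rw [v0 w1 nofun nofun nofun nofun nofun] at t
    simp only [Sm.fn_zero] at t
    exact tendsto_nhds_unique t tendsto_const_nhds
  have fl : ∀ p ∈ (⊤ : Opens Slice), (-toCone (lateSm h 0 γ2)).fn p = (pulseEnergy η p.1 : ℂ) :=
    fun p hp => by rw [Sm.fn_neg _ hp, fn_toCone, lateSm_γ2 h hη hsupp le_rfl, neg_neg]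
  have hq1 : ∀ {f : Sm (⊤ : Opens Slice)} {g : ℂ → ℂ},
      (∀ p ∈ (⊤ : Opens Slice), f.fn p = g p.1) → ∀ p ∈ (⊤ : Opens Slice),
      (ee * (d1 f + im * d2 f)).fn p = 2 * (bfe (p.1, 0) * dXiBar g p.1) := fun hf p hp => by
    rw [Sm.fn_mul _ _ hp, Sm.fn_add _ _ hp, Sm.fn_mul _ _ hp, Sm.fn_im hp, Sm.fn_ee' hp,
      Sm.fn_d1_fst hf hp, Sm.fn_d2_fst hf hp, dXiBar]
    have : bfe p = bfe (p.1, 0) := rfl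
    rw [this]
    ring
  set q : Sm (⊤ : Opens Slice) := ee * (d1 (-toCone (lateSm h 0 γ2)) + im * d2 (-toCone (lateSm h 0 γ2)))
    with hqd
  have fq := hq1 (g := fun ζ => (pulseEnergy η ζ : ℂ)) fl
  rw [← hqd] at fq
  have hh : ∀ x : Sm (⊤ : Opens Slice), x = 2 * (algebraMap ℂ _ (1 / 2) * x) := fun x => by
    rw [← mul_assoc, two_half, one_mul]
  have hb := boundary_values isConeHom_toCone (Ψ := lateSm h)
    (fun i n => Sm.ext_fn fun p _ => by
      rw [fn_toCone, late_gres hη hsupp h i n le_rfl, Sm.fn_zero])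
    (fun i n => Sm.ext_fn fun p _ => by
      rw [fn_toCone, late_gcon hη hsupp h i n le_rfl, Sm.fn_zero])
    (fun k i hi => Sm.ext_fn fun p _ => by rw [fn_toCone, lateSm_zero h k hi, Sm.fn_zero])
    (Sm.ext_fn fun p _ => by rw [fn_toCone, lateSm_γ1 h hη hsupp le_rfl, Sm.fn_zero])
    hw1 (l := -toCone (lateSm h 0 γ2)) (neg_neg _).symm hqd.symm (hh _)
  refine ⟨hpast, fun k i ξ => ?_⟩
  have ht : Tendsto (fun s => constantTermField d c k i (ξ, s)) (𝓝[>] 0)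
      (𝓝 ((toCone (lateSm h k i)).fn (ξ, 0))) := by
    rw [fn_toCone]
    refine (tendsto_constSm h k i ξ).congr' ?_
    filter_upwards [self_mem_nhdsWithin] with τ hτ
    exact (fn_constSm h k i _ hτ).symm
  have hv : (toCone (lateSm h k i)).fn (ξ, 0) = coneData (pulseEnergy η) k i ξ := by
    have hξ : (ξ, (0 : ℝ)) ∈ (⊤ : Opens Slice) := mem_univ _
    rw [hb k i]
    cases i
    case γ2 =>
      rcases k with _ | k
      · exact (Sm.fn_neg _ hξ).trans (congrArg _ (fl _ hξ))
      · exact Sm.fn_zero _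
    case w1 =>
      rcases k with _ | _ | _ | k
      · exact Sm.fn_zero _
      · exact Sm.fn_zero _
      · let u : Sm (⊤ : Opens Slice) := algebraMap ℂ _ (1 / 2) * q
        have hu : q = u + u := by rw [← two_mul]; exact hh q
        have fu : ∀ p ∈ (⊤ : Opens Slice), u.fn p = bfe (p.1, 0)
            * dXiBar (fun ζ => (pulseEnergy η ζ : ℂ)) p.1 := fun p hp => by
          rw [Sm.fn_mul _ _ hp, Sm.fn_algebraMap _ hp, fq p hp]
          ring
        have fu2 := hq1 (g := fun ζ => bfe (ζ, 0) * dXiBar (fun ζ => (pulseEnergy η ζ : ℂ)) ζ) fu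
          (ξ, 0) hξ
        have e2 : ee * (d1 q + im * d2 q) - 2 * lam * q
            = (ee * (d1 u + im * d2 u) - 2 * lam * u) + (ee * (d1 u + im * d2 u) - 2 * lam * u) := by
          rw [hu, map_add, map_add]
          ring
        have e3 : algebraMap ℂ _ (1 / 2) * (ee * (d1 q + im * d2 q) - 2 * lam * q)
            = ee * (d1 u + im * d2 u) - (lam * u + lam * u) := by
          rw [e2, ← two_mul, ← mul_assoc, mul_comm _ (2 : Sm (⊤ : Opens Slice)), two_half]
          ring
        have fL : (lam : Sm (⊤ : Opens Slice)).fn (ξ, 0) = bflam (ξ, 0) := Sm.fn_mk _ hξ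
        refine (congrArg (fun f => Sm.fn f (ξ, 0)) e3).trans ?_
        rw [Sm.fn_sub _ _ hξ, fu2, Sm.fn_add _ _ hξ, Sm.fn_mul _ _ hξ, fu _ hξ, fL]
        simp only [coneData]
        ring
      · exact Sm.fn_zero _
    case w2 =>
      rcases k with _ | _ | k
      · exact Sm.fn_zero _
      · refine (Sm.fn_neg _ hξ).trans ((congrArg _ (fq _ hξ)).trans ?_)
        simp only [coneData]
        ring
      · exact Sm.fn_zero _
    case w3 =>
      rcases k with _ | k
      · exact fl _ hξ
      · exact Sm.fn_zero _
    all_goals exact Sm.fn_zero _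
  rw [hv] at ht
  exact ht

omit h hη hsupp

theorem HasCharacteristicData.agree {Λ : ℂ → ℝ} {Ψ Ψ' : FormalField} (hs : IsFormalSolution Ψ)
    (hs' : IsFormalSolution Ψ') (hd : HasCharacteristicData Λ Ψ) (hd' : HasCharacteristicData Λ Ψ') :
    Agree Ψ' Ψ := by
  have e := fn_ofFormal Ψ hs.smooth
  have e' := fn_ofFormal Ψ' hs'.smooth
  set ψ := ofFormal Ψ hs.smooth
  set ψ' := ofFormal Ψ' hs'.smooth
  have hr := ((isFormalSolution_iff e).mp hs).2
  have hr' := ((isFormalSolution_iff e').mp hs').2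
  have key : ∀ k, ψ k = ψ' k := by
    intro k
    induction k using Nat.strong_induction_on with
    | _ k ih =>
      rcases Nat.eq_zero_or_pos k with rfl | hk
      · exact funext fun i => Sm.ext_fn fun p hp => by
          rw [← e 0 i p hp, ← e' 0 i p hp, hd.past i hp, hd'.past i hp]
      · refine eq_succ hr hr' ih hk.ne' fun i hi => Sm.eq_zero_of_d3_of_tendsto hi fun ξ => ?_
        have t := (hd'.cone k i ξ).sub (hd.cone k i ξ)
        rw [sub_self] at t
        refine t.congr' ?_
        filter_upwards [self_mem_nhdsWithin] with τ hτ
        have hτ' : (ξ, τ) ∈ upperO := hτ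
        rw [Sm.fn_sub _ _ hτ', e k i _ hτ', e' k i _ hτ']
  intro k i p hp
  rw [e k i p hp, e' k i p hp, key k]

end Characteristic

/-! ### The formal expansion of the Schwarzschild radius -/

section RadiusSeries

open Polynomial (evalRingHom)
open PowerSeries (X coeff mk coeff_mk)

/-- A recursion in which each term is determined by the preceding ones has a solution. -/
theorem exists_fixedPoint_of_causal {α : Type*} [Inhabited α] (T : (ℕ → α) → ℕ → α)
    (hT : ∀ a b n, (∀ k < n, a k = b k) → T a n = T b n) : ∃ a, ∀ n, a n = T a n := by
  have hA : ∀ n k, k < n → T^[n + 1] default k = T^[n] default k := by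
    intro n
    induction n with
    | zero => intro k hk; omega
    | succ n ih =>
      intro k hk
      simp only [Function.iterate_succ_apply'] at ih ⊢
      exact hT _ _ k fun j hj => ih j (by omega)
  have hB : ∀ n k, k < n → T^[n] default k = T^[k + 1] default k := by
    intro n k hk
    induction n, hk using Nat.le_induction with
    | base => rfl
    | succ n hn ih => rw [hA n k hn, ih]
  refine ⟨fun k => T^[k + 1] default k, fun n => ?_⟩
  rw [hT (fun k => T^[k + 1] default k) (T^[n] default) n fun k hk => (hB n k hk).symm,
    ← Function.iterate_succ_apply' T]

/-- Power series in `1/u` whose coefficients are polynomials in `ū`. -/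
abbrev Ser : Type := PowerSeries (Polynomial ℝ)

/-- A derivation acts on the coefficients of a power series. -/
def serDer {R : Type*} [CommRing R] (d : Der R) : Der (PowerSeries R) where
  toFun f := mk fun k => d (coeff k f)
  map_zero' := by ext; simp
  map_add' x y := by ext; simp
  leibniz' x y := by
    ext k
    simp [PowerSeries.coeff_mul, Der.leibniz, Finset.sum_add_distrib]

theorem coeff_serDer {R : Type*} [CommRing R] (d : Der R) (f : PowerSeries R) (k : ℕ) :
    coeff k (serDer d f) = d (coeff k f) :=
  coeff_mk k fun k => d (coeff k f)

/-- The Euler derivation of power series. -/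
def serEuler {R : Type*} [CommRing R] : Der (PowerSeries R) where
  toFun f := mk fun k => (k : R) * coeff k f
  map_zero' := by ext; simp
  map_add' x y := by ext; simp [mul_add]
  leibniz' x y := by
    ext k
    simp only [coeff_mk, map_add, PowerSeries.coeff_mul, Finset.mul_sum,
      ← Finset.sum_add_distrib]
    refine Finset.sum_congr rfl fun ij hij => ?_
    rw [← Finset.HasAntidiagonal.mem_antidiagonal.mp hij]
    push_cast
    ring

theorem coeff_serEuler {R : Type*} [CommRing R] (f : PowerSeries R) (k : ℕ) :
    coeff k (serEuler f) = (k : R) * coeff k f :=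
  coeff_mk k fun k => (k : R) * coeff k f

/-- The derivation `d/dū` of polynomials. -/
def polyDer : Der (Polynomial ℝ) where
  toFun := Polynomial.derivative
  map_zero' := map_zero _
  map_add' := map_add _
  leibniz' _ _ := Polynomial.derivative_mul

theorem polyDer_apply (f : Polynomial ℝ) : polyDer f = Polynomial.derivative f := rfl

/-- The antiderivative of a polynomial that vanishes at `0`. -/
def polyInt (f : Polynomial ℝ) : Polynomial ℝ :=
  f.sum fun n a => Polynomial.monomial (n + 1) (a / (n + 1))

theorem derivative_polyInt (f : Polynomial ℝ) : Polynomial.derivative (polyInt f) = f := by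
  rw [polyInt, Polynomial.sum, Polynomial.derivative_sum]
  conv_rhs => rw [f.as_sum_support]
  refine Finset.sum_congr rfl fun n _ => ?_
  rw [Polynomial.derivative_monomial]
  congr 1
  push_cast
  field_simp

theorem eval_zero_polyInt (f : Polynomial ℝ) : (polyInt f).eval 0 = 0 := by
  simp [polyInt, Polynomial.sum, Polynomial.eval_finsetSum]

theorem eval_polyInt_le {f : Polynomial ℝ} (hf : ∀ n, 0 ≤ f.coeff n) {s : ℝ} (hs : 0 ≤ s) :
    (polyInt f).eval s ≤ s * f.eval s := by
  rw [polyInt, Polynomial.sum, Polynomial.eval_finsetSum, Polynomial.eval_eq_sum, Polynomial.sum,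
    Finset.mul_sum]
  refine Finset.sum_le_sum fun n _ => ?_
  rw [Polynomial.eval_monomial]
  have h1 : f.coeff n / (n + 1) ≤ f.coeff n := div_le_self (hf n) (by linarith [n.cast_nonneg (α := ℝ)])
  calc f.coeff n / (n + 1) * s ^ (n + 1) ≤ f.coeff n * s ^ (n + 1) := by gcongr
    _ = s * (f.coeff n * s ^ n) := by ring

theorem coeff_polyInt_nonneg {f : Polynomial ℝ} (hf : ∀ n, 0 ≤ f.coeff n) (n : ℕ) :
    0 ≤ (polyInt f).coeff n := by
  rw [polyInt, Polynomial.sum, Polynomial.finsetSum_coeff]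
  refine Finset.sum_nonneg fun m _ => ?_
  rw [Polynomial.coeff_monomial]
  split_ifs
  · exact div_nonneg (hf m) (by positivity)
  · exact le_rfl

/-- A real constant, as a series. -/
def serConst : ℝ →+* Ser := (PowerSeries.C).comp Polynomial.C

theorem exists_radiusSeries (Λ : ℝ) : ∃ P : Ser, coeff 0 P = 1 ∧
    ∀ k, coeff (k + 1) P
      = polyInt (coeff k (P ^ 2 + serConst Λ * X * P ^ 3)) := by
  obtain ⟨a, ha⟩ := exists_fixedPoint_of_causal (α := Polynomial ℝ)
    (fun a n => n.rec 1 fun k _ => polyInt (coeff k ((mk a) ^ 2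
      + serConst Λ * X * (mk a) ^ 3))) (by
    rintro a b (_ | n) hab
    · rfl
    · refine congrArg polyInt (sub_eq_zero.mp ?_)
      have h : X ^ (n + 1) ∣ mk a - mk b :=
        PowerSeries.X_pow_dvd_iff.mpr fun m hm => by simp [hab m hm]
      rw [← map_sub]
      refine PowerSeries.X_pow_dvd_iff.mp (h.trans ⟨mk a + mk b
        + serConst Λ * X * (mk a ^ 2 + mk a * mk b
          + mk b ^ 2), ?_⟩) n n.lt_succ_self
      ring)
  exact ⟨mk a, by rw [coeff_mk]; exact ha 0,
    fun k => by rw [coeff_mk, ha]⟩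

variable (Λ : ℝ)

/-- The expansion of `y/x` in powers of `1/u`, where `y = -u` and `x` is `√2` times the area
radius. -/
def pSer : Ser := (exists_radiusSeries Λ).choose

theorem coeff_zero_pSer : coeff 0 (pSer Λ) = 1 := (exists_radiusSeries Λ).choose_spec.1

theorem coeff_succ_pSer (k : ℕ) : coeff (k + 1) (pSer Λ)
    = polyInt (coeff k (pSer Λ ^ 2 + serConst Λ * X * pSer Λ ^ 3)) :=
  (exists_radiusSeries Λ).choose_spec.2 k

/-- The expansion of `1/(1 - Λ/x)`. -/
def rSer : Ser := PowerSeries.invOfUnit (1 + serConst Λ * (X * pSer Λ)) 1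

/-- The expansion of `1/(1 - Λ/y)`. -/
def iSer : Ser := PowerSeries.invOfUnit (1 + serConst Λ * X) 1

theorem rSer_mul : rSer Λ * (1 + serConst Λ * (X * pSer Λ)) = 1 := by
  rw [mul_comm]
  exact PowerSeries.mul_invOfUnit _ _ (by simp)

theorem iSer_mul : iSer Λ * (1 + serConst Λ * X) = 1 := by
  rw [mul_comm]
  exact PowerSeries.mul_invOfUnit _ _ (by simp)

theorem serDer_X : serDer polyDer X = 0 := by
  ext1 k
  rw [coeff_serDer, PowerSeries.coeff_X]
  split_ifs <;> simp

theorem serDer_const : serDer polyDer (serConst Λ) = 0 := by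
  ext1 k
  rw [coeff_serDer]
  simp only [serConst, RingHom.comp_apply, PowerSeries.coeff_C]
  split_ifs <;> simp [polyDer_apply]

theorem serEuler_X : serEuler (X : Ser) = X := by
  ext1 k
  rw [coeff_serEuler, PowerSeries.coeff_X]
  split_ifs with h <;> simp [h]

theorem serEuler_const : serEuler (serConst Λ) = 0 := by
  ext1 k
  rw [coeff_serEuler]
  simp only [serConst, RingHom.comp_apply, PowerSeries.coeff_C]
  split_ifs with h <;> simp [h]

theorem serDer_pSer : serDer polyDer (pSer Λ)
    = X * (pSer Λ ^ 2 + serConst Λ * X * pSer Λ ^ 3) := by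
  ext1 k
  rw [coeff_serDer]
  cases k with
  | zero => simp [coeff_zero_pSer]
  | succ k => rw [coeff_succ_pSer, polyDer_apply, derivative_polyInt, PowerSeries.coeff_succ_X_mul]

theorem serDer_serEuler (f : Ser) : serDer polyDer (serEuler f) = serEuler (serDer polyDer f) := by
  ext1 k
  simp only [coeff_serDer, coeff_serEuler, Der.leibniz]
  rw [← nsmul_one, map_nsmul, Der.map_one]
  simp

/-- The restriction of a series to `ū = s`. -/
def serEval (s : ℝ) : Ser →+* PowerSeries ℝ := PowerSeries.map (evalRingHom s)

theorem coeff_serEval (s : ℝ) (f : Ser) (k : ℕ) :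
    coeff k (serEval s f) = (coeff k f).eval s := by
  simp [serEval]

theorem serEval_const (s : ℝ) (a : ℝ) : serEval s (serConst a) = PowerSeries.C a := by
  simp [serEval, serConst]

theorem serEval_X (s : ℝ) : serEval s X = X := by
  simp [serEval]

theorem serEval_zero_pSer : serEval 0 (pSer Λ) = 1 := by
  ext1 k
  rw [coeff_serEval]
  cases k with
  | zero => simp [coeff_zero_pSer]
  | succ k => rw [coeff_succ_pSer, eval_zero_polyInt, PowerSeries.coeff_one, if_neg (by omega)]

theorem serEval_serEuler (s : ℝ) (f : Ser) : serEval s (serEuler f) = serEuler (serEval s f) := by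
  ext1 k
  simp [coeff_serEval, coeff_serEuler]

/-- A series that solves a homogeneous linear equation and vanishes at `ū = 0` vanishes. -/
theorem eq_zero_of_serDer {Q B : Ser} (h : serDer polyDer Q = X * (B * Q))
    (h0 : serEval 0 Q = 0) : Q = 0 := by
  have key : ∀ n, ∀ k < n, coeff k Q = 0 := by
    intro n
    induction n with
    | zero => intro k hk; omega
    | succ n ih =>
      intro k hk
      have hk' : polyDer (coeff k Q) = 0 := by
        rw [← coeff_serDer, h]
        cases k with
        | zero => simp
        | succ k =>
          rw [PowerSeries.coeff_succ_X_mul, PowerSeries.coeff_mul]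
          refine Finset.sum_eq_zero fun ij hij => ?_
          rw [ih ij.2 (by have := Finset.HasAntidiagonal.mem_antidiagonal.mp hij; omega), mul_zero]
      have he : (coeff k Q).eval 0 = 0 := by rw [← coeff_serEval, h0, map_zero]
      rw [Polynomial.eq_C_of_derivative_eq_zero hk'] at he ⊢
      rw [Polynomial.eval_C] at he
      rw [he, map_zero]
  ext1 k
  rw [key (k + 1) k k.lt_succ_self, map_zero]

theorem serEuler_pSer : (1 + serConst Λ * X) * (serEuler (pSer Λ) + pSer Λ)
    = pSer Λ ^ 2 * (1 + serConst Λ * (X * pSer Λ)) := by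
  rw [← sub_eq_zero]
  have hp := serDer_pSer Λ
  have hx := serDer_X
  have hc := serDer_const Λ
  refine eq_zero_of_serDer (B := 2 * pSer Λ + 3 * (serConst Λ * (X * pSer Λ ^ 2))) ?_ ?_
  · simp only [map_sub, map_add, Der.leibniz, serDer_serEuler, hp, hx, hc, Der.map_one, pow_succ,
      pow_zero, one_mul, serEuler_X, serEuler_const]
    ring
  · simp only [map_sub, map_add, map_mul, map_pow, serEval_serEuler, serEval_zero_pSer,
      serEval_const, serEval_X, Der.map_one, map_one]
    ring

/-- The expansion of `1/x`, up to sign the product of `1/u` and `pSer`. -/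
def kSer : Ser := -(X * pSer Λ)

theorem serDer_kSer : serDer polyDer (kSer Λ) = -(kSer Λ ^ 2 * (1 - serConst Λ * kSer Λ)) := by
  simp only [kSer, map_neg, Der.leibniz, serDer_X, serDer_pSer]
  ring

theorem serEuler_kSer : X * serEuler (kSer Λ)
    = -(kSer Λ ^ 2 * (1 - serConst Λ * kSer Λ) * iSer Λ) := by
  simp only [kSer, map_neg, Der.leibniz, serEuler_X]
  linear_combination X ^ 2 * (serEuler (pSer Λ) + pSer Λ) * iSer_mul Λ
    - X ^ 2 * iSer Λ * serEuler_pSer Λ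

theorem der_inverse {A : Type*} [CommRing A] (d : Der A) {x y : A} (h : x * y = 1) :
    d x = -(x ^ 2 * d y) := by
  have h1 : d x * y + x * d y = 0 := by rw [← d.leibniz, h, d.map_one]
  linear_combination x * h1 - d x * h

end RadiusSeries

/-! ### The formal Schwarzschild field -/

section FormalSchwarzschild

open CoefRing Cpt
open PowerSeries (X coeff mk coeff_mk)

/-- The dependence of the Schwarzschild field on `ζ = 1/y`, `κ = 1/x`, `R = 1/(1 - Λ/x)` and
`I = 1/(1 - Λ/y)`, where `h = Λ/2`. -/
def radial {A : Type*} [CommRing A] (Λ h ζ κ R I : A) (i : Cpt) : A :=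
  match i with
  | e1 | e2 | γ3 | γ4 => κ
  | e3 => (1 - Λ * ζ) * R
  | γ2 => (1 - Λ * ζ) * κ
  | γ6 => -((1 - Λ * κ) * κ * I)
  | γ8 => h * I * (κ ^ 2 - ζ ^ 2)
  | w3 => -(Λ * κ ^ 3)
  | _ => 0

variable {K : Type*} [CommRing K] [Algebra ℂ K] [CoefRing K]

/-- The dependence of the Schwarzschild field on `ξ`. -/
def angular (i : Cpt) : K :=
  match i with
  | e1 => ee
  | e2 => im * ee
  | γ3 => lam
  | γ4 => cj lam
  | _ => 1

/-- A polynomial in `ū`, as a coefficient function. -/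
def polyCoef : Polynomial ℝ →+* K :=
  Polynomial.eval₂RingHom ((algebraMap ℂ K).comp Complex.ofRealHom) s

theorem polyCoef_C (a : ℝ) : (polyCoef (Polynomial.C a) : K) = algebraMap ℂ K a := by
  simp [polyCoef]

theorem polyCoef_X : (polyCoef Polynomial.X : K) = s := by simp [polyCoef]

theorem der_polyCoef (d : Der K) (hd : ∀ c, d (algebraMap ℂ K c) = 0) (f : Polynomial ℝ) :
    d (polyCoef f) = polyCoef (Polynomial.derivative f) * d s := by
  induction f using Polynomial.induction_on with
  | C a => rw [polyCoef_C, hd]; simp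
  | add f g hf hg => simp only [map_add, hf, hg, add_mul]
  | monomial n a h =>
    rw [pow_succ, ← mul_assoc]
    generalize Polynomial.C a * Polynomial.X ^ n = q at h ⊢
    rw [map_mul, Der.leibniz, h, polyCoef_X, Polynomial.derivative_mul, Polynomial.derivative_X,
      mul_one, map_add, map_mul, polyCoef_X]
    ring

theorem cj_polyCoef (f : Polynomial ℝ) : cj (polyCoef f : K) = polyCoef f := by
  induction f using Polynomial.induction_on with
  | C a => rw [polyCoef_C, cj_algebraMap, Complex.conj_ofReal]
  | add f g hf hg => simp only [map_add, hf, hg]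
  | monomial n a h => rw [pow_succ, ← mul_assoc, map_mul, map_mul cj, h, polyCoef_X, cj_s]

/-- A series with polynomial coefficients, as a Laurent series. -/
def serLaurent : Ser →+* K⸨X⸩ := (HahnSeries.ofPowerSeries ℤ K).comp (PowerSeries.map polyCoef)

theorem serLaurent_apply (f : Ser) : (serLaurent f : K⸨X⸩)
    = HahnSeries.ofPowerSeries ℤ K (mk fun k => polyCoef (coeff k f)) := by
  rw [serLaurent, RingHom.comp_apply]
  congr 1
  ext k
  simp

theorem serLaurent_coeff (f : Ser) (n : ℤ) : (serLaurent f : K⸨X⸩).coeff n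
    = if 0 ≤ n then polyCoef (coeff n.toNat f) else 0 := by
  rw [serLaurent_apply, Rep.ofPowerSeries_coeff]

theorem coeffDer_serLaurent (d : Der K) (hd : ∀ c, d (algebraMap ℂ K c) = 0) (hs : d s = 0)
    (f : Ser) : coeffDer d (serLaurent f) = 0 := by
  ext n
  rw [coeffDer_coeff, serLaurent_coeff]
  split_ifs
  · rw [der_polyCoef d hd, hs, mul_zero, HahnSeries.coeff_zero]
  · rw [map_zero, HahnSeries.coeff_zero]

theorem p1_serLaurent (f : Ser) : DiffRing.p1 (serLaurent f : K⸨X⸩) = 0 :=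
  coeffDer_serLaurent d1 d1_algebraMap d1_s f

theorem p2_serLaurent (f : Ser) : DiffRing.p2 (serLaurent f : K⸨X⸩) = 0 :=
  coeffDer_serLaurent d2 d2_algebraMap d2_s f

theorem p3_serLaurent (f : Ser) :
    DiffRing.p3 (serLaurent f : K⸨X⸩) = serLaurent (serDer polyDer f) := by
  ext n
  change d3 ((serLaurent f : K⸨X⸩).coeff n) = _
  rw [serLaurent_coeff, serLaurent_coeff]
  split_ifs
  · rw [der_polyCoef d3 d3_algebraMap, d3_s, mul_one, coeff_serDer, polyDer_apply]
  · rw [map_zero]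

theorem serLaurent_X : (serLaurent X : K⸨X⸩) = DiffRing.Z := by
  rw [serLaurent, RingHom.comp_apply, PowerSeries.map_X, HahnSeries.ofPowerSeries_X]
  rfl

theorem p4_serLaurent (f : Ser) : DiffRing.p4 (serLaurent f : K⸨X⸩)
    = -serLaurent (X * serEuler f) := by
  have h : eulerDer (serLaurent f : K⸨X⸩) = serLaurent (serEuler f) := by
    ext n
    change (n : K) * (serLaurent f : K⸨X⸩).coeff n = _
    rw [serLaurent_coeff, serLaurent_coeff]
    split_ifs with hn
    · rw [coeff_serEuler, map_mul, map_natCast]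
      congr 1
      exact_mod_cast congrArg (Int.cast (R := K)) (Int.toNat_of_nonneg hn).symm
    · rw [mul_zero]
  rw [map_mul, serLaurent_X, ← h]
  exact neg_mul _ _

theorem cj_serLaurent (f : Ser) : DiffRing.cj (serLaurent f : K⸨X⸩) = serLaurent f := by
  ext n
  change cj ((serLaurent f : K⸨X⸩).coeff n) = _
  rw [serLaurent_coeff]
  split_ifs
  · rw [cj_polyCoef]
  · rw [map_zero]

/-- The radial functions have the derivatives of the functions `1/y`, `1/x`, `1/(1 - Λ/x)` and
`1/(1 - Λ/y)`. -/
theorem gres_radial {L h z κ R I : K⸨X⸩} (hL : 2 * h = L)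
    (hR : R * (1 - L * κ) = 1) (hI : I * (1 - L * z) = 1)
    (h1 : ∀ x ∈ ({κ, R, I, h, L, z} : Set K⸨X⸩), DiffRing.p1 x = 0)
    (h2 : ∀ x ∈ ({κ, R, I, h, L, z} : Set K⸨X⸩), DiffRing.p2 x = 0)
    (hcj : ∀ x ∈ ({κ, R, I, h, L, z} : Set K⸨X⸩), DiffRing.cj x = x)
    (h3 : ∀ x ∈ ({h, L, z} : Set K⸨X⸩), DiffRing.p3 x = 0)
    (h4 : ∀ x ∈ ({h, L} : Set K⸨X⸩), DiffRing.p4 x = 0)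
    (hκ3 : DiffRing.p3 κ = -(κ ^ 2 * (1 - L * κ))) (hκ4 : DiffRing.p4 κ = κ ^ 2 * (1 - L * κ) * I)
    (hz4 : DiffRing.p4 z = z ^ 2) (i : Cpt) :
    gres (fun i => cst (angular i) * radial L h z κ R I i : Cpt → K⸨X⸩) i = 0 := by
  simp only [mem_insert_iff, mem_singleton_iff, forall_eq_or_imp, forall_eq] at h1 h2 h3 h4 hcj
  have hR3 := der_inverse DiffRing.p3 hR
  have hR4 := der_inverse DiffRing.p4 hR
  have hI3 := der_inverse DiffRing.p3 hI
  have hI4 := der_inverse DiffRing.p4 hI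
  have e3 : d3 (cj (lam : K)) = 0 := by rw [← cj_d3, d3_lam, map_zero]
  have e4 : d3 (im : K) = 0 := d3_algebraMap _
  simp only [map_sub, Der.map_one, Der.leibniz, h3, h4, hκ3, hκ4, hz4] at hR3 hR4 hI3 hI4
  cases i
  all_goals
    simp only [gres, gA1, gA2, gA3, gA4, gB1, gB2, gB3, gB4, op_apply, radial, angular, map_zero, map_neg, map_mul, map_add, map_sub, map_pow,
      Der.leibniz, p1_cst, p2_cst, p3_cst, p4_cst, cj_cst, cj_cj, d3_ee, d3_lam, e3, e4, cj_im,
      Der.map_one, cj_ee, map_one, hκ3, hκ4, hz4, hR3, hR4, hI3, hI4, h3, h4, hcj, h1, h2, pow_succ,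
      pow_zero, one_mul, mul_one, mul_zero, zero_mul, add_zero, zero_add, sub_zero, neg_zero, sub_self]
  case e1 => linear_combination -(cst ee * κ ^ 2 * (1 - L * z)) * hR
  case e2 => linear_combination -(cst im * cst ee * κ ^ 2 * (1 - L * z)) * hR
  case e3 =>
    linear_combination (1 - L * z) * L * R * κ ^ 2 * I * hR
      - (1 - L * z) * R * I * (κ ^ 2 - z ^ 2) * hL + L * z ^ 2 * R * hI
  case γ2 => linear_combination -((1 - L * z) ^ 2 * κ ^ 2) * hR
  case γ3 => linear_combination -(cst lam * κ ^ 2 * (1 - L * z)) * hR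
  case γ4 => linear_combination -(cst (cj lam) * κ ^ 2 * (1 - L * z)) * hR
  case γ6 => linear_combination -((1 - L * κ) * κ * I ^ 2 * (κ ^ 2 - z ^ 2)) * hL
  case γ8 =>
    linear_combination -(2 * h * κ ^ 3 * I * (1 - L * z)) * hR - 2 * h * κ ^ 3 * hI - κ ^ 3 * hL
  case w3 => linear_combination DiffRing.U ^ 4 * 3 * L * κ ^ 4 * (1 - L * z) * hR
  all_goals ring

variable (Λ : ℝ)

/-- The radial factors of the formal Schwarzschild field. -/
def schSer : Cpt → Ser :=
  radial (serConst Λ) (serConst (Λ / 2)) (-X) (kSer Λ) (rSer Λ) (iSer Λ)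

theorem map_radial {A B : Type*} [CommRing A] [CommRing B] (f : A →+* B) (L h z κ R I : A) (i : Cpt) :
    f (radial L h z κ R I i) = radial (f L) (f h) (f z) (f κ) (f R) (f I) i := by
  cases i <;> simp [radial]

theorem gres_schSer (i : Cpt) :
    gres (fun i => cst (angular i) * serLaurent (schSer Λ i) : Cpt → K⸨X⸩) i = 0 := by
  have hc : ∀ f, DiffRing.cj (serLaurent f : K⸨X⸩) = serLaurent f := cj_serLaurent
  have h1 : ∀ f, DiffRing.p1 (serLaurent f : K⸨X⸩) = 0 := p1_serLaurent
  have h2 : ∀ f, DiffRing.p2 (serLaurent f : K⸨X⸩) = 0 := p2_serLaurent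
  simp only [schSer, map_radial]
  apply gres_radial (L := serLaurent (serConst Λ))
  · rw [← map_ofNat (serLaurent.comp serConst) 2, RingHom.comp_apply, ← map_mul, ← map_mul]
    congr 2
    ring
  · have h := congrArg (serLaurent (K := K)) (rSer_mul Λ)
    simp only [map_mul, map_add, map_one] at h
    simp only [kSer, map_neg, map_mul]
    linear_combination h
  · have h := congrArg (serLaurent (K := K)) (iSer_mul Λ)
    simp only [map_mul, map_add, map_one] at h
    rw [map_neg]
    linear_combination h
  · simp only [mem_insert_iff, mem_singleton_iff, forall_eq_or_imp, forall_eq, h1, and_self]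
  · simp only [mem_insert_iff, mem_singleton_iff, forall_eq_or_imp, forall_eq, h2, and_self]
  · simp only [mem_insert_iff, mem_singleton_iff, forall_eq_or_imp, forall_eq, hc, and_self]
  · simp only [mem_insert_iff, mem_singleton_iff, forall_eq_or_imp, forall_eq, p3_serLaurent,
      serDer_const, serDer_X, map_neg, map_zero, neg_zero, and_self]
  · simp only [mem_insert_iff, mem_singleton_iff, forall_eq_or_imp, forall_eq, p4_serLaurent,
      serEuler_const, mul_zero, map_zero, neg_zero, and_self]
  · rw [p3_serLaurent, serDer_kSer]
    simp only [map_neg, map_mul, map_sub, map_pow, map_one]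
  · rw [p4_serLaurent, serEuler_kSer]
    simp only [map_neg, map_mul, map_sub, map_pow, map_one, neg_neg]
  · rw [p4_serLaurent, map_neg, serEuler_X]
    simp only [map_neg, map_mul]
    ring

/-- The quotient of `pSer Λ - 1` by `1/u`. -/
def p1Ser : Ser := mk fun k => coeff (k + 1) (pSer Λ)

/-- The series `∑ₖ ūᵏ (1/u)ᵏ`. -/
def geomSer : Ser := mk fun k => Polynomial.X ^ k

/-- The quotient of the difference of `pSer Λ` and `geomSer` by `1/u²`. -/
def p2Ser : Ser := mk fun k =>
  coeff (k + 2) (pSer Λ) - coeff (k + 2) geomSer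

theorem pSer_eq_p1Ser : pSer Λ = 1 + X * p1Ser Λ := by
  ext1 k
  cases k with
  | zero => simp [coeff_zero_pSer]
  | succ k => rw [map_add, PowerSeries.coeff_succ_X_mul, p1Ser, coeff_mk]; simp [PowerSeries.coeff_one]

theorem coeff_one_pSer : coeff 1 (pSer Λ) = Polynomial.X := by
  have h := coeff_succ_pSer Λ 0
  have h0 : PowerSeries.constantCoeff (pSer Λ) = 1 := by
    rw [← PowerSeries.coeff_zero_eq_constantCoeff_apply, coeff_zero_pSer]
  rw [zero_add] at h
  rw [h]
  simp only [PowerSeries.coeff_zero_eq_constantCoeff, map_add, map_mul, map_pow, h0,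
    PowerSeries.constantCoeff_X, mul_zero, zero_mul, one_pow, add_zero]
  rw [polyInt, ← Polynomial.C_1, Polynomial.sum_C_index] <;> simp [Polynomial.X]

theorem pSer_eq_p2Ser : pSer Λ = geomSer + X ^ 2 * p2Ser Λ := by
  ext1 k
  match k with
  | 0 => simp [coeff_zero_pSer, geomSer]
  | 1 => simp [coeff_one_pSer, geomSer, PowerSeries.coeff_X_pow_mul', coeff_mk]
  | k + 2 => rw [map_add, PowerSeries.coeff_X_pow_mul, p2Ser, coeff_mk]; ring

/-- The radial factors of the Minkowski field. -/
def minkSer (i : Cpt) : Ser :=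
  match i with
  | e1 | e2 | γ2 | γ3 | γ4 => -(X * geomSer)
  | e3 => 1
  | γ6 => X * geomSer
  | _ => 0

/-- The radial factors of the rescaled Schwarzschild field. -/
def psiSer (i : Cpt) : Ser :=
  match i with
  | e1 | e2 | γ3 | γ4 => -(X * p2Ser Λ)
  | e3 => -(serConst Λ * p1Ser Λ * rSer Λ)
  | γ2 => -(X * p2Ser Λ) - serConst Λ * pSer Λ
  | γ6 => X * (p2Ser Λ + serConst Λ * pSer Λ * p1Ser Λ * iSer Λ)
  | γ8 => serConst (Λ / 2) * p1Ser Λ * (1 + pSer Λ) * iSer Λ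
  | w3 => serConst Λ * pSer Λ ^ 3
  | _ => 0

theorem schSer_eq (i : Cpt) :
    schSer Λ i = minkSer i + X ^ (expM i).toNat * psiSer Λ i := by
  have hR := rSer_mul Λ
  have hI := iSer_mul Λ
  have h1 := pSer_eq_p1Ser Λ
  have h2 := pSer_eq_p2Ser Λ
  cases i <;> simp only [schSer, radial, minkSer, psiSer, expM, kSer, Int.reduceToNat, mul_zero, add_zero]
  case e3 => linear_combination hR - rSer Λ * serConst Λ * X * h1
  case γ6 =>
    linear_combination X * pSer Λ * hI + X * h2
      + X ^ 2 * pSer Λ * iSer Λ * serConst Λ * h1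
  case γ8 =>
    linear_combination serConst (Λ / 2) * iSer Λ * X ^ 2 * (1 + pSer Λ) * h1
  case w3 => ring
  all_goals linear_combination -X * h2

theorem mink_eq_serLaurent (i : Cpt) :
    (mink i : K⸨X⸩) = cst (angular i) * serLaurent (minkSer i) := by
  have h : (rinv : K⸨X⸩) = -(DiffRing.Z * serLaurent geomSer) := by
    rw [rinv, serLaurent_apply]
    simp only [geomSer, coeff_mk, map_pow, polyCoef_X]
    rfl
  cases i <;> simp only [mink, angular, minkSer, map_neg, map_mul, map_one, map_zero, mul_zero,
    serLaurent_X, h] <;> ring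

/-- The coefficient functions of the rescaled Schwarzschild field. -/
def schPsi (k : ℕ) (i : Cpt) : K := angular i * polyCoef (coeff k (psiSer Λ i))

theorem fullK_schPsi (i : Cpt) : fullK (schPsi Λ : ℕ → Cpt → K) i
    = cst (angular i) * serLaurent (schSer Λ i) := by
  have h : HahnSeries.single (expM i) 1 = (serLaurent (X ^ (expM i).toNat) : K⸨X⸩) := by
    rw [map_pow, serLaurent_X]
    change _ = (HahnSeries.single 1 1 : K⸨X⸩) ^ _
    rw [HahnSeries.single_pow, one_pow]
    cases i <;> simp [expM]
  have h2 : HahnSeries.ofPowerSeries ℤ K (mk fun k => schPsi Λ k i)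
      = cst (angular i) * serLaurent (psiSer Λ i) := by
    rw [serLaurent_apply, cst, ← HahnSeries.ofPowerSeries_C, ← map_mul]
    congr 1
    ext k
    simp [schPsi]
  rw [fullK, mink_eq_serLaurent, h, h2, schSer_eq, map_add, map_mul]
  ring

theorem serEval_zero_geomSer : serEval 0 geomSer = 1 := by
  ext1 k
  rw [coeff_serEval, geomSer, coeff_mk, PowerSeries.coeff_one]
  cases k <;> simp

theorem serEval_zero_p1Ser : serEval 0 (p1Ser Λ) = 0 := by
  ext1 k
  rw [coeff_serEval, p1Ser, coeff_mk, ← coeff_serEval, serEval_zero_pSer,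
    PowerSeries.coeff_one, if_neg (by omega), map_zero]

theorem serEval_zero_p2Ser : serEval 0 (p2Ser Λ) = 0 := by
  ext1 k
  rw [coeff_serEval, p2Ser, coeff_mk, Polynomial.eval_sub, ← coeff_serEval,
    ← coeff_serEval, serEval_zero_pSer, serEval_zero_geomSer, sub_self, map_zero]

theorem serEval_zero_psiSer (i : Cpt) : serEval 0 (psiSer Λ i)
    = PowerSeries.C (match i with | γ2 => -Λ | w3 => Λ | _ => 0) := by
  cases i <;> simp [psiSer, serEval_zero_p1Ser, serEval_zero_p2Ser, serEval_zero_pSer, serEval_const]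

theorem coeff_zero_psiSer (i : Cpt) : coeff 0 (psiSer Λ i)
    = match i with
      | e3 => -(Polynomial.C Λ * Polynomial.X)
      | γ2 => -Polynomial.C Λ
      | γ8 => Polynomial.C Λ * Polynomial.X
      | w3 => Polynomial.C Λ
      | _ => 0 := by
  have hP : PowerSeries.constantCoeff (pSer Λ) = 1 := by
    rw [← PowerSeries.coeff_zero_eq_constantCoeff_apply, coeff_zero_pSer]
  have hP1 : PowerSeries.constantCoeff (p1Ser Λ) = Polynomial.X := by
    rw [← PowerSeries.coeff_zero_eq_constantCoeff_apply, p1Ser, coeff_mk, coeff_one_pSer]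
  have hR : PowerSeries.constantCoeff (rSer Λ) = 1 := by simp [rSer]
  have hI : PowerSeries.constantCoeff (iSer Λ) = 1 := by simp [iSer]
  have hC : ∀ a, PowerSeries.constantCoeff (serConst a) = Polynomial.C a := fun a => by simp [serConst]
  cases i <;> simp [psiSer, hP, hP1, hR, hI, hC]
  have h2 : Polynomial.C (Λ / 2) * 2 = Polynomial.C Λ := by
    rw [← Polynomial.C_ofNat, ← Polynomial.C_mul]
    congr 1
    ring
  rw [← h2]
  ring

theorem fn_polyCoef (f : Polynomial ℝ) {p : Slice} (hp : p ∈ upperO) :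
    (polyCoef f : Sm upperO).fn p = ((f.eval p.2 : ℝ) : ℂ) := by
  rw [Sm.fn_eq_eval _ hp]
  induction f using Polynomial.induction_on with
  | C a => rw [polyCoef_C, ← Sm.fn_eq_eval _ hp, Sm.fn_algebraMap _ hp, Polynomial.eval_C]
  | add f g hf hg => rw [map_add, map_add, hf, hg, Polynomial.eval_add, Complex.ofReal_add]
  | monomial n a h =>
    rw [pow_succ, ← mul_assoc]
    generalize Polynomial.C a * Polynomial.X ^ n = q at h ⊢
    rw [map_mul, map_mul, h, polyCoef_X, ← Sm.fn_eq_eval _ hp, fn_s hp,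
      Polynomial.eval_mul, Polynomial.eval_X, Complex.ofReal_mul]

/-- The value of `angular`. -/
def angularVal (i : Cpt) (ξ : ℂ) : ℂ :=
  match i with
  | e1 => ((1 + ‖ξ‖ ^ 2) / 2 : ℝ)
  | e2 => Complex.I * ((1 + ‖ξ‖ ^ 2) / 2 : ℝ)
  | γ3 => -ξ / 2
  | γ4 => -starRingEnd ℂ ξ / 2
  | _ => 1

theorem fn_angular (i : Cpt) {p : Slice} (hp : p ∈ upperO) :
    (angular i : Sm upperO).fn p = angularVal i p.1 := by
  have h1 : (1 : Sm upperO).fn p = 1 := by rw [Sm.fn_eq_eval _ hp, map_one]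
  cases i <;> simp only [angular, angularVal, h1]
  · rw [fn_ee hp, bfe]
  · rw [Sm.fn_mul _ _ hp, Sm.fn_im hp, fn_ee hp, bfe]
  · rw [fn_lam hp]
  · rw [fn_cj _ hp, fn_lam hp, map_div₀, map_neg, Complex.conj_ofNat]

theorem toFormal_schPsi (k : ℕ) (i : Cpt) {p : Slice} (hp : p ∈ upperO) :
    toFormal (schPsi Λ) k i p
      = angularVal i p.1 * (((coeff k (psiSer Λ i)).eval p.2 : ℝ) : ℂ) := by
  rw [toFormal, schPsi, Sm.fn_mul _ _ hp, fn_polyCoef _ hp, fn_angular i hp]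

/-- A formal solution with the characteristic data of a constant pulse energy is the expansion of
the Schwarzschild field. -/
theorem HasCharacteristicData.agree_schPsi {E : ℂ → ℝ} (hE : ∀ ξ, E ξ = Λ) {Ψ : FormalField}
    (hs : IsFormalSolution Ψ) (hd : HasCharacteristicData E Ψ) :
    Agree Ψ (toFormal (schPsi Λ)) := by
  obtain rfl : E = fun _ => Λ := funext hE
  refine HasCharacteristicData.agree (Λ := fun _ => Λ)
    ((isFormalSolution_iff (ψ := schPsi Λ) fun _ _ _ _ => rfl).mpr ⟨fun k i hi => ?_, fun i => ?_⟩) hs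
    ⟨fun i p hp => ?_, fun k i ξ => ?_⟩ hd
  · rw [schPsi, map_mul, cj_polyCoef]
    rcases hi with rfl | rfl | rfl | rfl | rfl <;> simp [angular]
  · rw [funext (fullK_schPsi Λ), gres_schSer]
  · rw [toFormal_schPsi Λ 0 i hp, coeff_zero_psiSer]
    have hX : dXi (fun _ => (Λ : ℂ)) p.1 = 0 := by simp [dXi]
    cases i <;> simp [pastData, angularVal, hX] <;> ring
  · have h : coneData (fun _ => Λ) k i ξ
        = angularVal i ξ * (((coeff k (psiSer Λ i)).eval 0 : ℝ) : ℂ) := by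
      have hX : dXiBar (fun _ => (Λ : ℂ)) = fun _ => 0 := by
        ext
        simp [dXiBar]
      have hX0 : dXiBar (fun _ => (0 : ℂ)) ξ = 0 := by simp [dXiBar]
      rw [← coeff_serEval, serEval_zero_psiSer]
      cases i <;> rcases k with _ | _ | _ | k <;>
        simp [coneData, angularVal, hX, hX0, PowerSeries.coeff_C]
    rw [h]
    refine Tendsto.congr' (eventually_nhdsWithin_of_forall fun s hs =>
      (toFormal_schPsi Λ k i (p := (ξ, s)) hs).symm) ?_
    refine tendsto_const_nhds.mul (Tendsto.mono_left ?_ nhdsWithin_le_nhds)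
    exact (Complex.continuous_ofReal.comp (Polynomial.continuous _)).tendsto' _ _ rfl

/-- The coefficients of the full field with coefficient functions `schPsi`. -/
theorem coeff_fullField_of_agree {Ψ : FormalField} (h : Agree Ψ (toFormal (schPsi Λ))) (i : Cpt)
    (n : ℕ) {p : Slice} (hp : p ∈ upper) : (fullField Ψ i).coeff n p
      = angularVal i p.1 * ((coeff n (serEval p.2 (schSer Λ i)) : ℝ) : ℂ) := by
  have hp' : p ∈ upperO := hp
  rw [rep_fullField (ψ := schPsi Λ) (fun k i p hp => h k i hp) i n p hp, fullK_schPsi, cst,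
    HahnSeries.C_apply, HahnSeries.coeff_single_zero_mul, Sm.fn_mul _ _ hp', fn_angular i hp',
    serLaurent_coeff, if_pos (Int.natCast_nonneg n), Int.toNat_natCast, fn_polyCoef _ hp',
    coeff_serEval]

end FormalSchwarzschild

/-! ### Convergence of the formal Schwarzschild field -/

section Convergence

open PowerSeries (coeff)

/-- The power series `f` converges absolutely at `z`, with value `a`. -/
def Conv (z : ℝ) (f : PowerSeries ℝ) (a : ℝ) : Prop :=
  Summable (fun k => ‖coeff k f * z ^ k‖) ∧ HasSum (fun k => coeff k f * z ^ k) a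

namespace Conv

variable {z a b : ℝ} {f g : PowerSeries ℝ}

theorem of_summable (h : Summable fun k => ‖coeff k f * z ^ k‖) :
    Conv z f (∑' k, coeff k f * z ^ k) := ⟨h, h.of_norm.hasSum⟩

theorem add (hf : Conv z f a) (hg : Conv z g b) : Conv z (f + g) (a + b) := by
  simp only [Conv, map_add, add_mul]
  exact ⟨Summable.of_nonneg_of_le (fun _ => norm_nonneg _) (fun _ => norm_add_le _ _)
    (hf.1.add hg.1), hf.2.add hg.2⟩

theorem neg (hf : Conv z f a) : Conv z (-f) (-a) := by
  simp only [Conv, map_neg, neg_mul, norm_neg]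
  exact ⟨hf.1, hf.2.neg⟩

theorem sub (hf : Conv z f a) (hg : Conv z g b) : Conv z (f - g) (a - b) := by
  simpa [sub_eq_add_neg] using hf.add hg.neg

theorem coeff_mul_mul (f g : PowerSeries ℝ) (z : ℝ) (k : ℕ) : coeff k (f * g) * z ^ k
    = ∑ ij ∈ Finset.HasAntidiagonal.antidiagonal k, coeff ij.1 f * z ^ ij.1 * (coeff ij.2 g * z ^ ij.2) := by
  rw [PowerSeries.coeff_mul, Finset.sum_mul]
  refine Finset.sum_congr rfl fun ij hij => ?_
  rw [← Finset.HasAntidiagonal.mem_antidiagonal.mp hij]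
  ring

theorem mul (hf : Conv z f a) (hg : Conv z g b) : Conv z (f * g) (a * b) := by
  have h := summable_norm_sum_mul_antidiagonal_of_summable_norm hf.1 hg.1
  have h2 := tsum_mul_tsum_eq_tsum_sum_antidiagonal_of_summable_norm hf.1 hg.1
  rw [hf.2.tsum_eq, hg.2.tsum_eq] at h2
  simp only [← coeff_mul_mul] at h h2
  rw [h2]
  exact of_summable h

theorem pow (hf : Conv z f a) : ∀ n : ℕ, n ≠ 0 → Conv z (f ^ n) (a ^ n)
  | 1, _ => by simpa using hf
  | n + 2, _ => by rw [pow_succ, pow_succ]; exact (hf.pow (n + 1) (by omega)).mul hf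

theorem single {k : ℕ} (h : ∀ j ≠ k, coeff j f = 0) : Conv z f (coeff k f * z ^ k) :=
  ⟨summable_of_ne_finset_zero (s := {k}) fun j hj => by rw [h j (by simpa using hj)]; simp,
    hasSum_single k fun j hj => by rw [h j hj, zero_mul]⟩

theorem C (c : ℝ) : Conv z (PowerSeries.C c) c := by
  have h := single (z := z) (f := PowerSeries.C c) (k := 0) fun j hj => by simp [PowerSeries.coeff_C, hj]
  simpa using h

theorem X : Conv z PowerSeries.X z := by
  have h := single (z := z) (f := PowerSeries.X) (k := 1) fun j hj => by simp [PowerSeries.coeff_X, hj]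
  simpa using h

/-- The partial sums of the absolute values. -/
def part (t : ℝ) (n : ℕ) (f : PowerSeries ℝ) : ℝ := ∑ k ∈ Finset.range n, |coeff k f| * t ^ k

variable {t : ℝ} (ht : 0 ≤ t) {n : ℕ}
include ht

theorem part_nonneg : 0 ≤ part t n f := Finset.sum_nonneg fun _ _ => by positivity

theorem part_mono {m : ℕ} (h : m ≤ n) : part t m f ≤ part t n f :=
  Finset.sum_le_sum_of_subset_of_nonneg (by simpa using h) fun _ _ _ => by positivity

theorem part_add : part t n (f + g) ≤ part t n f + part t n g := by
  rw [part, part, part, ← Finset.sum_add_distrib]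
  refine Finset.sum_le_sum fun k _ => ?_
  rw [map_add, ← add_mul]
  gcongr
  exact abs_add_le _ _

theorem part_mul : part t n (f * g) ≤ part t n f * part t n g := by
  have h : ∀ k, |coeff k (f * g)| * t ^ k
      ≤ ∑ i ∈ Finset.range (k + 1), |coeff i f| * t ^ i * (|coeff (k - i) g| * t ^ (k - i)) := by
    intro k
    rw [PowerSeries.coeff_mul, Finset.Nat.sum_antidiagonal_eq_sum_range_succ
      (fun i j => coeff i f * coeff j g)]
    refine (mul_le_mul_of_nonneg_right (Finset.abs_sum_le_sum_abs _ _) (by positivity)).trans ?_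
    rw [Finset.sum_mul]
    refine Finset.sum_le_sum fun i hi => ?_
    rw [abs_mul]
    conv_lhs => rw [← Nat.add_sub_cancel' (Nat.lt_succ_iff.mp (Finset.mem_range.mp hi)), pow_add]
    rw [Nat.add_sub_cancel_left]
    exact le_of_eq (by ring)
  refine (Finset.sum_le_sum fun k _ => h k).trans ?_
  rw [Finset.sum_range_diag_flip n fun i j => |coeff i f| * t ^ i * (|coeff j g| * t ^ j), part,
    Finset.sum_mul]
  refine Finset.sum_le_sum fun i _ => ?_
  rw [← Finset.mul_sum]
  exact mul_le_mul_of_nonneg_left (part_mono ht (Nat.sub_le _ _)) (by positivity)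

theorem part_le_of_conv (hz : t = |z|) (h : Summable fun k => ‖coeff k f * z ^ k‖) :
    part t n f ≤ ∑' k, ‖coeff k f * z ^ k‖ := by
  refine le_trans (le_of_eq ?_) (h.sum_le_tsum (Finset.range n) fun _ _ => norm_nonneg _)
  simp [part, hz, abs_mul, abs_pow]

theorem summable_of_part {c : ℝ} (hz : t = |z|) (h : ∀ n, part t n f ≤ c) :
    Summable (fun k => ‖coeff k f * z ^ k‖) ∧ ∑' k, ‖coeff k f * z ^ k‖ ≤ c := by
  have h' : ∀ n, ∑ k ∈ Finset.range n, ‖coeff k f * z ^ k‖ ≤ c := by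
    intro n
    refine le_trans (le_of_eq ?_) (h n)
    simp [part, hz, abs_mul, abs_pow]
  exact ⟨summable_of_sum_range_le (fun _ => norm_nonneg _) h',
    Real.tsum_le_of_sum_range_le (fun _ => norm_nonneg _) h'⟩

theorem part_C_le (c : ℝ) : part t n (PowerSeries.C c) ≤ |c| := by
  rcases n with _ | n
  · simp [part]
  · rw [part, Finset.sum_eq_single 0] <;> simp +contextual [PowerSeries.coeff_C]

theorem part_X_le : part t n PowerSeries.X ≤ t := by
  by_cases hn : 1 < n
  · rw [part, Finset.sum_eq_single 1] <;> simp +contextual [PowerSeries.coeff_X, hn]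
  · refine (Finset.sum_nonpos fun k hk => ?_).trans ht
    have : k ≠ 1 := by have := Finset.mem_range.mp hk; omega
    simp [PowerSeries.coeff_X, this]

theorem part_succ (n : ℕ) : part t (n + 1) f
    = |coeff 0 f| + t * ∑ k ∈ Finset.range n, |coeff (k + 1) f| * t ^ k := by
  rw [part, Finset.sum_range_succ', Finset.mul_sum, add_comm]
  congr 1
  · simp
  · exact Finset.sum_congr rfl fun _ _ => by ring

omit ht in
/-- The reciprocal of a convergent series is convergent if the latter is close to `1`. -/
theorem inv {r : PowerSeries ℝ} (hf : Conv z f a) (hr : r * (1 + PowerSeries.X * f) = 1)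
    (hz : |z| * ∑' k, ‖coeff k f * z ^ k‖ ≤ 1 / 2) : Conv z r (1 + z * a)⁻¹ := by
  have ht := abs_nonneg z
  have hr' : r = 1 - PowerSeries.X * (f * r) := by linear_combination hr
  have key : ∀ n, part |z| n r ≤ 2 := by
    intro n
    induction n with
    | zero => simp [part]
    | succ n ih =>
      have h0 : |coeff 0 r| = 1 := by rw [hr']; simp
      have h1 : ∑ k ∈ Finset.range n, |coeff (k + 1) r| * |z| ^ k = part |z| n (f * r) := by
        refine Finset.sum_congr rfl fun k _ => ?_
        conv_lhs => rw [hr', map_sub, PowerSeries.coeff_succ_X_mul]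
        simp [PowerSeries.coeff_one]
      rw [part_succ ht, h0, h1]
      have h2 := part_mul ht (f := f) (g := r) (n := n)
      have h3 := part_le_of_conv ht rfl hf.1 (n := n)
      have h4 := part_nonneg ht (f := r) (n := n)
      calc 1 + |z| * part |z| n (f * r)
          ≤ 1 + |z| * ((∑' k, ‖coeff k f * z ^ k‖) * part |z| n r) := by gcongr; exact h2.trans (by gcongr)
        _ = 1 + (|z| * ∑' k, ‖coeff k f * z ^ k‖) * part |z| n r := by ring
        _ ≤ 1 + 1 / 2 * 2 := by gcongr
        _ = 2 := by norm_num
  have hs := of_summable (summable_of_part ht rfl key).1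
  have h1 := hs.mul ((C 1).add (X.mul hf))
  rw [map_one, hr] at h1
  have h2 := h1.2.unique (by simpa using (C (z := z) 1).2)
  rwa [← eq_inv_of_mul_eq_one_left h2]

end Conv

variable {Λ : ℝ} (hΛ : 0 ≤ Λ)

/-- The coefficients up to index `n` are polynomials with nonnegative coefficients. -/
def NonnegTo (n : ℕ) (f : Ser) : Prop := ∀ k ≤ n, ∀ j, 0 ≤ (coeff k f).coeff j

namespace NonnegTo

variable {n : ℕ} {f g : Ser}

theorem add (hf : NonnegTo n f) (hg : NonnegTo n g) : NonnegTo n (f + g) := fun k hk j => by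
  rw [map_add, Polynomial.coeff_add]
  exact add_nonneg (hf k hk j) (hg k hk j)

theorem mul (hf : NonnegTo n f) (hg : NonnegTo n g) : NonnegTo n (f * g) := fun k hk j => by
  rw [PowerSeries.coeff_mul, Polynomial.finsetSum_coeff]
  refine Finset.sum_nonneg fun ij hij => ?_
  have h := Finset.HasAntidiagonal.mem_antidiagonal.mp hij
  rw [Polynomial.coeff_mul]
  exact Finset.sum_nonneg fun ab _ => mul_nonneg (hf _ (by omega) _) (hg _ (by omega) _)

theorem X : NonnegTo n PowerSeries.X := fun k _ j => by
  rw [PowerSeries.coeff_X]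
  split_ifs
  · rw [Polynomial.coeff_one]; split_ifs <;> simp
  · simp

theorem const {c : ℝ} (hc : 0 ≤ c) : NonnegTo n (serConst c) := fun k _ j => by
  simp only [serConst, RingHom.comp_apply, PowerSeries.coeff_C]
  split_ifs
  · rw [Polynomial.coeff_C]; split_ifs <;> simp [hc]
  · simp

theorem radius_rhs (hΛ : 0 ≤ Λ) (h : NonnegTo n f) :
    NonnegTo n (f ^ 2 + serConst Λ * PowerSeries.X * f ^ 3) := by
  rw [pow_two, pow_succ, pow_two]
  exact (h.mul h).add (((const hΛ).mul X).mul ((h.mul h).mul h))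

theorem pSer (hΛ : 0 ≤ Λ) (n : ℕ) : NonnegTo n (pSer Λ) := by
  induction n with
  | zero =>
    intro k hk j
    obtain rfl : k = 0 := by omega
    rw [coeff_zero_pSer, Polynomial.coeff_one]
    split_ifs <;> simp
  | succ n ih =>
    intro k hk j
    rcases hk.lt_or_eq with h | rfl
    · exact ih k (by omega) j
    · rw [coeff_succ_pSer]
      exact coeff_polyInt_nonneg (radius_rhs hΛ ih n le_rfl) j

theorem eval_nonneg (hf : NonnegTo n f) {k : ℕ} (hk : k ≤ n) {s : ℝ} (hs : 0 ≤ s) :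
    0 ≤ coeff k (serEval s f) := by
  rw [coeff_serEval, Polynomial.eval_eq_sum, Polynomial.sum]
  exact Finset.sum_nonneg fun j _ => mul_nonneg (hf k hk j) (by positivity)

theorem eval_mono (hf : NonnegTo n f) {k : ℕ} (hk : k ≤ n) {s s' : ℝ} (hs : 0 ≤ s) (h : s ≤ s') :
    coeff k (serEval s f) ≤ coeff k (serEval s' f) := by
  rw [coeff_serEval, coeff_serEval, Polynomial.eval_eq_sum, Polynomial.eval_eq_sum, Polynomial.sum,
    Polynomial.sum]
  exact Finset.sum_le_sum fun j _ => mul_le_mul_of_nonneg_left (by gcongr) (hf k hk j)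

end NonnegTo

open Conv

include hΛ

theorem part_pSer_le {s t : ℝ} (hs : 0 ≤ s) (ht : 0 ≤ t) (hst : s * t ≤ 1 / 8) (hΛt : Λ * t ≤ 1 / 4)
    (n : ℕ) : part t n (serEval s (pSer Λ)) ≤ 3 / 2 := by
  induction n with
  | zero => norm_num [part]
  | succ n ih =>
    have hB := fun m => NonnegTo.radius_rhs (n := m) hΛ (NonnegTo.pSer hΛ m)
    set q := part t n (serEval s (pSer Λ))
    have hq : 0 ≤ q := part_nonneg ht
    have h1 : ∑ k ∈ Finset.range n, |coeff (k + 1) (serEval s (pSer Λ))| * t ^ k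
        ≤ s * part t n (serEval s (pSer Λ ^ 2 + serConst Λ * PowerSeries.X * pSer Λ ^ 3)) := by
      rw [part, Finset.mul_sum]
      refine Finset.sum_le_sum fun k _ => ?_
      rw [abs_of_nonneg ((NonnegTo.pSer hΛ (k + 1)).eval_nonneg le_rfl hs),
        abs_of_nonneg ((hB k).eval_nonneg le_rfl hs), coeff_serEval, coeff_serEval, coeff_succ_pSer,
        ← mul_assoc]
      gcongr
      exact eval_polyInt_le (hB k k le_rfl) hs
    have h2 : part t n (serEval s (pSer Λ ^ 2 + serConst Λ * PowerSeries.X * pSer Λ ^ 3))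
        ≤ q * q + Λ * t * (q * q * q) := by
      have hqq : part t n (serEval s (pSer Λ) * serEval s (pSer Λ)) ≤ q * q := part_mul ht
      simp only [pow_succ, pow_zero, one_mul, map_add, map_mul, serEval_const, serEval_X]
      refine (part_add ht).trans (add_le_add hqq ((part_mul ht).trans (mul_le_mul ?_ ?_
        (part_nonneg ht) (by positivity))))
      · refine (part_mul ht).trans (mul_le_mul ?_ (part_X_le ht) (part_nonneg ht) hΛ)
        exact (part_C_le ht Λ).trans (abs_of_nonneg hΛ).le
      · exact (part_mul ht).trans (by gcongr)
    have h3 : q * q + Λ * t * (q * q * q) ≤ 3 / 2 * (3 / 2) + 1 / 4 * (3 / 2 * (3 / 2) * (3 / 2)) := by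
      gcongr
    have h0 : coeff 0 (serEval s (pSer Λ)) = 1 := by rw [coeff_serEval, coeff_zero_pSer]; simp
    rw [part_succ ht, h0, abs_one]
    calc 1 + t * _ ≤ 1 + t * (s * 4) := by
          gcongr
          refine h1.trans (mul_le_mul_of_nonneg_left (h2.trans (h3.trans (by norm_num))) hs)
      _ = 1 + 4 * (s * t) := by ring
      _ ≤ 3 / 2 := by linarith

end Convergence

/-! ### The Schwarzschild radius -/

section Radius

variable {Λ : ℝ} (hΛ : 0 ≤ Λ)

/-- The tortoise coordinate, for `x = √2 r`. -/
def tortoise (Λ x : ℝ) : ℝ := x + Λ * Real.log (x - Λ)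

theorem hasDerivAt_tortoise {x : ℝ} (hx : Λ < x) : HasDerivAt (tortoise Λ) (x / (x - Λ)) x := by
  have h0 : x - Λ ≠ 0 := (sub_pos.mpr hx).ne'
  have h := (hasDerivAt_id x).add ((((hasDerivAt_id x).sub_const Λ).log h0).const_mul Λ)
  refine h.congr_deriv ?_
  simp only [id]
  field_simp
  ring

include hΛ

theorem strictMonoOn_tortoise : StrictMonoOn (tortoise Λ) (Ioi Λ) := by
  intro a ha b hb hab
  have h1 : Real.log (a - Λ) ≤ Real.log (b - Λ) :=
    Real.log_le_log (sub_pos.mpr ha) (by linarith)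
  have := mul_le_mul_of_nonneg_left h1 hΛ
  rw [tortoise, tortoise]
  linarith

theorem exists_tortoise_eq {y s : ℝ} (hy : Λ < y) (hs : 0 ≤ s) :
    ∃ x ∈ Ioi Λ, tortoise Λ x = tortoise Λ y + s := by
  have hc : ContinuousOn (tortoise Λ) (Icc y (y + s)) := fun x hx =>
    (hasDerivAt_tortoise (hy.trans_le hx.1)).continuousAt.continuousWithinAt
  have h1 : Real.log (y - Λ) ≤ Real.log (y + s - Λ) :=
    Real.log_le_log (sub_pos.mpr hy) (by linarith)
  have h2 : tortoise Λ y + s ≤ tortoise Λ (y + s) := by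
    have := mul_le_mul_of_nonneg_left h1 hΛ
    rw [tortoise, tortoise]
    linarith
  obtain ⟨x, hx, h⟩ := intermediate_value_Icc (by linarith) hc ⟨by linarith, h2⟩
  exact ⟨x, hy.trans_le hx.1, h⟩

omit hΛ in
/-- The inverse of the tortoise coordinate. -/
def radius (Λ : ℝ) : ℝ → ℝ := Function.invFunOn (tortoise Λ) (Ioi Λ)

theorem radius_tortoise {x : ℝ} (hx : Λ < x) : radius Λ (tortoise Λ x) = x :=
  (strictMonoOn_tortoise hΛ).injOn.leftInvOn_invFunOn hx

theorem hasDerivAt_contDiffAt_radius {x : ℝ} (hx : Λ < x) :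
    HasDerivAt (radius Λ) ((x - Λ) / x) (tortoise Λ x) ∧
      ContDiffAt ℝ ∞ (radius Λ) (tortoise Λ x) := by
  have h0 : x - Λ ≠ 0 := (sub_pos.mpr hx).ne'
  have hx0 : x ≠ 0 := (hΛ.trans_lt hx).ne'
  have hd : x / (x - Λ) ≠ 0 := div_ne_zero hx0 h0
  have hc : ContDiffAt ℝ ∞ (tortoise Λ) x :=
    contDiffAt_id.add (contDiffAt_const.mul ((contDiffAt_id.sub contDiffAt_const).log h0))
  have hf := (hasDerivAt_tortoise hx).hasFDerivAt_equiv hd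
  have hs := hc.hasStrictFDerivAt' hf (by simp)
  have hev : radius Λ =ᶠ[𝓝 (tortoise Λ x)] hs.localInverse := by
    have h1 := hs.localInverse_continuousAt.tendsto
    rw [hs.localInverse_apply_image] at h1
    filter_upwards [hs.eventually_right_inverse, h1 (Ioi_mem_nhds hx)] with w hw hw'
    rw [← hw]
    exact (radius_tortoise hΛ hw').trans (by rw [hw])
  constructor
  · refine HasDerivAt.congr_of_eventuallyEq ?_ hev
    have h := hs.to_localInverse.hasFDerivAt.hasDerivAt
    simpa using h
  · exact (hc.to_localInverse hf (by simp)).congr_of_eventuallyEq hev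

open PowerSeries (coeff)
open Conv

theorem conv_pSer {b y s x : ℝ} (hb : 0 < b) (hy : 8 * (b + 1) + 4 * Λ < y) (hs : 0 < s)
    (hsb : s ≤ b) (hx : Λ < x) (hxy : tortoise Λ x = tortoise Λ y + s) :
    Conv (-1 / y) (serEval s (pSer Λ)) (y / x)
      ∧ ∑' k, ‖coeff k (serEval s (pSer Λ)) * (-1 / y) ^ k‖ ≤ 3 / 2 := by
  have hy0 : 0 < y := by linarith
  set z := -1 / y with hzdef
  have hz : |z| = 1 / y := by rw [hzdef, abs_div, abs_neg, abs_one, abs_of_pos hy0]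
  have h1 : (b + 1) * (1 / y) ≤ 1 / 8 := by rw [mul_one_div, div_le_div_iff₀ hy0 (by norm_num)]; linarith
  have h2 : Λ * (1 / y) ≤ 1 / 4 := by rw [mul_one_div, div_le_div_iff₀ hy0 (by norm_num)]; linarith
  have hsum : ∀ s ∈ Icc 0 (b + 1), Summable (fun k => ‖coeff k (serEval s (pSer Λ)) * z ^ k‖)
      ∧ ∑' k, ‖coeff k (serEval s (pSer Λ)) * z ^ k‖ ≤ 3 / 2 := fun s hs' =>
    summable_of_part (abs_nonneg z) rfl fun n => part_pSer_le hΛ hs'.1 (abs_nonneg z)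
      (by rw [hz]; exact (mul_le_mul_of_nonneg_right hs'.2 (by positivity)).trans h1) (by rw [hz]; exact h2) n
  set f : ℝ → ℝ := fun s => ∑' k, coeff k (serEval s (pSer Λ)) * z ^ k with hf
  have hconv : ∀ s ∈ Icc 0 (b + 1), Conv z (serEval s (pSer Λ)) (f s) := fun s hs' =>
    of_summable (hsum s hs').1
  have hbound : ∀ s ∈ Icc 0 (b + 1), 1 / 2 ≤ f s ∧ f s ≤ 3 / 2 := by
    intro s hs'
    obtain ⟨hs1, hs2⟩ := hsum s hs'
    have h3 := le_hasSum ((hconv s hs').2.add hs1.hasSum) 0 fun k _ => by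
      have := neg_abs_le (coeff k (serEval s (pSer Λ)) * z ^ k)
      rw [Real.norm_eq_abs]
      linarith
    have h4 : coeff 0 (serEval s (pSer Λ)) = 1 := by rw [coeff_serEval, coeff_zero_pSer]; simp
    have h5 := hasSum_le (fun k => le_abs_self _) (hconv s hs').2 hs1.hasSum
    rw [h4, pow_zero, mul_one, norm_one] at h3
    exact ⟨by linarith, by linarith⟩
  set rhs : Ser := PowerSeries.X * (pSer Λ ^ 2 + serConst Λ * PowerSeries.X * pSer Λ ^ 3)
  have hrhs : ∀ s ∈ Icc 0 (b + 1), Conv z (serEval s rhs) (z * (f s ^ 2 + Λ * z * f s ^ 3)) := by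
    intro s hs'
    have h := hconv s hs'
    simp only [rhs, map_mul, map_add, map_pow, serEval_const, serEval_X]
    exact X.mul ((h.pow 2 (by norm_num)).add (((C Λ).mul X).mul (h.pow 3 (by norm_num))))
  have hb1 : b + 1 ∈ Icc 0 (b + 1) := ⟨by linarith, le_rfl⟩
  have hnn : ∀ k, NonnegTo k rhs := fun k => NonnegTo.X.mul (NonnegTo.radius_rhs hΛ (NonnegTo.pSer hΛ k))
  have hder : ∀ s ∈ Ioo 0 (b + 1), HasDerivAt f (z * (f s ^ 2 + Λ * z * f s ^ 3)) s := by
    intro s hs'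
    have h := hasDerivAt_tsum_of_isPreconnected (hrhs _ hb1).1 isOpen_Ioo isPreconnected_Ioo
      (g := fun k s => coeff k (serEval s (pSer Λ)) * z ^ k)
      (g' := fun k s => coeff k (serEval s rhs) * z ^ k) (t := Ioo 0 (b + 1)) (y₀ := s) (y := s)
      (fun k r hr => ?_) (fun k r hr => ?_) hs' (hsum s ⟨hs'.1.le, hs'.2.le⟩).1.of_norm hs'
    · rwa [(hrhs s ⟨hs'.1.le, hs'.2.le⟩).2.tsum_eq] at h
    · simp only [coeff_serEval, rhs, ← serDer_pSer, coeff_serDer, polyDer_apply]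
      exact (Polynomial.hasDerivAt _ _).mul_const _
    · rw [norm_mul, norm_mul, Real.norm_of_nonneg ((hnn k).eval_nonneg le_rfl hr.1.le),
        Real.norm_of_nonneg ((hnn k).eval_nonneg le_rfl hb1.1)]
      gcongr
      exact (hnn k).eval_mono le_rfl hr.1.le hr.2.le
  have hcont : ContinuousOn f (Icc 0 (b + 1)) := by
    refine continuousOn_tsum (fun k => ?_) (hsum _ hb1).1 fun k r hr => ?_
    · simp only [coeff_serEval]
      exact ((Polynomial.continuous _).mul continuous_const).continuousOn
    · have hp := NonnegTo.pSer hΛ k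
      rw [norm_mul, norm_mul, Real.norm_of_nonneg (hp.eval_nonneg le_rfl hr.1),
        Real.norm_of_nonneg (hp.eval_nonneg le_rfl hb1.1)]
      gcongr
      exact hp.eval_mono le_rfl hr.1 hr.2
  have hgt : ∀ s ∈ Icc 0 (b + 1), Λ < y / f s := by
    intro s hs'
    obtain ⟨h3, h4⟩ := hbound s hs'
    rw [lt_div_iff₀ (by linarith)]
    nlinarith
  have hne : ∀ s ∈ Icc 0 (b + 1), f s ≠ 0 := fun s hs' => by have := (hbound s hs').1; linarith
  have hf0 : f 0 = 1 := by
    have h := (C (z := z) 1).2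
    rw [map_one, ← serEval_zero_pSer Λ] at h
    exact h.tsum_eq
  have hconst : ∀ s ∈ Ioo 0 (b + 1), HasDerivAt (fun s => tortoise Λ (y / f s) - s) 0 s := by
    intro s hs'
    have hs2 : s ∈ Icc 0 (b + 1) := ⟨hs'.1.le, hs'.2.le⟩
    have hsub : y - f s * Λ ≠ 0 := by
      have := hgt s hs2
      rw [lt_div_iff₀ (by linarith [(hbound s hs2).1])] at this
      linarith
    have h := ((hasDerivAt_tortoise (hgt s hs2)).comp s ((hasDerivAt_const s y).div (hder s hs') (hne s hs2))).sub
      (hasDerivAt_id s)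
    refine h.congr_deriv ?_
    have := hne s hs2
    have h3 : y / f s - Λ = (y - f s * Λ) / f s := by field_simp
    rw [h3, hzdef]
    field_simp
    ring
  have hF : tortoise Λ (y / f s) - s = tortoise Λ (y / f 0) - 0 := by
    have hc : ContinuousOn (fun s => tortoise Λ (y / f s) - s) (Icc 0 s) := by
      refine ContinuousOn.sub (fun r hr => ?_) continuousOn_id
      have hr' : r ∈ Icc 0 (b + 1) := ⟨hr.1, by linarith [hr.2]⟩
      have hq : ContinuousWithinAt (fun s => y / f s) (Icc 0 (b + 1)) r :=
        continuousWithinAt_const.div (hcont r hr') (hne r hr')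
      exact (ContinuousAt.comp_continuousWithinAt (f := fun s => y / f s)
        (hasDerivAt_tortoise (hgt r hr')).continuousAt hq).mono
        fun q hq => ⟨hq.1, by linarith [hq.2]⟩
    obtain ⟨c, hc1, hc2⟩ := exists_hasDerivAt_eq_slope (fun s => tortoise Λ (y / f s) - s) (fun _ => 0) hs hc
      fun r hr => hconst r ⟨hr.1, by linarith [hr.2]⟩
    have := (div_eq_zero_iff.mp hc2.symm).resolve_right (by linarith)
    exact sub_eq_zero.mp this
  have hs' : s ∈ Icc 0 (b + 1) := ⟨hs.le, by linarith⟩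
  have hfx : y / f s = x := (strictMonoOn_tortoise hΛ).injOn (hgt s hs') hx (by
    rw [hf0, div_one] at hF
    linarith)
  have hfs : f s = y / x := by
    rw [← hfx, div_div_cancel₀ hy0.ne']
  exact ⟨hfs ▸ hconv s hs', (hsum s hs').2⟩

open Cpt

theorem hasSum_schSer {b : ℝ} (hb : 0 < b) {y s x : ℝ} (hy : 8 * (b + 1) + 4 * Λ < y) (hs : 0 < s)
    (hsb : s ≤ b) (hx : Λ < x) (hxy : tortoise Λ x = tortoise Λ y + s) (i : Cpt) :
    HasSum (fun n => coeff n (serEval s (schSer Λ i)) * (-1 / y) ^ n)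
      (radial Λ (Λ / 2) y⁻¹ x⁻¹ (1 - Λ * x⁻¹)⁻¹ (1 - Λ * y⁻¹)⁻¹ i) := by
  obtain ⟨hP, hP2⟩ := conv_pSer hΛ hb hy hs hsb hx hxy
  have hy0 : 0 < y := by linarith
  have hx0 : 0 < x := hΛ.trans_lt hx
  have hz : |-1 / y| = y⁻¹ := by rw [abs_div, abs_neg, abs_one, abs_of_pos hy0, one_div]
  have hΛy : y⁻¹ * Λ ≤ 1 / 4 := by rw [inv_mul_eq_div, div_le_div_iff₀ hy0 (by norm_num)]; linarith
  have hyv : Conv (-1 / y) (-PowerSeries.X) y⁻¹ := by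
    have := (X (z := -1 / y)).neg
    rwa [← neg_div, neg_neg, one_div] at this
  have hκ : Conv (-1 / y) (serEval s (kSer Λ)) x⁻¹ := by
    have h := (X.mul hP).neg
    rw [kSer, map_neg, map_mul, serEval_X]
    convert h using 1
    field_simp
  have hCP := (C (z := -1 / y) Λ).mul hP
  have hR : Conv (-1 / y) (serEval s (rSer Λ)) (1 - Λ * x⁻¹)⁻¹ := by
    have h := congrArg (serEval s) (rSer_mul Λ)
    simp only [map_mul, map_add, map_one, serEval_const, serEval_X] at h
    have h' := hCP.inv (r := serEval s (rSer Λ)) (by linear_combination h) (by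
      have h3 : ∀ k, ‖coeff k (PowerSeries.C Λ * serEval s (pSer Λ)) * (-1 / y) ^ k‖
          = Λ * ‖coeff k (serEval s (pSer Λ)) * (-1 / y) ^ k‖ := fun k => by
        rw [PowerSeries.coeff_C_mul, mul_assoc, norm_mul, Real.norm_of_nonneg hΛ]
      simp only [h3, tsum_mul_left, hz]
      nlinarith [mul_le_mul_of_nonneg_left hP2 (mul_nonneg (inv_nonneg.mpr hy0.le) hΛ)])
    convert h' using 2
    field_simp
    ring
  have hI : Conv (-1 / y) (serEval s (iSer Λ)) (1 - Λ * y⁻¹)⁻¹ := by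
    have h := congrArg (serEval s) (iSer_mul Λ)
    simp only [map_mul, map_add, map_one, serEval_const, serEval_X] at h
    have h' := (C (z := -1 / y) Λ).inv (r := serEval s (iSer Λ)) (by linear_combination h) (by
      rw [tsum_eq_single 0 fun k hk => by simp [PowerSeries.coeff_C, hk], hz]
      simp [abs_of_nonneg hΛ]
      linarith)
    convert h' using 2
    field_simp
    ring
  have h1 : Conv (-1 / y) 1 1 := by simpa using C (z := -1 / y) 1
  have hL := C (z := -1 / y) Λ
  have hh := C (z := -1 / y) (Λ / 2)
  have h0 : Conv (-1 / y) 0 0 := by simpa using C (z := -1 / y) 0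
  suffices Conv (-1 / y) (serEval s (schSer Λ i))
      (radial Λ (Λ / 2) y⁻¹ x⁻¹ (1 - Λ * x⁻¹)⁻¹ (1 - Λ * y⁻¹)⁻¹ i) from this.2
  rw [schSer, map_radial, serEval_const, serEval_const, map_neg, serEval_X]
  cases i
  case e3 => exact (h1.sub (hL.mul hyv)).mul hR
  case γ2 => exact (h1.sub (hL.mul hyv)).mul hκ
  case γ6 => exact (((h1.sub (hL.mul hκ)).mul hκ).mul hI).neg
  case γ8 => exact (hh.mul hI).mul ((hκ.pow 2 (by norm_num)).sub (hyv.pow 2 (by norm_num)))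
  case w3 => exact (hL.mul (hκ.pow 3 (by norm_num))).neg
  all_goals first | exact hκ | exact h0

end Radius

/-! ### The structure equations of a frame -/

section StructureEquations

variable {F : Pt → Cpt → ℂ} {x : Pt}

theorem Gam_antisymm (X : Cpt → ℂ) (a j k : Fin 4) : Gam X a j k = -Gam X a k j := by
  have h : pairSign j k = -pairSign k j ∧ pairIndex j k = pairIndex k j := by
    fin_cases j <;> fin_cases k <;> simp [pairSign, pairIndex]
  rw [Gam, Gam, h.1, h.2, neg_mul]

/-- The coefficients `Γ_{aj}{}^c`. -/
def gamUp (X : Cpt → ℂ) (a j c : Fin 4) : ℂ := ∑ d, Gam X a j d * gFrame d c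

theorem sum_gamUp (X : Cpt → ℂ) (a j k : Fin 4) : ∑ c, gamUp X a j c * gFrame c k = Gam X a j k := by
  fin_cases k <;> simp [gamUp, Fin.sum_univ_four, gFrame]

theorem along_congr {X : VField} {f g : Pt → ℂ} (h : f =ᶠ[𝓝 x] g) : along X f x = along X g x := by
  simp only [along, pd, h.fderiv_eq]

theorem along_const {X : VField} (c : ℂ) : along X (fun _ => c) x = 0 := by
  simp [along, pd]

theorem frame_eq (b : Fin 4) : frame F b x = Pi.single b 1 ᵥ* frameMatrix F x :=
  (Matrix.single_one_vecMul b (frameMatrix F x)).symm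

variable {U : Set Pt} (hU : IsOpen U) (hF : ∀ x ∈ U, IsUnit (frameMatrix F x).det)
include hU hF

theorem frameCpt_of_eq {Y : VField} (hx : x ∈ U) {v : Fin 4 → ℂ}
    (h : Y x = v ᵥ* frameMatrix F x) (c : Fin 4) : frameCpt F Y c x = v c := by
  rw [frameCpt, h, Matrix.vecMul_vecMul, Matrix.mul_nonsing_inv _ (hF x hx), Matrix.vecMul_one]

theorem gPair_eq (hx : x ∈ U) (v w : Fin 4 → ℂ) :
    gPair F x (v ᵥ* frameMatrix F x) (w ᵥ* frameMatrix F x) = v ⬝ᵥ (gFrame *ᵥ w) := by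
  have h1 := Matrix.mul_nonsing_inv _ (hF x hx)
  rw [gPair, metric, ← Matrix.mulVec_mulVec, ← Matrix.mulVec_mulVec, Matrix.mulVec_transpose,
    Matrix.vecMul_vecMul, h1, Matrix.vecMul_one, Matrix.dotProduct_mulVec, Matrix.vecMul_vecMul, h1,
    Matrix.vecMul_one]

/-- The connection in terms of frame components. -/
theorem nabla_eq (X Y : VField) {v : Fin 4 → ℂ} {f : Fin 4 → Pt → ℂ} (hx : x ∈ U)
    (hX : X x = v ᵥ* frameMatrix F x) (hY : ∀ y ∈ U, Y y = (fun c => f c y) ᵥ* frameMatrix F y) :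
    nabla F X Y x = (fun c => along X (f c) x + ∑ a, ∑ b, v a * f b x * gamUp (F x) a b c)
      ᵥ* frameMatrix F x := by
  have h : ∀ c, frameCpt F Y c =ᶠ[𝓝 x] f c := fun c => by
    filter_upwards [hU.mem_nhds hx] with y hy
    exact frameCpt_of_eq hU hF hy (hY y hy) c
  ext μ
  simp only [nabla, Matrix.vecMul, dotProduct]
  refine Finset.sum_congr rfl fun c _ => ?_
  rw [along_congr (h c)]
  simp only [frameCpt_of_eq hU hF hx hX, (h _).self_of_nhds, gamUp, Finset.mul_sum, mul_assoc]

theorem gPair_frame (hx : x ∈ U) (v : Fin 4 → ℂ) (a : Fin 4) :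
    gPair F x (v ᵥ* frameMatrix F x) (frame F a x) = ∑ c, v c * gFrame c a := by
  rw [frame_eq, gPair_eq hU hF hx]
  simp [dotProduct]

variable (htor : ∀ x ∈ U, ∀ j k, bracket (frame F j) (frame F k) x
  = (fun c => gamUp (F x) j k c - gamUp (F x) k j c) ᵥ* frameMatrix F x)
include htor

theorem leviCivita_of_torsion (hx : x ∈ U) (a j k : Fin 4) :
    (1 / 2 : ℂ) * (-gPair F x (frame F a x) (bracket (frame F j) (frame F k) x)
      + gPair F x (frame F k x) (bracket (frame F a) (frame F j) x)
      + gPair F x (frame F j x) (bracket (frame F k) (frame F a) x)) = Gam (F x) a j k := by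
  have h : ∀ a j k, gPair F x (frame F a x) (bracket (frame F j) (frame F k) x)
      = Gam (F x) j k a - Gam (F x) k j a := by
    intro a j k
    have hs : ∀ c, gFrame a c = gFrame c a := fun c => by fin_cases a <;> fin_cases c <;> simp [gFrame]
    rw [htor x hx, frame_eq, gPair_eq hU hF hx, ← sum_gamUp, ← sum_gamUp,
      ← Finset.sum_sub_distrib, single_one_dotProduct, Matrix.mulVec, dotProduct]
    exact Finset.sum_congr rfl fun c _ => by rw [hs]; ring
  rw [h, h, h, Gam_antisymm _ j a k, Gam_antisymm _ k a j, Gam_antisymm _ a k j]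
  ring

theorem riemann_eq (hd : ∀ a j k, DifferentiableAt ℝ (fun y => Gam (F y) a j k) x) (hx : x ∈ U)
    (a b j k : Fin 4) :
    gPair F x (nabla F (frame F j) (nabla F (frame F k) (frame F b)) x
      - nabla F (frame F k) (nabla F (frame F j) (frame F b)) x
      - nabla F (bracket (frame F j) (frame F k)) (frame F b) x) (frame F a x)
      = along (frame F j) (fun y => Gam (F y) k b a) x - along (frame F k) (fun y => Gam (F y) j b a) x
        + ∑ e, (gamUp (F x) k b e * Gam (F x) j e a - gamUp (F x) j b e * Gam (F x) k e a
          - (gamUp (F x) j k e - gamUp (F x) k j e) * Gam (F x) e b a) := by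
  have h1 : ∀ {X : VField} {v : Fin 4 → ℂ} {y}, y ∈ U → X y = v ᵥ* frameMatrix F y → ∀ b,
      nabla F X (frame F b) y = (fun c => ∑ a, v a * gamUp (F y) a b c) ᵥ* frameMatrix F y := by
    intro X v y hy hX b
    rw [nabla_eq hU hF X _ (f := fun c _ => (Pi.single b 1 : Fin 4 → ℂ) c) hy hX fun z _ => frame_eq b]
    congr 1
    ext c
    rw [along_const, zero_add]
    refine Finset.sum_congr rfl fun a _ => ?_
    rw [Finset.sum_eq_single b (fun e _ he => by simp [Pi.single_eq_of_ne he]) (by simp)]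
    simp
  have h2 : ∀ k b, ∀ y ∈ U, nabla F (frame F k) (frame F b) y
      = (fun c => gamUp (F y) k b c) ᵥ* frameMatrix F y := by
    intro k b y hy
    rw [h1 hy (frame_eq k)]
    congr 1
    ext c
    rw [Finset.sum_eq_single k (fun e _ he => by simp [Pi.single_eq_of_ne he]) (by simp)]
    simp
  have h3 : ∀ j k, nabla F (frame F j) (nabla F (frame F k) (frame F b)) x
      = (fun c => along (frame F j) (fun y => gamUp (F y) k b c) x
        + ∑ e, gamUp (F x) k b e * gamUp (F x) j e c) ᵥ* frameMatrix F x := by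
    intro j k
    rw [nabla_eq hU hF _ _ (f := fun c y => gamUp (F y) k b c) hx (frame_eq j) (h2 k b)]
    congr 1
    ext c
    rw [Finset.sum_eq_single j (fun e _ he => by simp [Pi.single_eq_of_ne he]) (by simp)]
    simp
  have h4 : ∀ X : VField, ∀ k, ∑ c, along X (fun y => gamUp (F y) k b c) x * gFrame c a
      = along X (fun y => Gam (F y) k b a) x := by
    intro X k
    have hg : ∀ c, DifferentiableAt ℝ (fun y => gamUp (F y) k b c) x := fun c =>
      DifferentiableAt.fun_sum fun d _ => (hd k b d).mul_const _
    simp only [← sum_gamUp (F _) k b a, along, pd, Finset.sum_mul]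
    rw [Finset.sum_comm]
    refine Finset.sum_congr rfl fun μ _ => ?_
    rw [fderiv_fun_sum fun c _ => (hg c).mul_const _]
    simp only [sum_apply, Finset.mul_sum, fderiv_mul_const (hg _),
      smul_apply, smul_eq_mul]
    exact Finset.sum_congr rfl fun c _ => by ring
  rw [h3, h3, h1 hx (htor x hx j k), ← Matrix.sub_vecMul, ← Matrix.sub_vecMul, gPair_frame hU hF hx,
    ← h4, ← h4, ← Finset.sum_sub_distrib]
  simp only [← sum_gamUp (F x) _ _ a, Pi.sub_apply, Fin.sum_univ_four]
  ring

end StructureEquations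

/-! ### The Schwarzschild field -/

section SchwarzschildField

variable (Λ : ℝ)

/-- The area radius, as a function of the coordinates. -/
def areaRadius (x : Pt) : ℝ := radius Λ (tortoise Λ (-x.2.2) + x.2.1)

/-- The Schwarzschild field. -/
def schField (x : Pt) (i : Cpt) : ℂ :=
  let κ : ℂ := (areaRadius Λ x : ℂ)⁻¹
  let ζ : ℂ := (-x.2.2 : ℂ)⁻¹
  angularVal i x.1 * radial (Λ : ℂ) (Λ / 2) ζ κ (1 - Λ * κ)⁻¹ (1 - Λ * ζ)⁻¹ i

theorem hasFDerivAt_coords (x : Pt) :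
    HasFDerivAt (fun y : Pt => y.2.1)
      ((ContinuousLinearMap.fst ℝ ℝ ℝ).comp (.snd ℝ ℂ (ℝ × ℝ))) x ∧
    HasFDerivAt (fun y : Pt => y.2.2)
      ((ContinuousLinearMap.snd ℝ ℝ ℝ).comp (.snd ℝ ℂ (ℝ × ℝ))) x :=
  ⟨((ContinuousLinearMap.fst ℝ ℝ ℝ).comp (.snd ℝ ℂ (ℝ × ℝ))).hasFDerivAt,
    ((ContinuousLinearMap.snd ℝ ℝ ℝ).comp (.snd ℝ ℂ (ℝ × ℝ))).hasFDerivAt⟩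

variable {Λ} (hΛ : 0 ≤ Λ) {x : Pt} (hx : x ∈ strip (-Λ))
include hΛ hx

theorem areaRadius_spec : Λ < areaRadius Λ x ∧
    tortoise Λ (areaRadius Λ x) = tortoise Λ (-x.2.2) + x.2.1 := by
  obtain ⟨X, hX, h⟩ := exists_tortoise_eq hΛ (lt_neg_of_lt_neg hx.2) hx.1.le
  have h' : areaRadius Λ x = X := by rw [areaRadius, ← h, radius_tortoise hΛ hX]
  rw [h']
  exact ⟨hX, h⟩

theorem hasFDerivAt_areaRadius : ∃ f' : Pt →L[ℝ] ℝ, HasFDerivAt (areaRadius Λ) f' x ∧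
    ∀ v, f' v = (areaRadius Λ x - Λ) / areaRadius Λ x * (v.2.1 - -x.2.2 / (-x.2.2 - Λ) * v.2.2) := by
  obtain ⟨h1, h2⟩ := areaRadius_spec hΛ hx
  have h3 := (hasDerivAt_contDiffAt_radius hΛ h1).1
  rw [h2] at h3
  have h4 := hasDerivAt_tortoise (Λ := Λ) (lt_neg_of_lt_neg hx.2)
  obtain ⟨h6, h5⟩ := hasFDerivAt_coords x
  have h7 := (h4.comp_hasFDerivAt x h5.fun_neg).fun_add h6
  refine ⟨_, h3.comp_hasFDerivAt x h7, fun v => ?_⟩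
  simp
  ring

theorem contDiffAt_areaRadius : ContDiffAt ℝ ∞ (areaRadius Λ) x := by
  obtain ⟨h1, h2⟩ := areaRadius_spec hΛ hx
  have h3 := (hasDerivAt_contDiffAt_radius hΛ h1).2
  rw [h2] at h3
  refine h3.comp x ?_
  unfold tortoise
  have h4 : -x.2.2 - Λ ≠ 0 := (sub_pos.mpr (lt_neg_of_lt_neg hx.2)).ne'
  fun_prop (disch := assumption)

theorem schField_ne : (areaRadius Λ x : ℂ) ≠ 0 ∧ (-x.2.2 : ℂ) ≠ 0 ∧
    1 - Λ * (areaRadius Λ x : ℂ)⁻¹ ≠ 0 ∧ 1 - Λ * (-x.2.2 : ℂ)⁻¹ ≠ 0 := by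
  have h : ∀ X : ℝ, Λ < X → (X : ℂ) ≠ 0 ∧ 1 - Λ * (X : ℂ)⁻¹ ≠ 0 := by
    intro X hX
    have h0 : (X : ℂ) ≠ 0 := Complex.ofReal_ne_zero.mpr (hΛ.trans_lt hX).ne'
    refine ⟨h0, fun h1 => hX.ne ?_⟩
    field_simp at h1
    rw [mul_zero] at h1
    exact_mod_cast (sub_eq_zero.mp h1).symm
  have h1 := h _ (areaRadius_spec hΛ hx).1
  have h2 := h _ (lt_neg_of_lt_neg hx.2)
  push_cast at h2
  exact ⟨h1.1, h2.1, h1.2, h2.2⟩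

theorem contDiffAt_schField (i : Cpt) : ContDiffAt ℝ ∞ (fun x => schField Λ x i) x := by
  obtain ⟨h1, h2, h3, h4⟩ := schField_ne hΛ hx
  have hc : ContDiff ℝ ∞ (fun z : ℝ => (z : ℂ)) := Complex.ofRealCLM.contDiff
  have h5 : ContDiffAt ℝ ∞ (fun x => (areaRadius Λ x : ℂ)⁻¹) x :=
    (hc.contDiffAt.comp x (contDiffAt_areaRadius hΛ hx)).inv h1
  have h6 : ContDiffAt ℝ ∞ (fun x : Pt => (-x.2.2 : ℂ)⁻¹) x :=
    ContDiffAt.inv (hc.contDiffAt.comp x (by fun_prop : ContDiffAt ℝ ∞ (fun x : Pt => x.2.2) x)).neg h2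
  have h7 := (contDiffAt_const.sub ((contDiffAt_const (c := (Λ : ℂ))).mul h5)).inv h3
  have h8 := (contDiffAt_const.sub ((contDiffAt_const (c := (Λ : ℂ))).mul h6)).inv h4
  have h9 : ContDiffAt ℝ ∞ (fun x : Pt => starRingEnd ℂ x.1) x :=
    Complex.conjCLE.contDiff.contDiffAt.comp x contDiffAt_fst
  have h10 : ContDiffAt ℝ ∞ (fun x : Pt => (((1 + ‖x.1‖ ^ 2) / 2 : ℝ) : ℂ)) x :=
    hc.contDiffAt.comp x (((contDiffAt_const.add (contDiffAt_fst.norm_sq ℝ)).div_const _))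
  refine ContDiffAt.mul ?_ ?_
  · cases i <;> simp only [angularVal] <;> fun_prop
  · cases i <;> simp only [radial] <;> fun_prop

omit hΛ hx in
theorem schField_conj (x : Pt) (i : Cpt) : star (schField Λ x i) = starRingEnd ℂ (angularVal i x.1) *
    radial (Λ : ℂ) (Λ / 2) (-x.2.2 : ℂ)⁻¹ (areaRadius Λ x : ℂ)⁻¹ (1 - Λ * (areaRadius Λ x : ℂ)⁻¹)⁻¹
      (1 - Λ * (-x.2.2 : ℂ)⁻¹)⁻¹ i := by
  rw [schField, star_mul', ← starRingEnd_apply, ← starRingEnd_apply]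
  congr 1
  cases i <;> simp [radial, Complex.conj_ofNat]

/-- The derivative of a function along the frame vectors. -/
structure HasFrameDeriv (Λ : ℝ) (f : Pt → ℂ) (d : Fin 4 → ℂ) (x : Pt) : Prop where
  diff : DifferentiableAt ℝ f x
  eq : ∀ a, along (frame (schField Λ) a) f x = d a

omit hΛ hx in
theorem HasFrameDeriv.of_hasFDerivAt {f : Pt → ℂ} {f' : Pt →L[ℝ] ℂ} (h : HasFDerivAt f f' x) :
    HasFrameDeriv Λ f (fun a => ∑ μ, frameMatrix (schField Λ) x a μ * f' (coordVec μ)) x :=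
  ⟨h.differentiableAt, fun a => by simp only [along, pd, h.fderiv, frame]⟩

omit hΛ hx in
theorem HasFrameDeriv.add {f g : Pt → ℂ} {d e : Fin 4 → ℂ} (hf : HasFrameDeriv Λ f d x)
    (hg : HasFrameDeriv Λ g e x) : HasFrameDeriv Λ (fun y => f y + g y) (fun a => d a + e a) x := by
  refine ⟨hf.diff.add hg.diff, fun a => ?_⟩
  rw [← hf.eq, ← hg.eq]
  simp only [along, pd, fderiv_fun_add hf.diff hg.diff, add_apply, mul_add, Finset.sum_add_distrib]

omit hΛ hx in
theorem HasFrameDeriv.mul {f g : Pt → ℂ} {d e : Fin 4 → ℂ} (hf : HasFrameDeriv Λ f d x)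
    (hg : HasFrameDeriv Λ g e x) :
    HasFrameDeriv Λ (fun y => f y * g y) (fun a => f x * e a + g x * d a) x := by
  refine ⟨hf.diff.mul hg.diff, fun a => ?_⟩
  rw [← hf.eq, ← hg.eq]
  simp only [along, pd, fderiv_fun_mul hf.diff hg.diff, add_apply, smul_apply, smul_eq_mul,
    Finset.mul_sum, ← Finset.sum_add_distrib]
  exact Finset.sum_congr rfl fun μ _ => by ring

omit hΛ hx in
theorem HasFrameDeriv.const (c : ℂ) : HasFrameDeriv Λ (fun _ => c) (fun _ => 0) x :=
  ⟨differentiableAt_const c, fun _ => along_const c⟩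

omit hΛ hx in
theorem HasFrameDeriv.inv {f : Pt → ℂ} {d : Fin 4 → ℂ} (hf : HasFrameDeriv Λ f d x) (h0 : f x ≠ 0) :
    HasFrameDeriv Λ (fun y => (f y)⁻¹) (fun a => -((f x)⁻¹ ^ 2 * d a)) x := by
  have h := (hasDerivAt_inv h0).hasFDerivAt.restrictScalars ℝ |>.comp x hf.diff.hasFDerivAt
  refine ⟨h.differentiableAt, fun a => ?_⟩
  have h' : fderiv ℝ (fun y => (f y)⁻¹) x = _ := h.fderiv
  rw [← hf.eq]
  simp only [along, pd, h', Finset.mul_sum, ← Finset.sum_neg_distrib]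
  refine Finset.sum_congr rfl fun μ _ => ?_
  simp
  ring

omit hΛ hx in
theorem frameMatrix_schField : frameMatrix (schField Λ) x =
    (let κ : ℂ := (areaRadius Λ x : ℂ)⁻¹
     let E : ℂ := 1 / 2 + 2 * (-x.1 / 2) * (-starRingEnd ℂ x.1 / 2)
     !![E * κ, Complex.I * (E * κ), 0, 0; E * κ, -(Complex.I * (E * κ)), 0, 0; 0, 0, 0, 1;
        0, 0, (1 - Λ * (-x.2.2 : ℂ)⁻¹) * (1 - Λ * κ)⁻¹, 0]) := by
  have hE : (((1 + ‖x.1‖ ^ 2) / 2 : ℝ) : ℂ)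
      = 1 / 2 + 2 * (-x.1 / 2) * (-starRingEnd ℂ x.1 / 2) := by
    push_cast
    rw [← Complex.mul_conj']
    ring
  simp only [frameMatrix, schField_conj]
  simp only [← hE, schField, angularVal, radial, map_mul, Complex.conj_ofReal, Complex.conj_I]
  ext i j
  fin_cases i <;> fin_cases j <;> simp [mul_assoc]

theorem hasFrameDeriv_base :
    (let κ : ℂ := (areaRadius Λ x : ℂ)⁻¹
     let ζ : ℂ := (-x.2.2 : ℂ)⁻¹
     let l : ℂ := -x.1 / 2
     let lb : ℂ := -starRingEnd ℂ x.1 / 2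
     HasFrameDeriv Λ (fun y => (areaRadius Λ y : ℂ)⁻¹)
        ![0, 0, κ ^ 2 * (1 - Λ * κ) * (1 - Λ * ζ)⁻¹, -((1 - Λ * ζ) * κ ^ 2)] x ∧
      HasFrameDeriv Λ (fun y => (-y.2.2 : ℂ)⁻¹) ![0, 0, ζ ^ 2, 0] x ∧
      HasFrameDeriv Λ (fun y => -y.1 / 2) ![0, -((1 / 2 + 2 * l * lb) * κ), 0, 0] x ∧
      HasFrameDeriv Λ (fun y => -starRingEnd ℂ y.1 / 2)
        ![-((1 / 2 + 2 * l * lb) * κ), 0, 0, 0] x) := by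
  obtain ⟨h1, h2, h3, h4⟩ := schField_ne hΛ hx
  obtain ⟨f', hf, hf'⟩ := hasFDerivAt_areaRadius hΛ hx
  have key : ∀ {f : Pt → ℂ} {d e : Fin 4 → ℂ}, HasFrameDeriv Λ f e x → e = d →
      HasFrameDeriv Λ f d x := by
    rintro f d e h rfl
    exact h
  have hF := frameMatrix_schField (Λ := Λ) (x := x)
  have g1 := HasFrameDeriv.of_hasFDerivAt (Λ := Λ) (Complex.ofRealCLM.hasFDerivAt.comp x hf) |>.inv h1
  have g2 := HasFrameDeriv.of_hasFDerivAt (Λ := Λ) (x := x) (-(Complex.ofRealCLM.comp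
    ((ContinuousLinearMap.snd ℝ ℝ ℝ).comp (ContinuousLinearMap.snd ℝ ℂ (ℝ × ℝ))))).hasFDerivAt
      |>.inv h2
  have g3 := HasFrameDeriv.of_hasFDerivAt (Λ := Λ) (x := x) (ContinuousLinearMap.fst ℝ ℂ (ℝ × ℝ)).hasFDerivAt
    |>.mul (.const (-1 / 2))
  have g4 := HasFrameDeriv.of_hasFDerivAt (Λ := Λ) (x := x)
    ((Complex.conjCLE : ℂ →L[ℝ] ℂ).comp (ContinuousLinearMap.fst ℝ ℂ (ℝ × ℝ))).hasFDerivAt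
    |>.mul (.const (-1 / 2))
  have h5 : (-x.2.2 - Λ : ℂ) ≠ 0 := fun h => h4 (by rw [← sub_eq_zero.mp h, mul_inv_cancel₀ h2, sub_self])
  have h6 : (areaRadius Λ x - Λ : ℂ) ≠ 0 := fun h => h3 (by rw [← sub_eq_zero.mp h, mul_inv_cancel₀ h1, sub_self])
  refine ⟨key g1 ?_, key g2 ?_, key (e := _) (f := fun y => -y.1 / 2) (by simpa [neg_div, div_eq_mul_inv] using g3) ?_,
    key (f := fun y => -starRingEnd ℂ y.1 / 2) (by simpa [neg_div, div_eq_mul_inv] using g4) ?_⟩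
  all_goals
    ext a
    simp only [hF]
    fin_cases a <;> simp [Fin.sum_univ_four, coordVec, hf']
  · have h7 := neg_ne_zero.mp h2
    have h9 : (x.2.2 + Λ : ℂ) ≠ 0 := fun h => h5 (by linear_combination -h)
    field_simp
    ring
  · field_simp
  all_goals
    ring_nf
    simp only [Complex.I_sq]
    ring

end SchwarzschildField

section SchwarzschildVacuum

variable {Λ : ℝ}

theorem gammaTable_schField (x : Pt) : gammaTable (schField Λ x) =
    (let κ : ℂ := (areaRadius Λ x : ℂ)⁻¹
     let ζ : ℂ := (-x.2.2 : ℂ)⁻¹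
     let γ6 : ℂ := -((1 - Λ * κ) * κ * (1 - Λ * ζ)⁻¹)
     let γ2 : ℂ := (1 - Λ * ζ) * κ
     !![2 * (-x.1 / 2) * κ, 0, γ6, 0, γ2, 0; -2 * (-starRingEnd ℂ x.1 / 2) * κ, γ6, 0, γ2, 0, 0;
        0, 0, 0, 0, 0, Λ * (1 - Λ * ζ)⁻¹ * (κ ^ 2 - ζ ^ 2); 0, 0, 0, 0, 0, 0]) := by
  simp only [gammaTable, schField_conj]
  simp only [schField, angularVal, radial]
  ext i j
  fin_cases i <;> fin_cases j <;> simp [Complex.conj_ofNat] <;> ring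

theorem weylTable_schField (x : Pt) : weylTable (schField Λ x) =
    (let w : ℂ := -(Λ * (areaRadius Λ x : ℂ)⁻¹ ^ 3)
     !![2 * w, 0, 0, 0, 0, 0; 0, 0, 0, 0, -w, 0; 0, 0, 0, -w, 0, 0; 0, 0, -w, 0, 0, 0;
        0, -w, 0, 0, 0, 0; 0, 0, 0, 0, 0, 2 * w]) := by
  simp only [weylTable, schField_conj]
  simp only [schField, angularVal, radial]
  ext i j
  fin_cases i <;> fin_cases j <;> simp <;> ring

variable (hΛ : 0 ≤ Λ) {x : Pt} (hx : x ∈ strip (-Λ))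
include hΛ hx

theorem isUnit_det_frameMatrix_schField : IsUnit (frameMatrix (schField Λ) x).det := by
  obtain ⟨h1, h2, h3, h4⟩ := schField_ne hΛ hx
  have hE : (1 / 2 + 2 * (-x.1 / 2) * (-starRingEnd ℂ x.1 / 2) : ℂ) ≠ 0 := by
    have h : (1 / 2 + 2 * (-x.1 / 2) * (-starRingEnd ℂ x.1 / 2) : ℂ) = ((1 + ‖x.1‖ ^ 2) / 2 : ℝ) := by
      push_cast
      rw [← Complex.mul_conj']
      ring
    rw [h]
    exact Complex.ofReal_ne_zero.mpr (by positivity)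
  replace hE := And.intro (mul_ne_zero hE (inv_ne_zero h1)) (mul_ne_zero h4 (inv_ne_zero h3))
  rw [frameMatrix_schField, isUnit_iff_ne_zero]
  simp only [Matrix.det_succ_row_zero, Fin.sum_univ_four, Fin.sum_univ_three, Fin.sum_univ_two,
    Matrix.det_fin_zero, Matrix.submatrix_apply]
  generalize (1 / 2 + 2 * (-x.1 / 2) * (-starRingEnd ℂ x.1 / 2) : ℂ) * (areaRadius Λ x : ℂ)⁻¹ = a at hE
  generalize (1 - Λ * (-x.2.2 : ℂ)⁻¹) * (1 - Λ * (areaRadius Λ x : ℂ)⁻¹)⁻¹ = b at hE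
  simp [Fin.succAbove]
  rw [show a * (Complex.I * a * b) + Complex.I * a * (a * b) = 2 * Complex.I * (a * a * b) by ring]
  simp [hE.1, hE.2]

theorem bracket_schField (j k : Fin 4) : bracket (frame (schField Λ) j) (frame (schField Λ) k) x
      = (fun c => gamUp (schField Λ x) j k c - gamUp (schField Λ x) k j c)
        ᵥ* frameMatrix (schField Λ) x := by
  obtain ⟨h1, h2, h3, h4⟩ := schField_ne hΛ hx
  obtain ⟨dκ, dζ, dl, dlb⟩ := hasFrameDeriv_base hΛ hx
  have hM := fun y => frameMatrix_schField (Λ := Λ) (x := y)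
  have hG := gammaTable_schField (Λ := Λ) x
  have dEκ := (((HasFrameDeriv.const (1 / 2)).add (((HasFrameDeriv.const 2).mul dl).mul dlb)).mul dκ)
  have de3 := (((HasFrameDeriv.const 1).add ((HasFrameDeriv.const (-Λ : ℂ)).mul dζ)).mul
    (((HasFrameDeriv.const 1).add ((HasFrameDeriv.const (-Λ : ℂ)).mul dκ)).inv
      (by rwa [neg_mul, ← sub_eq_add_neg])))
  simp only [neg_mul, ← sub_eq_add_neg] at de3
  have dIEκ := (HasFrameDeriv.const Complex.I).mul dEκ
  have dIEκ' := (HasFrameDeriv.const (-1)).mul dIEκ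
  simp only [neg_mul, one_mul] at dIEκ'
  have hc := fun c => (HasFrameDeriv.const (Λ := Λ) (x := x) c).eq
  have key : ∀ p ∈ [((0 : Fin 4), (1 : Fin 4)), (0, 2), (0, 3), (1, 2), (1, 3), (2, 3)], ∀ μ,
      along (frame (schField Λ) p.1) (fun y => frame (schField Λ) p.2 y μ) x
        - along (frame (schField Λ) p.2) (fun y => frame (schField Λ) p.1 y μ) x
      = ∑ c, (gamUp (schField Λ x) p.1 p.2 c - gamUp (schField Λ x) p.2 p.1 c)
        * frameMatrix (schField Λ) x c μ := by
    intro p hp μ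
    simp only [frame, gamUp, Gam, hG, hM]
    have q1 := dEκ.eq
    have q2 := dIEκ.eq
    have q3 := dIEκ'.eq
    have q4 := de3.eq
    simp at q1 q2 q3 q4
    clear dEκ dIEκ dIEκ' de3 dκ dζ dl dlb
    fin_cases hp <;> fin_cases μ <;>
      simp [Fin.sum_univ_four, gFrame, pairSign, pairIndex, q1, q2, q3, q4, hc]
    on_goal 11 =>
      have h5 := mul_inv_cancel₀ h3
      have h6 : (1 + Λ * (x.2.2 : ℂ)⁻¹) * (1 + Λ * (x.2.2 : ℂ)⁻¹)⁻¹ = 1 :=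
        mul_inv_cancel₀ (by simpa [inv_neg] using h4)
      simp only [← inv_pow]
      linear_combination (Λ * (areaRadius Λ x : ℂ)⁻¹ ^ 2 * (1 - Λ * (areaRadius Λ x : ℂ)⁻¹)⁻¹
        * ((1 + Λ * (x.2.2 : ℂ)⁻¹) * (1 + Λ * (x.2.2 : ℂ)⁻¹)⁻¹)) * h5
        + (Λ * (x.2.2 : ℂ)⁻¹ ^ 2 * (1 - Λ * (areaRadius Λ x : ℂ)⁻¹)⁻¹) * h6
    all_goals ring
  have key' : ∀ j k, j < k → ((j, k) : Fin 4 × Fin 4) ∈ [((0 : Fin 4), (1 : Fin 4)), (0, 2), (0, 3), (1, 2), (1, 3), (2, 3)] := by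
    decide
  ext μ
  simp only [bracket, Matrix.vecMul, dotProduct]
  rcases lt_trichotomy j k with h | rfl | h
  · exact key _ (key' j k h) μ
  · simp
  · have := key _ (key' k j h) μ
    rw [← neg_inj, neg_sub, this, ← Finset.sum_neg_distrib]
    exact Finset.sum_congr rfl fun c _ => by ring

/-- The derivatives of the connection coefficients of the Schwarzschild field. -/
theorem hasFrameDeriv_gammaTable (a : Fin 4) (i : Fin 6) : HasFrameDeriv Λ
    (fun y => gammaTable (schField Λ y) a i) (fun b =>
      let κ : ℂ := (areaRadius Λ x : ℂ)⁻¹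
      let ζ : ℂ := (-x.2.2 : ℂ)⁻¹
      let l : ℂ := -x.1 / 2
      let lb : ℂ := -starRingEnd ℂ x.1 / 2
      let κ' : Fin 4 → ℂ := ![0, 0, κ ^ 2 * (1 - Λ * κ) * (1 - Λ * ζ)⁻¹, -((1 - Λ * ζ) * κ ^ 2)]
      let ζ' : Fin 4 → ℂ := ![0, 0, ζ ^ 2, 0]
      let E : ℂ := 1 / 2 + 2 * l * lb
      let γ6 : ℂ := -((1 - 2 * Λ * κ) * κ' b * (1 - Λ * ζ)⁻¹)
        - (1 - Λ * κ) * κ * Λ * ζ' b * (1 - Λ * ζ)⁻¹ ^ 2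
      let γ2 : ℂ := (1 - Λ * ζ) * κ' b - Λ * ζ' b * κ
      !![2 * (![0, -(E * κ), 0, 0] b * κ + l * κ' b), 0, γ6, 0, γ2, 0;
        -2 * (![-(E * κ), 0, 0, 0] b * κ + lb * κ' b), γ6, 0, γ2, 0, 0;
        0, 0, 0, 0, 0, Λ * (1 - Λ * ζ)⁻¹ * (2 * κ * κ' b - 2 * ζ * ζ' b)
          + Λ * (Λ * ζ' b * (1 - Λ * ζ)⁻¹ ^ 2) * (κ ^ 2 - ζ ^ 2);
        0, 0, 0, 0, 0, 0] a i) x := by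
  obtain ⟨h1, h2, h3, h4⟩ := schField_ne hΛ hx
  obtain ⟨dκ, dζ, dl, dlb⟩ := hasFrameDeriv_base hΛ hx
  have key : ∀ {f g : Pt → ℂ} {d e : Fin 4 → ℂ}, HasFrameDeriv Λ f e x → (∀ y, g y = f y) →
      (∀ b, e b = d b) → HasFrameDeriv Λ g d x := by
    intro f g d e h h' h''
    obtain rfl : g = f := funext h'
    obtain rfl : e = d := funext h''
    exact h
  have c := HasFrameDeriv.const (Λ := Λ) (x := x)
  have dA := (c 1).add ((c (-Λ)).mul dκ)
  have dB := (c 1).add ((c (-Λ)).mul dζ)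
  have dI := dB.inv (by rwa [neg_mul, ← sub_eq_add_neg])
  simp only [gammaTable_schField]
  have d6 := (c (-1)).mul ((dA.mul dκ).mul dI)
  have d2 := dB.mul dκ
  have d8 := ((c Λ).mul dI).mul ((dκ.mul dκ).add ((c (-1)).mul (dζ.mul dζ)))
  have dl' := ((c 2).mul dl).mul dκ
  have dlb' := ((c (-2)).mul dlb).mul dκ
  fin_cases a <;> fin_cases i <;> simp only [Fin.zero_eta, Fin.mk_one, Fin.reduceFinMk] <;> first
    | exact key (c 0) (fun y => rfl) fun b => rfl
    | refine key d6 (fun y => ?_) (fun b => ?_) <;> simp only [Matrix.of_apply, Matrix.cons_val] <;> ring1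
    | refine key d2 (fun y => ?_) (fun b => ?_) <;> simp only [Matrix.of_apply, Matrix.cons_val] <;> ring1
    | refine key d8 (fun y => ?_) (fun b => ?_) <;> simp only [Matrix.of_apply, Matrix.cons_val] <;> ring1
    | refine key dl' (fun y => ?_) (fun b => ?_) <;> simp only [Matrix.of_apply, Matrix.cons_val] <;> ring1
    | refine key dlb' (fun y => ?_) (fun b => ?_) <;> simp only [Matrix.of_apply, Matrix.cons_val] <;> ring1

end SchwarzschildVacuum

section SchwarzschildCurvature

/-- An identity between tensors that are antisymmetric in both pairs of indices holds if it holds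
for the pairs of the ordered sequence. -/
theorem eq_zero_of_pairs {F : Fin 4 → Fin 4 → Fin 4 → Fin 4 → ℂ} (h1 : ∀ a b j k, F a b j k = -F b a j k)
    (h2 : ∀ a b j k, F a b j k = -F a b k j)
    (h : ∀ p q : Fin 6, F (![0, 2, 2, 3, 3, 2] p) (![1, 0, 1, 0, 1, 3] p) (![0, 2, 2, 3, 3, 2] q)
      (![1, 0, 1, 0, 1, 3] q) = 0) (a b j k : Fin 4) : F a b j k = 0 := by
  have hp : ∀ a b : Fin 4, a = b ∨ (∃ p : Fin 6, (![0, 2, 2, 3, 3, 2] p : Fin 4) = a ∧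
      (![1, 0, 1, 0, 1, 3] p : Fin 4) = b) ∨ ∃ p : Fin 6, (![0, 2, 2, 3, 3, 2] p : Fin 4) = b ∧
      (![1, 0, 1, 0, 1, 3] p : Fin 4) = a := by decide
  have hz : ∀ z : ℂ, z = -z → z = 0 := fun z hz => by linear_combination hz / 2
  rcases hp a b with rfl | ⟨p, rfl, rfl⟩ | ⟨p, rfl, rfl⟩
  · exact hz _ (h1 _ _ _ _)
  all_goals rcases hp j k with rfl | ⟨q, rfl, rfl⟩ | ⟨q, rfl, rfl⟩
  · exact hz _ (h2 _ _ _ _)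
  · exact h p q
  · rw [h2, h, neg_zero]
  · exact hz _ (h2 _ _ _ _)
  · rw [h1, h, neg_zero]
  · rw [h1, h2, h, neg_zero, neg_zero]

/-- The curvature in terms of the connection coefficients and their derivatives. -/
def curvature (X : Cpt → ℂ) (dΓ : Fin 4 → Fin 4 → Fin 4 → Fin 4 → ℂ) (a b j k : Fin 4) : ℂ :=
  dΓ j k b a - dΓ k j b a + ∑ e, (gamUp X k b e * Gam X j e a - gamUp X j b e * Gam X k e a
    - (gamUp X j k e - gamUp X k j e) * Gam X e b a)

theorem curvature_eq_Weyl {X : Cpt → ℂ} {dΓ : Fin 4 → Fin 4 → Fin 4 → Fin 4 → ℂ}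
    (hd : ∀ c a j k, dΓ c a j k = -dΓ c a k j)
    (h : ∀ p q : Fin 6, curvature X dΓ (![0, 2, 2, 3, 3, 2] p) (![1, 0, 1, 0, 1, 3] p)
      (![0, 2, 2, 3, 3, 2] q) (![1, 0, 1, 0, 1, 3] q) = weylTable X p q) (a b j k : Fin 4) :
    curvature X dΓ a b j k = Weyl X a b j k := by
  have hS : ∀ a b : Fin 4, pairSign a b = -pairSign b a := fun a b => by
    fin_cases a <;> fin_cases b <;> simp [pairSign]
  have hP : ∀ a b : Fin 4, pairIndex a b = pairIndex b a := fun a b => by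
    fin_cases a <;> fin_cases b <;> rfl
  have hG := Gam_antisymm X
  refine sub_eq_zero.mp (eq_zero_of_pairs (F := fun a b j k => curvature X dΓ a b j k - Weyl X a b j k)
    (fun a b j k => ?_) (fun a b j k => ?_) (fun p q => sub_eq_zero.mpr ?_) a b j k)
  · simp only [Weyl, curvature]
    rw [hS b a, hP b a, hd j k a b, hd k j a b]
    have h2 : ∀ c d e : Fin 4, gamUp X c d e = ![Gam X c d 1, Gam X c d 0, -Gam X c d 3, -Gam X c d 2] e :=
      fun c d e => by fin_cases e <;> simp [gamUp, Fin.sum_univ_four, gFrame]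
    simp only [Fin.sum_univ_four, h2 _ a, h2 _ b, hG _ b a, hG _ 0 a, hG _ 1 a, hG _ 2 a, hG _ 3 a,
      hG _ 0 b, hG _ 1 b, hG _ 2 b, hG _ 3 b, Matrix.cons_val]
    ring
  · simp only [Weyl, curvature]
    rw [hS j k, hP j k]
    simp only [Fin.sum_univ_four]
    ring
  · rw [h]
    fin_cases p <;> fin_cases q <;> simp [Weyl, pairSign, pairIndex]

variable {Λ : ℝ} (hΛ : 0 ≤ Λ) {x : Pt} (hx : x ∈ strip (-Λ))
include hΛ hx

set_option maxHeartbeats 2000000 in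
theorem curvature_schField (a b j k : Fin 4) : curvature (schField Λ x)
    (fun c a j k => along (frame (schField Λ) c) (fun y => Gam (schField Λ y) a j k) x) a b j k
      = Weyl (schField Λ x) a b j k := by
  have hd : ∀ c a j k, along (frame (schField Λ) c) (fun y => Gam (schField Λ y) a j k) x = _ :=
    fun c a j k => ((HasFrameDeriv.const (pairSign j k)).mul
      (hasFrameDeriv_gammaTable hΛ hx a (pairIndex j k))).eq c
  have hJ : 1 - Λ * (-x.2.2 : ℂ)⁻¹ ≠ 0 := (schField_ne hΛ hx).2.2.2
  replace hJ := inv_mul_cancel₀ hJ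
  refine curvature_eq_Weyl (fun c a j k => ?_) (fun p q => ?_) a b j k
  · simp only [Gam_antisymm _ _ j k, along, pd, fderiv_fun_neg, neg_apply, mul_neg,
      Finset.sum_neg_distrib]
  simp only [curvature, hd]
  clear hd
  simp only [gamUp, Gam, gammaTable_schField, weylTable_schField, mul_zero, add_zero]
  generalize (1 - Λ * (-x.2.2 : ℂ)⁻¹)⁻¹ = J at *
  generalize (areaRadius Λ x : ℂ)⁻¹ = κ at *
  generalize (-x.2.2 : ℂ)⁻¹ = ζ at *
  generalize -x.1 / 2 = l at *
  generalize -starRingEnd ℂ x.1 / 2 = lb at *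
  generalize (Λ : ℂ) = m at *
  clear hΛ hx
  fin_cases p <;> fin_cases q <;>
    simp only [Fin.zero_eta, Fin.mk_one, Fin.reduceFinMk, Fin.sum_univ_four, gFrame, pairSign, pairIndex, Matrix.of_apply,
      Matrix.cons_val, mul_zero, zero_mul, add_zero, zero_add, neg_zero, mul_one, one_mul, sub_zero, zero_sub, neg_neg, mul_neg, neg_mul]
  all_goals try ring1
  · linear_combination 2 * κ ^ 2 * (1 - m * κ) * hJ
  · linear_combination m * κ ^ 3 * hJ
  · linear_combination m * κ ^ 3 * hJ
  · linear_combination m * κ * (κ ^ 2 - ζ ^ 2) * hJ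
  · linear_combination m * κ * (κ ^ 2 - ζ ^ 2) * hJ
  · linear_combination -2 * m * κ ^ 3 * hJ

omit hΛ hx in
theorem isOpen_strip (u₁ : ℝ) : IsOpen (strip u₁) :=
  IsOpen.inter (isOpen_lt (f := fun _ : Pt => (0 : ℝ)) (by fun_prop) (by fun_prop))
    (isOpen_lt (g := fun _ : Pt => u₁) (by fun_prop) (by fun_prop))

omit hx in
/-- The Schwarzschild field is a vacuum field. -/
theorem isVacuumField_schField : IsVacuumField (schField Λ) (strip (-Λ)) := by
  have hU := isOpen_strip (-Λ)
  have hF : ∀ x ∈ strip (-Λ), IsUnit (frameMatrix (schField Λ) x).det := fun x hx =>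
    isUnit_det_frameMatrix_schField hΛ hx
  have htor : ∀ x ∈ strip (-Λ), ∀ j k, bracket (frame (schField Λ) j) (frame (schField Λ) k) x
      = (fun c => gamUp (schField Λ x) j k c - gamUp (schField Λ x) k j c)
        ᵥ* frameMatrix (schField Λ) x := fun x hx => bracket_schField hΛ hx
  have hgrad : ∀ x ∈ strip (-Λ), ∀ V : Fin 4 → ℂ, ∃ v, V = v ᵥ* frameMatrix (schField Λ) x :=
    fun x hx V => ⟨V ᵥ* (frameMatrix (schField Λ) x)⁻¹, by
      rw [Matrix.vecMul_vecMul, Matrix.nonsing_inv_mul _ (hF x hx), Matrix.vecMul_one]⟩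
  have hN : ∀ x, schField Λ x .e3 • frame (schField Λ) 2 x
      = ![0, 0, schField Λ x .e3, 0] ᵥ* frameMatrix (schField Λ) x := fun x => by
    ext μ
    simp [Matrix.vecMul, dotProduct, Fin.sum_univ_four, frame]
  refine ⟨fun i x hx => (contDiffAt_schField hΛ hx i).contDiffWithinAt, fun x hx => ?_, fun x hx => ?_,
    fun x hx => ?_, fun x hx a j k => leviCivita_of_torsion hU hF htor hx a j k,
    fun x hx a b j k => ?_, fun x hx V => ?_, fun x hx => ?_, fun x hx V => ?_, fun x hx => ?_⟩
  · simp [InR, schField, angularVal, radial]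
  · have h : schField Λ x .e3
        = ((1 - Λ * (-x.2.2)⁻¹) * (1 - Λ * (areaRadius Λ x)⁻¹)⁻¹ : ℝ) := by
      simp [schField, angularVal, radial]
    have h1 : ∀ X, Λ < X → 0 < 1 - Λ * X⁻¹ := fun X hX => by
      rw [sub_pos, ← div_eq_mul_inv, div_lt_one (hΛ.trans_lt hX)]
      exact hX
    rw [h, Complex.ofReal_re]
    exact mul_pos (h1 _ (lt_neg_of_lt_neg hx.2)) (inv_pos.mpr (h1 _ (areaRadius_spec hΛ hx).1))
  · have h : schField Λ x .e1 * star (schField Λ x .e2)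
        = ((-((1 + ‖x.1‖ ^ 2) / 2 * (areaRadius Λ x)⁻¹) ^ 2 : ℝ) : ℂ) * Complex.I := by
      rw [schField_conj]
      simp only [schField, angularVal, radial, map_mul, Complex.conj_I, Complex.conj_ofReal]
      push_cast
      ring
    have h1 := hΛ.trans_lt (areaRadius_spec hΛ hx).1
    rw [h, Complex.im_ofReal_mul, Complex.I_im, mul_one]
    exact (neg_neg_of_pos (by positivity)).ne
  · rw [riemann_eq hU hF htor (fun a j k => ?_) hx, ← curvature_schField hΛ hx, curvature]
    exact ((HasFrameDeriv.const _).mul (hasFrameDeriv_gammaTable hΛ hx a (pairIndex j k))).diff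
  · obtain ⟨v, rfl⟩ := hgrad x hx V
    rw [hN, gPair_eq hU hF hx]
    simp [Matrix.vecMul, Matrix.mulVec, dotProduct, Fin.sum_univ_four, gFrame, frameMatrix, mul_comm]
  · have h : along (frame (schField Λ) 2) (fun y => schField Λ y .e3) x
        - along (frame (schField Λ) 3) (fun _ => 0) x = _ := congrFun (htor x hx 2 3) 2
    rw [nabla_eq hU hF _ _ (f := fun c y => ![0, 0, schField Λ y .e3, 0] c) hx (hN x) fun y hy => hN y]
    have hX : ∀ g, along (fun y => schField Λ y .e3 • frame (schField Λ) 2 y) g x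
        = schField Λ x .e3 * along (frame (schField Λ) 2) g x := fun g => by
      simp [along, Finset.mul_sum, mul_assoc]
    have hG : gamUp (schField Λ x) 2 2 0 = 0 ∧ gamUp (schField Λ x) 2 2 1 = 0 ∧
        gamUp (schField Λ x) 2 2 3 = 0 ∧ gamUp (schField Λ x) 3 2 3 = 0 ∧
        gamUp (schField Λ x) 2 3 3 = -gamUp (schField Λ x) 2 2 2 := by
      simp [gamUp, Gam, gammaTable_schField, Fin.sum_univ_four, gFrame, pairSign, pairIndex]
    obtain ⟨g0, g1, g3, g4, g5⟩ := hG
    rw [along_const, sub_zero, Matrix.vecMul, dotProduct, Fin.sum_univ_four, g4, g5] at h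
    simp only [frameMatrix, Matrix.of_apply, Matrix.cons_val, mul_zero, zero_add, sub_zero] at h
    refine Eq.trans (congrArg (· ᵥ* frameMatrix (schField Λ) x) (funext fun c => ?_)) (Matrix.zero_vecMul _)
    fin_cases c <;> simp [Fin.sum_univ_four, hX, along_const, g0, g1, g3, h]
    ring
  · obtain ⟨v, rfl⟩ := hgrad x hx V
    rw [frame_eq, gPair_eq hU hF hx]
    simp [Matrix.vecMul, Matrix.mulVec, dotProduct, Fin.sum_univ_four, gFrame, frameMatrix]
  · rw [nabla_eq hU hF _ _ (v := Pi.single 3 1) (f := fun c _ => (Pi.single 3 1 : Fin 4 → ℂ) c) hx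
      (frame_eq 3) fun y hy => frame_eq 3]
    have hG : ∀ c, gamUp (schField Λ x) 3 3 c = 0 := fun c => by
      simp [gamUp, Gam, gammaTable_schField, Fin.sum_univ_four, pairSign, pairIndex]
    simp only [along_const, Fin.sum_univ_four]
    simp [hG]
    exact Matrix.zero_vecMul _

end SchwarzschildCurvature

/-! ### The isometry to the Schwarzschild spacetime -/

section SchwarzschildIsometry

/-- Stereographic projection; the parameter `ε = ± 1` distinguishes the two charts. -/
def sphereMap (ε : ℝ) (ξ : ℂ) : EuclideanSpace ℝ (Fin 3) :=
  !₂[2 * ξ.re * (1 + ξ.re ^ 2 + ξ.im ^ 2)⁻¹, ε * (2 * ξ.im * (1 + ξ.re ^ 2 + ξ.im ^ 2)⁻¹),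
    ε * (2 * (1 + ξ.re ^ 2 + ξ.im ^ 2)⁻¹ - 1)]

theorem one_add_re_im_ne (ξ : ℂ) : 1 + ξ.re ^ 2 + ξ.im ^ 2 ≠ 0 := by positivity

theorem norm_sphereMap {ε : ℝ} (hε : ε ^ 2 = 1) (ξ : ℂ) : ‖sphereMap ε ξ‖ = 1 := by
  rw [EuclideanSpace.norm_eq, Real.sqrt_eq_one]
  have h := one_add_re_im_ne ξ
  simp [Fin.sum_univ_three, sphereMap, mul_pow, hε, inv_pow]
  field_simp
  ring

theorem injective_sphereMap {ε : ℝ} (hε : ε ^ 2 = 1) : Function.Injective (sphereMap ε) := by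
  intro ξ ξ' h
  have h0 : ε ≠ 0 := fun h => by simp [h] at hε
  have h1 := congrFun (congrArg WithLp.ofLp h) 0
  have h2 := congrFun (congrArg WithLp.ofLp h) 1
  have h3 := congrFun (congrArg WithLp.ofLp h) 2
  have h4 := inv_ne_zero (one_add_re_im_ne ξ')
  simp only [sphereMap, Matrix.cons_val, mul_right_inj' h0, sub_left_inj,
    mul_right_inj' (two_ne_zero' ℝ)] at h1 h2 h3
  rw [h3, mul_left_inj' h4, mul_right_inj' (two_ne_zero' ℝ)] at h1 h2
  exact Complex.ext h1 h2

theorem sphereMap_inv (ε : ℝ) {ξ : ℂ} (hξ : ξ ≠ 0) : sphereMap (-ε) ξ⁻¹ = sphereMap ε ξ := by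
  have h0 : Complex.normSq ξ ≠ 0 := Complex.normSq_eq_zero.not.mpr hξ
  have h1 := one_add_re_im_ne ξ
  have h2 : 1 + ξ⁻¹.re ^ 2 + ξ⁻¹.im ^ 2 = (1 + ξ.re ^ 2 + ξ.im ^ 2) / Complex.normSq ξ := by
    rw [Complex.inv_re, Complex.inv_im]
    field_simp
    rw [Complex.normSq_apply]
    ring
  have h3 : Complex.normSq ξ = ξ.re ^ 2 + ξ.im ^ 2 := by rw [Complex.normSq_apply]; ring
  rw [sphereMap, sphereMap, h2, Complex.inv_re, Complex.inv_im]
  congr 1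
  ext i
  fin_cases i <;> simp <;> field_simp
  rw [h3]
  ring

theorem hasFDerivAt_sphereMap (ε : ℝ) (ξ : ℂ) : ∃ f' : ℂ →L[ℝ] EuclideanSpace ℝ (Fin 3),
    HasFDerivAt (sphereMap ε) f' ξ ∧ ∀ v,
      f' v 0 = 2 * v.re * (1 + ξ.re ^ 2 + ξ.im ^ 2)⁻¹
        - 4 * ξ.re * (ξ.re * v.re + ξ.im * v.im) * (1 + ξ.re ^ 2 + ξ.im ^ 2)⁻¹ ^ 2 ∧
      f' v 1 = ε * (2 * v.im * (1 + ξ.re ^ 2 + ξ.im ^ 2)⁻¹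
        - 4 * ξ.im * (ξ.re * v.re + ξ.im * v.im) * (1 + ξ.re ^ 2 + ξ.im ^ 2)⁻¹ ^ 2) ∧
      f' v 2 = -(ε * (4 * (ξ.re * v.re + ξ.im * v.im) * (1 + ξ.re ^ 2 + ξ.im ^ 2)⁻¹ ^ 2)) := by
  have hr : HasFDerivAt Complex.re Complex.reCLM ξ := Complex.reCLM.hasFDerivAt
  have hi : HasFDerivAt Complex.im Complex.imCLM ξ := Complex.imCLM.hasFDerivAt
  have hn : HasFDerivAt (fun ξ : ℂ => 1 + ξ.re ^ 2 + ξ.im ^ 2) _ ξ :=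
    ((hasFDerivAt_const (1 : ℝ) ξ).add (HasFDerivAt.pow hr 2)).add (HasFDerivAt.pow hi 2)
  have hs := (hasDerivAt_inv (one_add_re_im_ne ξ)).comp_hasFDerivAt ξ hn
  have hd : DifferentiableAt ℝ (sphereMap ε) ξ := by
    rw [differentiableAt_euclidean]
    intro i
    have h1 := hr.differentiableAt
    have h2 := hi.differentiableAt
    have h3 := one_add_re_im_ne ξ
    fin_cases i <;> simp [sphereMap] <;> fun_prop (disch := assumption)
  refine ⟨_, hd.hasFDerivAt, fun v => ?_⟩
  have hc : ∀ i, fderiv ℝ (sphereMap ε) ξ v i = fderiv ℝ (fun ξ => sphereMap ε ξ i) ξ v := fun i => by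
    have h := ((EuclideanSpace.proj i : EuclideanSpace ℝ (Fin 3) →L[ℝ] ℝ).hasFDerivAt.comp ξ
      hd.hasFDerivAt).fderiv
    exact (congrArg (fun L : ℂ →L[ℝ] ℝ => L v) h).symm
  have h0 : HasFDerivAt (fun ξ => sphereMap ε ξ 0) _ ξ := (hr.const_mul 2).mul hs
  have h1 : HasFDerivAt (fun ξ => sphereMap ε ξ 1) _ ξ := ((hi.const_mul 2).mul hs).const_mul ε
  have h2 : HasFDerivAt (fun ξ => sphereMap ε ξ 2) _ ξ := ((hs.const_mul 2).sub_const 1).const_mul ε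
  rw [hc, hc, hc, h0.fderiv, h1.fderiv, h2.fderiv]
  refine ⟨?_, ?_, ?_⟩ <;> simp <;> ring

/-- The pullback of the round metric. -/
theorem inner_fderiv_sphereMap {ε : ℝ} (hε : ε ^ 2 = 1) (ξ v w : ℂ) :
    inner ℝ (fderiv ℝ (sphereMap ε) ξ v) (fderiv ℝ (sphereMap ε) ξ w)
      = 4 * (1 + ξ.re ^ 2 + ξ.im ^ 2)⁻¹ ^ 2 * (v.re * w.re + v.im * w.im) := by
  obtain ⟨f', hf, h⟩ := hasFDerivAt_sphereMap ε ξ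
  have h0 := mul_inv_cancel₀ (one_add_re_im_ne ξ)
  rw [hf.fderiv, PiLp.inner_apply, Fin.sum_univ_three]
  simp only [h, RCLike.inner_apply, conj_trivial]
  generalize (1 + ξ.re ^ 2 + ξ.im ^ 2)⁻¹ = s at *
  linear_combination (16 * s ^ 3 * (ξ.re * v.re + ξ.im * v.im) * (ξ.re * w.re + ξ.im * w.im)) * h0
    + ((2 * v.im * s - 4 * ξ.im * (ξ.re * v.re + ξ.im * v.im) * s ^ 2)
        * (2 * w.im * s - 4 * ξ.im * (ξ.re * w.re + ξ.im * w.im) * s ^ 2)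
      + 16 * (ξ.re * v.re + ξ.im * v.im) * (ξ.re * w.re + ξ.im * w.im) * s ^ 4) * hε

variable {Λ : ℝ}

/-- The isometric embedding into the Schwarzschild spacetime. -/
def schEmbedding (Λ ε : ℝ) (x : Pt) : SchwAmbient :=
  ((√2)⁻¹ * (x.2.1 - tortoise Λ (-x.2.2)), (√2)⁻¹ * areaRadius Λ x, sphereMap ε x.1)

theorem two_mul_mass_div (Λ r : ℝ) :
    2 * ((2 : ℝ) ^ (-(3 / 2) : ℝ) * Λ) / ((√2)⁻¹ * r) = Λ / r := by
  have h : (2 : ℝ) ^ (-(3 / 2) : ℝ) = (√2)⁻¹ / 2 := by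
    rw [show (-(3 / 2) : ℝ) = -(1 / 2) - 1 by norm_num, Real.rpow_sub_one two_ne_zero,
      Real.rpow_neg zero_le_two, Real.sqrt_eq_rpow]
  have h0 : (√2)⁻¹ ≠ 0 := by positivity
  rw [h, show 2 * ((√2)⁻¹ / 2 * Λ) = (√2)⁻¹ * Λ by ring, mul_div_mul_left _ _ h0]

variable (hΛ : 0 ≤ Λ)
include hΛ

theorem contDiffAt_schEmbedding (ε : ℝ) {x : Pt} (hx : x ∈ strip (-Λ)) :
    ContDiffAt ℝ ∞ (schEmbedding Λ ε) x := by
  have h4 : -x.2.2 - Λ ≠ 0 := (sub_pos.mpr (lt_neg_of_lt_neg hx.2)).ne'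
  have h3 := one_add_re_im_ne x.1
  refine (ContDiffAt.prodMk ?_ ((contDiffAt_const.mul (contDiffAt_areaRadius hΛ hx)).prodMk ?_))
  · unfold tortoise
    fun_prop (disch := assumption)
  · rw [contDiffAt_euclidean]
    have hr : ContDiffAt ℝ ∞ (fun x : Pt => x.1.re) x :=
      Complex.reCLM.contDiff.contDiffAt.comp x contDiffAt_fst
    have hi : ContDiffAt ℝ ∞ (fun x : Pt => x.1.im) x :=
      Complex.imCLM.contDiff.contDiffAt.comp x contDiffAt_fst
    intro i
    fin_cases i <;> simp [sphereMap] <;> fun_prop (disch := assumption)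

theorem schMetric_schEmbedding {ε : ℝ} (hε : ε ^ 2 = 1) {x : Pt} (hx : x ∈ strip (-Λ)) (v w : Pt) :
    schwMetric ((2 : ℝ) ^ (-(3 / 2) : ℝ) * Λ) (schEmbedding Λ ε x) (fderiv ℝ (schEmbedding Λ ε) x v)
      (fderiv ℝ (schEmbedding Λ ε) x w)
      = -((1 - Λ / areaRadius Λ x) * (-x.2.2 / (-x.2.2 - Λ)) * (v.2.1 * w.2.2 + v.2.2 * w.2.1))
        + areaRadius Λ x ^ 2 * 2 * (1 + x.1.re ^ 2 + x.1.im ^ 2)⁻¹ ^ 2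
          * (v.1.re * w.1.re + v.1.im * w.1.im) := by
  obtain ⟨f', hf, hf'⟩ := hasFDerivAt_areaRadius hΛ hx
  obtain ⟨g', hg, -⟩ := hasFDerivAt_sphereMap ε x.1
  have h4 := hasDerivAt_tortoise (Λ := Λ) (lt_neg_of_lt_neg hx.2)
  obtain ⟨h6, h5⟩ := hasFDerivAt_coords x
  have h7 := (h6.fun_sub (h4.comp_hasFDerivAt x h5.fun_neg)).const_mul (√2)⁻¹
  have h8 : HasFDerivAt (fun x : Pt => sphereMap ε x.1) _ x := hg.comp x hasFDerivAt_fst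
  have h9 : HasFDerivAt (schEmbedding Λ ε) _ x := h7.prodMk ((hf.const_mul (√2)⁻¹).prodMk h8)
  have hc : ((√2)⁻¹ : ℝ) ^ 2 = 1 / 2 := by rw [inv_pow, Real.sq_sqrt zero_le_two, one_div]
  have hs := inner_fderiv_sphereMap hε x.1 v.1 w.1
  rw [hg.fderiv] at hs
  obtain ⟨h1, -⟩ := areaRadius_spec hΛ hx
  have h10 : areaRadius Λ x ≠ 0 := (hΛ.trans_lt h1).ne'
  have h11 : areaRadius Λ x - Λ ≠ 0 := (sub_pos.mpr h1).ne'
  rw [h9.fderiv, schwMetric, schEmbedding, two_mul_mass_div]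
  simp only [ContinuousLinearMap.prod_apply, ContinuousLinearMap.comp_apply, smul_apply, sub_apply,
    neg_apply, ContinuousLinearMap.coe_fst', ContinuousLinearMap.coe_snd', smul_eq_mul, hs, hf']
  have hA : (areaRadius Λ x - Λ) / areaRadius Λ x = 1 - Λ / areaRadius Λ x := by field_simp
  have hA' := inv_mul_cancel₀ (hA ▸ div_ne_zero h11 h10 : 1 - Λ / areaRadius Λ x ≠ 0)
  rw [hA]
  generalize (1 - Λ / areaRadius Λ x)⁻¹ = B at *
  generalize 1 - Λ / areaRadius Λ x = A at *
  generalize -x.2.2 / (-x.2.2 - Λ) = q at *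
  generalize (√2)⁻¹ = c at *
  linear_combination (c ^ 2 * A * (v.2.1 - q * v.2.2) * (w.2.1 - q * w.2.2)) * hA'
    + (-A * (v.2.1 + q * v.2.2) * (w.2.1 + q * w.2.2) + A * (v.2.1 - q * v.2.2) * (w.2.1 - q * w.2.2)
      + 4 * areaRadius Λ x ^ 2 * (1 + x.1.re ^ 2 + x.1.im ^ 2)⁻¹ ^ 2
        * (v.1.re * w.1.re + v.1.im * w.1.im)) * hc

theorem isSchwarzschildIsometry_schEmbedding {ε : ℝ} (hε : ε ^ 2 = 1) :
    IsSchwarzschildIsometry ((2 : ℝ) ^ (-(3 / 2) : ℝ) * Λ) (schField Λ) (strip (-Λ))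
      (schEmbedding Λ ε) := by
  have hc : 0 < (√2)⁻¹ := by positivity
  refine ⟨fun x hx => (contDiffAt_schEmbedding hΛ ε hx).contDiffWithinAt, fun x hx => ?_,
    fun x hx x' hx' h => ?_, fun x hx μ ν => ?_⟩
  · obtain ⟨h1, -⟩ := areaRadius_spec hΛ hx
    have h2 : 0 < (√2)⁻¹ * areaRadius Λ x := mul_pos hc (hΛ.trans_lt h1)
    refine ⟨h2, ?_, norm_sphereMap hε _⟩
    refine (div_lt_one h2).mp ?_
    rw [two_mul_mass_div, div_lt_one (hΛ.trans_lt h1)]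
    exact h1
  · simp only [schEmbedding, Prod.mk.injEq, mul_right_inj' hc.ne'] at h
    obtain ⟨h1, h2, h3⟩ := h
    have h4 := (areaRadius_spec hΛ hx).2
    rw [h2, (areaRadius_spec hΛ hx').2] at h4
    have h5 : tortoise Λ (-x.2.2) = tortoise Λ (-x'.2.2) := by linarith
    have h6 := (strictMonoOn_tortoise hΛ).injOn (lt_neg_of_lt_neg hx.2) (lt_neg_of_lt_neg hx'.2) h5
    exact Prod.ext (injective_sphereMap hε h3) (Prod.ext (by linarith) (neg_inj.mp h6))
  · obtain ⟨h1, h2, h3, h4⟩ := schField_ne hΛ hx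
    have hE : (1 / 2 + 2 * (-x.1 / 2) * (-starRingEnd ℂ x.1 / 2) : ℂ)
        = ((1 + x.1.re ^ 2 + x.1.im ^ 2 : ℝ) : ℂ) / 2 := by
      have h : starRingEnd ℂ x.1 * x.1 = ((x.1.re ^ 2 + x.1.im ^ 2 : ℝ) : ℂ) := by
        rw [← Complex.normSq_eq_conj_mul_self, Complex.normSq_apply]
        push_cast
        ring
      rw [add_assoc, Complex.ofReal_add, ← h]
      push_cast
      ring
    have hM := frameMatrix_schField (Λ := Λ) (x := x)
    have hF := isUnit_det_frameMatrix_schField hΛ hx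
    simp only [hE] at hM
    have hE0 : ((1 + x.1.re ^ 2 + x.1.im ^ 2 : ℝ) : ℂ) ≠ 0 :=
      Complex.ofReal_ne_zero.mpr (one_add_re_im_ne _)
    have hy : (-x.2.2 - Λ : ℂ) ≠ 0 := fun h => h4 (by rw [← sub_eq_zero.mp h, mul_inv_cancel₀ h2, sub_self])
    have key : ∀ G, frameMatrix (schField Λ) x * G * (frameMatrix (schField Λ) x)ᵀ = gFrame →
        metric (schField Λ) x = G := fun G hG => by
      rw [metric, ← hG, Matrix.transpose_nonsing_inv, Matrix.mul_assoc _ G,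
        Matrix.nonsing_inv_mul_cancel_left _ _ hF,
        Matrix.mul_nonsing_inv_cancel_right _ _ (by rwa [Matrix.det_transpose])]
    rw [schMetric_schEmbedding hΛ hε hx, key (let a : ℂ := (areaRadius Λ x : ℂ) ^ 2 * 2 * ((1 + x.1.re ^ 2 + x.1.im ^ 2 : ℝ) : ℂ)⁻¹ ^ 2
      let b : ℂ := -((1 - Λ / areaRadius Λ x) * (-x.2.2 / (-x.2.2 - Λ)))
      !![a, 0, 0, 0; 0, a, 0, 0; 0, 0, 0, b; 0, 0, b, 0])]
    · fin_cases μ <;> fin_cases ν <;> simp [coordVec]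
    · rw [hM]
      generalize ((1 + x.1.re ^ 2 + x.1.im ^ 2 : ℝ) : ℂ) = n at *
      ext i j
      fin_cases i <;> fin_cases j <;> simp [Matrix.mul_apply, Fin.sum_univ_four, gFrame]
      all_goals
        have hI := Complex.I_mul_I
        have hP : n / 2 * (areaRadius Λ x : ℂ)⁻¹ * ((areaRadius Λ x : ℂ) ^ 2 * 2 * (n ^ 2)⁻¹)
            * (n / 2 * (areaRadius Λ x : ℂ)⁻¹) = 1 / 2 := by field_simp
        have hA := mul_inv_cancel₀ h3
        have hq : (-x.2.2 / (-x.2.2 - Λ) : ℂ) * (1 + Λ * (x.2.2 : ℂ)⁻¹) = 1 := by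
          have := neg_ne_zero.mp h2
          field_simp
          ring
      · linear_combination hP * (1 + Complex.I * Complex.I) + hI / 2
      · linear_combination hP * (1 - Complex.I * Complex.I) - hI / 2
      · linear_combination hP * (1 - Complex.I * Complex.I) - hI / 2
      · linear_combination hP * (1 + Complex.I * Complex.I) + hI / 2
      all_goals linear_combination ((-x.2.2 / (-x.2.2 - Λ) : ℂ) * (1 + Λ * (x.2.2 : ℂ)⁻¹)) * hA + hq

/-- Formal solutions with the characteristic data of a constant pulse energy represent the
Schwarzschild spacetime. -/
theorem representsSchwarzschild {Ψ : Bool → FormalField}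
    (h : ∀ σ, Agree (Ψ σ) (toFormal (schPsi Λ))) :
    RepresentsSchwarzschild ((2 : ℝ) ^ (-(3 / 2) : ℝ) * Λ) (-Λ) Ψ := by
  refine ⟨schField Λ, fun σ => schEmbedding Λ (if σ then 1 else -1), isVacuumField_schField hΛ,
    fun σ => isSchwarzschildIsometry_schEmbedding hΛ (by cases σ <;> simp), fun σ ξ s u hξ _ => ?_,
    fun σ b hb => ⟨-(8 * (b + 1) + 4 * Λ), by linarith, fun ξ s u hs hsb hu i => ?_⟩⟩
  · refine Prod.ext rfl (Prod.ext rfl ?_)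
    simp only [schEmbedding]
    cases σ
    · simpa using (sphereMap_inv (-1) hξ).symm
    · simpa using (sphereMap_inv 1 hξ).symm
  · have hx : (ξ, s, u) ∈ strip (-Λ) := ⟨hs, by linarith⟩
    obtain ⟨h1, h2⟩ := areaRadius_spec hΛ hx
    have h3 := ((hasSum_schSer hΛ hb (lt_neg_of_lt_neg hu) hs hsb h1 h2 i).mapL Complex.ofRealCLM).mul_left
      (angularVal i ξ)
    have h4 : schField Λ (ξ, s, u) i = angularVal i ξ * Complex.ofRealCLM (radial Λ (Λ / 2) (-u)⁻¹
        (areaRadius Λ (ξ, s, u))⁻¹ (1 - Λ * (areaRadius Λ (ξ, s, u))⁻¹)⁻¹ (1 - Λ * (-u)⁻¹)⁻¹ i) := by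
      refine congrArg (angularVal i ξ * ·) ?_
      cases i <;> simp [radial]
    have h5 : ∀ n : ℕ, (fullField (Ψ σ) i).coeff n (ξ, s) / (u : ℂ) ^ n = angularVal i ξ *
        Complex.ofRealCLM (PowerSeries.coeff n (serEval s (schSer Λ i)) * (-1 / -u) ^ n) := fun n => by
      rw [coeff_fullField_of_agree Λ (h σ) i n hs, mul_div_assoc]
      simp [div_eq_mul_inv]
    rw [h4, funext h5]
    exact h3

end SchwarzschildIsometry

end
end FarField

theorem mainTheorem8
    (η : Bool → ℂ × ℝ → ℂ)
    (hη_smooth : ∀ σ, ContDiffOn ℝ ∞ (η σ) upper)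
    (hη_flip : ∀ σ ξ s, ξ ≠ 0 → 0 < s →
      η σ (ξ, s) = ξ ^ 2 / (starRingEnd ℂ ξ) ^ 2 * η (!σ) (ξ⁻¹, s))
    (hη_supp : ∀ σ, ∀ p ∈ upper, η σ p ≠ 0 → 1 / 2 < p.2 ∧ p.2 < 3 / 4)
    (hη_mean : ∀ σ ξ, ∫ s in (1 / 2 : ℝ)..(3 / 4), η σ (ξ, s) = 0) :
    (∀ σ, ∀ 𝔄 : ℝ, 𝔄 ≠ 0 →
      ∃ ΨF, IsFarFieldSolution (finiteMassData 𝔄 (η σ)) (𝔄 ^ 4 / 2) ΨF ∧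
        ∀ Ψ', IsFarFieldSolution (finiteMassData 𝔄 (η σ)) (𝔄 ^ 4 / 2) Ψ' → Agree Ψ' ΨF) ∧
    ∃ (d : ℕ → ℕ) (c : Bool → ℕ → Cpt → ℕ → ℕ → ℂ → ℂ),
      (∀ σ, ∀ 𝔄 : ℝ, 𝔄 ≠ 0 →
        ∀ ΨF, IsFarFieldSolution (finiteMassData 𝔄 (η σ)) (𝔄 ^ 4 / 2) ΨF →
          ∀ k i ξ s, 3 / 4 * 𝔄 ^ 4 < s → ΨF k i (ξ, s) = polynomialField d (c σ) 𝔄 k i (ξ, s)) ∧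
      (∀ σ,
        IsFormalSolution (constantTermField d (c σ)) ∧
        HasCharacteristicData (pulseEnergy (η σ)) (constantTermField d (c σ)) ∧
        (∀ Ψ', IsFormalSolution Ψ' → HasCharacteristicData (pulseEnergy (η σ)) Ψ' →
          Agree Ψ' (constantTermField d (c σ))) ∧
        ConstraintsVanish (constantTermField d (c σ))) ∧
      ∀ Λ : ℝ, (∀ σ ξ, pulseEnergy (η σ) ξ = Λ) →
        RepresentsSchwarzschild ((2 : ℝ) ^ (-(3 / 2) : ℝ) * Λ) (-Λ)
          (fun σ => constantTermField d (c σ)) := by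
  choose L hL using fun σ (𝔄 : ℝ) (h𝔄 : 𝔄 ≠ 0) =>
    exists_solution_finiteMassData (hη_smooth σ) (hη_supp σ) h𝔄
  obtain ⟨d, c, hc⟩ := exists_isLateExpansion hη_smooth hη_supp
  have hs := fun σ => isFormalSolution_constantTermField (hc σ) (hη_smooth σ) (hη_supp σ)
  have hd := fun σ => hasCharacteristicData_constantTermField (hc σ) (hη_smooth σ) (hη_supp σ)
  refine ⟨fun σ 𝔄 h𝔄 => ⟨_, hL σ 𝔄 h𝔄, fun Ψ' h' => h'.agree (by positivity) (hL σ 𝔄 h𝔄)⟩, d, c,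
    fun σ 𝔄 h𝔄 Ψ hΨ => (hc σ).eq 𝔄 h𝔄 Ψ hΨ,
    fun σ => ⟨hs σ, hd σ, fun Ψ' h h' => HasCharacteristicData.agree (hs σ) h (hd σ) h',
      constraintsVanish_constantTermField (hc σ) (hη_smooth σ) (hη_supp σ)⟩,
    fun Λ hΛ => representsSchwarzschild ?_ fun σ => HasCharacteristicData.agree_schPsi Λ (hΛ σ) (hs σ) (hd σ)⟩
  rw [← hΛ true 0]
  exact intervalIntegral.integral_nonneg (by norm_num) fun _ _ => by positivity
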